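/- Let $S$ be a string of length $n$ over the alphabet $\{0,\dots,\sigma-1\}$, with positions $0,\dots,n-1$. A *sequence of windows* over $S$ is a sequence $[i_t,j_t]$, $t=0,\dots,T$, with $i_0=j_0=0$, $0\le i_t\le j_t\le n-1$, and, for each $t<T$, either $(i_{t+1},j_{t+1})=(i_t+1,j_t)$ (the leftmost letter is deleted) or $(i_{t+1},j_{t+1})=(i_t,j_t+1)$ (a letter is appended). Let $d\ge\max_t(j_t-i_t+1)$, and let $\sigma'$ be the maximum number of distinct letters in a window $S[i_t..j_t]$. A substring $W[a..b]$ of a string $W$ (with $a\le b$) is a *minimal unique palindromic substring* (MUPS) of $W$ if it is a palindrome, occurs exactly once in $W$, and $W[a+1..b-1]$ is empty or occurs at least twice in $W$. **(1)** The set of MUPSs can be maintained for a sliding window in $O(n(1+\log\sigma'))$ total time and $O(d)$ space. That is, there are a constant $C$ and an online algorithm (one program each for initialization, append and delete) on a unit-cost random access machine whose arithmetic operations are addition and truncated subtraction, such that the following holds for all $\sigma$, $d$, $S$ and all sequences of windows as above. The algorithm is given $d$ at the start, each letter only when it is appended, and the kind of each operation. It uses $C d$ memory cells, all initially $0$, and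 a constant number of registers, each holding a number below $\sigma+C(n+d)$. At every time $t$ the memory holds an explicit array of the intervals $[a,b]$ of positions of $S$, each once, for which $S[a..b]$ is, at these positions, a MUPS of the window $S[i_t..j_t]$. The total number of steps, including the initialization, is at most $C\,n\,(1+\lfloor\log_2\sigma'\rfloor)$. **(2)** Each operation affects the MUPS status only locally. If the leftmost letter of a string $cW$ is deleted and a string $w$ is a MUPS of exactly one of $cW$ and $W$, then $w$, or $w$ without its first and its last letter, is the longest or the second longest nonempty palindromic prefix of $cW$. If $c$ is appended to $W$ and $w$ is a MUPS of exactly one of $Wc$ and $W$, then $w$, or $w$ without its first and its last letter, is the longest or the second longest nonempty palindromic suffix of $Wc$. -/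

import Mathlib

namespace SlidingMUPS

/-! ### Strings, occurrences and minimal unique palindromic substrings -/

section Strings

variable {α : Type} [DecidableEq α]

/-- The substring `W[a..b]` with both ends included; it is empty when `a > b`. -/
def slice (W : List α) (a b : ℕ) : List α := (W.drop a).take (b + 1 - a)

/-- The starting positions of the occurrences of `w` in `W`. -/
def occurrences (w W : List α) : Finset ℕ :=
  (Finset.range (W.length + 1)).filter fun s => (W.drop s).take w.length = w

/-- The nonempty string `w` occurs exactly once in `W`. -/
def IsUnique (w W : List α) : Prop := w ≠ [] ∧ (occurrences w W).card = 1

/-- `w` occurs at least twice in `W`; by convention the empty string is repeating everywhere. -/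
def IsRepeating (w W : List α) : Prop := w = [] ∨ 2 ≤ (occurrences w W).card

/-- `w[1..|w|-2]`: the string `w` without its first and its last letter
(empty when `w` has at most two letters). -/
def interior (w : List α) : List α := w.tail.dropLast

/-- The string `w` is a minimal unique palindromic substring of `W`. -/
def IsMUPS (w W : List α) : Prop :=
  w.Palindrome ∧ IsUnique w W ∧ IsRepeating (interior w) W

/-- The set of the intervals `[a, b]` for which `W[a..b]` is a minimal unique palindromic
substring of `W`. -/
def MUPS (W : List α) : Set (ℕ × ℕ) :=
  {p | p.1 ≤ p.2 ∧ p.2 < W.length ∧ IsMUPS (slice W p.1 p.2) W}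

/-- `p` is the longest or the second longest nonempty palindromic prefix of `W`:
at most one palindromic prefix of `W` is longer. -/
def IsTopTwoPalPrefix (p W : List α) : Prop :=
  p ≠ [] ∧ p <+: W ∧ p.Palindrome ∧
    ((Finset.Icc (p.length + 1) W.length).filter fun l => (W.take l).Palindrome).card ≤ 1

/-- `p` is the longest or the second longest nonempty palindromic suffix of `W`:
at most one palindromic suffix of `W` is longer. -/
def IsTopTwoPalSuffix (p W : List α) : Prop :=
  p ≠ [] ∧ p <:+ W ∧ p.Palindrome ∧
    ((Finset.Icc (p.length + 1) W.length).filter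
      fun l => (W.drop (W.length - l)).Palindrome).card ≤ 1

end Strings

/-! ### Sliding windows -/

/-- `[i t, j t]`, for the times `t = 0, …, T`, is a sequence of windows over a string of length
`n`: it starts with the window `[0, 0]`, the windows are nonempty and lie inside the string, and
every step either deletes the leftmost letter or appends one letter at the right end. -/
structure IsWindowSequence (n T : ℕ) (i j : ℕ → ℕ) : Prop where
  left_zero : i 0 = 0
  right_zero : j 0 = 0
  left_le_right : ∀ t ≤ T, i t ≤ j t
  right_lt : ∀ t ≤ T, j t < n
  step : ∀ t < T, (i (t + 1) = i t + 1 ∧ j (t + 1) = j t) ∨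
    (i (t + 1) = i t ∧ j (t + 1) = j t + 1)

/-- The maximum number of distinct letters in one of the windows at the times `0, …, T`. -/
def maxDistinct {α : Type} [DecidableEq α] (S : List α) (T : ℕ) (i j : ℕ → ℕ) : ℕ :=
  (Finset.range (T + 1)).sup fun t => (slice S (i t) (j t)).toFinset.card

/-! ### The machine: a random access machine with a structured programming language

A machine has registers (a program mentions only finitely many of them) and an addressable memory
of `cells` cells. Registers and cells hold natural numbers below `word`. The arithmetic
operations are addition and truncated subtraction. -/

/-- Contents of the registers and of the memory. -/
structure Config where
  reg : ℕ → ℕ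
  mem : ℕ → ℕ

/-- Expressions; `mem a` is the content of the cell whose address is the value of `a`. -/
inductive Expr where
  | lit (k : ℕ)
  | reg (x : ℕ)
  | mem (a : Expr)
  | add (a b : Expr)
  | sub (a b : Expr)

/-- The value of an expression. Cells that do not exist are never written to and read as `0`. -/
def Expr.eval (s : Config) : Expr → ℕ
  | .lit k => k
  | .reg x => s.reg x
  | .mem a => s.mem (a.eval s)
  | .add a b => a.eval s + b.eval s
  | .sub a b => a.eval s - b.eval s

/-- The number of steps it takes to evaluate an expression. -/
def Expr.cost : Expr → ℕ
  | .lit _ => 1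
  | .reg _ => 1
  | .mem a => a.cost + 1
  | .add a b => a.cost + b.cost + 1
  | .sub a b => a.cost + b.cost + 1

/-- Conditions. -/
inductive Test where
  | lt (a b : Expr)
  | eq (a b : Expr)
  | neg (b : Test)
  | conj (b c : Test)
  | disj (b c : Test)

/-- The truth of a condition. -/
def Test.Holds (s : Config) : Test → Prop
  | .lt a b => a.eval s < b.eval s
  | .eq a b => a.eval s = b.eval s
  | .neg b => ¬ b.Holds s
  | .conj b c => b.Holds s ∧ c.Holds s
  | .disj b c => b.Holds s ∨ c.Holds s

/-- The number of steps it takes to decide a condition. -/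
def Test.cost : Test → ℕ
  | .lt a b => a.cost + b.cost + 1
  | .eq a b => a.cost + b.cost + 1
  | .neg b => b.cost + 1
  | .conj b c => b.cost + c.cost + 1
  | .disj b c => b.cost + c.cost + 1

/-- Programs: `assign x e` sets register `x` to `e`, `store a e` sets the cell with address `a`
to `e`, `cond b c₁ c₂` is "if `b` then `c₁` else `c₂`", `loop b c` is "while `b` do `c`". -/
inductive Cmd where
  | skip
  | assign (x : ℕ) (e : Expr)
  | store (a e : Expr)
  | seq (c₁ c₂ : Cmd)
  | cond (b : Test) (c₁ c₂ : Cmd)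
  | loop (b : Test) (c : Cmd)

/-- Register `x` receives the value `v`. -/
def Config.setReg (s : Config) (x v : ℕ) : Config := { s with reg := Function.update s.reg x v }

/-- Cell `a` receives the value `v`. -/
def Config.setMem (s : Config) (a v : ℕ) : Config := { s with mem := Function.update s.mem a v }

/-- `Run cells word c s t s'`: on a machine with `cells` memory cells and registers and cells that
hold numbers below `word`, the program `c`, started in `s`, halts in `s'` after `t` steps. There is
no such run if the program does not halt, writes to a cell that does not exist, or produces a
number that does not fit. -/
inductive Run (cells word : ℕ) : Cmd → Config → ℕ → Config → Prop where
  | skip (s : Config) : Run cells word .skip s 1 s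
  | assign (s : Config) (x : ℕ) (e : Expr) (hv : e.eval s < word) :
      Run cells word (.assign x e) s (e.cost + 1) (s.setReg x (e.eval s))
  | store (s : Config) (a e : Expr) (ha : a.eval s < cells) (hv : e.eval s < word) :
      Run cells word (.store a e) s (a.cost + e.cost + 1) (s.setMem (a.eval s) (e.eval s))
  | seq {c₁ c₂ : Cmd} {s₁ s₂ s₃ : Config} {t₁ t₂ : ℕ}
      (h₁ : Run cells word c₁ s₁ t₁ s₂) (h₂ : Run cells word c₂ s₂ t₂ s₃) :
      Run cells word (.seq c₁ c₂) s₁ (t₁ + t₂) s₃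
  | condTrue {b : Test} {c₁ c₂ : Cmd} {s s' : Config} {t : ℕ}
      (hb : b.Holds s) (h : Run cells word c₁ s t s') :
      Run cells word (.cond b c₁ c₂) s (b.cost + 1 + t) s'
  | condFalse {b : Test} {c₁ c₂ : Cmd} {s s' : Config} {t : ℕ}
      (hb : ¬ b.Holds s) (h : Run cells word c₂ s t s') :
      Run cells word (.cond b c₁ c₂) s (b.cost + 1 + t) s'
  | loopDone {b : Test} {c : Cmd} {s : Config} (hb : ¬ b.Holds s) :
      Run cells word (.loop b c) s (b.cost + 1) s
  | loopStep {b : Test} {c : Cmd} {s₁ s₂ s₃ : Config} {t₁ t₂ : ℕ} (hb : b.Holds s₁)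
      (h₁ : Run cells word c s₁ t₁ s₂) (h₂ : Run cells word (.loop b c) s₂ t₂ s₃) :
      Run cells word (.loop b c) s₁ (b.cost + 1 + t₁ + t₂) s₃

/-! ### Sliding window algorithms -/

/-- A sliding window algorithm: one program for the initialization and one for either operation. -/
structure Algorithm where
  init : Cmd
  append : Cmd
  delete : Cmd

/-- The initial configuration: register `0` holds the bound `d` on the window length, everything
else is `0`. -/
def startConfig (d : ℕ) : Config where
  reg := Function.update (fun _ => 0) 0 d
  mem := fun _ => 0

/-- `Appends A cells word S k s t s'`: the letter `S[k]` is put into register `1`, and the append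
program of `A` leads from `s` to `s'` in `t` steps. -/
def Appends {σ : ℕ} (A : Algorithm) (cells word : ℕ) (S : List (Fin σ)) (k : ℕ)
    (s : Config) (t : ℕ) (s' : Config) : Prop :=
  ∃ c : Fin σ, S[k]? = some c ∧ Run cells word A.append (s.setReg 1 c) t s'

/-- `A` processes the windows `[i t, j t]`, `t = 0, …, T`, over `S` online: it is in the
configuration `conf t` at time `t` and has made `cost t` steps since the time before (for `t = 0`,
since the start). It learns `d` at the start, a letter of `S` when this is appended, and which of
the two operations is performed; nothing else. -/
structure IsExecution {σ : ℕ} (A : Algorithm) (cells word d : ℕ) (S : List (Fin σ)) (T : ℕ)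
    (i j : ℕ → ℕ) (conf : ℕ → Config) (cost : ℕ → ℕ) : Prop where
  start : ∃ (s : Config) (t₀ t₁ : ℕ), Run cells word A.init (startConfig d) t₀ s ∧
    Appends A cells word S 0 s t₁ (conf 0) ∧ cost 0 = t₀ + t₁
  step_delete : ∀ t < T, i (t + 1) = i t + 1 →
    Run cells word A.delete (conf t) (cost (t + 1)) (conf (t + 1))
  step_append : ∀ t < T, j (t + 1) = j t + 1 →
    Appends A cells word S (j (t + 1)) (conf t) (cost (t + 1)) (conf (t + 1))

/-- The list of pairs that a configuration holds: an array that begins at the address in register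
`2` and has as many entries, of two cells each, as register `3` says. -/
def Config.pairs (s : Config) : List (ℕ × ℕ) :=
  (List.range (s.reg 3)).map fun m => (s.mem (s.reg 2 + 2 * m), s.mem (s.reg 2 + 2 * m + 1))

/-- The configuration explicitly stores the set of minimal unique palindromic substrings of the
window `S[i..j]`, each of them once, as intervals of positions in `S`. -/
def StoresMUPS {α : Type} [DecidableEq α] (cells : ℕ) (S : List α) (i j : ℕ) (s : Config) : Prop :=
  s.reg 2 + 2 * s.reg 3 ≤ cells ∧ s.pairs.Nodup ∧
    ∀ p : ℕ × ℕ, p ∈ s.pairs ↔ ∃ q ∈ MUPS (slice S i j), p = (i + q.1, i + q.2)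

end SlidingMUPS

/-! The data structure is a palindromic tree: its nodes are distinct palindromes of the stored text,
`inner` strips both end letters, and `link` leads to the longest proper palindromic suffix.
Appending a letter creates at most one node, that of the longest palindromic suffix `P` of the new
window, which is found by climbing along links from the previous longest palindromic suffix. Lengths
are stored increased by one, so that the imaginary root of length -1 gets the value 0.

Deletions never remove nodes. Instead the work is divided into epochs: when the window has moved
past the text that it held when the epoch began, everything is rebuilt from the current window.
Hence at most `2 * d` letters are stored at a time, and they all lie in the union of two windows, so
that at most `2σ'` different letters occur. The children of a node are kept in a deterministic 1-2-3
skip list, whose height is logarithmic in the number of its keys; this gives the factor `1 + log σ'`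
(`Skip.pow_le_card`, `Sound.height`).

Exact occurrence counts would be too expensive, but only the question whether a palindrome occurs
never, once or more often matters. Some occurrences are recorded, among them every surface
palindrome, one that is neither a proper prefix nor a proper suffix of another palindrome of the
window. If a live node `u` has the link `v`, then `v` begins and ends `u` and occurs at least twice.
If no live node has the link `v`, then every occurrence of `v` is a surface palindrome and therefore
recorded. So the weight, the number of recorded occurrences plus twice the number of live nodes
linked to `v`, is 1 exactly when `v` is unique, and 0 exactly when `v` is absent (`Tree.unique_iff`,
`Tree.mem_live_iff`). Sums of recorded positions and of live children, modulo the array size,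
recover the only position and the only relevant child.

A change at one end of the window affects the uniqueness of at most two palindromes, `P` and `link
P`, where `P` is the longest palindromic suffix or prefix: the shorter ones occur at least twice in
either window (`Tree.unique_append`, `Tree.unique_delete`). The status of a palindrome depends on
its own uniqueness and on that of its interior, and a palindrome that occurs once is the interior of
at most one live palindrome. So four nodes must be refreshed: `P`, `link P`, and one child of each
(`Tree.target_append`, `Tree.target_delete`).

The time is amortized by a potential. The lengths of the current palindromic suffix and of its link
pay for the climbs, and every append lays aside what the repetition of that append in the next
rebuild will cost (`append_sound`, `delete_sound`). The programs are written in a small language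
with arrays and compiled to the machine with a constant slowdown.

Part (2) is shown directly on strings: a palindromic prefix occurs at the start of the string and at
the end of every longer palindromic prefix, so one that is not among the two longest occurs at least
three times, and the loss of one occurrence changes nothing. Appending is the mirror image. -/

namespace SlidingMUPS

/-! ### A small language with named registers and arrays -/

/-- Named registers; `d`, `letter`, `out` and `cnt` are the registers `0`, `1`, `2` and `3` of the
machine. -/
inductive Reg where
  | d | letter | out | cnt | left | right | base | epoch | cur | nodes | cells | modulus
  | x | y | t | v | p | q | a | u | c1 | c2 | k | e
  deriving DecidableEq

/-- Named arrays. -/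
inductive Arr where
  | buf | len | link | inner | head | weight | possum | chsum | slot | owner | entry | mark
  | key | right | down | val
  deriving DecidableEq

/-- The number of a register. -/
def Reg.idx : Reg → ℕ
  | d => 0 | letter => 1 | out => 2 | cnt => 3 | left => 4 | right => 5 | base => 6 | epoch => 7
  | cur => 8 | nodes => 9 | cells => 10 | modulus => 11 | x => 12 | y => 13 | t => 14 | v => 15
  | p => 16 | q => 17 | a => 18 | u => 19 | c1 => 20 | c2 => 21 | k => 22 | e => 23

/-- The number of an array. -/
def Arr.idx : Arr → ℕ
  | buf => 0 | len => 1 | link => 2 | inner => 3 | head => 4 | weight => 5 | possum => 6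
  | chsum => 7 | slot => 8 | owner => 9 | entry => 10 | mark => 11 | key => 12 | right => 13
  | down => 14 | val => 15

theorem Reg.idx_inj {r r' : Reg} : r.idx = r'.idx ↔ r = r' := by
  cases r <;> cases r' <;> simp [Reg.idx]

theorem Arr.idx_inj {r r' : Arr} : r.idx = r'.idx ↔ r = r' := by
  cases r <;> cases r' <;> simp [Arr.idx]

theorem Arr.idx_lt (r : Arr) : r.idx < 16 := by cases r <;> simp [Arr.idx]

/-- A state: the registers, the arrays, and a write-only output array. -/
structure St where
  reg : Reg → ℕ
  arr : Arr → ℕ → ℕ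
  out : ℕ → ℕ

/-- Expressions. -/
inductive HExpr where
  | lit (k : ℕ)
  | reg (r : Reg)
  | arr (a : Arr) (i : HExpr)
  | add (a b : HExpr)
  | sub (a b : HExpr)

instance : Add HExpr := ⟨HExpr.add⟩
instance : Sub HExpr := ⟨HExpr.sub⟩
instance (n : ℕ) : OfNat HExpr n := ⟨HExpr.lit n⟩
instance : Coe Reg HExpr := ⟨HExpr.reg⟩

/-- The entry of the array `a` at an index. -/
abbrev Arr.at (a : Arr) (i : HExpr) : HExpr := HExpr.arr a i

/-- The value of an expression. -/
def HExpr.eval (s : St) : HExpr → ℕ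
  | .lit k => k
  | .reg r => s.reg r
  | .arr a i => s.arr a (i.eval s)
  | .add a b => a.eval s + b.eval s
  | .sub a b => a.eval s - b.eval s

section
variable (s : St) (a b : HExpr)
@[simp] theorem HExpr.eval_lit (k : ℕ) : (HExpr.lit k).eval s = k := rfl
@[simp] theorem HExpr.eval_ofNat (k : ℕ) :
    HExpr.eval s (no_index (OfNat.ofNat k)) = OfNat.ofNat k := rfl
@[simp] theorem HExpr.eval_reg (r : Reg) : (HExpr.reg r).eval s = s.reg r := rfl
@[simp] theorem HExpr.eval_arr (r : Arr) : (HExpr.arr r a).eval s = s.arr r (a.eval s) := rfl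
@[simp] theorem HExpr.eval_add : (a + b).eval s = a.eval s + b.eval s := rfl
@[simp] theorem HExpr.eval_sub : (a - b).eval s = a.eval s - b.eval s := rfl
end

/-- Conditions. -/
inductive HTest where
  | lt (a b : HExpr)
  | eq (a b : HExpr)
  | neg (b : HTest)
  | conj (b c : HTest)
  | disj (b c : HTest)

/-- The truth of a condition. -/
def HTest.Holds (s : St) : HTest → Prop
  | .lt a b => a.eval s < b.eval s
  | .eq a b => a.eval s = b.eval s
  | .neg b => ¬ b.Holds s
  | .conj b c => b.Holds s ∧ c.Holds s
  | .disj b c => b.Holds s ∨ c.Holds s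

/-- Programs; `emit i e` writes to the output array. -/
inductive HCmd where
  | skip
  | assign (r : Reg) (e : HExpr)
  | store (a : Arr) (i e : HExpr)
  | emit (i e : HExpr)
  | seq (c₁ c₂ : HCmd)
  | cond (b : HTest) (c₁ c₂ : HCmd)
  | loop (b : HTest) (c : HCmd)

infixr:30 " ;; " => HCmd.seq

/-- Register `r` receives the value `v`. -/
def St.set (s : St) (r : Reg) (v : ℕ) : St := { s with reg := Function.update s.reg r v }

/-- Entry `i` of the array `a` receives the value `v`. -/
def St.put (s : St) (a : Arr) (i v : ℕ) : St :=
  { s with arr := Function.update s.arr a (Function.update (s.arr a) i v) }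

/-- Entry `i` of the output array receives the value `v`. -/
def St.emit (s : St) (i v : ℕ) : St := { s with out := Function.update s.out i v }

section
variable (s : St) (r r' : Reg) (a b : Arr) (i j v : ℕ)
@[simp] theorem St.set_reg : (s.set r v).reg r' = if r' = r then v else s.reg r' := by
  simp [St.set, Function.update_apply]
@[simp] theorem St.set_arr : (s.set r v).arr = s.arr := rfl
@[simp] theorem St.set_out : (s.set r v).out = s.out := rfl
@[simp] theorem St.put_reg : (s.put a i v).reg = s.reg := rfl
@[simp] theorem St.put_arr :
    (s.put a i v).arr b = if b = a then Function.update (s.arr a) i v else s.arr b := by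
  simp only [St.put, Function.update_apply]
@[simp] theorem St.put_out : (s.put a i v).out = s.out := rfl
@[simp] theorem St.emit_reg : (s.emit i v).reg = s.reg := rfl
@[simp] theorem St.emit_arr : (s.emit i v).arr = s.arr := rfl
@[simp] theorem St.emit_out : (s.emit i v).out = Function.update s.out i v := rfl
end

/-- Runs of programs on arrays of `N` entries with numbers below `word`; every atomic statement
and every test takes one step. The register `d` is read-only. -/
inductive HRun (N word : ℕ) : HCmd → St → ℕ → St → Prop where
  | skip (s : St) : HRun N word .skip s 1 s
  | assign (s : St) (r : Reg) (e : HExpr) (hr : r ≠ .d) (hv : e.eval s < word) :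
      HRun N word (.assign r e) s 1 (s.set r (e.eval s))
  | store (s : St) (a : Arr) (i e : HExpr) (hi : i.eval s < N) (hv : e.eval s < word) :
      HRun N word (.store a i e) s 1 (s.put a (i.eval s) (e.eval s))
  | emit (s : St) (i e : HExpr) (hi : i.eval s < N) (hv : e.eval s < word) :
      HRun N word (.emit i e) s 1 (s.emit (i.eval s) (e.eval s))
  | seq {c₁ c₂ : HCmd} {s₁ s₂ s₃ : St} {t₁ t₂ : ℕ}
      (h₁ : HRun N word c₁ s₁ t₁ s₂) (h₂ : HRun N word c₂ s₂ t₂ s₃) :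
      HRun N word (.seq c₁ c₂) s₁ (t₁ + t₂) s₃
  | condTrue {b : HTest} {c₁ c₂ : HCmd} {s s' : St} {t : ℕ}
      (hb : b.Holds s) (h : HRun N word c₁ s t s') :
      HRun N word (.cond b c₁ c₂) s (1 + t) s'
  | condFalse {b : HTest} {c₁ c₂ : HCmd} {s s' : St} {t : ℕ}
      (hb : ¬ b.Holds s) (h : HRun N word c₂ s t s') :
      HRun N word (.cond b c₁ c₂) s (1 + t) s'
  | loopDone {b : HTest} {c : HCmd} {s : St} (hb : ¬ b.Holds s) :
      HRun N word (.loop b c) s 1 s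
  | loopStep {b : HTest} {c : HCmd} {s₁ s₂ s₃ : St} {t₁ t₂ : ℕ} (hb : b.Holds s₁)
      (h₁ : HRun N word c s₁ t₁ s₂) (h₂ : HRun N word (.loop b c) s₂ t₂ s₃) :
      HRun N word (.loop b c) s₁ (1 + t₁ + t₂) s₃

/-! ### Compilation -/

/-- The expression `k * e`. -/
def Expr.scale (e : Expr) : ℕ → Expr
  | 0 => .lit 0
  | k + 1 => .add (Expr.scale e k) e

theorem Expr.eval_scale (s : Config) (e : Expr) (k : ℕ) :
    (Expr.scale e k).eval s = k * e.eval s := by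
  induction k with
  | zero => simp [Expr.scale, Expr.eval]
  | succ k ih => simp [Expr.scale, Expr.eval, ih]; ring

/-- The address of entry `i` of the array `a`, as an expression. -/
def Arr.address (a : Arr) (i : Expr) : Expr :=
  -- Register 0 holds `d`. The first `32 * d` cells are the output; behind them the 16 arrays are
  -- interleaved, so that entry `i` begins at the offset `16 * i`.
  .add (Expr.scale (.reg 0) 32) (.add (Expr.scale i 16) (.lit a.idx))

/-- The machine expression of an expression. -/
def HExpr.compile : HExpr → Expr
  | .lit k => .lit k
  | .reg r => .reg r.idx
  | .arr a i => .mem (a.address i.compile)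
  | .add a b => .add a.compile b.compile
  | .sub a b => .sub a.compile b.compile

/-- The machine condition of a condition. -/
def HTest.compile : HTest → Test
  | .lt a b => .lt a.compile b.compile
  | .eq a b => .eq a.compile b.compile
  | .neg b => .neg b.compile
  | .conj b c => .conj b.compile c.compile
  | .disj b c => .disj b.compile c.compile

/-- The machine program of a program. -/
def HCmd.compile : HCmd → Cmd
  | .skip => .skip
  | .assign r e => .assign r.idx e.compile
  | .store a i e => .store (a.address i.compile) e.compile
  | .emit i e => .store i.compile e.compile
  | .seq c₁ c₂ => .seq c₁.compile c₂.compile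
  | .cond b c₁ c₂ => .cond b.compile c₁.compile c₂.compile
  | .loop b c => .loop b.compile c.compile

/-- The maximum number of machine steps of an atomic statement or test of a program. -/
def HCmd.unit : HCmd → ℕ
  | .skip => 1
  | .assign _ e => e.compile.cost + 1
  | .store a i e => (a.address i.compile).cost + e.compile.cost + 1
  | .emit i e => i.compile.cost + e.compile.cost + 1
  | .seq c₁ c₂ => max c₁.unit c₂.unit
  | .cond b c₁ c₂ => max (b.compile.cost + 1) (max c₁.unit c₂.unit)
  | .loop b c => max (b.compile.cost + 1) c.unit

/-- The machine configuration `S` represents the state `s`. -/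
structure Sim (d : ℕ) (S : Config) (s : St) : Prop where
  reg : ∀ r : Reg, S.reg r.idx = s.reg r
  arr : ∀ (a : Arr) (i : ℕ), S.mem (32 * d + (16 * i + a.idx)) = s.arr a i
  out : ∀ i < 32 * d, S.mem i = s.out i
  size : s.reg .d = d

theorem Sim.eval {d : ℕ} {S : Config} {s : St} (h : Sim d S s) (e : HExpr) :
    e.compile.eval S = e.eval s := by
  have h0 : S.reg 0 = d := by rw [← h.size]; exact h.reg .d
  induction e with
  | lit k => rfl
  | reg r => exact h.reg r
  | arr a i ih =>
    simp only [HExpr.compile, Arr.address, Expr.eval, Expr.eval_scale, ih, h0]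
    exact h.arr a _
  | add a b iha ihb => simp only [HExpr.compile, Expr.eval, HExpr.eval, iha, ihb]
  | sub a b iha ihb => simp only [HExpr.compile, Expr.eval, HExpr.eval, iha, ihb]

theorem Sim.eval_address {d : ℕ} {S : Config} {s : St} (h : Sim d S s) (a : Arr) (i : HExpr) :
    (a.address i.compile).eval S = 32 * d + (16 * i.eval s + a.idx) := by
  have h0 : S.reg 0 = d := by rw [← h.size]; exact h.reg .d
  simp only [Arr.address, Expr.eval, Expr.eval_scale, h.eval, h0]

theorem Sim.holds {d : ℕ} {S : Config} {s : St} (h : Sim d S s) (b : HTest) :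
    b.compile.Holds S ↔ b.Holds s := by
  induction b with
  | lt a b => simp only [HTest.compile, Test.Holds, HTest.Holds, h.eval]
  | eq a b => simp only [HTest.compile, Test.Holds, HTest.Holds, h.eval]
  | neg b ih => simp only [HTest.compile, Test.Holds, HTest.Holds, ih]
  | conj a b iha ihb => simp only [HTest.compile, Test.Holds, HTest.Holds, iha, ihb]
  | disj a b iha ihb => simp only [HTest.compile, Test.Holds, HTest.Holds, iha, ihb]

theorem Sim.set {d : ℕ} {S : Config} {s : St} (h : Sim d S s) {r : Reg} (hr : r ≠ .d) (v : ℕ) :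
    Sim d (S.setReg r.idx v) (s.set r v) where
  reg r' := by simp [Config.setReg, Function.update_apply, Reg.idx_inj, h.reg]
  arr a i := h.arr a i
  out i hi := h.out i hi
  size := by simp [Ne.symm hr, h.size]

/-- Addresses cannot collide: beyond the `32 * d` output cells, the number of the array, being below
16, is the residue of the offset modulo 16. -/
theorem Sim.put {d : ℕ} {S : Config} {s : St} (h : Sim d S s) (a : Arr) (i v : ℕ) :
    Sim d (S.setMem (32 * d + (16 * i + a.idx)) v) (s.put a i v) where
  reg r' := h.reg r'
  arr b j := by
    have hb := b.idx_lt
    have ha := a.idx_lt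
    by_cases hab : b = a
    · subst hab
      by_cases hij : j = i
      · subst hij; simp [Config.setMem]
      · have : 32 * d + (16 * j + b.idx) ≠ 32 * d + (16 * i + b.idx) := by omega
        simp [Config.setMem, Function.update_apply, hij, this, h.arr]
    · have : b.idx ≠ a.idx := fun e => hab (Arr.idx_inj.1 e)
      have : 32 * d + (16 * j + b.idx) ≠ 32 * d + (16 * i + a.idx) := by omega
      simp only [Config.setMem, Function.update_apply, this, h.arr, St.put_arr, hab, if_false]
  out j hj := by
    have : j ≠ 32 * d + (16 * i + a.idx) := by omega
    simp [Config.setMem, Function.update_apply, this, h.out j hj]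
  size := h.size

theorem Sim.emit {d : ℕ} {S : Config} {s : St} (h : Sim d S s) {i : ℕ} (hi : i < 32 * d) (v : ℕ) :
    Sim d (S.setMem i v) (s.emit i v) where
  reg r' := h.reg r'
  arr b j := by
    have : 32 * d + (16 * j + b.idx) ≠ i := by omega
    simp only [Config.setMem, Function.update_apply, this, h.arr, if_false, St.emit_arr]
  out j hj := by
    simp [Config.setMem, Function.update_apply, h.out j hj]
  size := h.size

/-- Compilation is correct. -/
theorem HRun.compile {d word : ℕ} {c : HCmd} {s s' : St} {t : ℕ}
    (h : HRun (32 * d) word c s t s') {S : Config} (hS : Sim d S s) {cells : ℕ}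
    (hc : 544 * d ≤ cells) :
    ∃ (t' : ℕ) (S' : Config), Run cells word c.compile S t' S' ∧ Sim d S' s' ∧
      t' ≤ c.unit * t := by
  induction h generalizing S with
  | skip s => exact ⟨1, S, .skip S, hS, by simp [HCmd.unit]⟩
  | assign s r e hr hv =>
    refine ⟨_, _, .assign S r.idx e.compile (by rwa [hS.eval]), ?_, by simp [HCmd.unit]⟩
    rw [hS.eval]; exact hS.set hr _
  | store s a i e hi hv =>
    have ha := a.idx_lt
    refine ⟨_, _, .store S (a.address i.compile) e.compile ?_ (by rwa [hS.eval]), ?_,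
      by simp [HCmd.unit]⟩
    · rw [hS.eval_address]; omega
    · rw [hS.eval, hS.eval_address]; exact hS.put a _ _
  | emit s i e hi hv =>
    refine ⟨_, _, .store S i.compile e.compile ?_ (by rwa [hS.eval]), ?_,
      by simp [HCmd.unit]⟩
    · rw [hS.eval]; omega
    · rw [hS.eval, hS.eval]; exact hS.emit hi _
  | @seq c₁ c₂ s₁ s₂ s₃ t₁ t₂ h₁ h₂ ih₁ ih₂ =>
    obtain ⟨a₁, S₁, r₁, m₁, b₁⟩ := ih₁ hS
    obtain ⟨a₂, S₂, r₂, m₂, b₂⟩ := ih₂ m₁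
    refine ⟨_, _, r₁.seq r₂, m₂, ?_⟩
    simp only [HCmd.unit]
    have := Nat.mul_le_mul_right t₁ (le_max_left c₁.unit c₂.unit)
    have := Nat.mul_le_mul_right t₂ (le_max_right c₁.unit c₂.unit)
    rw [Nat.mul_add]; omega
  | @condTrue b c₁ c₂ s s' t hb h ih =>
    obtain ⟨a₁, S₁, r₁, m₁, b₁⟩ := ih hS
    refine ⟨_, _, .condTrue ((hS.holds b).2 hb) r₁, m₁, ?_⟩
    simp only [HCmd.unit]
    have := Nat.mul_le_mul_right t ((le_max_left c₁.unit c₂.unit).trans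
      (le_max_right (b.compile.cost + 1) _))
    have := le_max_left (b.compile.cost + 1) (max c₁.unit c₂.unit)
    rw [Nat.mul_add]; omega
  | @condFalse b c₁ c₂ s s' t hb h ih =>
    obtain ⟨a₁, S₁, r₁, m₁, b₁⟩ := ih hS
    refine ⟨_, _, .condFalse (mt (hS.holds b).1 hb) r₁, m₁, ?_⟩
    simp only [HCmd.unit]
    have := Nat.mul_le_mul_right t ((le_max_right c₁.unit c₂.unit).trans
      (le_max_right (b.compile.cost + 1) _))
    have := le_max_left (b.compile.cost + 1) (max c₁.unit c₂.unit)
    rw [Nat.mul_add]; omega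
  | @loopDone b c s hb =>
    exact ⟨_, _, .loopDone (mt (hS.holds b).1 hb), hS, by simp [HCmd.unit]⟩
  | @loopStep b c s₁ s₂ s₃ t₁ t₂ hb h₁ h₂ ih₁ ih₂ =>
    obtain ⟨a₁, S₁, r₁, m₁, b₁⟩ := ih₁ hS
    obtain ⟨a₂, S₂, r₂, m₂, b₂⟩ := ih₂ m₁
    refine ⟨_, _, .loopStep ((hS.holds b).2 hb) r₁ r₂, m₂, ?_⟩
    simp only [HCmd.unit] at *
    have := Nat.mul_le_mul_right t₁ (le_max_right (b.compile.cost + 1) c.unit)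
    have := le_max_left (b.compile.cost + 1) c.unit
    rw [Nat.mul_add, Nat.mul_add]; omega

/-! ### Reasoning about programs -/

/-- The program halts, and `Q` holds for the number of steps and the final state. -/
def Ex (N word : ℕ) (c : HCmd) (s : St) (Q : ℕ → St → Prop) : Prop :=
  ∃ t s', HRun N word c s t s' ∧ Q t s'

/-- The number of atomic statements and tests in a program. -/
def HCmd.size : HCmd → ℕ
  | .skip => 1
  | .assign _ _ => 1
  | .store _ _ _ => 1
  | .emit _ _ => 1
  | .seq c₁ c₂ => c₁.size + c₂.size
  | .cond _ c₁ c₂ => 1 + (c₁.size + c₂.size)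
  | .loop _ c => 1 + c.size

/-- A sufficient condition for a loop-free program to halt in a state that satisfies `Q`. -/
def HCmd.wp (N word : ℕ) : HCmd → (St → Prop) → St → Prop
  | .skip, Q, s => Q s
  | .assign r e, Q, s => r ≠ .d ∧ e.eval s < word ∧ Q (s.set r (e.eval s))
  | .store a i e, Q, s => i.eval s < N ∧ e.eval s < word ∧ Q (s.put a (i.eval s) (e.eval s))
  | .emit i e, Q, s => i.eval s < N ∧ e.eval s < word ∧ Q (s.emit (i.eval s) (e.eval s))
  | .seq c₁ c₂, Q, s => c₁.wp N word (c₂.wp N word Q) s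
  | .cond b c₁ c₂, Q, s => (b.Holds s → c₁.wp N word Q s) ∧ (¬ b.Holds s → c₂.wp N word Q s)
  | .loop _ _, _, _ => False

section
variable {N word : ℕ} {c c₁ c₂ : HCmd} {b : HTest} {s : St} {Q : ℕ → St → Prop}

/-- Without loops every statement and every test is executed at most once, so their number bounds
the time. -/
theorem HCmd.wp.run {Q : St → Prop} (h : c.wp N word Q s) :
    Ex N word c s fun t s' => t ≤ c.size ∧ Q s' := by
  induction c generalizing s Q with
  | skip => exact ⟨1, s, .skip s, le_rfl, h⟩
  | assign r e => exact ⟨1, _, .assign s r e h.1 h.2.1, le_rfl, h.2.2⟩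
  | store a i e => exact ⟨1, _, .store s a i e h.1 h.2.1, le_rfl, h.2.2⟩
  | emit i e => exact ⟨1, _, .emit s i e h.1 h.2.1, le_rfl, h.2.2⟩
  | seq c₁ c₂ ih₁ ih₂ =>
    obtain ⟨t₁, s₁, r₁, b₁, h₁⟩ := ih₁ h
    obtain ⟨t₂, s₂, r₂, b₂, h₂⟩ := ih₂ h₁
    exact ⟨_, _, r₁.seq r₂, Nat.add_le_add b₁ b₂, h₂⟩
  | cond b c₁ c₂ ih₁ ih₂ =>
    by_cases hb : b.Holds s
    · obtain ⟨t₁, s₁, r₁, b₁, h₁⟩ := ih₁ (h.1 hb)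
      exact ⟨_, _, .condTrue hb r₁, by simp only [HCmd.size]; omega, h₁⟩
    · obtain ⟨t₁, s₁, r₁, b₁, h₁⟩ := ih₂ (h.2 hb)
      exact ⟨_, _, .condFalse hb r₁, by simp only [HCmd.size]; omega, h₁⟩
  | loop b c ih => exact h.elim

theorem Ex.mono {Q' : ℕ → St → Prop} (h : Ex N word c s Q) (hQ : ∀ t s', Q t s' → Q' t s') :
    Ex N word c s Q' :=
  let ⟨t, s', r, q⟩ := h
  ⟨t, s', r, hQ _ _ q⟩

theorem Ex.seq (h : Ex N word c₁ s fun t₁ s₁ => Ex N word c₂ s₁ fun t₂ s₂ => Q (t₁ + t₂) s₂) :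
    Ex N word (c₁ ;; c₂) s Q :=
  let ⟨_, _, r₁, _, _, r₂, q⟩ := h
  ⟨_, _, r₁.seq r₂, q⟩

theorem Ex.cond (h₁ : b.Holds s → Ex N word c₁ s fun t s' => Q (1 + t) s')
    (h₂ : ¬ b.Holds s → Ex N word c₂ s fun t s' => Q (1 + t) s') :
    Ex N word (.cond b c₁ c₂) s Q := by
  by_cases hb : b.Holds s
  · obtain ⟨t, s', r, q⟩ := h₁ hb
    exact ⟨_, _, .condTrue hb r, q⟩
  · obtain ⟨t, s', r, q⟩ := h₂ hb
    exact ⟨_, _, .condFalse hb r, q⟩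

/-- A loop with an invariant `I` and a measure `n` that each round decreases. -/
theorem Ex.loop {I : ℕ → St → Prop} {n k : ℕ} (hI : I n s)
    (hstep : ∀ n s, I n s → b.Holds s → Ex N word c s fun t s' => t ≤ k ∧ ∃ n' < n, I n' s') :
    Ex N word (.loop b c) s fun t s' =>
      -- The measure `n'` that is left over stays in the bound, so that unspent potential can be
      -- carried on.
      ∃ n' ≤ n, I n' s' ∧ ¬ b.Holds s' ∧ t + (k + 1) * n' ≤ (k + 1) * n + 1 := by
  induction n using Nat.strong_induction_on generalizing s with
  | _ n ih =>
    by_cases hb : b.Holds s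
    · obtain ⟨t, s', r, ht, n', hn', hI'⟩ := hstep n s hI hb
      obtain ⟨t₂, s₂, r₂, n₂, hn₂, hI₂, hb₂, ht₂⟩ := ih n' hn' hI'
      refine ⟨_, _, .loopStep hb r r₂, n₂, by omega, hI₂, hb₂, ?_⟩
      have : (k + 1) * (n' + 1) ≤ (k + 1) * n := Nat.mul_le_mul_left _ hn'
      rw [Nat.mul_add] at this
      omega
    · exact ⟨_, _, .loopDone hb, n, le_rfl, hI, hb, by omega⟩
end

/-- The states agree outside the registers `rs`, the arrays `as`, and the output array. -/
structure St.Frame (rs : List Reg) (as : List Arr) (s s' : St) : Prop where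
  reg : ∀ r, r ∉ rs → s'.reg r = s.reg r
  arr : ∀ a, a ∉ as → s'.arr a = s.arr a

theorem St.Frame.trans {rs rs' : List Reg} {as as' : List Arr} {s s' s'' : St}
    (h : s.Frame rs as s') (h' : s'.Frame rs' as' s'') : s.Frame (rs ++ rs') (as ++ as') s'' where
  reg r hr := by
    simp only [List.mem_append, not_or] at hr
    rw [h'.reg r hr.2, h.reg r hr.1]
  arr r hr := by
    simp only [List.mem_append, not_or] at hr
    rw [h'.arr r hr.2, h.arr r hr.1]

theorem St.Frame.mono {rs rs' : List Reg} {as as' : List Arr} {s s' : St}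
    (h : s.Frame rs as s') (hr : rs ⊆ rs') (ha : as ⊆ as') : s.Frame rs' as' s' where
  reg r hr' := h.reg r fun c => hr' (hr c)
  arr r hr' := h.arr r fun c => hr' (ha c)

theorem St.Frame.comp {rs : List Reg} {as : List Arr} {s s' s'' : St}
    (h : s.Frame rs as s') (h' : s'.Frame rs as s'') : s.Frame rs as s'' :=
  (h.trans h').mono (by simp) (by simp)

theorem St.Frame.refl {rs : List Reg} {as : List Arr} (s : St) : s.Frame rs as s :=
  ⟨fun _ _ => rfl, fun _ _ => rfl⟩

theorem St.Frame.set {rs : List Reg} {as : List Arr} {s s' : St} (h : s.Frame rs as s') {r : Reg}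
    (hr : r ∈ rs) (z : ℕ) : s.Frame rs as (s'.set r z) where
  reg r' hr' := by
    rw [St.set_reg, if_neg (by rintro rfl; exact hr' hr), h.reg r' hr']
  arr := h.arr

theorem St.Frame.put {rs : List Reg} {as : List Arr} {s s' : St} (h : s.Frame rs as s') {a : Arr}
    (ha : a ∈ as) (i z : ℕ) : s.Frame rs as (s'.put a i z) where
  reg := h.reg
  arr a' ha' := by
    rw [St.put_arr, if_neg (by rintro rfl; exact ha' ha), h.arr a' ha']

end SlidingMUPS

namespace SlidingMUPS

/-! ### 1-2-3 skip lists -/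

/-- `p` is one of the nodes `1, …, al - 1`. -/
def Nd (al p : ℕ) : Prop := 0 < p ∧ p < al

/-- A family of 1-2-3 skip lists that share the nodes `1, …, al - 1`. The node `p` lies in the list
of `ow p`, at level `lv p`. The lists of each level have decreasing keys and end with the key `0`;
every list is contained in the list one level below, with one or two or three elements between
adjacent elements. -/
structure Skip (K R D lv ow : ℕ → ℕ) (al : ℕ) : Prop where
  key0 : K 0 = 0
  inj : ∀ p q, Nd al p → Nd al q → ow p = ow q → lv p = lv q → K p = K q → p = q
  right_null : ∀ p, Nd al p → K p = 0 → R p = 0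
  right : ∀ p, Nd al p → K p ≠ 0 → Nd al (R p) ∧ ow (R p) = ow p ∧ lv (R p) = lv p ∧ K (R p) < K p
  right_max : ∀ p q, Nd al p → Nd al q → ow q = ow p → lv q = lv p → K q < K p → K q ≤ K (R p)
  down_null : ∀ p, Nd al p → (D p = 0 ↔ lv p = 0)
  down : ∀ p, Nd al p → lv p ≠ 0 →
    Nd al (D p) ∧ ow (D p) = ow p ∧ lv (D p) + 1 = lv p ∧ K p < K (D p)
  down_lt : ∀ p q, Nd al p → Nd al q → ow q = ow p → lv q = lv p → lv p ≠ 0 → K p < K q →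
    K (D p) < K q
  down_max : ∀ p r, Nd al p → Nd al r → ow r = ow p → lv r + 1 = lv p → K (D p) < K r →
    ∃ q, Nd al q ∧ ow q = ow p ∧ lv q = lv p ∧ K p < K q ∧ K q ≤ K r
  sub : ∀ p, Nd al p → lv p ≠ 0 → ∃ r, Nd al r ∧ ow r = ow p ∧ lv r + 1 = lv p ∧ K r = K p
  gap : ∀ p, Nd al p → lv p ≠ 0 →
    K (R (D p)) = K p ∨ K (R (R (D p))) = K p ∨ K (R (R (R (D p)))) = K p

/-- Every node that covers a node with the key `k` at the level below leaves room for an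
insertion. -/
def Room (K R D lv ow : ℕ → ℕ) (al o l k : ℕ) : Prop :=
  ∀ q, Nd al q → ow q = o → lv q = l + 1 → K q ≤ k →
    (∀ q', Nd al q' → ow q' = o → lv q' = l + 1 → K q < K q' → k < K q') →
    K (R (D q)) = K q ∨ K (R (R (D q))) = K q

/-- The node `p` is the first node of its list with a key at most `k`. -/
def Covers (K lv ow : ℕ → ℕ) (al p k : ℕ) : Prop :=
  K p ≤ k ∧ ∀ q, Nd al q → ow q = ow p → lv q = lv p → K p < K q → k < K q

/-- The key of `p` itself is present on the level below, so a move to the right from a larger key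
cannot jump over it. -/
theorem Skip.down_right {K R D lv ow : ℕ → ℕ} {al : ℕ} (h : Skip K R D lv ow al) {p q : ℕ}
    (hp : Nd al p) (hq : Nd al q) (h0 : lv p ≠ 0) (ho : ow q = ow p) (hl : lv q + 1 = lv p)
    (hk : K p < K q) :
    Nd al (R q) ∧ ow (R q) = ow p ∧ lv (R q) + 1 = lv p ∧ K p ≤ K (R q) ∧ K (R q) < K q := by
  obtain ⟨r, r1, r2, r3, r4⟩ := h.sub p hp h0
  obtain ⟨a1, a2, a3, a4⟩ := h.right q hq (by omega)
  have := h.right_max q r hq r1 (by omega) (by omega) (by omega)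
  exact ⟨a1, by omega, by omega, by omega, a4⟩

open Function in
/-- The node `al` is put behind `t`; it inherits the key of `t`, and `t` gets the key `k`. -/
theorem Skip.insert {K R D lv ow : ℕ → ℕ} {al : ℕ} (h : Skip K R D lv ow al) {t k dx : ℕ}
    (ht : Nd al t) (hk : K t < k) (hc : Covers K lv ow al t k)
    (hroom : Room K R D lv ow al (ow t) (lv t) k)
    (h0 : lv t = 0 → dx = 0)
    (h1 : lv t ≠ 0 → Nd al dx ∧ ow dx = ow t ∧ lv dx + 1 = lv t ∧ K t < K dx ∧ K dx < k ∧
      k < K (D t) ∧ (∃ r, Nd al r ∧ ow r = ow t ∧ lv r + 1 = lv t ∧ K r = k ∧ R (D t) = r ∧ R r = dx) ∧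
      K (R dx) = K t) :
    Skip (update (update K t k) al (K t)) (update (update R t al) al (R t)) (update D al dx)
      (update lv al (lv t)) (update ow al (ow t)) (al + 1) := by
  have hnd : ∀ p, Nd (al + 1) p ↔ Nd al p ∨ p = al := by
    intro p; unfold Nd at *; omega
  have hta : t ≠ al := by unfold Nd at ht; omega
  have hna : ¬ Nd al al := by unfold Nd; omega
  have hn0 : ¬ Nd al 0 := by unfold Nd; omega
  have ha0 : (0 : ℕ) ≠ al := by unfold Nd at ht; omega
  have ht0 : (0 : ℕ) ≠ t := by unfold Nd at ht; omega
  obtain ⟨hc1, hc2⟩ := hc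
  have hKt : K t ≠ k := by omega
  have hnd3 : ∀ p, Nd (al + 1) p → (Nd al p ∧ p ≠ t ∧ p ≠ al) ∨ p = t ∨ p = al := by
    intro p; unfold Nd at *; omega
  obtain ⟨K', hK'⟩ : ∃ K', K' = update (update K t k) al (K t) := ⟨_, rfl⟩
  obtain ⟨R', hR'⟩ : ∃ R', R' = update (update R t al) al (R t) := ⟨_, rfl⟩
  obtain ⟨D', hD'⟩ : ∃ D', D' = update D al dx := ⟨_, rfl⟩
  obtain ⟨lv', hlv'⟩ : ∃ lv', lv' = update lv al (lv t) := ⟨_, rfl⟩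
  obtain ⟨ow', how'⟩ : ∃ ow', ow' = update ow al (ow t) := ⟨_, rfl⟩
  have eK : ∀ p, p ≠ t → p ≠ al → K' p = K p := by intro p h1 h2; simp [hK', h1, h2]
  have eKt : K' t = k := by simp [hK', hta]
  have eKa : K' al = K t := by simp [hK']
  have eR : ∀ p, p ≠ t → p ≠ al → R' p = R p := by intro p h1 h2; simp [hR', h1, h2]
  have eRt : R' t = al := by simp [hR', hta]
  have eRa : R' al = R t := by simp [hR']
  have eD : ∀ p, p ≠ al → D' p = D p := by intro p h1; simp [hD', h1]
  have eDa : D' al = dx := by simp [hD']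
  have eL : ∀ p, p ≠ al → lv' p = lv p := by intro p h1; simp [hlv', h1]
  have eLa : lv' al = lv t := by simp [hlv']
  have eO : ∀ p, p ≠ al → ow' p = ow p := by intro p h1; simp [how', h1]
  have eOa : ow' al = ow t := by simp [how']
  rw [← hK', ← hR', ← hD', ← hlv', ← how']
  have hne : ∀ p, Nd al p → p ≠ al := by rintro p hp rfl; exact hna hp
  have hdl : lv t ≠ 0 → dx ≠ t ∧ dx ≠ al ∧ D t ≠ t ∧ D t ≠ al := by
    intro h00
    obtain ⟨a1, a2, a3, a4⟩ := h.down t ht h00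
    obtain ⟨b1, b2, b3, -⟩ := h1 h00
    exact ⟨by rintro rfl; omega, hne _ b1, fun e => by rw [e] at a3; omega, hne _ a1⟩
  have hK'lt : ∀ q, Nd al q → ow q = ow t → lv q = lv t → q ≠ t → K q ≠ K t ∧ (K t < K q → k < K q) :=
    fun q a b c e => ⟨fun e' => e (h.inj _ _ a ht b c e'), hc2 q a b c⟩
  constructor
  · rw [eK 0 ht0 ha0, h.key0]
  · have := h.inj
    intro p q hp hq
    rcases hnd3 p hp with hp | hp | hp <;> rcases hnd3 q hq with hq | hq | hq <;> grind
  · have := h.right_null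
    intro p hp
    rcases hnd3 p hp with hp | hp | hp <;> grind
  · have := h.right
    intro p hp
    simp only [hnd]
    rcases hnd3 p hp with hp | hp | hp <;> grind
  · have := h.right_max
    have := h.right
    have := h.inj
    intro p q hp hq
    rcases hnd3 p hp with hp | hp | hp <;> rcases hnd3 q hq with hq | hq | hq <;> grind
  · have := h.down_null
    intro p hp
    rcases hnd3 p hp with hp | hp | hp <;> grind
  · have := h.down
    intro p hp
    simp only [hnd]
    rcases hnd3 p hp with hp | hp | hp <;> grind
  · have d1 := h.down
    have d2 := h.down_lt
    have d3 := h.sub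
    intro p q hp hq ho hl h00 hlt
    rcases hnd3 p hp with hp | hp | hp
    · rw [eL p hp.2.2, eO p hp.2.2] at *
      rw [eD p hp.2.2]
      rw [eK p hp.2.1 hp.2.2] at hlt
      obtain ⟨b1, b2, b3, b4⟩ := d1 p hp.1 h00
      -- The gap of `p` begins at `t`, whose key grows to `k`. Larger keys on the level of `p` also
      -- occur on the level of `t`, where `Covers` puts them above `k`.
      by_cases hdt : D p = t
      · rw [hdt, eKt]
        rw [hdt] at b2 b3
        rcases hnd3 q hq with hq | hq | hq
        · rw [eL q hq.2.2] at hl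
          rw [eO q hq.2.2] at ho
          rw [eK q hq.2.1 hq.2.2] at hlt ⊢
          obtain ⟨r, r1, r2, r3, r4⟩ := d3 q hq.1 (by omega)
          have := d2 p q hp.1 hq.1 ho hl h00 hlt
          rw [hdt] at this
          rw [← r4]
          exact hc2 r r1 (by omega) (by omega) (by omega)
        · rw [hq, eL t hta] at hl; omega
        · rw [hq, eLa] at hl; omega
      · rw [eK _ hdt (hne _ b1)]
        rcases hnd3 q hq with hq | hq | hq
        · grind
        · subst hq
          have := hK'lt p hp.1
          grind
        · subst hq
          grind
    · subst hp
      have := hdl (by rwa [eL p hta] at h00)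
      rcases hnd3 q hq with hq | hq | hq <;> grind
    · subst hp
      have := hdl (by rwa [eLa] at h00)
      rcases hnd3 q hq with hq | hq | hq <;> grind
  · intro p r hp hr ho hl hlt
    simp only [hnd]
    rcases hnd3 p hp with hp | hp | hp
    · rw [eL p hp.2.2, eO p hp.2.2, eK p hp.2.1 hp.2.2] at *
      rw [eD p hp.2.2] at hlt
      have h00 : lv p ≠ 0 := by omega
      obtain ⟨b1, b2, b3, b4⟩ := h.down p hp.1 h00
      have conv : ∀ r, Nd al r → ow r = ow p → lv r + 1 = lv p → K (D p) < K r →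
          ∃ q, (Nd al q ∨ q = al) ∧ ow' q = ow p ∧ lv' q = lv p ∧ K p < K' q ∧ K' q ≤ K r := by
        intro r c1 c2 c3 c4
        obtain ⟨q, q1, q2, q3, q4, q5⟩ := h.down_max p r hp.1 c1 c2 c3 c4
        by_cases hqt : q = t
        · subst hqt
          exact ⟨al, Or.inr rfl, by rw [eOa, q2], by rw [eLa, q3], by rwa [eKa], by rwa [eKa]⟩
        · have := hne q q1
          exact ⟨q, Or.inl q1, by rw [eO q this, q2], by rw [eL q this, q3],
            by rwa [eK q hqt this], by rwa [eK q hqt this]⟩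
      have same : ow t = ow p → lv t + 1 = lv p → D p ≠ t → K t ≠ K (D p) ∧
          (K t < K (D p) → k < K (D p)) := by
        intro c1 c2 c3
        have := hK'lt (D p) b1 (by omega) (by omega) c3
        exact ⟨this.1.symm, this.2⟩
      rcases hnd3 r hr with hr | hr | hr
      · rw [eL r hr.2.2] at hl
        rw [eO r hr.2.2] at ho
        rw [eK r hr.2.1 hr.2.2] at hlt ⊢
        refine conv r hr.1 ho hl ?_
        by_cases hdt : D p = t
        · rw [hdt, eKt] at hlt
          rw [hdt]; omega
        · rwa [eK _ hdt (hne _ b1)] at hlt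
      · subst hr
        rw [eL r hta] at hl
        rw [eO r hta] at ho
        rw [eKt] at hlt ⊢
        by_cases hdt : D p = r
        · rw [hdt, eKt] at hlt; omega
        · rw [eK _ hdt (hne _ b1)] at hlt
          have := same ho hl hdt
          obtain ⟨q, q1, q2, q3, q4, q5⟩ := conv r ht ho hl (by omega)
          exact ⟨q, q1, q2, q3, q4, by omega⟩
      · subst hr
        rw [eLa] at hl
        rw [eOa] at ho
        rw [eKa] at hlt ⊢
        by_cases hdt : D p = t
        · rw [hdt, eKt] at hlt; omega
        · rw [eK _ hdt (hne _ b1)] at hlt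
          exact conv t ht ho hl hlt
    · subst hp
      have h00 : lv p ≠ 0 := by rw [eL p hta] at hl; omega
      have := hdl h00
      rw [eD p hta, eK _ this.2.2.1 this.2.2.2] at hlt
      rcases hnd3 r hr with hr | hr | hr
      · rw [eL r hr.2.2, eL p hta] at hl
        rw [eO r hr.2.2, eO p hta] at ho
        rw [eK r hr.2.1 hr.2.2] at hlt ⊢
        obtain ⟨q, q1, q2, q3, q4, q5⟩ := h.down_max p r ht hr.1 ho hl hlt
        have hqp : q ≠ p := by rintro rfl; omega
        refine ⟨q, Or.inl q1, ?_⟩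
        rw [eO q (hne q q1), eO p hta, eL q (hne q q1), eL p hta, eKt, eK q hqp (hne q q1)]
        exact ⟨q2, q3, hc2 q q1 q2 q3 q4, q5⟩
      · subst hr; omega
      · subst hr; rw [eLa, eL p hta] at hl; omega
    · subst hp
      rw [eLa] at hl
      rw [eOa] at ho
      have h00 : lv t ≠ 0 := by omega
      obtain ⟨d1, d2, d3, d4⟩ := hdl h00
      obtain ⟨a1, a2, a3, a4, a5, a6, ⟨z, z1, z2, z3, z4, z5, z6⟩, -⟩ := h1 h00
      rw [eDa, eK _ d1 d2] at hlt
      refine ⟨t, Or.inl ht, by rw [eO t hta, eOa], by rw [eL t hta, eLa], by rwa [eKt, eKa], ?_⟩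
      rw [eKt]
      rcases hnd3 r hr with hr | hr | hr
      · rw [eL r hr.2.2] at hl
        rw [eO r hr.2.2] at ho
        rw [eK r hr.2.1 hr.2.2] at hlt ⊢
        by_contra hcon
        have := h.right_max z r z1 hr.1 (by omega) (by omega) (by omega)
        rw [z6] at this; omega
      · subst hr; rw [eL r hta] at hl; omega
      · subst hr; rw [eLa] at hl; omega
  · intro p hp h00
    have key : ∃ r, Nd al r ∧ ow r = ow' p ∧ lv r + 1 = lv' p ∧ K r = K' p := by
      rcases hnd3 p hp with hp | hp | hp
      · rw [eO p hp.2.2, eL p hp.2.2, eK p hp.2.1 hp.2.2]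
        rw [eL p hp.2.2] at h00
        exact h.sub p hp.1 h00
      · subst hp
        rw [eO p hta, eL p hta, eKt]
        rw [eL p hta] at h00
        obtain ⟨-, -, -, -, -, -, ⟨r, r1, r2, r3, r4, -⟩, -⟩ := h1 h00
        exact ⟨r, r1, r2, r3, r4⟩
      · subst hp
        rw [eOa, eLa, eKa]
        rw [eLa] at h00
        exact h.sub t ht h00
    obtain ⟨r, r1, r2, r3, r4⟩ := key
    by_cases hrt : r = t
    · refine ⟨al, (hnd _).2 (Or.inr rfl), ?_⟩
      rw [eOa, eLa, eKa, ← hrt]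
      exact ⟨r2, r3, r4⟩
    · refine ⟨r, (hnd _).2 (Or.inl r1), ?_⟩
      rw [eO _ (hne _ r1), eL _ (hne _ r1), eK _ hrt (hne _ r1)]
      exact ⟨r2, r3, r4⟩
  · intro p hp h00
    rcases hnd3 p hp with hp | hp | hp
    · obtain ⟨hp, hpt, hpa⟩ := hp
      rw [eL p hpa] at h00
      rw [eD p hpa, eK p hpt hpa]
      obtain ⟨a1, a2, a3, a4⟩ := h.down p hp h00
      have hg := h.gap p hp h00
      have dr : ∀ q, Nd al q → ow q = ow p → lv q + 1 = lv p → K p < K q → _ :=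
        fun q c1 c2 c3 c4 => h.down_right hp c1 h00 c2 c3 c4
      obtain ⟨b1, b2, b3, b4, b5⟩ := dr _ a1 a2 a3 a4
      -- If `t` lies in the gap of `p` or at its end, then `p` covers `k`, and `hroom` leaves at
      -- most two nodes in the gap before the insertion.
      have hcov : ow t = ow p → lv t + 1 = lv p → K p ≤ K t → K t ≤ K (D p) →
          K (R (D p)) = K p ∨ K (R (R (D p))) = K p := by
        intro c1 c2 c3 c4
        refine hroom p hp c1.symm c2.symm (by omega) ?_
        intro q' e1 e2 e3 e4
        obtain ⟨r, r1, r2, r3, r4⟩ := h.sub q' e1 (by omega)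
        have := h.down_lt p q' hp e1 (by omega) (by omega) h00 e4
        rw [← r4]
        exact hc2 r r1 (by omega) (by omega) (by omega)
      generalize D p = a at *
      have haa := hne a a1
      have hba := hne _ b1
      generalize hb : R a = b at *
      by_cases hat : a = t
      · subst hat
        have hbt : b ≠ a := by rintro rfl; omega
        rw [eRt, eRa, hb, eK _ hbt hba, eR _ hbt hba]
        rcases hcov a2 a3 a4.le le_rfl with c | c
        · exact Or.inr (Or.inl c)
        · by_cases hb : K b = K p
          · exact Or.inr (Or.inl hb)
          obtain ⟨e1, e2, e3, e4, e5⟩ := dr _ b1 b2 b3 (by omega)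
          refine Or.inr (Or.inr ?_)
          rw [eK _ (by intro e; rw [e] at e5; omega) (hne _ e1)]
          exact c
      · rw [eR a hat haa, hb]
        by_cases hbt : b = t
        · subst hbt
          rw [eRt, eKt, eKa, eRa]
          rcases hcov b2 b3 b4 b5.le with c | c
          · exact Or.inr (Or.inl c)
          · by_cases hb : K b = K p
            · exact Or.inr (Or.inl hb)
            obtain ⟨e1, e2, e3, e4, e5⟩ := dr _ b1 b2 b3 (by omega)
            refine Or.inr (Or.inr ?_)
            rw [eK _ (by intro e; rw [e] at e5; omega) (hne _ e1)]
            exact c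
        · rw [eK _ hbt hba, eR _ hbt hba]
          by_cases hb : K b = K p
          · exact Or.inl hb
          obtain ⟨e1, e2, e3, e4, e5⟩ := dr _ b1 b2 b3 (by omega)
          generalize hc : R b = c at *
          by_cases hct : c = t
          · subst hct
            rw [eRt, eKa]
            rcases hcov e2 e3 e4 (by omega) with c | c
            · exact Or.inl c
            · exact Or.inr (Or.inr c)
          · rw [eK _ hct (hne _ e1), eR _ hct (hne _ e1)]
            by_cases hc' : K c = K p
            · exact Or.inr (Or.inl hc')
            obtain ⟨f1, f2, f3, f4, f5⟩ := dr _ e1 e2 e3 (by omega)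
            generalize R c = g at *
            -- Here the gap holds three nodes before its end `g`, which `hroom` would forbid if `t`
            -- were this end.
            have hft : g ≠ t := by
              rintro rfl
              rcases hcov f2 f3 f4 (by omega) with c | c <;> omega
            rw [eK _ hft (hne _ f1)]
            exact hg
    · subst hp
      rw [eL p hta] at h00
      obtain ⟨d1, d2, d3, d4⟩ := hdl h00
      obtain ⟨-, -, -, -, -, -, ⟨z, z1, z2, z3, z4, z5, z6⟩, -⟩ := h1 h00
      left
      rw [eD p hta, eR _ d3 d4, z5, eK z (by rintro rfl; omega) (hne z z1), z4, eKt]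
    · subst hp
      rw [eLa] at h00
      obtain ⟨d1, d2, d3, d4⟩ := hdl h00
      obtain ⟨a1, a2, a3, a4, a5, a6, -, a8⟩ := h1 h00
      left
      obtain ⟨c1, c2, c3, c4⟩ := h.right dx a1 (by omega)
      rw [eDa, eR _ d1 d2, eK _ (by intro e; rw [e] at c3; omega) (hne _ c1), a8, eKa]

end SlidingMUPS

/-! ### Size and height of the skip lists -/

namespace SlidingMUPS

/-- Each node `p` of `A` is charged to two nodes below it: the start `D p` of its gap, and the node
with the key of `p`. By `down_lt`, gaps of different nodes start at different nodes, and the start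
of a gap never carries a key that occurs on the upper level. -/
theorem Skip.two_mul_card {K R D lv ow : ℕ → ℕ} {al : ℕ} (h : Skip K R D lv ow al)
    {A B : Finset ℕ} (hA : ∀ p ∈ A, Nd al p ∧ lv p ≠ 0)
    (hB : ∀ p ∈ A, ∀ q, Nd al q → ow q = ow p → lv q + 1 = lv p → q ∈ B) :
    2 * A.card ≤ B.card := by
  have hs : ∀ p, ∃ r, p ∈ A → Nd al r ∧ ow r = ow p ∧ lv r + 1 = lv p ∧ K r = K p := by
    intro p
    by_cases hp : p ∈ A
    · obtain ⟨r, hr⟩ := h.sub p (hA p hp).1 (hA p hp).2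
      exact ⟨r, fun _ => hr⟩
    · exact ⟨0, fun e => absurd e hp⟩
  choose g hg using hs
  have hd : ∀ p ∈ A, _ := fun p hp => h.down p (hA p hp).1 (hA p hp).2
  have hlt := h.down_lt
  have h1 : (A.image D).card = A.card := by
    refine Finset.card_image_of_injOn fun p hp q hq e => ?_
    obtain ⟨a1, a2, a3, a4⟩ := hd p hp
    obtain ⟨b1, b2, b3, b4⟩ := hd q hq
    replace e : D p = D q := e
    rw [e] at a1 a2 a3 a4
    have := hlt p q (hA p hp).1 (hA q hq).1 (by omega) (by omega) (hA p hp).2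
    have := hlt q p (hA q hq).1 (hA p hp).1 (by omega) (by omega) (hA q hq).2
    rw [e] at *
    exact h.inj p q (hA p hp).1 (hA q hq).1 (by omega) (by omega) (by omega)
  have h2 : (A.image g).card = A.card := by
    refine Finset.card_image_of_injOn fun p hp q hq e => ?_
    obtain ⟨a1, a2, a3, a4⟩ := hg p hp
    obtain ⟨b1, b2, b3, b4⟩ := hg q hq
    replace e : g p = g q := e
    rw [e] at a1 a2 a3 a4
    exact h.inj p q (hA p hp).1 (hA q hq).1 (by omega) (by omega) (by omega)
  have h3 : Disjoint (A.image D) (A.image g) := by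
    rw [Finset.disjoint_left]
    intro z hz hz'
    obtain ⟨p, hp, rfl⟩ := Finset.mem_image.1 hz
    obtain ⟨q, hq, e⟩ := Finset.mem_image.1 hz'
    obtain ⟨a1, a2, a3, a4⟩ := hd p hp
    obtain ⟨b1, b2, b3, b4⟩ := hg q hq
    rw [e] at *
    have := hlt p q (hA p hp).1 (hA q hq).1 (by omega) (by omega) (hA p hp).2 (by omega)
    omega
  calc 2 * A.card = (A.image D ∪ A.image g).card := by
        rw [Finset.card_union_of_disjoint h3, h1, h2]; ring
    _ ≤ B.card := Finset.card_le_card <| by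
        intro z hz
        rcases Finset.mem_union.1 hz with hz | hz
        · obtain ⟨p, hp, rfl⟩ := Finset.mem_image.1 hz
          exact hB p hp _ (hd p hp).1 (hd p hp).2.1 (hd p hp).2.2.1
        · obtain ⟨p, hp, rfl⟩ := Finset.mem_image.1 hz
          exact hB p hp _ (hg p hp).1 (hg p hp).2.1 (hg p hp).2.2.1

/-- The nodes at level `l` of the list of `o`. -/
def level (lv ow : ℕ → ℕ) (al o l : ℕ) : Finset ℕ :=
  (Finset.Ico 1 al).filter fun p => ow p = o ∧ lv p = l

/-- The nodes at level `0`. -/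
def ground (lv : ℕ → ℕ) (al : ℕ) : Finset ℕ := (Finset.Ico 1 al).filter fun p => lv p = 0

theorem mem_level {lv ow : ℕ → ℕ} {al o l p : ℕ} :
    p ∈ level lv ow al o l ↔ Nd al p ∧ ow p = o ∧ lv p = l := by
  simp [level, Nd, Nat.one_le_iff_ne_zero, Nat.pos_iff_ne_zero]

theorem mem_ground {lv : ℕ → ℕ} {al p : ℕ} : p ∈ ground lv al ↔ Nd al p ∧ lv p = 0 := by
  simp [ground, Nd, Nat.one_le_iff_ne_zero, Nat.pos_iff_ne_zero]

/-- Each level has at least twice as many nodes as the level above. Thus the height is at most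
logarithmic in the number of ground nodes. -/
theorem Skip.pow_le_card {K R D lv ow : ℕ → ℕ} {al : ℕ} (h : Skip K R D lv ow al) {p : ℕ}
    (hp : Nd al p) : 2 ^ lv p ≤ (level lv ow al (ow p) 0).card := by
  have : ∀ l m, l + m = lv p → 2 ^ m ≤ (level lv ow al (ow p) l).card := by
    intro l m
    induction m generalizing l with
    | zero =>
      intro e
      exact Finset.card_pos.2 ⟨p, mem_level.2 ⟨hp, rfl, by omega⟩⟩
    | succ m ih =>
      intro e
      have h1 := ih (l + 1) (by omega)
      have h2 := h.two_mul_card (A := level lv ow al (ow p) (l + 1))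
        (B := level lv ow al (ow p) l)
        (fun q hq => ⟨(mem_level.1 hq).1, by rw [(mem_level.1 hq).2.2]; omega⟩)
        (fun q hq r h1 h2 h3 => mem_level.2
          ⟨h1, by rw [h2, (mem_level.1 hq).2.1], by rw [(mem_level.1 hq).2.2] at h3; omega⟩)
      rw [pow_succ]; omega
  exact this 0 (lv p) (by omega)

/-- Applied to all nodes above the ground at once, `Skip.two_mul_card` shows that they are at most
half of all nodes. This bounds the memory in terms of the entries. -/
theorem Skip.le_two_mul_ground {K R D lv ow : ℕ → ℕ} {al : ℕ} (h : Skip K R D lv ow al) :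
    al ≤ 2 * (ground lv al).card + 1 := by
  have h2 := h.two_mul_card (A := (Finset.Ico 1 al).filter fun p => lv p ≠ 0)
    (B := Finset.Ico 1 al)
    (fun q hq => by
      simp only [Finset.mem_filter, Finset.mem_Ico] at hq
      exact ⟨⟨by omega, by omega⟩, hq.2⟩)
    (fun q hq r h1 h2 h3 => by
      simp only [Finset.mem_Ico]
      exact ⟨h1.1, h1.2⟩)
  have h3 := Finset.card_filter_add_card_filter_not (s := Finset.Ico 1 al) (fun p => lv p = 0)
  simp only [Nat.card_Ico, ne_eq] at *
  rw [ground]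
  omega

open Function in
/-- A new node with the key `0` is put on top of the list of `o`. -/
theorem Skip.sentinel {K R D lv ow : ℕ → ℕ} {al : ℕ} (h : Skip K R D lv ow al) {o l dx : ℕ}
    (hal : 0 < al) (hl : ∀ q, Nd al q → ow q = o → lv q < l)
    (h0 : l = 0 → dx = 0)
    (h1 : l ≠ 0 → Nd al dx ∧ ow dx = o ∧ lv dx + 1 = l ∧ 0 < K dx ∧ K (R dx) = 0 ∧
      ∀ q, Nd al q → ow q = o → lv q + 1 = l → K q ≤ K dx) :
    Skip (update K al 0) (update R al 0) (update D al dx) (update lv al l) (update ow al o)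
      (al + 1) := by
  have hnd3 : ∀ p, Nd (al + 1) p ↔ (Nd al p ∧ p ≠ al) ∨ p = al := by
    intro p; unfold Nd at *; omega
  have hna : ¬ Nd al al := by unfold Nd; omega
  have hn0 : ∀ p, Nd al p → p ≠ 0 := by unfold Nd; omega
  obtain ⟨K', hK'⟩ : ∃ K', K' = update K al 0 := ⟨_, rfl⟩
  obtain ⟨R', hR'⟩ : ∃ R', R' = update R al 0 := ⟨_, rfl⟩
  obtain ⟨D', hD'⟩ : ∃ D', D' = update D al dx := ⟨_, rfl⟩
  obtain ⟨lv', hlv'⟩ : ∃ lv', lv' = update lv al l := ⟨_, rfl⟩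
  obtain ⟨ow', how'⟩ : ∃ ow', ow' = update ow al o := ⟨_, rfl⟩
  have eK : ∀ p, p ≠ al → K' p = K p := by intro p h1; simp [hK', h1]
  have eKa : K' al = 0 := by simp [hK']
  have eR : ∀ p, p ≠ al → R' p = R p := by intro p h1; simp [hR', h1]
  have eRa : R' al = 0 := by simp [hR']
  have eD : ∀ p, p ≠ al → D' p = D p := by intro p h1; simp [hD', h1]
  have eDa : D' al = dx := by simp [hD']
  have eL : ∀ p, p ≠ al → lv' p = lv p := by intro p h1; simp [hlv', h1]
  have eLa : lv' al = l := by simp [hlv']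
  have eO : ∀ p, p ≠ al → ow' p = ow p := by intro p h1; simp [how', h1]
  have eOa : ow' al = o := by simp [how']
  rw [← hK', ← hR', ← hD', ← hlv', ← how']
  have hne : ∀ p, Nd al p → p ≠ al := by rintro p hp rfl; exact hna hp
  have hdn : ∀ p, Nd al p → lv p ≠ 0 → D p ≠ al := fun p hp h0 => hne _ (h.down p hp h0).1
  have hdx : l ≠ 0 → dx ≠ al := fun h0 => hne _ (h1 h0).1
  constructor
  · rw [eK 0 (by omega), h.key0]
  · have := h.inj
    intro p q hp hq
    rw [hnd3] at hp hq
    rcases hp with hp | hp <;> rcases hq with hq | hq <;> grind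
  · have := h.right_null
    intro p hp
    rw [hnd3] at hp
    grind
  · have := h.right
    intro p hp
    rw [hnd3] at hp
    rw [hnd3]
    grind
  · have := h.right_max
    have := h.right
    intro p q hp hq
    rw [hnd3] at hp hq
    rcases hp with hp | hp <;> rcases hq with hq | hq <;> grind
  · have := h.down_null
    intro p hp
    rw [hnd3] at hp
    grind
  · have := h.down
    intro p hp
    rw [hnd3] at hp
    rw [hnd3]
    grind
  · have := h.down_lt
    have := h.down
    intro p q hp hq
    rw [hnd3] at hp hq
    rcases hp with hp | hp <;> rcases hq with hq | hq <;> grind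
  · intro p q hp hq ho hlv hlt
    rw [hnd3] at hp hq
    rcases hp with ⟨hp, hpa⟩ | rfl
    · rw [eL p hpa] at hlv
      rw [eO p hpa] at ho
      rcases hq with ⟨hq, hqa⟩ | rfl
      · rw [eL q hqa] at hlv
        rw [eO q hqa] at ho
        rw [eD p hpa, eK q hqa, eK _ (hdn p hp (by omega))] at hlt
        obtain ⟨z, z1, z2, z3, z4, z5⟩ := h.down_max p q hp hq ho hlv hlt
        have := hne z z1
        exact ⟨z, (hnd3 z).2 (Or.inl ⟨z1, this⟩), by rw [eO z this, eO p hpa, z2],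
          by rw [eL z this, eL p hpa, z3], by rwa [eK z this, eK p hpa],
          by rwa [eK z this, eK q hqa]⟩
      · rw [eLa] at hlv
        rw [eOa] at ho
        have := hl p hp ho.symm
        omega
    · rw [eLa] at hlv
      rw [eOa] at ho
      rcases hq with ⟨hq, hqa⟩ | rfl
      · rw [eL q hqa] at hlv
        rw [eO q hqa] at ho
        rw [eDa, eK q hqa, eK _ (hdx (by omega))] at hlt
        have := (h1 (by omega)).2.2.2.2.2 q hq ho hlv
        omega
      · rw [eLa] at hlv; omega
  · have := h.sub
    intro p hp
    simp only [hnd3] at *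
    rcases hp with hp | hp
    · grind
    · subst hp
      rw [eLa, eOa, eKa]
      intro hl0
      obtain ⟨a1, a2, a3, a4, a5, a6⟩ := h1 hl0
      obtain ⟨b1, b2, b3, b4⟩ := h.right dx a1 (by omega)
      have := hne _ b1
      exact ⟨R dx, Or.inl ⟨b1, this⟩, by rw [eO _ this]; omega, by rw [eL _ this]; omega,
        by rw [eK _ this]; omega⟩
  · intro p hp
    rw [hnd3] at hp
    rcases hp with ⟨hp, hpa⟩ | hp
    · rw [eL p hpa, eD p hpa, eK p hpa]
      intro h00
      have hg := h.gap p hp h00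
      obtain ⟨a1, a2, a3, a4⟩ := h.down p hp h00
      have haa := hne _ a1
      obtain ⟨b1, b2, b3, b4, b5⟩ := h.down_right hp a1 h00 a2 a3 a4
      rw [eR _ haa, eK _ (hne _ b1), eR _ (hne _ b1)]
      by_cases hb : K (R (D p)) = K p
      · exact Or.inl hb
      obtain ⟨c1, c2, c3, c4, c5⟩ := h.down_right hp b1 h00 b2 b3 (by omega)
      rw [eR _ (hne _ c1), eK _ (hne _ c1)]
      by_cases hc : K (R (R (D p))) = K p
      · exact Or.inr (Or.inl hc)
      obtain ⟨d1, d2, d3, d4, d5⟩ := h.down_right hp c1 h00 c2 c3 (by omega)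
      rw [eK _ (hne _ d1)]
      exact hg
    · subst hp
      rw [eLa, eDa, eKa]
      intro h00
      obtain ⟨a1, a2, a3, a4, a5, a6⟩ := h1 h00
      obtain ⟨b1, b2, b3, b4⟩ := h.right dx a1 (by omega)
      rw [eR _ (hne _ a1), eK _ (hne _ b1)]
      exact Or.inl a5

/-! ### Searching -/

/-- No node of the list and the level of `p` before `p` has a key at most `k`. -/
def Low (K lv ow : ℕ → ℕ) (al p k : ℕ) : Prop :=
  ∀ q, Nd al q → ow q = ow p → lv q = lv p → K p < K q → k < K q

theorem Skip.low_right {K R D lv ow : ℕ → ℕ} {al : ℕ} (h : Skip K R D lv ow al) {p k : ℕ}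
    (hp : Nd al p) (hk : k < K p) :
    Nd al (R p) ∧ ow (R p) = ow p ∧ lv (R p) = lv p ∧ Low K lv ow al (R p) k := by
  obtain ⟨a1, a2, a3, a4⟩ := h.right p hp (by omega)
  refine ⟨a1, a2, a3, fun q b1 b2 b3 b4 => ?_⟩
  have := h.right_max p q hp b1 (by omega) (by omega)
  omega

/-- A lower node before `D p` belongs to an earlier upper node `q`: its key is at least that of `q`,
which exceeds `k`. -/
theorem Skip.low_down {K R D lv ow : ℕ → ℕ} {al : ℕ} (h : Skip K R D lv ow al) {p k : ℕ}
    (hp : Nd al p) (h0 : lv p ≠ 0) (hk : K p ≤ k) (hl : Low K lv ow al p k) :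
    Low K lv ow al (D p) k := by
  obtain ⟨a1, a2, a3, a4⟩ := h.down p hp h0
  intro q b1 b2 b3 b4
  obtain ⟨r, c1, c2, c3, c4, c5⟩ := h.down_max p q hp b1 (by omega) (by omega) b4
  have := hl r c1 c2 c3 c4
  omega

theorem Skip.gap_le {K R D lv ow : ℕ → ℕ} {al : ℕ} (h : Skip K R D lv ow al) {p k : ℕ}
    (hp : Nd al p) (h0 : lv p ≠ 0) (hk : K p ≤ k) : ∃ j ≤ 3, K (R^[j] (D p)) ≤ k := by
  rcases h.gap p hp h0 with e | e | e
  · exact ⟨1, by omega, by simpa [e] using hk⟩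
  · exact ⟨2, by omega, by simpa [e] using hk⟩
  · exact ⟨3, by omega, by simpa [e] using hk⟩

/-- The skip lists in memory. -/
abbrev St.Skip (s : St) (lv ow : ℕ → ℕ) (al : ℕ) : Prop :=
  SlidingMUPS.Skip (s.arr .key) (s.arr .right) (s.arr .down) lv ow al

/-- The list of `o` begins at `p`. -/
structure Top (K : ℕ → ℕ) (lv ow : ℕ → ℕ) (al p o : ℕ) : Prop where
  nd : Nd al p
  own : ow p = o
  key : K p = 0
  le : ∀ q, Nd al q → ow q = o → lv q ≤ lv p
  eq : ∀ q, Nd al q → ow q = o → lv q = lv p → q = p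

open Reg Arr in
/-- The test of the search loop. -/
def descending : HTest := .disj (.lt 0 (down.at t)) (.lt v (key.at t))

open Reg Arr in
/-- Search for the key in the register `v` in the list of the node in the register `x`. -/
def search (x : Reg) : HCmd :=
  .assign t (head.at x) ;;
  .loop descending (.cond (.lt v (key.at t)) (.assign t (Arr.right.at t)) (.assign t (down.at t)))

/-- The measure is `4 * level + j`, where `j ≤ 3` moves to the right lead to a key that is at most
`v`. A move to the right lowers `j`; a move down lowers the level and resets `j` by the gap
condition. `Low` guarantees that the node reached is the first one with a small enough key. -/
theorem search_spec {N word : ℕ} {s : St} {lv ow : ℕ → ℕ} {al : ℕ} (h : s.Skip lv ow al) {x : Reg}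
    (hw : al ≤ word) {o : ℕ} (ht : Top (s.arr .key) lv ow al (s.arr .head (s.reg x)) o) :
    Ex N word (search x) s fun n s' => n ≤ 16 * lv (s.arr .head (s.reg x)) + 2 ∧
      s.Frame [.t] [] s' ∧ Nd al (s'.reg .t) ∧ ow (s'.reg .t) = o ∧ lv (s'.reg .t) = 0 ∧
      Covers (s.arr .key) lv ow al (s'.reg .t) (s.reg .v) := by
  have hal := ht.nd.2
  refine Ex.seq ⟨1, _, .assign s .t _ (by decide) ?_, ?_⟩
  · simp only [HExpr.eval_arr, HExpr.eval_reg]; omega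
  let I : ℕ → St → Prop := fun n s' => s.Frame [.t] [] s' ∧ Nd al (s'.reg .t) ∧
    ow (s'.reg .t) = o ∧ Low (s.arr .key) lv ow al (s'.reg .t) (s.reg .v) ∧
    ∃ j ≤ 3, (s.arr .key) ((s.arr .right)^[j] (s'.reg .t)) ≤ s.reg .v ∧
      n = 4 * lv (s'.reg .t) + j
  have hI : I (4 * lv (s.arr .head (s.reg x))) (s.set .t (s.arr .head (s.reg x))) := by
    refine ⟨⟨?_, by simp⟩, ?_⟩
    · intro r hr
      simp only [List.mem_singleton] at hr
      simp [hr]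
    · simp only [St.set_reg, if_true]
      refine ⟨ht.nd, ht.own, ?_, 0, by omega, by simp [ht.key], by omega⟩
      intro q hq h1 h2 h3
      rw [ht.eq q hq (by rw [h1, ht.own]) h2] at h3; omega
  refine (Ex.loop (k := 3) hI ?_).mono ?_
  · rintro n s' ⟨hf, hnd, how, hlow, j, hj, hk, rfl⟩ hb
    have e1 : s'.arr .key = s.arr .key := hf.arr _ (by simp)
    have e2 : s'.arr .right = s.arr .right := hf.arr _ (by simp)
    have e3 : s'.arr .down = s.arr .down := hf.arr _ (by simp)
    have e4 : s'.reg .v = s.reg .v := hf.reg _ (by simp)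
    have hfr : ∀ z, s.Frame [.t] [] (s'.set .t z) := by
      intro z
      refine ⟨?_, by simpa using hf.arr⟩
      intro r hr
      have := hf.reg r hr
      simp only [List.mem_singleton] at hr
      simp [hr, this]
    refine (HCmd.wp.run (Q := fun s' => ∃ n' < _, I n' s') ?_).mono fun t s'' h => ⟨by simpa [HCmd.size] using h.1, h.2⟩
    simp only [descending, HCmd.wp, HTest.Holds, HExpr.eval_reg, HExpr.eval_arr,
      HExpr.eval_ofNat, e1, e2, e3, e4] at hb ⊢
    constructor
    · intro hlt
      obtain ⟨a1, a2, a3, a4⟩ := h.low_right hnd hlt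
      refine ⟨by decide, lt_of_lt_of_le a1.2 hw, ?_⟩
      have hj0 : j ≠ 0 := by rintro rfl; simp at hk; omega
      obtain ⟨j, rfl⟩ := Nat.exists_eq_succ_of_ne_zero hj0
      rw [Function.iterate_succ_apply] at hk
      refine ⟨4 * lv (s'.reg .t) + j, by omega, hfr _, ?_⟩
      simp only [St.set_reg, if_true]
      exact ⟨a1, by rw [a2, how], a4, j, by omega, hk, by rw [a3]⟩
    · intro hlt
      have hd : s.arr .down (s'.reg .t) ≠ 0 := by rcases hb with hb | hb <;> omega
      have h0 : lv (s'.reg .t) ≠ 0 := fun e => hd ((h.down_null _ hnd).2 e)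
      obtain ⟨a1, a2, a3, a4⟩ := h.down _ hnd h0
      have hlow' := h.low_down hnd h0 (by omega) hlow
      obtain ⟨j', hj', hk'⟩ := h.gap_le hnd h0 (k := s.reg .v) (by omega)
      refine ⟨by decide, lt_of_lt_of_le a1.2 hw,
        4 * lv (s.arr .down (s'.reg .t)) + j', by omega, hfr _, ?_⟩
      simp only [St.set_reg, if_true]
      exact ⟨a1, by rw [a2, how], hlow', j', hj', hk', rfl⟩
  · rintro n s' ⟨n', hn', ⟨hf, hnd, how, hlow, j, hj, hk, rfl⟩, hb, hn⟩
    have e1 : s'.arr .key = s.arr .key := hf.arr _ (by simp)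
    have e3 : s'.arr .down = s.arr .down := hf.arr _ (by simp)
    have e4 : s'.reg .v = s.reg .v := hf.reg _ (by simp)
    simp only [descending, HTest.Holds, HExpr.eval_reg, HExpr.eval_arr,
      HExpr.eval_ofNat, e1, e3, e4, not_or, not_lt, Nat.le_zero] at hb
    exact ⟨by omega, hf, hnd, how, (h.down_null _ hnd).1 hb.1, hb.2, hlow⟩

end SlidingMUPS

/-! ### Top-down insertion: what changes, and the invariant of the descent -/

namespace SlidingMUPS
open Function

/-- Something that changed only above the ground level in the list of `o`. -/
structure Raised (o : ℕ) (K lv ow : ℕ → ℕ) (al : ℕ) (K' lv' ow' : ℕ → ℕ) (al' : ℕ) : Prop where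
  le : al ≤ al'
  lv_eq : ∀ p, Nd al p → lv' p = lv p
  ow_eq : ∀ p, Nd al p → ow' p = ow p
  new : ∀ p, Nd al' p → ¬ Nd al p → lv' p ≠ 0 ∧ ow' p = o
  key_eq : ∀ p, Nd al p → (lv p = 0 ∨ ow p ≠ o) → K' p = K p

theorem Nd.mono {al al' p : ℕ} (h : Nd al p) (hle : al ≤ al') : Nd al' p := ⟨h.1, by have := h.2; omega⟩

theorem Raised.trans {o : ℕ} {K lv ow : ℕ → ℕ} {al : ℕ} {K' lv' ow' : ℕ → ℕ} {al' : ℕ}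
    {K'' lv'' ow'' : ℕ → ℕ} {al'' : ℕ} (h : Raised o K lv ow al K' lv' ow' al')
    (h' : Raised o K' lv' ow' al' K'' lv'' ow'' al'') : Raised o K lv ow al K'' lv'' ow'' al'' where
  le := h.le.trans h'.le
  lv_eq p hp := by rw [h'.lv_eq p (hp.mono h.le), h.lv_eq p hp]
  ow_eq p hp := by rw [h'.ow_eq p (hp.mono h.le), h.ow_eq p hp]
  new p hp hn := by
    by_cases hp' : Nd al' p
    · rw [h'.lv_eq p hp', h'.ow_eq p hp']; exact h.new p hp' hn
    · exact h'.new p hp hp'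
  key_eq p hp hk := by
    rw [h'.key_eq p (hp.mono h.le) (by rwa [h.lv_eq p hp, h.ow_eq p hp]), h.key_eq p hp hk]

theorem Raised.nd_of {o : ℕ} {K lv ow : ℕ → ℕ} {al : ℕ} {K' lv' ow' : ℕ → ℕ} {al' : ℕ}
    (h : Raised o K lv ow al K' lv' ow' al') {p : ℕ} (hp : Nd al' p)
    (h0 : lv' p = 0 ∨ ow' p ≠ o) : Nd al p := by
  by_contra hn
  have := h.new p hp hn
  tauto

theorem Raised.top {o : ℕ} {K lv ow : ℕ → ℕ} {al : ℕ} {K' lv' ow' : ℕ → ℕ} {al' : ℕ}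
    (h : Raised o K lv ow al K' lv' ow' al') {p o' : ℕ} (ht : Top K lv ow al p o') (ho : o' ≠ o) :
    Top K' lv' ow' al' p o' where
  nd := ht.nd.mono h.le
  own := by rw [h.ow_eq p ht.nd, ht.own]
  key := by rw [h.key_eq p ht.nd (Or.inr (by rwa [ht.own])), ht.key]
  le q hq e := by
    have := h.nd_of hq (Or.inr (by rwa [e]))
    rw [h.lv_eq q this, h.lv_eq p ht.nd]
    exact ht.le q this (by rw [← h.ow_eq q this, e])
  eq q hq e e' := by
    have := h.nd_of hq (Or.inr (by rwa [e]))
    rw [h.lv_eq q this, h.lv_eq p ht.nd] at e'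
    exact ht.eq q this (by rw [← h.ow_eq q this, e]) e'

theorem Raised.ground {o : ℕ} {K lv ow : ℕ → ℕ} {al : ℕ} {K' lv' ow' : ℕ → ℕ} {al' : ℕ}
    (h : Raised o K lv ow al K' lv' ow' al') : ground lv' al' = ground lv al := by
  ext p
  rw [mem_ground, mem_ground]
  constructor
  · rintro ⟨h1, h2⟩
    have := h.nd_of h1 (Or.inl h2)
    exact ⟨this, by rw [← h.lv_eq p this, h2]⟩
  · rintro ⟨h1, h2⟩
    exact ⟨h1.mono h.le, by rw [h.lv_eq p h1, h2]⟩

/-- The list of `o` holds the entry `u` at the key `k`. -/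
def Entry (K V lv ow : ℕ → ℕ) (al o k u : ℕ) : Prop :=
  ∃ p, Nd al p ∧ ow p = o ∧ lv p = 0 ∧ K p = k ∧ k ≠ 0 ∧ V p = u

/-- Entries live on the ground level, where nothing has changed. -/
theorem Raised.entry {o : ℕ} {K lv ow : ℕ → ℕ} {al : ℕ} {K' lv' ow' : ℕ → ℕ} {al' : ℕ}
    (h : Raised o K lv ow al K' lv' ow' al') (V : ℕ → ℕ) (o' k u : ℕ) :
    Entry K' V lv' ow' al' o' k u ↔ Entry K V lv ow al o' k u := by
  constructor
  · rintro ⟨p, h1, h2, h3, h4⟩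
    have := h.nd_of h1 (Or.inl h3)
    rw [h.ow_eq p this] at h2
    rw [h.lv_eq p this] at h3
    rw [h.key_eq p this (Or.inl h3)] at h4
    exact ⟨p, this, h2, h3, h4⟩
  · rintro ⟨p, h1, h2, h3, h4⟩
    exact ⟨p, h1.mono h.le, by rwa [h.ow_eq p h1], by rwa [h.lv_eq p h1],
      by rwa [h.key_eq p h1 (Or.inl h3)]⟩

open Reg Arr in
/-- Put the new node `cells` behind the node `t`. -/
def putBehind (k dx : HExpr) : HCmd :=
  .store down cells dx ;; .store key cells (key.at t) ;; .store key t k ;;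
  .store Arr.right cells (Arr.right.at t) ;; .store Arr.right t cells ;;
  .assign cells (cells + 1)

theorem putBehind_wp {N word : ℕ} {s : St} {Q : St → Prop} {k dx : HExpr} {kv dv : ℕ}
    (hal : s.reg .cells < N) (hw : s.reg .cells + 1 < word) (ht : s.reg .t < s.reg .cells)
    (hdx : dx.eval s = dv) (hdw : dv < word)
    (hk : k.eval ((s.put .down (s.reg .cells) dv).put .key (s.reg .cells)
      (s.arr .key (s.reg .t))) = kv) (hkw : kv < word)
    (hKt : s.arr .key (s.reg .t) < word) (hRt : s.arr .right (s.reg .t) < word)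
    (hQ : ∀ s', s.Frame [.cells] [.down, .key, .right] s' →
      s'.arr .key = update (update (s.arr .key) (s.reg .t) kv) (s.reg .cells)
        (s.arr .key (s.reg .t)) →
      s'.arr .right = update (update (s.arr .right) (s.reg .t) (s.reg .cells)) (s.reg .cells)
        (s.arr .right (s.reg .t)) →
      s'.arr .down = update (s.arr .down) (s.reg .cells) dv →
      s'.reg .cells = s.reg .cells + 1 → Q s') :
    (putBehind k dx).wp N word Q s := by
  have hne : s.reg .t ≠ s.reg .cells := by omega
  simp only [putBehind, HCmd.wp, HExpr.eval_reg, HExpr.eval_arr, hdx, St.put_reg, St.put_arr,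
    if_true, HExpr.eval_add, HExpr.eval_ofNat, reduceCtorEq, if_false] at hk ⊢
  simp only [hk, update_of_ne hne]
  refine ⟨hal, hdw, hal, hKt, by omega, hkw, hal, hRt, by omega, by omega, by decide, hw, ?_⟩
  refine hQ _ ⟨?_, ?_⟩ ?_ ?_ ?_ ?_
  · intro r hr
    simp only [List.mem_singleton] at hr
    simp [hr]
  · intro a ha
    simp only [List.mem_cons, List.not_mem_nil, or_false, not_or] at ha
    simp [ha]
  · simp only [St.set_arr, St.put_arr, reduceCtorEq, if_false, if_true]
    rw [update_comm hne.symm]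
  · simp only [St.set_arr, St.put_arr, reduceCtorEq, if_false, if_true]
    rw [update_comm hne.symm]
  · simp
  · simp

open Reg Arr in
/-- Split the node `t` if it covers four nodes. -/
def raise : HCmd :=
  -- This holds exactly when the gap below `t` has three nodes. A null pointer is harmless because
  -- the cell 0 has the key 0.
  .cond (.lt (key.at t) (key.at (Arr.right.at (Arr.right.at (down.at t)))))
    (putBehind (key.at (Arr.right.at (down.at t))) (Arr.right.at (Arr.right.at (down.at t)))) .skip

/-- The invariant of the insertion in the list of `o` that begins at `hd`: the current node is `t`
and the key is `k`. -/
structure Inserting (K R D lv ow : ℕ → ℕ) (al o hd t k : ℕ) : Prop where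
  skip : Skip K R D lv ow al
  nd : Nd al t
  own : ow t = o
  low : Low K lv ow al t k
  room : Room K R D lv ow al o (lv t) k
  hd_nd : Nd al hd
  hd_own : ow hd = o
  hd_le : ∀ q, Nd al q → ow q = o → lv q ≤ lv hd
  hd_key : ∀ q, Nd al q → ow q = o → lv q = lv hd → K q ≤ K hd
  top : (t = hd ∧ K hd = 0) ∨ (lv t < lv hd ∧ (K hd = 0 ∨ K (R hd) = 0))

theorem Inserting.right {K R D lv ow : ℕ → ℕ} {al o hd t k : ℕ}
    (h : Inserting K R D lv ow al o hd t k) (hk : k < K t) :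
    Inserting K R D lv ow al o hd (R t) k := by
  obtain ⟨a1, a2, a3, a4⟩ := h.skip.low_right h.nd hk
  refine ⟨h.skip, a1, a2.trans h.own, a4, by rw [a3]; exact h.room, h.hd_nd, h.hd_own, h.hd_le,
    h.hd_key, ?_⟩
  rcases h.top with ⟨b1, b2⟩ | b
  · rw [b1] at hk; omega
  · rw [a3]; exact Or.inr b

/-- The keys of the upper level all occur on the level of `t`, and there none lies strictly between
`K t` and `k` or `k'`, nor equals `k` or `k'` unless it is `K t`. So the same upper nodes cover `k`
and `k'`. -/
theorem Inserting.covered {K R D lv ow : ℕ → ℕ} {al o hd t k : ℕ}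
    (h : Inserting K R D lv ow al o hd t k) {k' : ℕ} (hk : K t ≤ k)
    (hk' : Covers K lv ow al t k') : Room K R D lv ow al (ow t) (lv t) k' := by
  intro q h1 h2 h3 h4 h5
  obtain ⟨r, r1, r2, r3, r4⟩ := h.skip.sub q h1 (by omega)
  refine h.room q h1 (by rw [h2, h.own]) h3 ?_ ?_
  · by_contra hc
    have := hk'.2 r r1 (by omega) (by omega) (by omega)
    omega
  · intro q' e1 e2 e3 e4
    have := h5 q' e1 (by rw [e2, h.own]) e3 e4
    obtain ⟨z, z1, z2, z3, z4⟩ := h.skip.sub q' e1 (by omega)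
    rw [← z4]
    have := hk'.1
    exact h.low z z1 (by rw [z2, e2, h.own]) (by omega) (by omega)

theorem Inserting.down {K R D lv ow : ℕ → ℕ} {al o hd t k : ℕ}
    (h : Inserting K R D lv ow al o hd t k) (h0 : lv t ≠ 0) (hk : K t ≤ k)
    (hr : ¬ K t < K (R (R (D t)))) : Inserting K R D lv ow al o hd (D t) k := by
  obtain ⟨a1, a2, a3, a4⟩ := h.skip.down t h.nd h0
  refine ⟨h.skip, a1, a2.trans h.own, h.skip.low_down h.nd h0 hk h.low, ?_, h.hd_nd, h.hd_own,
    h.hd_le, h.hd_key, Or.inr ?_⟩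
  · intro q h1 h2 h3 h4 h5
    -- On its level only `t` covers `k`, and its gap has just passed the test.
    have hqt : q = t := by
      refine h.skip.inj q t h1 h.nd (by rw [h2, h.own]) (by omega) ?_
      by_contra hne
      rcases Nat.lt_or_gt_of_ne hne with c | c
      · have := h5 t h.nd h.own (by omega) c
        omega
      · have := h.low q h1 (by rw [h2, h.own]) (by omega) c
        omega
    subst hqt
    obtain ⟨b1, b2, b3, b4, b5⟩ := h.skip.down_right h1 a1 h0 a2 a3 a4
    by_cases hb : K (R (D q)) = K q
    · exact Or.inl hb
    obtain ⟨c1, c2, c3, c4, c5⟩ := h.skip.down_right h1 b1 h0 b2 b3 (by omega)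
    omega
  · rcases h.top with ⟨b1, b2⟩ | ⟨b1, b2⟩
    · rw [b1] at a3; rw [b1]; exact ⟨by omega, Or.inl b2⟩
    · exact ⟨by omega, b2⟩

/-- The new node stands behind `t`, which keeps its identity, so the head stays the first node of
its level. On the top level only a head with the key 0 is split, so the second node there inherits
the key 0 and is the last one. -/
theorem Inserting.head_insert {K R D lv ow : ℕ → ℕ} {al o hd t k k' : ℕ}
    (h : Inserting K R D lv ow al o hd t k) (hk : K t < k') (hcov : Covers K lv ow al t k') :
    (∀ q, Nd (al + 1) q → update ow al (ow t) q = o →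
      update lv al (lv t) q ≤ update lv al (lv t) hd) ∧
    (∀ q, Nd (al + 1) q → update ow al (ow t) q = o →
      update lv al (lv t) q = update lv al (lv t) hd →
      update (update K t k') al (K t) q ≤ update (update K t k') al (K t) hd) ∧
    (update (update K t k') al (K t) hd = 0 ∨
      update (update K t k') al (K t) (update (update R t al) al (R t) hd) = 0) := by
  have hs := h.skip
  have hne : ∀ p, Nd al p → p ≠ al := by rintro p hp rfl; exact absurd hp.2 (lt_irrefl _)
  have hnd : ∀ p, Nd (al + 1) p ↔ Nd al p ∨ p = al := by
    have := h.nd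
    intro p; unfold Nd at *; omega
  refine ⟨?_, ?_, ?_⟩
  · intro q e1 e2
    rw [update_of_ne (hne _ h.hd_nd)]
    rcases (hnd q).1 e1 with e1 | rfl
    · rw [update_of_ne (hne _ e1)] at *
      exact h.hd_le q e1 e2
    · rw [update_self]; exact h.hd_le t h.nd h.own
  · intro q e1 e2 e3
    rw [update_of_ne (hne _ h.hd_nd)] at e3 ⊢
    have main : ∀ q, Nd al q → ow q = o → lv q = lv hd →
        update K t k' q ≤ update K t k' hd := by
      intro q e1 e2 e3
      have h4 := h.hd_key q e1 e2 e3
      by_cases hqt : q = t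
      · subst hqt
        rw [update_self]
        by_cases hqh : hd = q
        · subst hqh; rw [update_self]
        · rw [update_of_ne hqh]
          have : K q ≠ K hd := fun e => hqh
            (hs.inj hd q h.hd_nd e1 (h.hd_own.trans h.own.symm) (by omega) e.symm)
          have := hcov.2 hd h.hd_nd (h.hd_own.trans h.own.symm) (by omega) (by omega)
          omega
      · rw [update_of_ne hqt]
        by_cases hqh : hd = t
        · rw [hqh, update_self]; rw [hqh] at h4; omega
        · rwa [update_of_ne hqh]
    rcases (hnd q).1 e1 with e1 | rfl
    · rw [update_of_ne (hne _ e1)] at e2 e3 ⊢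
      exact main q e1 e2 e3
    · rw [update_self] at e3 ⊢
      have := main t h.nd h.own e3
      rw [update_self] at this
      omega
  · rw [update_of_ne (hne _ h.hd_nd), update_of_ne (hne _ h.hd_nd)]
    rcases h.top with ⟨e1, e2⟩ | ⟨e1, e2⟩
    · subst e1
      rw [update_self, update_self, update_self]
      exact Or.inr e2
    · have hht : hd ≠ t := by rintro rfl; omega
      rw [update_of_ne hht, update_of_ne hht]
      by_cases hz : K hd = 0
      · exact Or.inl hz
      · have := hs.right hd h.hd_nd hz
        rw [update_of_ne (hne _ this.1), update_of_ne]
        · exact e2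
        · intro e; rw [e] at this; omega

/-- The gap of three nodes is split around its middle, whose key moves up and becomes the key of
`t`. Whichever of `t` and the new node covers `k` then has a gap of one node, so the level below has
room for a further insertion. -/
theorem Inserting.raise {K R D lv ow : ℕ → ℕ} {al o hd t k : ℕ}
    (h : Inserting K R D lv ow al o hd t k) (h0 : lv t ≠ 0) (hk : K t ≤ k)
    (hr : K t < K (R (R (D t)))) :
    Inserting (update (update K t (K (R (D t)))) al (K t)) (update (update R t al) al (R t))
      (update D al (R (R (D t)))) (update lv al (lv t)) (update ow al (ow t)) (al + 1) o hd
      (D t) k ∧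
    Raised o K lv ow al (update (update K t (K (R (D t)))) al (K t)) (update lv al (lv t))
      (update ow al (ow t)) (al + 1) ∧
    (update (update K t (K (R (D t)))) al (K t)) ((update (update R t al) al (R t))^[3] (D t))
      ≤ k := by
  have hs := h.skip
  have hlow := h.low
  obtain ⟨a1, a2, a3, a4⟩ := hs.down t h.nd h0
  have hlowd := hs.low_down h.nd h0 hk h.low
  have nK := hs.key0
  have hKD : K (D t) ≠ 0 := by omega
  have hb0 := hs.down_right h.nd a1 h0 a2 a3 a4
  have hg := hs.gap t h.nd h0
  have hdl := fun q h1 h2 h3 h4 => hs.down_lt t q h.nd h1 h2 h3 h0 h4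
  obtain ⟨b1, b2, b3, b4, b5⟩ := hb0
  -- Otherwise the first move to the right already reaches the key of `t`, and the second one a
  -- smaller key or the null cell, against `hr`.
  have hb : K t < K (R (D t)) := by
    rcases Nat.lt_or_ge (K t) (K (R (D t))) with c | c
    · exact c
    · exfalso
      have e : K (R (D t)) = K t := le_antisymm c b4
      by_cases hz : K t = 0
      · rw [hs.right_null _ b1 (by omega)] at hr; omega
      · have := (hs.right _ b1 (by omega)).2.2.2
        omega
  obtain ⟨c1, c2, c3, c4, c5⟩ := hs.down_right h.nd b1 h0 b2 b3 hb
  obtain ⟨d1, d2, d3, d4, d5⟩ := hs.down_right h.nd c1 h0 c2 c3 hr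
  have hg3 : K (R (R (R (D t)))) = K t := by
    rcases hg with e | e | e <;> omega
  generalize hDt : D t = z at *
  generalize hr1 : R z = r at *
  generalize hx : R r = dx at *
  have htn : t ≠ al := by have := h.nd.2; omega
  have hne : ∀ p, Nd al p → p ≠ al := by rintro p hp rfl; exact absurd hp.2 (lt_irrefl _)
  have hzt : z ≠ t := by rintro rfl; omega
  have hrt : r ≠ t := by rintro rfl; omega
  have hxt : dx ≠ t := by rintro rfl; omega
  have hyt : R dx ≠ t := by intro e; rw [e] at d3; omega
  have hcov : Covers K lv ow al t (K r) :=
    ⟨hb.le, fun q e1 e2 e3 e4 => by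
      have := hdl q e1 e2 e3 e4; omega⟩
  have hins := hs.insert h.nd hb hcov (h.covered hk hcov) (dx := dx) (fun e => absurd e h0)
    (fun _ => ⟨c1, c2, c3, hr, c5, by rw [hDt]; exact b5,
      ⟨r, b1, b2, b3, rfl, by rw [hDt]; exact hr1, hx⟩, hg3⟩)
  have hnd : ∀ p, Nd (al + 1) p ↔ Nd al p ∨ p = al := by
    have := h.nd
    intro p; unfold Nd at *; omega
  refine ⟨⟨hins, (hnd _).2 (Or.inl a1), ?_, ?_, ?_, (hnd _).2 (Or.inl h.hd_nd), ?_, ?_, ?_, ?_⟩,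
    ⟨by omega, ?_, ?_, ?_, ?_⟩, ?_⟩
  · rw [update_of_ne (hne _ a1), a2, h.own]
  · intro q e1 e2 e3 e4
    rw [update_of_ne (hne _ a1)] at e2 e3
    rcases (hnd q).1 e1 with e1 | rfl
    · rw [update_of_ne (hne _ e1)] at e2 e3
      have hqt : q ≠ t := by rintro rfl; omega
      rw [update_of_ne (hne _ a1), update_of_ne hzt, update_of_ne (hne _ e1),
        update_of_ne hqt] at e4
      rw [update_of_ne (hne _ e1), update_of_ne hqt]
      exact hlowd q e1 e2 e3 e4
    · rw [update_self] at e3; omega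
  · intro q e1 e2 e3 e4 e5
    rw [update_of_ne (hne _ a1)] at e3
    left
    -- After the split `k` is covered by one of the two halves.
    have hq : q = t ∨ q = al := by
      rcases (hnd q).1 e1 with e1 | e1
      · by_contra hc
        push Not at hc
        rw [update_of_ne hc.2] at e2 e3
        rw [update_of_ne hc.2, update_of_ne hc.1] at e4
        have hne2 : K q ≠ K t := fun e => hc.1 (hs.inj q t e1 h.nd (by rw [e2, h.own]) (by omega) e)
        rcases Nat.lt_or_gt_of_ne hne2 with c | c
        · have := e5 al ((hnd _).2 (Or.inr rfl)) (by rw [update_self, h.own])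
            (by rw [update_self, update_of_ne (hne _ a1)]; omega)
            (by rw [update_self, update_of_ne hc.2, update_of_ne hc.1]; exact c)
          rw [update_self] at this; omega
        · have := hlow q e1 (by rw [e2, h.own]) (by omega) c
          omega
      · exact Or.inr e1
    rcases hq with rfl | rfl
    · rw [update_of_ne htn, hDt, update_of_ne (hne _ a1), update_of_ne hzt, hr1,
        update_of_ne (hne _ b1), update_of_ne hrt, update_of_ne htn, update_self]
    · rw [update_self, update_of_ne (hne _ c1), update_of_ne hxt, update_self,
        update_of_ne (hne _ d1), update_of_ne hyt, hg3]
  · rw [update_of_ne (hne _ h.hd_nd), h.hd_own]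
  · exact (h.head_insert hb hcov).1
  · exact (h.head_insert hb hcov).2.1
  · refine Or.inr ⟨?_, (h.head_insert hb hcov).2.2⟩
    rw [update_of_ne (hne _ a1), update_of_ne (hne _ h.hd_nd)]
    have := h.hd_le t h.nd h.own
    omega
  · intro p hp; rw [update_of_ne (hne _ hp)]
  · intro p hp; rw [update_of_ne (hne _ hp)]
  · intro p hp hn
    rcases (hnd p).1 hp with hp | rfl
    · exact absurd hp hn
    · rw [update_self, update_self]; exact ⟨h0, h.own⟩
  · intro p hp hc
    have : p ≠ t := by
      rintro rfl
      have := h.own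
      tauto
    rw [update_of_ne (hne _ hp), update_of_ne this]
  · simp only [iterate_succ, iterate_zero, comp_apply, id_eq]
    rw [update_of_ne (hne _ a1), update_of_ne hzt, hr1, update_of_ne (hne _ b1),
      update_of_ne hrt, hx, update_of_ne (hne _ c1), update_of_ne hxt, update_of_ne (hne _ d1),
      update_of_ne hyt, hg3]
    exact hk

end SlidingMUPS

/-! ### Insertion into the dictionaries of the tree nodes -/

namespace SlidingMUPS
open Function

/-- All registers and all array entries are below `word`. -/
structure St.Bdd (word : ℕ) (s : St) : Prop where
  reg : ∀ r, s.reg r < word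
  arr : ∀ a i, s.arr a i < word

/-- A run checks every value that it writes, so the bound is an invariant of all programs, and the
side conditions on copied values come for free. -/
theorem HRun.bdd {N word : ℕ} {c : HCmd} {s s' : St} {t : ℕ} (h : HRun N word c s t s')
    (hs : s.Bdd word) : s'.Bdd word := by
  induction h with
  | skip => exact hs
  | assign s r e _ hv =>
    refine ⟨fun r' => ?_, hs.arr⟩
    rw [St.set_reg]; split_ifs
    · exact hv
    · exact hs.reg r'
  | store s a i e _ hv =>
    refine ⟨hs.reg, fun b j => ?_⟩
    rw [St.put_arr]; split_ifs
    · rw [update_apply]; split_ifs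
      · exact hv
      · exact hs.arr _ _
    · exact hs.arr _ _
  | emit => exact ⟨hs.reg, hs.arr⟩
  | seq _ _ ih₁ ih₂ => exact ih₂ (ih₁ hs)
  | condTrue _ _ ih => exact ih hs
  | condFalse _ _ ih => exact ih hs
  | loopDone => exact hs
  | loopStep _ _ _ ih₁ ih₂ => exact ih₂ (ih₁ hs)

theorem Ex.bdd {N word : ℕ} {c : HCmd} {s : St} {Q : ℕ → St → Prop} (h : Ex N word c s Q)
    (hs : s.Bdd word) : Ex N word c s fun t s' => Q t s' ∧ s'.Bdd word :=
  let ⟨t, s', r, q⟩ := h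
  ⟨t, s', r, q, r.bdd hs⟩

/-- The dictionaries of the nodes `1, …, nn - 1`. -/
structure Dict (s : St) (lv ow : ℕ → ℕ) (nn : ℕ) : Prop where
  skip : s.Skip lv ow (s.reg .cells)
  pos : 0 < s.reg .cells
  top : ∀ o, 0 < o → o < nn → Top (s.arr .key) lv ow (s.reg .cells) (s.arr .head o) o
  own : ∀ p, Nd (s.reg .cells) p → 0 < ow p ∧ ow p < nn

/-- The dictionary of `o` holds the entry `u` at the key `k`. -/
abbrev St.Entry (s : St) (lv ow : ℕ → ℕ) (o k u : ℕ) : Prop :=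
  SlidingMUPS.Entry (s.arr .key) (s.arr .val) lv ow (s.reg .cells) o k u

theorem nd_succ {al p : ℕ} (hal : 0 < al) : Nd (al + 1) p ↔ Nd al p ∨ p = al := by
  unfold Nd; omega

theorem card_ground_succ {lv : ℕ → ℕ} {al l : ℕ} (hal : 0 < al) :
    (ground (update lv al l) (al + 1)).card = (ground lv al).card + if l = 0 then 1 else 0 := by
  have hne : ∀ p, Nd al p → p ≠ al := by rintro p hp rfl; exact absurd hp.2 (lt_irrefl _)
  split_ifs with h
  · have : ground (update lv al l) (al + 1) = insert al (ground lv al) := by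
      ext p
      simp only [mem_ground, Finset.mem_insert, nd_succ hal]
      constructor
      · rintro ⟨h1 | rfl, h2⟩
        · rw [update_of_ne (hne p h1)] at h2; exact Or.inr ⟨h1, h2⟩
        · exact Or.inl rfl
      · rintro (rfl | ⟨h1, h2⟩)
        · exact ⟨Or.inr rfl, by rw [update_self, h]⟩
        · exact ⟨Or.inl h1, by rwa [update_of_ne (hne p h1)]⟩
    rw [this, Finset.card_insert_of_notMem]
    rw [mem_ground]
    rintro ⟨h, -⟩
    exact hne _ h rfl
  · have : ground (update lv al l) (al + 1) = ground lv al := by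
      ext p
      simp only [mem_ground, nd_succ hal]
      constructor
      · rintro ⟨h1 | rfl, h2⟩
        · rw [update_of_ne (hne p h1)] at h2; exact ⟨h1, h2⟩
        · rw [update_self] at h2; exact absurd h2 h
      · rintro ⟨h1, h2⟩
        exact ⟨Or.inl h1, by rwa [update_of_ne (hne p h1)]⟩
    rw [this]; rfl

theorem Top.of_insert {K lv ow : ℕ → ℕ} {al t l o o' p : ℕ} (hal : 0 < al)
    (h : Top K lv ow al p o') (ho : o' ≠ o) (hown : t = al ∨ ow t = o) (K' : ℕ → ℕ)
    (hK' : ∀ q, q ≠ t → q ≠ al → K' q = K q) :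
    Top K' (update lv al l) (update ow al o) (al + 1) p o' := by
  have hne : ∀ p, Nd al p → p ≠ al := by rintro p hp rfl; exact absurd hp.2 (lt_irrefl _)
  have hpt : p ≠ t := by
    rintro rfl
    rcases hown with e | e
    · exact hne _ h.nd e
    · rw [h.own] at e; exact ho e
  refine ⟨h.nd.mono (by omega), ?_, ?_, ?_, ?_⟩
  · rw [update_of_ne (hne _ h.nd), h.own]
  · rw [hK' p hpt (hne _ h.nd), h.key]
  · intro q hq e
    rcases (nd_succ hal).1 hq with hq | rfl
    · rw [update_of_ne (hne _ hq)] at e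
      rw [update_of_ne (hne _ hq), update_of_ne (hne _ h.nd)]
      exact h.le q hq e
    · rw [update_self] at e; exact absurd e.symm ho
  · intro q hq e e'
    rcases (nd_succ hal).1 hq with hq | rfl
    · rw [update_of_ne (hne _ hq)] at e
      rw [update_of_ne (hne _ hq), update_of_ne (hne _ h.nd)] at e'
      exact h.eq q hq e e'
    · rw [update_self] at e; exact absurd e.symm ho

theorem Entry.insert_iff {K V lv ow : ℕ → ℕ} {al t k u : ℕ} (hal : 0 < al) (ht : Nd al t)
    (h0 : lv t = 0) (hk : 0 < k) (o' k' u' : ℕ) :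
    Entry (update (update K t k) al (K t)) (update (update V t u) al (V t)) (update lv al (lv t))
      (update ow al (ow t)) (al + 1) o' k' u' ↔
    Entry K V lv ow al o' k' u' ∨ (o' = ow t ∧ k' = k ∧ u' = u) := by
  have hne : ∀ p, Nd al p → p ≠ al := by rintro p hp rfl; exact absurd hp.2 (lt_irrefl _)
  constructor
  · rintro ⟨p, h1, h2, h3, h4, h5, h6⟩
    rcases (nd_succ hal).1 h1 with h1 | rfl
    · simp only [update_of_ne (hne _ h1)] at h2 h3 h4 h6
      by_cases hpt : p = t
      · subst hpt
        rw [update_self] at h4 h6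
        exact Or.inr ⟨h2.symm, h4.symm, h6.symm⟩
      · rw [update_of_ne hpt] at h4 h6
        exact Or.inl ⟨p, h1, h2, h3, h4, h5, h6⟩
    · rw [update_self] at h2 h4 h6
      exact Or.inl ⟨t, ht, h2, h0, h4, h5, h6⟩
  · rintro (⟨p, h1, h2, h3, h4, h5, h6⟩ | ⟨rfl, rfl, rfl⟩)
    · by_cases hpt : p = t
      · subst hpt
        exact ⟨al, (nd_succ hal).2 (Or.inr rfl), by rwa [update_self], by rwa [update_self],
          by rwa [update_self], h5, by rwa [update_self]⟩
      · exact ⟨p, h1.mono (by omega), by rwa [update_of_ne (hne _ h1)],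
          by rwa [update_of_ne (hne _ h1)], by rwa [update_of_ne (hne _ h1), update_of_ne hpt], h5,
          by rwa [update_of_ne (hne _ h1), update_of_ne hpt]⟩
    · exact ⟨t, ht.mono (by omega), by rw [update_of_ne (hne _ ht)],
        by rwa [update_of_ne (hne _ ht)], by rw [update_of_ne (hne _ ht), update_self], hk.ne',
        by rw [update_of_ne (hne _ ht), update_self]⟩

open Reg Arr in
/-- The loop of the insertion. -/
def descend : HCmd :=
  .loop descending (.cond (.lt v (key.at t)) (.assign t (Arr.right.at t))
    (raise ;; .assign t (down.at t)))

open Reg Arr in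
/-- Insertion of the entry in the register `nodes` at the key in the register `v`, which must be
new, into the dictionary of the node in the register `x`. -/
def insertion (x : Reg) : HCmd :=
  .assign t (head.at x) ;; descend ;;
  (.store val cells (val.at t) ;; .store val t nodes ;; putBehind v 0) ;;
  -- A right pointer that is not null means that the top level now has two nodes.
  .cond (.lt 0 (Arr.right.at (head.at x)))
    (.store down cells (head.at x) ;; .store key cells 0 ;; .store Arr.right cells 0 ;;
      .store head x cells ;; .assign cells (cells + 1)) .skip

/-- The measure is that of `search_spec`, with a body of at most 11 steps. After a split the walk
goes on at the start of the old gap and may need all three moves to the right, also past the raised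
key. -/
theorem descend_spec {N word : ℕ} {s : St} {lv ow : ℕ → ℕ} {o hd : ℕ}
    (h : Inserting (s.arr .key) (s.arr .right) (s.arr .down) lv ow (s.reg .cells) o hd (s.reg .t)
      (s.reg .v)) (hht : s.reg .t = hd) (hK : s.arr .key hd = 0) (hb : s.Bdd word)
    (hN : 2 * (ground lv (s.reg .cells)).card + 1 < N) (hNw : N < word) :
    Ex N word descend s fun n s' => n ≤ 48 * lv hd + 1 ∧ ∃ lv' ow',
      s.Frame [.t, .cells] [.key, .right, .down] s' ∧ s'.Bdd word ∧
      Inserting (s'.arr .key) (s'.arr .right) (s'.arr .down) lv' ow' (s'.reg .cells) o hd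
        (s'.reg .t) (s.reg .v) ∧ lv' (s'.reg .t) = 0 ∧ s'.arr .key (s'.reg .t) ≤ s.reg .v ∧
      Raised o (s.arr .key) lv ow (s.reg .cells) (s'.arr .key) lv' ow' (s'.reg .cells) := by
  let I : ℕ → St → Prop := fun n s' => ∃ lv' ow',
      s.Frame [.t, .cells] [.key, .right, .down] s' ∧ s'.Bdd word ∧
      Inserting (s'.arr .key) (s'.arr .right) (s'.arr .down) lv' ow' (s'.reg .cells) o hd
        (s'.reg .t) (s.reg .v) ∧
      Raised o (s.arr .key) lv ow (s.reg .cells) (s'.arr .key) lv' ow' (s'.reg .cells) ∧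
      ∃ j ≤ 3, (s'.arr .key) ((s'.arr .right)^[j] (s'.reg .t)) ≤ s.reg .v ∧
      n = 4 * lv' (s'.reg .t) + j
  have hI : I (4 * lv hd) s := by
    refine ⟨lv, ow, ⟨fun _ _ => rfl, fun _ _ => rfl⟩, hb, h, ⟨le_rfl, ?_, ?_, ?_, ?_⟩, 0, ?_⟩
    · intros; rfl
    · intros; rfl
    · intro p h1 h2; exact absurd h1 h2
    · intros; rfl
    · rw [hht]; simp [hK]
  refine (Ex.loop (k := 11) hI ?_).mono ?_
  · rintro n s' ⟨lv', ow', hf, hbd, hin, hra, j, hj, hk, rfl⟩ hbt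
    have e4 : s'.reg .v = s.reg .v := hf.reg _ (by simp)
    -- Splits allocate cells above the ground only, so the size of the original ground bounds the
    -- memory throughout the loop.
    have hgr : s'.reg .cells ≤ 2 * (ground lv (s.reg .cells)).card + 1 := by
      rw [← hra.ground]; exact hin.skip.le_two_mul_ground
    refine ((HCmd.wp.run (Q := fun s'' => s''.Bdd word → ∃ n' < _, I n' s'') ?_).bdd hbd).mono
      fun t s'' h => ⟨h.1.1.trans (by simp [HCmd.size, raise, putBehind]), h.1.2 h.2⟩
    have hnd := hin.nd
    simp only [descending, HCmd.wp, HTest.Holds, HExpr.eval_reg, HExpr.eval_arr,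
      HExpr.eval_ofNat, e4] at hbt ⊢
    constructor
    · intro hlt
      refine ⟨by decide, hbd.arr _ _, fun hbd' => ?_⟩
      have hj0 : j ≠ 0 := by rintro rfl; simp at hk; omega
      obtain ⟨j, rfl⟩ := Nat.exists_eq_succ_of_ne_zero hj0
      rw [Function.iterate_succ_apply] at hk
      have hr := hin.skip.right _ hnd (by omega)
      refine ⟨4 * lv' (s'.reg .t) + j, by omega, lv', ow', hf.set (by simp) _, hbd', ?_⟩
      simp only [St.set_reg, if_true, St.set_arr, reduceCtorEq, if_false]
      exact ⟨hin.right hlt, hra, j, by omega, hk, by rw [hr.2.2.1]⟩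
    · intro hlt
      have hd : s'.arr .down (s'.reg .t) ≠ 0 := by rcases hbt with hb | hb <;> omega
      have h0 : lv' (s'.reg .t) ≠ 0 := fun e => hd ((hin.skip.down_null _ hnd).2 e)
      obtain ⟨a1, a2, a3, a4⟩ := hin.skip.down _ hnd h0
      rw [raise]
      simp only [HCmd.wp, HTest.Holds, HExpr.eval_reg, HExpr.eval_arr]
      constructor
      · intro hrs
        obtain ⟨r1, r2, r3⟩ := hin.raise h0 (by omega) hrs
        have htc : s'.reg .t ≠ s'.reg .cells := by have := hnd.2; omega
        have hRc : s'.arr .right (s'.arr .down (s'.reg .t)) ≠ s'.reg .cells := by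
          have := (hin.skip.right _ a1 (by omega)).1.2; omega
        refine putBehind_wp (kv := s'.arr .key (s'.arr .right (s'.arr .down (s'.reg .t))))
          (dv := s'.arr .right (s'.arr .right (s'.arr .down (s'.reg .t))))
          (by omega) (by omega) hnd.2 rfl (hbd.arr _ _) ?_ (hbd.arr _ _) (hbd.arr _ _)
          (hbd.arr _ _) ?_
        · simp [htc, hRc]
        · intro s'' hf'' ek er ed ec
          have et : s''.reg .t = s'.reg .t := hf''.reg _ (by simp)
          have edt : s''.arr .down (s'.reg .t) = s'.arr .down (s'.reg .t) := by
            rw [ed, update_of_ne htc]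
          rw [et, edt]
          refine ⟨by decide, hbd.arr _ _, fun hbd' => ?_⟩
          have e0 : update lv' (s'.reg .cells) (lv' (s'.reg .t)) (s'.arr .down (s'.reg .t)) =
              lv' (s'.arr .down (s'.reg .t)) := by
            rw [update_of_ne]; have := a1.2; omega
          refine ⟨4 * lv' (s'.arr .down (s'.reg .t)) + 3, by omega,
            update lv' (s'.reg .cells) (lv' (s'.reg .t)), update ow' (s'.reg .cells) (ow' (s'.reg .t)), (hf.comp
            (hf''.mono (by simp) (by simp))).set (by simp) _, hbd', ?_⟩
          simp only [St.set_reg, if_true, St.set_arr, reduceCtorEq, if_false, ek, er, ed, ec]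
          exact ⟨r1, hra.trans r2, 3, le_rfl, r3, by rw [e0]⟩
      · intro hrs
        refine ⟨by decide, hbd.arr _ _, fun hbd' => ?_⟩
        obtain ⟨j', hj', hk'⟩ := hin.skip.gap_le hnd h0 (k := s.reg .v) (by omega)
        refine ⟨4 * lv' (s'.arr .down (s'.reg .t)) + j', by omega, lv', ow', hf.set (by simp) _, hbd', ?_⟩
        simp only [St.set_reg, if_true, St.set_arr, reduceCtorEq, if_false]
        exact ⟨hin.down h0 (by omega) hrs, hra, j', hj', hk', rfl⟩
  · rintro n s' ⟨n', hn', ⟨lv', ow', hf, hbd, hin, hra, j, hj, hk, rfl⟩, hbt, hn⟩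
    have e4 : s'.reg .v = s.reg .v := hf.reg _ (by simp)
    simp only [descending, HTest.Holds, HExpr.eval_reg, HExpr.eval_arr,
      HExpr.eval_ofNat, e4, not_or, not_lt, Nat.le_zero] at hbt
    exact ⟨by omega, lv', ow', hf, hbd, hin, (hin.skip.down_null _ hin.nd).1 hbt.1, hbt.2, hra⟩

theorem Dict.inserting {s : St} {lv ow : ℕ → ℕ} {nn o k : ℕ} (h : Dict s lv ow nn) (ho : 0 < o)
    (hn : o < nn) :
    Inserting (s.arr .key) (s.arr .right) (s.arr .down) lv ow (s.reg .cells) o (s.arr .head o)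
      (s.arr .head o) k := by
  have ht := h.top o ho hn
  refine ⟨h.skip, ht.nd, ht.own, ?_, ?_, ht.nd, ht.own, ht.le, ?_, Or.inl ⟨rfl, ht.key⟩⟩
  · intro q h1 h2 h3 h4
    rw [ht.eq q h1 (by rw [h2, ht.own]) h3] at h4
    omega
  · intro q h1 h2 h3
    have := ht.le q h1 h2
    omega
  · intro q h1 h2 h3
    rw [ht.eq q h1 h2 h3]

/-- The room prepared by the descent admits the new entry on the ground. If the top level has two
nodes afterwards, a new head with the key 0 above them restores a top level of one node. -/
theorem insertion_spec {N word : ℕ} {s : St} {lv ow : ℕ → ℕ} {nn o : ℕ} (h : Dict s lv ow nn)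
    {x : Reg} (hx : x ≠ .t ∧ x ≠ .cells) (hxo : s.reg x = o) (ho : 0 < o) (hn : o < nn)
    (hv : 0 < s.reg .v)
    (hnew : ∀ u, ¬ s.Entry lv ow o (s.reg .v) u) (hb : s.Bdd word) (hoN : o < N)
    (hN : 2 * (ground lv (s.reg .cells)).card + 4 < N) (hNw : N < word) :
    Ex N word (insertion x) s fun n s' => n ≤ 48 * lv (s.arr .head o) + 20 ∧ ∃ lv' ow',
      s.Frame [.t, .cells] [.key, .right, .down, .val, .head] s' ∧ Dict s' lv' ow' nn ∧
      (∀ o' k u, s'.Entry lv' ow' o' k u ↔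
        s.Entry lv ow o' k u ∨ (o' = o ∧ k = s.reg .v ∧ u = s.reg .nodes)) ∧
      (ground lv' (s'.reg .cells)).card = (ground lv (s.reg .cells)).card + 1 := by
  have hal : 0 < s.reg .cells := h.pos
  refine Ex.seq ⟨1, _, .assign s .t _ (by decide) (by simpa using hb.arr _ _), ?_⟩
  simp only [HExpr.eval_arr, HExpr.eval_reg, hxo]
  refine Ex.seq ((descend_spec (lv := lv) (ow := ow) (o := o) (hd := s.arr .head o) ?_ ?_ ?_ ?_ ?_
    hNw).mono ?_)
  · simpa using h.inserting ho hn
  · simp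
  · simpa using (h.top o ho hn).key
  · refine ⟨fun r => ?_, hb.arr⟩
    rw [St.set_reg]; split_ifs
    · exact hb.arr _ _
    · exact hb.reg _
  · simp; omega
  rintro n s₁ ⟨hn₁, lv₁, ow₁, hf, hbd, hin, hlt, hKt, hra⟩
  simp only [St.set_arr, St.set_reg, reduceCtorEq, if_false] at hra hin hKt
  have hsf : s.Frame [.t, .cells] [.key, .right, .down] s₁ :=
    ((St.Frame.refl s).set (by simp) _).comp hf
  have hval : s₁.arr .val = s.arr .val := hsf.arr _ (by simp)
  have hhead : s₁.arr .head = s.arr .head := hsf.arr _ (by simp)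
  have hv1 : s₁.reg .v = s.reg .v := hsf.reg _ (by simp)
  have hx1 : s₁.reg x = o := by rw [hsf.reg _ (by simpa using hx), hxo]
  have hnod : s₁.reg .nodes = s.reg .nodes := hsf.reg _ (by simp)
  have hal1 : 0 < s₁.reg .cells := lt_of_lt_of_le hal hra.le
  have hg1 := hra.ground
  have hcl : s₁.reg .cells ≤ 2 * (ground lv (s.reg .cells)).card + 1 := by
    rw [← hg1]; exact hin.skip.le_two_mul_ground
  have hnd := hin.nd
  have htc : s₁.reg .t ≠ s₁.reg .cells := by have := hnd.2; omega
  have hlt2 : s₁.arr .key (s₁.reg .t) < s.reg .v := by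
    refine lt_of_le_of_ne hKt fun e => hnew (s.arr .val (s₁.reg .t)) ?_
    refine (hra.entry _ _ _ _).1 ?_
    rw [← hval]
    exact ⟨_, hnd, hin.own, hlt, e, hv.ne', rfl⟩
  have hcov : Covers (s₁.arr .key) lv₁ ow₁ (s₁.reg .cells) (s₁.reg .t) (s.reg .v) :=
    ⟨hKt, hin.low⟩
  have hskip := hin.skip.insert (dx := 0) hnd hlt2 hcov (hin.covered hKt hcov) (fun _ => rfl)
    (fun e => absurd hlt e)
  obtain ⟨hd1, hd2, hd3⟩ := hin.head_insert hlt2 hcov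
  have hne : ∀ p, Nd (s₁.reg .cells) p → p ≠ s₁.reg .cells := by
    rintro p hp rfl; exact absurd hp.2 (lt_irrefl _)
  have hcard := card_ground_succ (lv := lv₁) (l := lv₁ (s₁.reg .t)) hal1
  rw [hlt, if_pos rfl, hg1] at hcard
  have hent := fun o' k' u' => Entry.insert_iff (K := s₁.arr .key) (V := s₁.arr .val) (lv := lv₁)
    (ow := ow₁) (u := s₁.reg .nodes) hal1 hnd hlt hv o' k' u'
  simp only [hin.own, hlt] at hskip hent hd1 hd2
  have htop : ∀ o', 0 < o' → o' < nn → o' ≠ o → Top (update (update (s₁.arr .key) (s₁.reg .t)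
      (s.reg .v)) (s₁.reg .cells) (s₁.arr .key (s₁.reg .t))) (update lv₁ (s₁.reg .cells) 0)
      (update ow₁ (s₁.reg .cells) o) (s₁.reg .cells + 1) (s.arr .head o') o' := by
    intro o' h1 h2 h3
    refine Top.of_insert hal1 (hra.top (h.top o' h1 h2) h3) h3 (Or.inr hin.own) _ ?_
    intro q h1 h2
    rw [update_of_ne h2, update_of_ne h1]
  have hown : ∀ p, Nd (s₁.reg .cells + 1) p → 0 < update ow₁ (s₁.reg .cells) o p ∧
      update ow₁ (s₁.reg .cells) o p < nn := by
    intro p hp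
    rcases (nd_succ hal1).1 hp with hp | rfl
    · rw [update_of_ne (hne _ hp)]
      by_cases e : ow₁ p = o
      · rw [e]; exact ⟨ho, hn⟩
      · have := hra.nd_of hp (Or.inr e)
        rw [hra.ow_eq p this]
        exact h.own p this
    · rw [update_self]; exact ⟨ho, hn⟩
  have hhd : s.arr .head o ≠ s₁.reg .cells := hne _ hin.hd_nd
  refine ((HCmd.wp.run (Q := fun s₂ => ∃ lv' ow',
      s.Frame [.t, .cells] [.key, .right, .down, .val, .head] s₂ ∧ Dict s₂ lv' ow' nn ∧
      (∀ o' k u, s₂.Entry lv' ow' o' k u ↔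
        s.Entry lv ow o' k u ∨ (o' = o ∧ k = s.reg .v ∧ u = s.reg .nodes)) ∧
      (ground lv' (s₂.reg .cells)).card = (ground lv (s.reg .cells)).card + 1) ?_)).mono ?_
  swap
  · rintro t s₂ ⟨h1, h2⟩
    refine ⟨?_, h2⟩
    simp [HCmd.size, putBehind] at h1
    omega
  simp only [HCmd.wp, HExpr.eval_reg, HExpr.eval_arr, St.put_arr, St.put_reg, if_true, hval]
  refine ⟨by omega, by rw [← hval]; exact hbd.arr _ _, by have := hnd.2; omega,
    by rw [hnod]; exact hb.reg _, ?_⟩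
  refine putBehind_wp (kv := s.reg .v) (dv := 0) (by simpa using by omega) (by simpa using by omega)
    (by simpa using hnd.2) rfl (by omega) (by simp [hv1]) (hb.reg _) (by simpa using hbd.arr _ _)
    (by simpa using hbd.arr _ _) ?_
  intro s₂ hf₂ ek er ed ec
  simp only [St.put_arr, St.put_reg, reduceCtorEq, if_false] at ek er ed ec
  have ev : s₂.arr .val = update (update (s₁.arr .val) (s₁.reg .t) (s₁.reg .nodes))
      (s₁.reg .cells) (s₁.arr .val (s₁.reg .t)) := by
    rw [hf₂.arr .val (by simp)]
    simp only [St.put_arr, if_true, hval]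
    rw [update_comm htc.symm]
  have eh : s₂.arr .head = s.arr .head := by
    rw [hf₂.arr .head (by simp)]
    simp [hhead]
  have ex : s₂.reg x = o := by
    rw [hf₂.reg x (by simpa using hx.2)]
    simp [hx1]
  have hf₃ : s.Frame [.t, .cells] [.key, .right, .down, .val, .head] s₂ := by
    have a := hsf.mono (rs' := [.t, .cells]) (as' := [.key, .right, .down, .val, .head]) (by simp)
      (by simp)
    exact ((a.put (by simp) _ _).put (by simp) _ _).comp (hf₂.mono (by simp) (by simp))
  have hent₂ : ∀ o' k u, Entry (s₂.arr .key) (s₂.arr .val) (update lv₁ (s₁.reg .cells) 0)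
      (update ow₁ (s₁.reg .cells) o) (s₂.reg .cells) o' k u ↔
      s.Entry lv ow o' k u ∨ (o' = o ∧ k = s.reg .v ∧ u = s.reg .nodes) := by
    intro o' k u
    rw [ek, ev, ec, hent, hnod, St.Entry, ← hra.entry, hval]
  rw [← ek] at hskip hd2 hd3 htop
  rw [← er] at hskip hd3
  rw [← ed] at hskip
  rw [← ec] at hskip hd1 hd2 htop hown hcard
  have hhd2 : Nd (s₂.reg .cells) (s.arr .head o) := by rw [ec]; exact hin.hd_nd.mono (by omega)
  have hho : update ow₁ (s₁.reg .cells) o (s.arr .head o) = o := by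
    rw [update_of_ne hhd, hin.hd_own]
  have hal2 : 0 < s₂.reg .cells := by omega
  constructor
  · intro hR
    simp only [HTest.Holds, HExpr.eval_arr, HExpr.eval_reg, HExpr.eval_ofNat, ex, eh] at hR
    have hK0 : s₂.arr .key (s.arr .head o) ≠ 0 := by
      intro e
      have := hskip.right_null _ hhd2 e
      omega
    -- The second node of the old top level has the key 0, so the old head alone forms the gap of
    -- the new head.
    have hsent := hskip.sentinel (o := o) (l := update lv₁ (s₁.reg .cells) 0 (s.arr .head o) + 1)
      (dx := s.arr .head o) hal2 (fun q h1 h2 => by have := hd1 q h1 h2; omega) (fun e => by omega)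
      (fun _ => ⟨hhd2, hho, rfl, by omega, by tauto, fun q h1 h2 h3 => hd2 q h1 h2 (by omega)⟩)
    simp only [HExpr.eval_arr, HExpr.eval_reg, HExpr.eval_ofNat, ex, eh, St.put_reg, St.put_arr,
      HExpr.eval_add, reduceCtorEq, if_false]
    refine ⟨by omega, by rw [← eh, eh]; exact hb.arr _ _, by omega, by omega, by omega, by omega,
      by omega, by omega, by decide, by omega,
      update (update lv₁ (s₁.reg .cells) 0) (s₂.reg .cells)
        (update lv₁ (s₁.reg .cells) 0 (s.arr .head o) + 1),
      update (update ow₁ (s₁.reg .cells) o) (s₂.reg .cells) o, ?_, ⟨?_, ?_, ?_, ?_⟩, ?_, ?_⟩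
    · exact ((((hf₃.put (by simp) _ _).put (by simp) _ _).put (by simp) _ _).put
        (by simp) _ _).set (by simp) _
    · simpa [St.Skip] using hsent
    · simp
    · intro o' h1 h2
      by_cases e : o' = o
      · subst e
        simp only [St.set_reg, St.set_arr, St.put_arr, reduceCtorEq, if_true, if_false,
          update_self]
        refine ⟨⟨hal2, by omega⟩, by rw [update_self], by rw [update_self], ?_, ?_⟩
        · intro q hq e
          rcases (nd_succ hal2).1 hq with hq | rfl
          · have hne2 : q ≠ s₂.reg .cells := by have := hq.2; omega
            rw [update_of_ne hne2] at e ⊢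
            have := hd1 q hq e
            rw [update_self]; omega
          · exact le_rfl
        · intro q hq e e2
          rcases (nd_succ hal2).1 hq with hq | rfl
          · have hne2 : q ≠ s₂.reg .cells := by have := hq.2; omega
            rw [update_of_ne hne2] at e e2
            have := hd1 q hq e
            rw [update_self] at e2; omega
          · rfl
      · simp only [St.set_reg, St.set_arr, St.put_arr, reduceCtorEq, if_true, if_false,
          update_of_ne e, eh]
        refine Top.of_insert (t := s₂.reg .cells) hal2 (htop o' h1 h2 e) e (Or.inl rfl) _ ?_
        intro q h1 h2
        rw [update_of_ne h1]
    · intro p hp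
      simp only [St.set_reg, if_true] at hp
      rcases (nd_succ hal2).1 hp with hp | rfl
      · have hne2 : p ≠ s₂.reg .cells := by have := hp.2; omega
        rw [update_of_ne hne2]
        exact hown p hp
      · rw [update_self]; exact ⟨ho, hn⟩
    · intro o' k u
      rw [← hent₂]
      have hra2 : Raised o (s₂.arr .key) (update lv₁ (s₁.reg .cells) 0)
          (update ow₁ (s₁.reg .cells) o) (s₂.reg .cells) (update (s₂.arr .key) (s₂.reg .cells) 0)
          (update (update lv₁ (s₁.reg .cells) 0) (s₂.reg .cells)
            (update lv₁ (s₁.reg .cells) 0 (s.arr .head o) + 1))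
          (update (update ow₁ (s₁.reg .cells) o) (s₂.reg .cells) o) (s₂.reg .cells + 1) := by
        have hne2 : ∀ p, Nd (s₂.reg .cells) p → p ≠ s₂.reg .cells := by
          intro p hp; have := hp.2; omega
        refine ⟨by omega, ?_, ?_, ?_, ?_⟩
        · intro p hp; rw [update_of_ne (hne2 p hp)]
        · intro p hp; rw [update_of_ne (hne2 p hp)]
        · intro p hp hn
          rcases (nd_succ hal2).1 hp with hp | rfl
          · exact absurd hp hn
          · rw [update_self, update_self]; exact ⟨by omega, rfl⟩
        · intro p hp _; rw [update_of_ne (hne2 p hp)]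
      simpa [St.Entry] using hra2.entry (s₂.arr .val) o' k u
    · simp only [St.set_reg, if_true]
      rw [card_ground_succ hal2, hcard, if_neg (by omega)]
  · intro hR
    simp only [HTest.Holds, HExpr.eval_arr, HExpr.eval_reg, HExpr.eval_ofNat, ex, eh, not_lt,
      Nat.le_zero] at hR
    have hK0 : s₂.arr .key (s.arr .head o) = 0 := by
      by_contra e
      have := (hskip.right _ hhd2 e).1.1
      omega
    refine ⟨_, _, hf₃, ⟨hskip, hal2, ?_, hown⟩, hent₂, hcard⟩
    intro o' h1 h2
    rw [eh]
    by_cases e : o' = o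
    · subst e
      refine ⟨hhd2, hho, hK0, hd1, ?_⟩
      intro q h3 h4 h5
      have := hd2 q h3 h4 h5
      exact hskip.inj q _ h3 hhd2 (by rw [h4, hho]) h5 (by omega)
    · exact htop o' h1 h2 e

end SlidingMUPS

namespace SlidingMUPS
open Function

/-! ### Palindromes in a text, by positions -/

/-- The substrings of length `n` at the positions `a` and `b` are equal. -/
def Same (x : ℕ → ℕ) (a b n : ℕ) : Prop := ∀ k < n, x (a + k) = x (b + k)

/-- The substring at the positions `a, …, b - 1` is a palindrome. -/
def Pal (x : ℕ → ℕ) (a b : ℕ) : Prop := ∀ k, a ≤ k → k < b → x k = x (a + b - 1 - k)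

section
variable {x : ℕ → ℕ} {a b c e n : ℕ}

theorem Same.refl (x : ℕ → ℕ) (a n : ℕ) : Same x a a n := fun _ _ => rfl

theorem Same.symm (h : Same x a b n) : Same x b a n := fun k hk => (h k hk).symm

theorem Same.trans (h : Same x a b n) (h' : Same x b c n) : Same x a c n :=
  fun k hk => (h k hk).trans (h' k hk)

theorem Same.sub (h : Same x a b n) (k m : ℕ) (hk : k + m ≤ n) : Same x (a + k) (b + k) m := by
  intro i hi
  rw [Nat.add_assoc, Nat.add_assoc]
  exact h _ (by omega)

theorem Pal.congr (h : Same x a b n) (hp : Pal x a (a + n)) : Pal x b (b + n) := by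
  intro k h1 h2
  have e1 := h (k - b) (by omega)
  have e2 := h (n - 1 - (k - b)) (by omega)
  have e3 := hp (a + (k - b)) (by omega) (by omega)
  rw [show a + (a + n) - 1 - (a + (k - b)) = a + (n - 1 - (k - b)) by omega] at e3
  rw [show b + (b + n) - 1 - k = b + (n - 1 - (k - b)) by omega, ← e2, ← e3, e1,
    show b + (k - b) = k by omega]

theorem Pal.shrink (h : Pal x a b) (k : ℕ) (hk : a + 2 * k ≤ b) : Pal x (a + k) (b - k) := by
  intro i h1 h2
  rw [h i (by omega) (by omega)]
  congr 1
  omega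

theorem Pal.grow (h : Pal x (a + 1) b) (hab : a < b) (hx : x a = x b) : Pal x a (b + 1) := by
  intro i h1 h2
  rcases Nat.eq_or_lt_of_le h1 with rfl | h3
  · rw [hx]; congr 1; omega
  · rcases Nat.eq_or_lt_of_le (Nat.le_of_lt_succ h2) with rfl | h4
    · rw [← hx]; congr 1; omega
    · rw [h i h3 h4]; congr 1; omega

theorem Pal.ends (h : Pal x a b) (hab : a < b) : x a = x (b - 1) := by
  rw [h a le_rfl hab]; congr 1; omega

theorem Pal.single : Pal x a (a + 1) := by
  intro i h1 h2
  congr 1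
  omega

theorem Pal.empty (h : b ≤ a) : Pal x a b := fun _ _ _ => by omega

/-- The mirror image of a part of a palindrome is the reversed part, and a palindromic part equals
its own reversal. -/
theorem Pal.reflect (h : Pal x a b) (hac : a ≤ c) (hce : c ≤ e) (heb : e ≤ b) (h' : Pal x c e) :
    Same x c (a + b - e) (e - c) := by
  intro k hk
  rw [h' (c + k) (by omega) (by omega), h (c + e - 1 - (c + k)) (by omega) (by omega)]
  congr 1
  omega

theorem Pal.reflect_pal (h : Pal x a b) (hac : a ≤ c) (hce : c ≤ e) (heb : e ≤ b)
    (h' : Pal x c e) : Pal x (a + b - e) (a + b - c) := by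
  have h1 := h.reflect hac hce heb h'
  rw [show e = c + (e - c) by omega] at h'
  have := Pal.congr h1 h'
  rwa [show a + b - e + (e - c) = a + b - c by omega] at this

end

/-! ### The palindromic tree of a window -/

/-- The string of the node `v` occurs at the position `a`. -/
def At (x len st : ℕ → ℕ) (v a : ℕ) : Prop := Same x (st v) a (len v - 1)

/-- `v` is a node that represents a nonempty palindrome. -/
def Real (nn v : ℕ) : Prop := 3 ≤ v ∧ v < nn

/-- A palindromic tree for the window at the positions `l, …, m - 1` of the text `x`. The node `1`
is the imaginary root, the node `2` represents the empty string, a node `v ≥ 3` represents the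
palindrome of length `len v - 1` at the position `st v`. -/
structure Tree (x len link inner st : ℕ → ℕ) (nn l m : ℕ) : Prop where
  three_le : 3 ≤ nn
  len_one : len 1 = 0
  len_two : len 2 = 1
  link_one : link 1 = 1
  link_two : link 2 = 1
  two_le_len : ∀ v, Real nn v → 2 ≤ len v
  pal : ∀ v, Real nn v → Pal x (st v) (st v + (len v - 1))
  inj : ∀ u v, Real nn u → Real nn v → len u = len v → Same x (st u) (st v) (len u - 1) → u = v
  inner_lt : ∀ v, Real nn v → 0 < inner v ∧ inner v < nn
  len_inner : ∀ v, Real nn v → len (inner v) + 2 = len v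
  inner_at : ∀ v, Real nn v → At x len st (inner v) (st v + 1)
  link_lt : ∀ v, Real nn v → 2 ≤ link v ∧ link v < nn
  len_link : ∀ v, Real nn v → len (link v) < len v
  link_at : ∀ v, Real nn v → At x len st (link v) (st v + len v - len (link v))
  link_max : ∀ v, Real nn v → ∀ q, st v < q → q + 1 < st v + len v →
    Pal x q (st v + (len v - 1)) → st v + len v ≤ q + len (link v)
  complete : ∀ a b, l ≤ a → a < b → b ≤ m → Pal x a b → ∃ v, Real nn v ∧ len v = b - a + 1 ∧
    At x len st v a

section
variable {x len link inner st : ℕ → ℕ} {nn l m : ℕ}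

theorem Tree.real_or (h : Tree x len link inner st nn l m) {v : ℕ} (h0 : 0 < v) (hv : v < nn) :
    v = 1 ∨ v = 2 ∨ Real nn v := by
  unfold Real; omega

theorem Tree.inj' (h : Tree x len link inner st nn l m) {u v a : ℕ} (hu0 : 0 < u) (hu : u < nn)
    (hv0 : 0 < v) (hv : v < nn) (hl : len u = len v) (h1 : At x len st u a)
    (h2 : At x len st v a) : u = v := by
  have l1 := h.len_one
  have l2 := h.len_two
  rcases h.real_or hu0 hu with rfl | rfl | hu' <;> rcases h.real_or hv0 hv with rfl | rfl | hv'
  · rfl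
  · omega
  · have := h.two_le_len v hv'; omega
  · omega
  · rfl
  · have := h.two_le_len v hv'; omega
  · have := h.two_le_len u hu'; omega
  · have := h.two_le_len u hu'; omega
  · refine h.inj u v hu' hv' hl (Same.trans h1 (Same.symm ?_))
    rw [hl]; exact h2

theorem Tree.pal_at (h : Tree x len link inner st nn l m) {v a : ℕ} (hv : Real nn v)
    (ha : At x len st v a) : Pal x a (a + (len v - 1)) :=
  Pal.congr ha (h.pal v hv)

theorem Tree.len_link_le (h : Tree x len link inner st nn l m) {v : ℕ} (h0 : 0 < v) (hv : v < nn) :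
    len (link v) ≤ len v := by
  rcases h.real_or h0 hv with rfl | rfl | hv'
  · rw [h.link_one]
  · rw [h.link_two, h.len_one]; omega
  · exact (h.len_link v hv').le

theorem Tree.link_pos (h : Tree x len link inner st nn l m) {v : ℕ} (h0 : 0 < v) (hv : v < nn) :
    0 < link v ∧ link v < nn := by
  have := h.three_le
  rcases h.real_or h0 hv with rfl | rfl | hv'
  · rw [h.link_one]; omega
  · rw [h.link_two]; omega
  · have := h.link_lt v hv'; omega

/-- The letter at the position `m` may be appended: all candidates for the palindromic suffixes from
`p₀` on extend suffixes of the string of `v`. -/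
structure Climb (x len st : ℕ → ℕ) (nn l m p₀ v : ℕ) : Prop where
  pos : 0 < v
  lt : v < nn
  left : l ≤ p₀
  room : p₀ + len v ≤ m + 1
  room' : p₀ = l ∨ p₀ + len v ≤ m
  suffix : At x len st v (m + 1 - len v)
  max : ∀ q, p₀ ≤ q → q ≤ m → Pal x q (m + 1) → m ≤ q + len v

/-- Stripped of its end letters, a palindromic suffix of the extended window is a palindromic suffix
of the old one. If `v` cannot be extended, the stripped suffix is shorter than `v`, hence a proper
palindromic suffix of `v` and no longer than the link. -/
theorem Climb.step (h : Tree x len link inner st nn l m) {p₀ v : ℕ} (hlm : l ≤ m)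
    (hc : Climb x len st nn l m p₀ v)
    (ht : ¬ (l + len v ≤ m ∧ x (m - len v) = x m)) :
    Climb x len st nn l m p₀ (link v) ∧ len (link v) < len v := by
  have hl := hc.left
  have hroom := hc.room
  have hroom' := hc.room'
  -- Equality would mean `q = m - len v`, where the end letters of the palindrome agree and the test
  -- succeeds.
  have main : ∀ q, p₀ ≤ q → q ≤ m → Pal x q (m + 1) → m < q + len v := by
    intro q h1 h2 h3
    refine lt_of_le_of_ne (hc.max q h1 h2 h3) fun e => ht ⟨by omega, ?_⟩
    have := h3.ends (by omega)
    rwa [show m - len v = q by omega]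
  rcases h.real_or hc.pos hc.lt with rfl | rfl | hv
  -- At the imaginary root the new letter is compared with itself, so the climb ends there at the
  -- latest.
  · exact absurd ⟨by rw [h.len_one]; omega, by rw [h.len_one]; rfl⟩ ht
  · rw [h.link_two, h.len_two, h.len_one]
    rw [h.len_two] at main hroom hroom'
    have := h.three_le
    refine ⟨⟨one_pos, by omega, hl, by rw [h.len_one]; omega, by rw [h.len_one]; omega, ?_, ?_⟩,
      one_pos⟩
    · rw [At, h.len_one]; exact fun k hk => by omega
    · intro q h1 h2 h3
      have := main q h1 h2 h3
      omega
  · have h2 := h.len_link v hv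
    have h3 := h.link_lt v hv
    have hlk : 1 ≤ len (link v) := by
      have h0 := h.two_le_len
      rcases h.real_or (v := link v) (by omega) h3.2 with e | e | e
      · omega
      · rw [e, h.len_two]
      · have := h0 _ e; omega
    refine ⟨⟨by omega, h3.2, hl, by omega, by omega, ?_, ?_⟩, h2⟩
    · have e1 := h.link_at v hv
      have e2 := Same.sub hc.suffix (len v - len (link v)) (len (link v) - 1) (by omega)
      rw [show st v + (len v - len (link v)) = st v + len v - len (link v) by omega,
        show m + 1 - len v + (len v - len (link v)) = m + 1 - len (link v) by omega] at e2
      exact Same.trans e1 e2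
    · intro q h4 h5 h6
      have h7 := main q h4 h5 h6
      by_cases hq : q + 1 < m
      · have h8 := h6.shrink 1 (by omega)
        rw [show m + 1 - 1 = m by omega] at h8
        have e2 := Same.sub hc.suffix (q + 1 - (m + 1 - len v)) (m - (q + 1)) (by omega)
        rw [show m + 1 - len v + (q + 1 - (m + 1 - len v)) = q + 1 by omega] at e2
        rw [show m = q + 1 + (m - (q + 1)) by omega] at h8
        have h9 := Pal.congr e2.symm h8
        have h10 := h.link_max v hv (st v + (q + 1 - (m + 1 - len v))) (by omega) (by omega) (by
          rwa [show st v + (q + 1 - (m + 1 - len v)) + (m - (q + 1)) = st v + (len v - 1) by omega]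
            at h9)
        omega
      · omega

/-- The test only refers to the left end of the window; `room'` supplies the stronger bound when
`p₀` lies further to the right. -/
theorem Climb.done (h : Tree x len link inner st nn l m) {p₀ v : ℕ}
    (hc : Climb x len st nn l m p₀ v) (ht : l + len v ≤ m ∧ x (m - len v) = x m) :
    p₀ + len v ≤ m ∧ Pal x (m - len v) (m + 1) ∧ At x len st v (m - len v + 1) := by
  have hroom' := hc.room'
  have hs := hc.suffix
  rw [show m + 1 - len v = m - len v + 1 by omega] at hs
  refine ⟨by omega, ?_, hs⟩
  rcases h.real_or hc.pos hc.lt with rfl | rfl | hv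
  · rw [h.len_one]; exact Pal.single
  · rw [h.len_two] at *
    exact Pal.grow (Pal.empty (by omega)) (by omega) ht.2
  · have h1 := h.pal_at hv hs
    have := h.two_le_len v hv
    rw [show m - len v + 1 + (len v - 1) = m by omega] at h1
    exact Pal.grow h1 (by omega) ht.2

/-- A child of `X` with the letter `x p` occurs around an occurrence of `X`. -/
theorem Tree.at_of_inner (h : Tree x len link inner st nn l m) {u p : ℕ} (hu : Real nn u)
    (h1 : At x len st (inner u) (p + 1)) (h2 : x (st u) = x p)
    (h3 : Pal x p (p + (len u - 1))) : At x len st u p := by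
  have e1 := h.inner_at u hu
  have e2 := h.len_inner u hu
  have e3 := h.pal u hu
  have e4 := h.two_le_len u hu
  have hs : Same x (st u + 1) (p + 1) (len (inner u) - 1) := e1.symm.trans h1
  intro k hk
  rcases Nat.eq_zero_or_pos k with rfl | hk0
  · exact h2
  · by_cases hk2 : k + 1 = len u - 1
    · have a := e3.ends (by omega)
      have b := h3.ends (by omega)
      rw [show st u + k = st u + (len u - 1) - 1 by omega,
        show p + k = p + (len u - 1) - 1 by omega, ← a, ← b, h2]
    · have := hs (k - 1) (by omega)
      rwa [show st u + 1 + (k - 1) = st u + k by omega,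
        show p + 1 + (k - 1) = p + k by omega] at this

/-- The parent of a node at `p` is the node at `p + 1`. -/
theorem Tree.inner_eq (h : Tree x len link inner st nn l m) {u v p : ℕ} (hu : Real nn u)
    (h1 : At x len st u p) (hv0 : 0 < v) (hv : v < nn) (h2 : At x len st v (p + 1))
    (h3 : len v + 2 = len u) : inner u = v := by
  have e1 := h.inner_at u hu
  have e2 := h.len_inner u hu
  have e3 := h.inner_lt u hu
  refine h.inj' e3.1 e3.2 hv0 hv (by omega) (e1.trans ?_) h2
  exact Same.sub h1 1 _ (by omega)

/-- Without its end letters, a long link of `v` is a proper palindromic suffix of `inner v`. The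
amortized analysis uses this when the longest palindromic suffix has a node already and no second
climb takes place. -/
theorem Tree.len_link_inner (h : Tree x len link inner st nn l m) {v : ℕ} (hv : Real nn v) :
    len (link v) ≤ len (link (inner v)) + 2 := by
  have e2 := h.len_inner v hv
  have e3 := h.inner_lt v hv
  have e4 := h.len_link v hv
  have e5 := h.inner_at v hv
  rcases h.real_or e3.1 e3.2 with e | e | hX
  · rw [e] at e2 ⊢; rw [h.len_one] at e2; omega
  · rw [e] at e2 ⊢; rw [h.len_two] at e2; omega
  · have e6 := h.link_lt _ hX
    have hlk : 1 ≤ len (link (inner v)) := by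
      rcases h.real_or (v := link (inner v)) (by omega) e6.2 with e | e | e
      · omega
      · rw [e, h.len_two]
      · have := h.two_le_len _ e; omega
    by_cases hc : len (link v) ≤ 3
    · omega
    · have e7 := h.link_lt v hv
      have e8 : Real nn (link v) := by
        rcases h.real_or (v := link v) (by omega) e7.2 with e | e | e
        · omega
        · rw [e, h.len_two] at hc; omega
        · exact e
      have e9 := (h.pal_at e8 (h.link_at v hv)).shrink 1 (by omega)
      rw [show st v + len v - len (link v) + (len (link v) - 1) - 1 = st v + (len v - 2) by omega]
        at e9
      have e10 := Same.sub e5 (len v - len (link v)) (len (link v) - 3) (by omega)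
      rw [show st v + len v - len (link v) + 1 = st v + 1 + (len v - len (link v)) by omega,
        show st v + (len v - 2) = st v + 1 + (len v - len (link v)) + (len (link v) - 3) by omega]
        at e9
      have e11 := Pal.congr e10.symm e9
      have e12 := h.link_max _ hX (st (inner v) + (len v - len (link v))) (by omega) (by omega) (by
        rwa [show st (inner v) + (len v - len (link v)) + (len (link v) - 3) =
          st (inner v) + (len (inner v) - 1) by omega] at e11)
      omega

/-- Nodes survive deletions: the window enters the definition only through completeness, which is
weaker for a smaller window. -/
theorem Tree.mono_left (h : Tree x len link inner st nn l m) {l' : ℕ} (hl : l ≤ l') :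
    Tree x len link inner st nn l' m :=
  { h with complete := fun a b h1 => h.complete a b (hl.trans h1) }

theorem Tree.mono_right (h : Tree x len link inner st nn l m) {m' : ℕ} (hm : m' ≤ m) :
    Tree x len link inner st nn l m' :=
  { h with complete := fun a b h1 h2 h3 => h.complete a b h1 h2 (h3.trans hm) }

/-- The longest palindromic suffix after an append has a node already. -/
theorem Tree.append_old (h : Tree x len link inner st nn l m) {v p : ℕ} (hlp : l ≤ p)
    (hpal : Pal x p (m + 1)) (hmax : ∀ q, l ≤ q → q ≤ m → Pal x q (m + 1) → p ≤ q)
    (hv : Real nn v) (hlen : p + len v = m + 2) (hat : At x len st v p) :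
    Tree x len link inner st nn l (m + 1) := by
  refine { h with complete := ?_ }
  intro a b h1 h2 h3 h4
  rcases Nat.eq_or_lt_of_le h3 with rfl | h3
  · have h5 := hmax a h1 (by omega) h4
    rcases Nat.eq_or_lt_of_le h5 with rfl | h5
    · exact ⟨v, hv, by omega, hat⟩
    -- A shorter palindromic suffix is mirrored to a prefix of the longest one. That copy lies in
    -- the old window, so it has a node.
    · have h6 := hpal.reflect h5.le h2.le le_rfl h4
      have h7 := hpal.reflect_pal h5.le h2.le le_rfl h4
      obtain ⟨u, u1, u2, u3⟩ := h.complete _ _ (by omega) (by omega) (by omega) h7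
      refine ⟨u, u1, by omega, u3.trans ?_⟩
      rw [u2]
      convert h6.symm using 1
      omega
  · exact h.complete a b h1 h2 (by omega) h4

/-- The longest palindromic suffix after an append gets a new node. -/
theorem Tree.append_new (h : Tree x len link inner st nn l m) {X Q p : ℕ} (hlp : l ≤ p)
    (hpal : Pal x p (m + 1)) (hmax : ∀ q, l ≤ q → q ≤ m → Pal x q (m + 1) → p ≤ q)
    (hX0 : 0 < X) (hX : X < nn) (hlen : p + len X = m) (hat : At x len st X (p + 1))
    (hQ0 : 2 ≤ Q) (hQ : Q < nn) (hQl : len Q < len X + 2) (hQat : At x len st Q (m + 2 - len Q))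
    (hQmax : ∀ q, p < q → q ≤ m → Pal x q (m + 1) → m + 2 ≤ q + len Q)
    (hnew : ∀ v, Real nn v → len v = len X + 2 → ¬ At x len st v p) :
    Tree x (update len nn (len X + 2)) (update link nn Q) (update inner nn X) (update st nn p)
      (nn + 1) l (m + 1) := by
  have h3 := h.three_le
  have hre : ∀ v, Real (nn + 1) v → (Real nn v ∧ v ≠ nn) ∨ v = nn := by
    intro v; unfold Real; omega
  have hlt : ∀ v, Real nn v → v ≠ nn := by unfold Real; intros; omega
  have hAt : ∀ v a, v ≠ nn → (At x (update len nn (len X + 2)) (update st nn p) v a ↔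
      At x len st v a) := by
    intro v a hv
    rw [At, At, update_of_ne hv, update_of_ne hv]
  refine ⟨by omega, ?_, ?_, ?_, ?_, ?_, ?_, ?_, ?_, ?_, ?_, ?_, ?_, ?_, ?_, ?_⟩
  · rw [update_of_ne (by omega), h.len_one]
  · rw [update_of_ne (by omega), h.len_two]
  · rw [update_of_ne (by omega), h.link_one]
  · rw [update_of_ne (by omega), h.link_two]
  · intro v hv
    rcases hre v hv with ⟨hv, hne⟩ | rfl
    · rw [update_of_ne hne]; exact h.two_le_len v hv
    · rw [update_self]; omega
  · intro v hv
    rcases hre v hv with ⟨hv, hne⟩ | rfl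
    · rw [update_of_ne hne, update_of_ne hne]; exact h.pal v hv
    · rw [update_self, update_self, show p + (len X + 2 - 1) = m + 1 by omega]; exact hpal
  · intro u v hu hv e1 e2
    rcases hre u hu with ⟨hu, hne⟩ | rfl <;> rcases hre v hv with ⟨hv, hne'⟩ | rfl
    · simp only [update_of_ne hne, update_of_ne hne'] at e1 e2
      exact h.inj u v hu hv e1 e2
    · simp only [update_of_ne hne, update_self] at e1 e2
      exact absurd e2 (hnew u hu e1)
    · simp only [update_of_ne hne', update_self] at e1 e2
      rw [e1] at e2
      exact absurd e2.symm (hnew v hv e1.symm)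
    · rfl
  · intro v hv
    rcases hre v hv with ⟨hv, hne⟩ | rfl
    · rw [update_of_ne hne]; have := h.inner_lt v hv; omega
    · rw [update_self]; omega
  · intro v hv
    rcases hre v hv with ⟨hv, hne⟩ | rfl
    · rw [update_of_ne hne, update_of_ne hne, update_of_ne (h.inner_lt v hv).2.ne]
      exact h.len_inner v hv
    · rw [update_self, update_self, update_of_ne hX.ne]
  · intro v hv
    rcases hre v hv with ⟨hv, hne⟩ | rfl
    · rw [update_of_ne hne, update_of_ne hne, hAt _ _ (h.inner_lt v hv).2.ne]
      exact h.inner_at v hv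
    · rw [update_self, update_self, hAt _ _ hX.ne]; exact hat
  · intro v hv
    rcases hre v hv with ⟨hv, hne⟩ | rfl
    · rw [update_of_ne hne]; have := h.link_lt v hv; omega
    · rw [update_self]; omega
  · intro v hv
    rcases hre v hv with ⟨hv, hne⟩ | rfl
    · rw [update_of_ne hne, update_of_ne hne, update_of_ne (h.link_lt v hv).2.ne]
      exact h.len_link v hv
    · rw [update_self, update_self, update_of_ne hQ.ne]; exact hQl
  · intro v hv
    rcases hre v hv with ⟨hv, hne⟩ | rfl
    · rw [update_of_ne hne, update_of_ne hne, update_of_ne hne, hAt _ _ (h.link_lt v hv).2.ne,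
        update_of_ne (h.link_lt v hv).2.ne]
      exact h.link_at v hv
    · rw [update_self, update_self, update_self, hAt _ _ hQ.ne, update_of_ne hQ.ne,
        show p + (len X + 2) - len Q = m + 2 - len Q by omega]
      exact hQat
  · intro v hv
    rcases hre v hv with ⟨hv, hne⟩ | rfl
    · rw [update_of_ne hne, update_of_ne hne, update_of_ne hne,
        update_of_ne (h.link_lt v hv).2.ne]
      exact h.link_max v hv
    · rw [update_self, update_self, update_self, update_of_ne hQ.ne,
        show p + (len X + 2 - 1) = m + 1 by omega]
      intro q h1 h2 h4
      have := hQmax q h1 (by omega) h4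
      omega
  · intro a b h1 h2 h3 h4
    rcases Nat.eq_or_lt_of_le h3 with rfl | h3
    · have h5 := hmax a h1 (by omega) h4
      rcases Nat.eq_or_lt_of_le h5 with rfl | h5
      · refine ⟨nn, by unfold Real; omega, by rw [update_self]; omega, ?_⟩
        rw [At, update_self]; exact Same.refl _ _ _
      · have h6 := hpal.reflect h5.le h2.le le_rfl h4
        have h7 := hpal.reflect_pal h5.le h2.le le_rfl h4
        obtain ⟨u, u1, u2, u3⟩ := h.complete _ _ (by omega) (by omega) (by omega) h7
        refine ⟨u, by unfold Real at *; omega, by rw [update_of_ne (hlt u u1)]; omega, ?_⟩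
        rw [hAt _ _ (hlt u u1)]
        refine u3.trans ?_
        rw [u2]
        convert h6.symm using 1
        omega
    · obtain ⟨u, u1, u2, u3⟩ := h.complete a b h1 h2 (by omega) h4
      exact ⟨u, by unfold Real at *; omega, by rw [update_of_ne (hlt u u1), u2],
        (hAt _ _ (hlt u u1)).2 u3⟩

end

end SlidingMUPS

namespace SlidingMUPS
open Function

/-! ### Occurrences of nodes in the window -/

open Classical in
/-- The positions of the occurrences of the node `v` in the window at the positions
`l, …, m - 1`. -/
noncomputable def occ (x len st : ℕ → ℕ) (l m v : ℕ) : Finset ℕ :=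
  (Finset.Ico l m).filter fun a => a + len v ≤ m + 1 ∧ At x len st v a

open Classical in
/-- The nodes that occur in the window. -/
noncomputable def live (x len st : ℕ → ℕ) (nn l m : ℕ) : Finset ℕ :=
  (Finset.Ico 3 nn).filter fun v => (occ x len st l m v).Nonempty

section
variable {x len link inner st mark : ℕ → ℕ} {nn l m : ℕ}

theorem mem_occ {v a : ℕ} : a ∈ occ x len st l m v ↔
    l ≤ a ∧ a < m ∧ a + len v ≤ m + 1 ∧ At x len st v a := by
  simp [occ, and_assoc]

theorem mem_live {v : ℕ} : v ∈ live x len st nn l m ↔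
    Real nn v ∧ (occ x len st l m v).Nonempty := by
  simp [live, Real]

/-- The recorded occurrences of palindromes: `mark a` is `0` or a node that occurs at `a`. Palindromes
that are neither proper prefixes nor proper suffixes of other palindromes are recorded. -/
structure Marks (x len st : ℕ → ℕ) (nn l m : ℕ) (mark : ℕ → ℕ) : Prop where
  ok : ∀ a, l ≤ a → a < m → mark a ≠ 0 →
    Real nn (mark a) ∧ At x len st (mark a) a ∧ a + len (mark a) ≤ m + 1
  surface : ∀ a b, l ≤ a → a < b → b ≤ m → Pal x a b →
    (∀ a', l ≤ a' → a' < a → ¬ Pal x a' b) → (∀ b', b < b' → b' ≤ m → ¬ Pal x a b') →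
    mark a ≠ 0 ∧ a + len (mark a) = b + 1

/-- A palindrome that ends with an occurrence of `v`, and is longer, contains an occurrence of a
node whose link is `v`. -/
theorem Tree.exists_link (h : Tree x len link inner st nn l m) {v a b c : ℕ} (hv : Real nn v)
    (hc : l ≤ c) (hca : c < a) (hab : a + (len v - 1) = b) (hbm : b ≤ m) (hat : At x len st v a)
    (hp : Pal x c b) : ∃ u ∈ live x len st nn l m, link u = v := by
  have hv2 := h.two_le_len v hv
  induction hn : a - c using Nat.strong_induction_on generalizing c with
  | _ n ih =>
    obtain ⟨u, u1, u2, u3⟩ := h.complete c b hc (by omega) hbm hp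
    have h1 := h.link_lt u u1
    have h2 := h.len_link u u1
    have h3 := h.link_at u u1
    have h4 := h.link_max u u1
    have hu : u ∈ live x len st nn l m :=
      mem_live.2 ⟨u1, c, mem_occ.2 ⟨hc, by omega, by omega, u3⟩⟩
    have hvp : Pal x a b := hab ▸ h.pal_at hv hat
    have h5 := Same.sub u3 (a - c) (b - a) (by omega)
    rw [show c + (a - c) = a by omega] at h5
    -- Since `v` is a proper palindromic suffix of `u`, the link of `u` is at least as long: it is
    -- `v`, or a shorter palindrome than `u` with which the induction continues.
    have h6 := h4 (st u + (a - c)) (by omega) (by omega) (by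
      have := Pal.congr h5.symm (by rwa [show a + (b - a) = b by omega])
      rwa [show st u + (a - c) + (b - a) = st u + (len u - 1) by omega] at this)
    have hlr : Real nn (link u) := by
      rcases h.real_or (v := link u) (by omega) h1.2 with e | e | e
      · omega
      · rw [e, h.len_two] at h6; omega
      · exact e
    have h7 := h.two_le_len _ hlr
    have h8 := Same.sub u3 (len u - len (link u)) (len (link u) - 1) (by omega)
    rw [show st u + (len u - len (link u)) = st u + len u - len (link u) by omega,
      show c + (len u - len (link u)) = b + 1 - len (link u) by omega] at h8
    have h9 : At x len st (link u) (b + 1 - len (link u)) := Same.trans h3 h8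
    rcases Nat.eq_or_lt_of_le (show len v ≤ len (link u) by omega) with e | e
    · refine ⟨u, hu, h.inj' (a := a) (by omega) h1.2 (by have := hv.1; omega) hv.2 e.symm ?_ hat⟩
      rwa [show b + 1 - len (link u) = a by omega] at h9
    · refine ih (a - (b + 1 - len (link u))) (by omega) (c := b + 1 - len (link u)) (by omega)
        (by omega) ?_ rfl
      have := h.pal_at hlr h9
      rwa [show b + 1 - len (link u) + (len (link u) - 1) = b by omega] at this

/-- An occurrence of `v` that properly ends a palindrome yields a live node linked to `v` by
`Tree.exists_link`; one that properly begins a palindrome has a mirror image that ends it. If there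
is no such node, all occurrences of `v` are surface palindromes and therefore recorded. -/
theorem Tree.occ_eq (h : Tree x len link inner st nn l m) (hm : Marks x len st nn l m mark) {v : ℕ}
    (hv : Real nn v) (hno : ∀ u ∈ live x len st nn l m, link u ≠ v) :
    occ x len st l m v = (Finset.Ico l m).filter fun a => mark a = v := by
  have hv2 := h.two_le_len v hv
  have hv0 := hv.1
  ext a
  rw [mem_occ, Finset.mem_filter, Finset.mem_Ico]
  constructor
  · rintro ⟨h1, h2, h3, h4⟩
    have hp := h.pal_at hv h4
    obtain ⟨e1, e2⟩ := hm.surface a (a + (len v - 1)) h1 (by omega) (by omega) hp (by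
      intro a' h5 h6 h7
      obtain ⟨u, u1, u2⟩ := h.exists_link hv h5 h6 rfl (by omega) h4 h7
      exact hno u u1 u2) (by
      intro b' h5 h6 h7
      have e1 := h7.reflect le_rfl (by omega) h5.le hp
      rw [show a + (len v - 1) - a = len v - 1 by omega] at e1
      obtain ⟨u, u1, u2⟩ := h.exists_link (a := a + b' - (a + (len v - 1))) (b := b') hv h1
        (by omega) (by omega) (by omega) (Same.trans h4 e1) h7
      exact hno u u1 u2)
    obtain ⟨e3, e4, e5⟩ := hm.ok a h1 h2 e1
    exact ⟨⟨h1, h2⟩, h.inj' (by have := e3.1; omega) e3.2 (by omega) hv.2 (by omega) e4 h4⟩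
  · rintro ⟨⟨h1, h2⟩, rfl⟩
    obtain ⟨e3, e4, e5⟩ := hm.ok a h1 h2 (by omega)
    exact ⟨h1, h2, e5, e4⟩

theorem At.transport {u v a b : ℕ} (ha : At x len st u a) (hb : At x len st u b) (k : ℕ)
    (hk : k + len v ≤ len u) (h : At x len st v (a + k)) : At x len st v (b + k) := by
  rcases Nat.eq_zero_or_pos (len v) with e | e
  · intro i hi; omega
  · exact Same.trans h (Same.sub (Same.trans ha.symm hb) k (len v - 1) (by omega))

/-- A palindromic suffix of a palindrome is a prefix. -/
theorem Tree.at_prefix (h : Tree x len link inner st nn l m) {u v a : ℕ} (hu : Real nn u)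
    (h1 : At x len st u a) (hlt : len v ≤ len u) (hv : Real nn v)
    (hat : At x len st v (a + len u - len v)) : At x len st v a := by
  have hv2 := h.two_le_len v hv
  have hp := h.pal_at hu h1
  have hq := h.pal_at hv hat
  have := hp.reflect (by omega) (by omega) (by omega) hq
  refine Same.trans hat ?_
  convert this using 1 <;> omega

/-- A palindromic prefix of a palindrome is a suffix. -/
theorem Tree.at_suffix (h : Tree x len link inner st nn l m) {u v a : ℕ} (hu : Real nn u)
    (h1 : At x len st u a) (hlt : len v ≤ len u) (hv : Real nn v)
    (hat : At x len st v a) : At x len st v (a + len u - len v) := by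
  have hv2 := h.two_le_len v hv
  have hp := h.pal_at hu h1
  have hq := h.pal_at hv hat
  have := hp.reflect le_rfl (by omega) (by omega) hq
  refine Same.trans hat ?_
  convert this using 1 <;> omega

theorem Tree.link_at' (h : Tree x len link inner st nn l m) {u a : ℕ} (hu : Real nn u)
    (h1 : At x len st u a) : At x len st (link u) (a + len u - len (link u)) := by
  have h2 := h.len_link u hu
  have h3 := At.transport (b := a) (Same.refl x (st u) _) h1 (len u - len (link u))
    (v := link u) (by omega)
  rw [show a + len u - len (link u) = a + (len u - len (link u)) by omega]
  refine h3 ?_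
  rw [show st u + (len u - len (link u)) = st u + len u - len (link u) by omega]
  exact h.link_at u hu

theorem Tree.len_link_ge (h : Tree x len link inner st nn l m) {u a q : ℕ} (hu : Real nn u)
    (h1 : At x len st u a) (hq : a < q) (hqu : q + 1 < a + len u)
    (hp : Pal x q (a + (len u - 1))) : a + len u ≤ q + len (link u) := by
  have h2 := Same.sub h1 (q - a) (a + len u - 1 - q) (by omega)
  rw [show a + (q - a) = q by omega] at h2
  have := h.link_max u hu (st u + (q - a)) (by omega) (by omega) (by
    have := Pal.congr h2.symm
      (by rwa [show q + (a + len u - 1 - q) = a + (len u - 1) by omega])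
    rwa [show st u + (q - a) + (a + len u - 1 - q) = st u + (len u - 1) by omega] at this)
  omega

theorem Tree.len_le_link (h : Tree x len link inner st nn l m) {u v a : ℕ} (hu : Real nn u)
    (hv : Real nn v) (hlt : len v < len u) (h1 : At x len st u a)
    (h2 : At x len st v (a + len u - len v)) : len v ≤ len (link u) ∧ (v ≠ link u →
      len v < len (link u) ∧ Real nn (link u)) := by
  have hv2 := h.two_le_len v hv
  have h3 := At.transport (b := st u) (v := v) h1 (Same.refl x (st u) _) (len u - len v) (by omega)
    (by rwa [show a + (len u - len v) = a + len u - len v by omega])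
  have h4 := h.link_max u hu (st u + (len u - len v)) (by omega) (by omega) (by
    have := h.pal_at hv h3
    rwa [show st u + (len u - len v) + (len v - 1) = st u + (len u - 1) by omega] at this)
  have h5 := h.link_lt u hu
  refine ⟨by omega, fun hne => ?_⟩
  have h6 : len v ≠ len (link u) := by
    intro e
    refine hne (h.inj' (a := a + len u - len v) (by have := hv.1; omega) hv.2 (by omega) h5.2 e h2 ?_)
    rw [e]; exact h.link_at' hu h1
  refine ⟨by omega, ?_⟩
  rcases h.real_or (v := link u) (by omega) h5.2 with e | e | e
  · omega
  · rw [e, h.len_two] at h4; omega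
  · exact e

/-- The link of `u` is a proper suffix of `u` and, by symmetry, also a prefix. -/
theorem Tree.two_le_occ (h : Tree x len link inner st nn l m) {u v : ℕ} (hv : Real nn v)
    (hu : u ∈ live x len st nn l m) (huv : link u = v) : 2 ≤ (occ x len st l m v).card := by
  subst huv
  obtain ⟨hu, a, ha⟩ := mem_live.1 hu
  obtain ⟨h1, h2, h3, h4⟩ := mem_occ.1 ha
  have h5 := h.len_link u hu
  have h6 := h.link_at' hu h4
  have h7 := h.two_le_len _ hv
  refine Finset.one_lt_card.2 ⟨a, mem_occ.2 ⟨h1, h2, by omega, h.at_prefix hu h4 h5.le hv h6⟩,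
    a + len u - len (link u), mem_occ.2 ⟨by omega, by omega, by omega, h6⟩, by omega⟩

theorem Tree.inner_occ (h : Tree x len link inner st nn l m) {u a : ℕ} (hu : Real nn u)
    (ha : a ∈ occ x len st l m u) : At x len st (inner u) (a + 1) ∧
      (3 < len u → a + 1 ∈ occ x len st l m (inner u)) := by
  obtain ⟨h1, h2, h3, h4⟩ := mem_occ.1 ha
  have h5 := h.len_inner u hu
  have h6 := At.transport (b := a) (v := inner u) (Same.refl x (st u) _) h4 1 (by omega)
    (h.inner_at u hu)
  exact ⟨h6, fun h7 => mem_occ.2 ⟨by omega, by omega, by omega, h6⟩⟩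

/-- A string with a single occurrence is the interior of at most one palindrome. -/
theorem Tree.inner_inj (h : Tree x len link inner st nn l m) {u u' : ℕ}
    (hu : u ∈ live x len st nn l m) (hu' : u' ∈ live x len st nn l m) (he : inner u = inner u')
    (h3 : 3 < len u) (hc : (occ x len st l m (inner u)).card = 1) : u = u' := by
  obtain ⟨hu, a, ha⟩ := mem_live.1 hu
  obtain ⟨hu', a', ha'⟩ := mem_live.1 hu'
  have e1 := h.len_inner u hu
  have e2 := h.len_inner u' hu'
  rw [he] at e1
  have b1 := (h.inner_occ hu ha).2 h3
  have b2 := (h.inner_occ hu' ha').2 (by omega)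
  rw [← he] at b2
  have := Finset.card_le_one.1 hc.le _ b1 _ b2
  have e3 : a = a' := by omega
  subst e3
  exact h.inj' (by have := hu.1; omega) hu.2 (by have := hu'.1; omega) hu'.2 (by omega)
    (mem_occ.1 ha).2.2.2 (mem_occ.1 ha').2.2.2

/-! ### Appending a letter -/

/-- The node `P` is the longest palindromic suffix of the window `l, …, m`. -/
structure IsSuffix (x len st : ℕ → ℕ) (nn l m P a : ℕ) : Prop where
  real : Real nn P
  at_ : At x len st P a
  left : l ≤ a
  right : a + len P = m + 2
  max : ∀ q, l ≤ q → q ≤ m → Pal x q (m + 1) → a ≤ q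

theorem occ_append_of (v : ℕ) : occ x len st l m v ⊆ occ x len st l (m + 1) v := by
  intro a ha
  obtain ⟨h1, h2, h3, h4⟩ := mem_occ.1 ha
  exact mem_occ.2 ⟨by omega, by omega, by omega, h4⟩

/-- A new occurrence ends with the new letter, so it is a palindromic suffix of `P`; if it is
proper, it is a prefix of `P` too. -/
theorem Tree.occ_append (h : Tree x len link inner st nn l (m + 1)) {P a v b : ℕ}
    (hP : IsSuffix x len st nn l m P a) (hv : Real nn v) (hb : b ∈ occ x len st l (m + 1) v)
    (hb' : b ∉ occ x len st l m v) : b + len v = m + 2 ∧ a ≤ b ∧ (v ≠ P → a < b ∧ len v < len P ∧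
      At x len st v a) := by
  have hv2 := h.two_le_len v hv
  obtain ⟨h1, h2, h3, h4⟩ := mem_occ.1 hb
  have h5 : b + len v = m + 2 := by
    by_contra hc
    exact hb' (mem_occ.2 ⟨h1, by omega, by omega, h4⟩)
  have h6 := hP.max b h1 (by omega) (by
    have := h.pal_at hv h4
    rwa [show b + (len v - 1) = m + 1 by omega] at this)
  have hr := hP.right
  refine ⟨h5, h6, fun hne => ?_⟩
  have h7 : a < b := by
    refine lt_of_le_of_ne h6 fun e => ?_
    subst e
    exact hne (h.inj' (by have := hv.1; omega) hv.2 (by have := hP.real.1; omega) hP.real.2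
      (by omega) h4 hP.at_)
  refine ⟨h7, by omega, h.at_prefix hP.real hP.at_ (by omega) hv ?_⟩
  rwa [show a + len P - len v = b by omega]

/-- A palindromic suffix of `P` that is shorter than `link P` occurs twice even without the new
letter: at the start of `P`, and at the end of the copy of `link P` that begins `P`. -/
theorem Tree.unique_append (h : Tree x len link inner st nn l (m + 1)) {P a v : ℕ}
    (hP : IsSuffix x len st nn l m P a) (hv : Real nn v) (h1 : v ≠ P) (h2 : v ≠ link P) :
    (occ x len st l m v).card = 1 ↔ (occ x len st l (m + 1) v).card = 1 := by
  by_cases hs : occ x len st l (m + 1) v ⊆ occ x len st l m v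
  · rw [(occ_append_of v).antisymm hs]
  · obtain ⟨b, hb, hb'⟩ := Finset.not_subset.1 hs
    obtain ⟨e1, e2, e3⟩ := h.occ_append hP hv hb hb'
    obtain ⟨e4, e5, e6⟩ := e3 h1
    have hr := hP.right
    have hl := hP.left
    have hv2 := h.two_le_len v hv
    have hbt := (mem_occ.1 hb).2.2.2
    obtain ⟨f1, f2⟩ := h.len_le_link hP.real hv e5 hP.at_
      (by rwa [show a + len P - len v = b by omega])
    obtain ⟨f2, f3⟩ := f2 h2
    have f4 := h.link_at' hP.real hP.at_
    have f5 := h.len_link P hP.real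
    have f6 := h.at_prefix hP.real hP.at_ f5.le f3 f4
    have f7 := At.transport (v := v) f4 f6 (len (link P) - len v) (by omega)
      (by rwa [show a + len P - len (link P) + (len (link P) - len v) = b by omega])
    have h2 : 2 ≤ (occ x len st l m v).card :=
      Finset.one_lt_card.2 ⟨a, mem_occ.2 ⟨hl, by omega, by omega, e6⟩, _,
        mem_occ.2 ⟨by omega, by omega, by omega, f7⟩, by omega⟩
    have := Finset.card_le_card (occ_append_of (x := x) (len := len) (st := st) (l := l) (m := m) v)
    omega

/-- Every palindromic suffix other than `P` occurs earlier, as a prefix of `P`. -/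
theorem Tree.live_append (h : Tree x len link inner st nn l (m + 1)) {P a : ℕ}
    (hP : IsSuffix x len st nn l m P a) :
    live x len st nn l (m + 1) = insert P (live x len st nn l m) := by
  ext v
  rw [Finset.mem_insert, mem_live, mem_live]
  have hr := hP.right
  have hl := hP.left
  constructor
  · rintro ⟨hv, b, hb⟩
    by_cases hne : v = P
    · exact Or.inl hne
    · refine Or.inr ⟨hv, ?_⟩
      by_cases hb' : b ∈ occ x len st l m v
      · exact ⟨b, hb'⟩
      · obtain ⟨e1, e2, e3⟩ := h.occ_append hP hv hb hb'
        obtain ⟨e4, e5, e6⟩ := e3 hne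
        have hv2 := h.two_le_len v hv
        exact ⟨a, mem_occ.2 ⟨hl, by omega, by omega, e6⟩⟩
  · rintro (rfl | ⟨hv, b, hb⟩)
    · have hv2 := h.two_le_len _ hP.real
      exact ⟨hP.real, a, mem_occ.2 ⟨hl, by omega, by omega, hP.at_⟩⟩
    · exact ⟨hv, b, occ_append_of v hb⟩

/-- Among the palindromes that end with the new letter only `P` is a surface palindrome. A mark that
is overwritten at `a` belongs to a proper prefix of `P`. -/
theorem Marks.append (h : Tree x len link inner st nn l (m + 1)) {P a : ℕ}
    (hP : IsSuffix x len st nn l m P a) (hM : Marks x len st nn l m mark) :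
    Marks x len st nn l (m + 1) (update (update mark m 0) a P) := by
  have hr := hP.right
  have hl := hP.left
  have hP2 := h.two_le_len _ hP.real
  have hPp := h.pal_at hP.real hP.at_
  rw [show a + (len P - 1) = m + 1 by omega] at hPp
  constructor
  · intro s h1 h2 h3
    by_cases e : s = a
    · subst e
      rw [update_self] at *
      exact ⟨hP.real, hP.at_, by omega⟩
    · rw [update_of_ne e] at *
      by_cases e' : s = m
      · subst e'; rw [update_self] at h3; exact absurd rfl h3
      · rw [update_of_ne e'] at *
        obtain ⟨e1, e2, e3⟩ := hM.ok s h1 (by omega) h3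
        exact ⟨e1, e2, by omega⟩
  · intro s b h1 h2 h3 h4 h5 h6
    have hP0 := hP.real.1
    rcases Nat.eq_or_lt_of_le h3 with rfl | h3
    · have h7 := hP.max s h1 (by omega) h4
      have : s = a := by
        by_contra hne
        exact h5 a hl (by omega) hPp
      subst this
      rw [update_self]
      omega
    · have : s ≠ a := by
        rintro rfl
        exact h6 (m + 1) (by omega) le_rfl hPp
      rw [update_of_ne this, update_of_ne (by omega)]
      exact hM.surface s b h1 h2 (by omega) h4 h5 fun b' h7 h8 => h6 b' h7 (by omega)

/-! ### Deleting a letter -/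

/-- The node `P` is the longest palindromic prefix of the window `l, …, m - 1`. -/
structure IsPrefix (x len st : ℕ → ℕ) (nn l m P : ℕ) : Prop where
  real : Real nn P
  at_ : At x len st P l
  right : l + len P ≤ m + 1
  max : ∀ e, l < e → e ≤ m → Pal x l e → e + 1 ≤ l + len P

/-- Nothing begins before the window, so its longest palindromic prefix is a surface palindrome and
is recorded at `l`. -/
theorem Marks.isPrefix (hM : Marks x len st nn l m mark) (hlm : l < m) :
    IsPrefix x len st nn l m (mark l) := by
  classical
  have hex : ∃ e, (l < e ∧ e ≤ m ∧ Pal x l e) ∧ ∀ e', l < e' → e' ≤ m → Pal x l e' → e' ≤ e := by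
    have hne : ((Finset.Icc (l + 1) m).filter fun e => Pal x l e).Nonempty :=
      ⟨l + 1, by simp [Pal.single]; omega⟩
    refine ⟨Finset.max' _ hne, ?_, fun e' h1 h2 h3 => Finset.le_max' _ e'
      (Finset.mem_filter.2 ⟨Finset.mem_Icc.2 ⟨h1, h2⟩, h3⟩)⟩
    have := Finset.max'_mem _ hne
    simp only [Finset.mem_filter, Finset.mem_Icc] at this
    exact ⟨by omega, by omega, this.2⟩
  obtain ⟨e, ⟨h1, h2, h3⟩, h4⟩ := hex
  obtain ⟨h5, h6⟩ := hM.surface l e le_rfl h1 h2 h3 (fun a' _ _ => by omega) (fun b' h6 h7 h8 => by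
    have := h4 b' (by omega) h7 h8
    omega)
  obtain ⟨h7, h8, h9⟩ := hM.ok l le_rfl hlm h5
  exact ⟨h7, h8, h9, fun e' h1 h2 h3 => by have := h4 e' h1 h2 h3; omega⟩

theorem occ_delete_of (v : ℕ) : occ x len st (l + 1) m v ⊆ occ x len st l m v := by
  intro a ha
  obtain ⟨h1, h2, h3, h4⟩ := mem_occ.1 ha
  exact mem_occ.2 ⟨by omega, by omega, by omega, h4⟩

theorem Tree.occ_delete (h : Tree x len link inner st nn l m) {P v b : ℕ}
    (hP : IsPrefix x len st nn l m P) (hv : Real nn v) (hb : b ∈ occ x len st l m v)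
    (hb' : b ∉ occ x len st (l + 1) m v) : b = l ∧ (v ≠ P → len v < len P ∧
      At x len st v (l + len P - len v)) := by
  have hv2 := h.two_le_len v hv
  have hP2 := h.two_le_len P hP.real
  obtain ⟨h1, h2, h3, h4⟩ := mem_occ.1 hb
  have h5 : b = l := by
    by_contra hc
    exact hb' (mem_occ.2 ⟨by omega, by omega, by omega, h4⟩)
  subst h5
  have h6 := hP.max (b + (len v - 1)) (by omega) (by omega) (h.pal_at hv h4)
  refine ⟨rfl, fun hne => ?_⟩
  have h7 : len v ≠ len P := fun e =>
    hne (h.inj' (by have := hv.1; omega) hv.2 (by have := hP.real.1; omega) hP.real.2 e h4 hP.at_)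
  exact ⟨by omega, h.at_suffix hP.real hP.at_ (by omega) hv h4⟩

/-- A palindromic prefix of `P` that is shorter than `link P` occurs twice after the deletion: at
the end of `P`, and at the start of the copy of `link P` that ends `P`. -/
theorem Tree.unique_delete (h : Tree x len link inner st nn l m) {P v : ℕ}
    (hP : IsPrefix x len st nn l m P) (hv : Real nn v) (h1 : v ≠ P) (h2 : v ≠ link P) :
    (occ x len st l m v).card = 1 ↔ (occ x len st (l + 1) m v).card = 1 := by
  by_cases hs : occ x len st l m v ⊆ occ x len st (l + 1) m v
  · rw [hs.antisymm (occ_delete_of v)]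
  · obtain ⟨b, hb, hb'⟩ := Finset.not_subset.1 hs
    obtain ⟨rfl, e3⟩ := h.occ_delete hP hv hb hb'
    obtain ⟨e5, e6⟩ := e3 h1
    have hr := hP.right
    have hv2 := h.two_le_len v hv
    obtain ⟨f1, f2⟩ := h.len_le_link hP.real hv e5 hP.at_ e6
    obtain ⟨f2, f3⟩ := f2 h2
    have f4 := h.link_at' hP.real hP.at_
    have f5 := h.len_link P hP.real
    have f7 := h.at_prefix f3 f4 f2.le hv
      (by rwa [show b + len P - len (link P) + len (link P) - len v = b + len P - len v by omega])
    have h2 : 2 ≤ (occ x len st (b + 1) m v).card :=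
      Finset.one_lt_card.2 ⟨_, mem_occ.2 ⟨by omega, by omega, by omega, e6⟩, _,
        mem_occ.2 ⟨by omega, by omega, by omega, f7⟩, by omega⟩
    have := Finset.card_le_card (occ_delete_of (x := x) (len := len) (st := st) (l := b) (m := m) v)
    omega

/-- Every palindromic prefix other than `P` occurs again at the end of `P`. -/
theorem Tree.live_delete (h : Tree x len link inner st nn l m) {P v : ℕ}
    (hP : IsPrefix x len st nn l m P) (hne : v ≠ P) :
    v ∈ live x len st nn (l + 1) m ↔ v ∈ live x len st nn l m := by
  rw [mem_live, mem_live]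
  refine and_congr_right fun hv => ⟨fun ⟨b, hb⟩ => ⟨b, occ_delete_of v hb⟩, fun ⟨b, hb⟩ => ?_⟩
  by_cases hb' : b ∈ occ x len st (l + 1) m v
  · exact ⟨b, hb'⟩
  · obtain ⟨rfl, e3⟩ := h.occ_delete hP hv hb hb'
    obtain ⟨e5, e6⟩ := e3 hne
    have hr := hP.right
    have hv2 := h.two_le_len v hv
    exact ⟨_, mem_occ.2 ⟨by omega, by omega, by omega, e6⟩⟩

/-- Suppose `b < e` and compare the distances `s - l` and `e - b`. If the first is smaller,
shrinking `[l, e)` gives a longer palindrome that begins at `s`. If they are equal, reflecting `[l,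
b)` in `[l, e)` gives `[s, e)`. If the second is smaller, shrinking gives a longer palindrome that
ends at `b`. -/
theorem Pal.eq_of_prefix {b e s : ℕ} (h1 : Pal x l e) (h2 : Pal x l b) (hs : l < s) (hsb : s < b)
    (hbe : b ≤ e) (hem : e ≤ m) (h3 : Pal x s b)
    (h4 : ∀ a', l + 1 ≤ a' → a' < s → ¬ Pal x a' b) (h5 : ∀ b', b < b' → b' ≤ m → ¬ Pal x s b') :
    b = e := by
  by_contra hne
  rcases lt_trichotomy (s - l) (e - b) with hp | hp | hp
  · have := h1.shrink (s - l) (by omega)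
    rw [show l + (s - l) = s by omega] at this
    exact h5 _ (by omega) (by omega) this
  · have := h1.reflect_pal le_rfl (by omega) hbe h2
    rw [show l + e - b = s by omega, show l + e - l = e by omega] at this
    exact h5 e (by omega) hem this
  · have := h1.shrink (e - b) (by omega)
    rw [show e - (e - b) = b by omega] at this
    exact h4 _ (by omega) (by omega) this

/-- A palindrome that becomes a surface palindrome was a proper suffix of a palindromic prefix of
the window. By `Pal.eq_of_prefix` this prefix is `P`, so the palindrome is `link P` at the end of
`P`. It is recorded unless something at least as long is recorded at the same position. -/
theorem Marks.delete (h : Tree x len link inner st nn l m) {P a : ℕ}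
    (hP : IsPrefix x len st nn l m P) (hM : Marks x len st nn l m mark) (hm0 : len 0 = 0)
    (ha : a = l + len P - len (link P)) :
    Marks x len st nn (l + 1) m
      (if 3 ≤ link P ∧ len (mark a) < len (link P) then update mark a (link P) else mark) := by
  have hP2 := h.two_le_len P hP.real
  have hlk := h.len_link P hP.real
  have hlt := h.link_lt P hP.real
  have hat := h.link_at' hP.real hP.at_
  have hr := hP.right
  have hPp := h.pal_at hP.real hP.at_
  rw [← ha] at hat
  constructor
  · intro s h1 h2 h3
    split_ifs at h3 ⊢ with hc
    · by_cases e : s = a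
      · subst e
        rw [update_self] at *
        exact ⟨⟨hc.1, hlt.2⟩, hat, by omega⟩
      · rw [update_of_ne e] at *
        exact hM.ok s (by omega) h2 h3
    · exact hM.ok s (by omega) h2 h3
  · intro s b h1 h2 h3 h4 h5 h6
    by_cases hl : Pal x l b
    · have hbe := hP.max b (by omega) h3 hl
      have hb : b = l + (len P - 1) := hPp.eq_of_prefix hl (by omega) h2 (by omega) (by omega) h4
        h5 h6
      have h7 := h.len_link_ge hP.real hP.at_ (q := s) (by omega) (by omega) (by rwa [← hb])
      have hQ : Real nn (link P) := ⟨by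
        by_contra hc
        have : link P = 2 := by omega
        rw [this, h.len_two] at h7
        omega, hlt.2⟩
      have hQ2 := h.two_le_len _ hQ
      have hsa : s = a := by
        by_contra hne
        refine h5 a (by omega) (by omega) ?_
        have := h.pal_at hQ hat
        rwa [show a + (len (link P) - 1) = b by omega] at this
      subst hsa
      split_ifs with hc
      · rw [update_self]
        have := hQ.1
        omega
      -- Without an update the palindrome recorded at `s` is at least as long as `link P`, and a
      -- longer one would contradict `h6`.
      · have h8 : len (link P) ≤ len (mark s) := by
          by_contra h8
          exact hc ⟨hQ.1, by omega⟩
        have h9 : mark s ≠ 0 := by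
          intro e; rw [e] at h8; omega
        obtain ⟨f1, f2, f3⟩ := hM.ok s (by omega) (by omega) h9
        refine ⟨h9, ?_⟩
        by_contra hne
        exact h6 (s + (len (mark s) - 1)) (by omega) (by omega) (h.pal_at f1 f2)
    · obtain ⟨f1, f2⟩ := hM.surface s b (by omega) h2 h3 h4 (by
        intro a' h7 h8 h9
        rcases Nat.eq_or_lt_of_le h7 with rfl | h7
        · exact hl h9
        · exact h5 a' h7 h8 h9) h6
      split_ifs with hc
      · have : s ≠ a := by
          rintro rfl
          refine h6 (s + (len (link P) - 1)) (by omega) (by omega) (h.pal_at ⟨hc.1, hlt.2⟩ hat)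
        rw [update_of_ne this]
        exact ⟨f1, f2⟩
      · exact ⟨f1, f2⟩

end

end SlidingMUPS

namespace SlidingMUPS
open Function

/-! ### Counting recorded occurrences and links -/

/-- For a set `A` of nodes and recorded occurrences at the positions `l, …, m - 1`: the weight of a
node is the number of its recorded occurrences plus twice the number of nodes in `A` linked to it;
the sum of the recorded positions and the sum of the nodes in `A` around it are kept modulo `M`. -/
structure Tally (link inner : ℕ → ℕ) (nn l m M : ℕ) (A : Finset ℕ)
    (mark weight possum chsum : ℕ → ℕ) : Prop where
  sub : A ⊆ Finset.range nn
  weight : ∀ v, Nd nn v → weight v = ((Finset.Ico l m).filter fun a => mark a = v).card +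
    2 * (A.filter fun u => link u = v).card
  possum : ∀ v, Nd nn v →
    possum v = (∑ a ∈ (Finset.Ico l m).filter (fun a => mark a = v), a) % M
  chsum : ∀ v, Nd nn v → chsum v = (∑ u ∈ A.filter (fun u => inner u = v), u) % M

section
variable {link inner mark weight possum chsum : ℕ → ℕ} {nn l m M : ℕ} {A : Finset ℕ}

theorem add_mod_sub {S a M : ℕ} (ha : a < M) (h : a ≤ S) :
    (S - a) % M = (S % M + M - a) % M := by
  rw [← Nat.add_mod_right, show S - a + M = S + (M - a) by omega,
    show S % M + M - a = S % M + (M - a) by omega, Nat.mod_add_mod]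

theorem Tally.add_live (h : Tally link inner nn l m M A mark weight possum chsum) {u : ℕ}
    (hu : u ∉ A) (hun : u < nn) :
    Tally link inner nn l m M (insert u A) mark (update weight (link u) (weight (link u) + 2))
      possum (update chsum (inner u) ((chsum (inner u) + u) % M)) where
  sub := Finset.insert_subset (Finset.mem_range.2 hun) h.sub
  weight v hv := by
    rw [Finset.filter_insert]
    split_ifs with e
    · subst e
      rw [update_self, Finset.card_insert_of_notMem (by simp [hu]), h.weight _ hv]
      ring
    · rw [update_of_ne (Ne.symm e), h.weight v hv]
  possum := h.possum
  chsum v hv := by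
    rw [Finset.filter_insert]
    split_ifs with e
    · subst e
      rw [update_self, Finset.sum_insert (by simp [hu]), h.chsum _ hv, Nat.mod_add_mod,
        Nat.add_comm]
    · rw [update_of_ne (Ne.symm e), h.chsum v hv]

theorem Tally.remove_live (h : Tally link inner nn l m M A mark weight possum chsum) {u : ℕ}
    (hu : u ∈ A) (hM : u < M) :
    Tally link inner nn l m M (A.erase u) mark (update weight (link u) (weight (link u) - 2))
      possum (update chsum (inner u) ((chsum (inner u) + M - u) % M)) where
  sub := (Finset.erase_subset _ _).trans h.sub
  weight v hv := by
    rw [Finset.filter_erase]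
    by_cases e : v = link u
    · subst e
      have hm : u ∈ A.filter fun w => link w = link u := by simp [hu]
      have := Finset.card_pos.2 ⟨u, hm⟩
      rw [update_self, Finset.card_erase_of_mem hm, h.weight _ hv]
      omega
    · rw [update_of_ne e, h.weight v hv, Finset.erase_eq_of_notMem]
      simp only [Finset.mem_filter, not_and]
      exact fun _ => Ne.symm e
  possum := h.possum
  chsum v hv := by
    rw [Finset.filter_erase]
    by_cases e : v = inner u
    · subst e
      have hm : u ∈ A.filter fun w => inner w = inner u := by simp [hu]
      have := Finset.sum_erase_add _ (fun w => w) hm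
      rw [update_self, h.chsum _ hv, ← add_mod_sub hM (by omega), ← this, Nat.add_sub_cancel]
    · rw [update_of_ne e, h.chsum v hv, Finset.erase_eq_of_notMem]
      simp only [Finset.mem_filter, not_and]
      exact fun _ => Ne.symm e

theorem filter_update_mark {a w v : ℕ} (hv : v ≠ 0) (h0 : mark a = 0) (hal : l ≤ a) (ham : a < m) :
    ((Finset.Ico l m).filter fun b => update mark a w b = v) =
      if v = w then insert a ((Finset.Ico l m).filter fun b => mark b = v)
      else (Finset.Ico l m).filter fun b => mark b = v := by
  split_ifs with e <;> ext b <;> by_cases hb : b = a <;>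
    simp [hb, update_of_ne, e, h0, hal, ham] <;> omega

theorem Tally.add_mark (h : Tally link inner nn l m M A mark weight possum chsum) {a w : ℕ}
    (h0 : mark a = 0) (hal : l ≤ a) (ham : a < m) :
    Tally link inner nn l m M A (update mark a w) (update weight w (weight w + 1))
      (update possum w ((possum w + a) % M)) chsum where
  sub := h.sub
  weight v hv := by
    have hv0 : v ≠ 0 := hv.1.ne'
    rw [filter_update_mark hv0 h0 hal ham]
    split_ifs with e
    · subst e
      rw [update_self, Finset.card_insert_of_notMem (by simp [h0, hv0.symm]), h.weight _ hv]
      ring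
    · rw [update_of_ne e, h.weight v hv]
  possum v hv := by
    have hv0 : v ≠ 0 := hv.1.ne'
    rw [filter_update_mark hv0 h0 hal ham]
    split_ifs with e
    · subst e
      rw [update_self, Finset.sum_insert (by simp [h0, hv0.symm]), h.possum _ hv, Nat.mod_add_mod,
        Nat.add_comm]
    · rw [update_of_ne e, h.possum v hv]
  chsum := h.chsum

theorem Tally.remove_mark (h : Tally link inner nn l m M A mark weight possum chsum) {a : ℕ}
    (hal : l ≤ a) (ham : a < m) (haM : a < M) :
    Tally link inner nn l m M A (update mark a 0) (update weight (mark a) (weight (mark a) - 1))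
      (update possum (mark a) ((possum (mark a) + M - a) % M)) chsum := by
  have key : ∀ v, v ≠ 0 → ((Finset.Ico l m).filter fun b => mark b = v) =
      if v = mark a then insert a ((Finset.Ico l m).filter fun b => update mark a 0 b = v)
      else (Finset.Ico l m).filter fun b => update mark a 0 b = v := by
    intro v hv
    have := filter_update_mark (mark := update mark a 0) (a := a) (w := mark a) hv (by simp) hal ham
    simpa using this
  refine ⟨h.sub, fun v hv => ?_, fun v hv => ?_, h.chsum⟩
  · have hv0 : v ≠ 0 := hv.1.ne'
    have hw := h.weight v hv
    rw [key v hv0] at hw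
    split_ifs at hw with e
    · subst e
      rw [Finset.card_insert_of_notMem (by simp [hv0.symm])] at hw
      rw [update_self, hw]
      omega
    · rw [update_of_ne e, hw]
  · have hv0 : v ≠ 0 := hv.1.ne'
    have hw := h.possum v hv
    rw [key v hv0] at hw
    split_ifs at hw with e
    · subst e
      rw [update_self, hw, ← add_mod_sub haM, Finset.sum_insert (by simp [hv0.symm]),
        Nat.add_sub_cancel_left]
      rw [Finset.sum_insert (by simp [hv0.symm])]
      omega
    · rw [update_of_ne e, hw]

theorem Tally.grow (h : Tally link inner nn l m M A mark weight possum chsum) (hlm : l ≤ m)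
    (h0 : mark m = 0) : Tally link inner nn l (m + 1) M A mark weight possum chsum := by
  have key : ∀ v, v ≠ 0 → ((Finset.Ico l (m + 1)).filter fun b => mark b = v) =
      (Finset.Ico l m).filter fun b => mark b = v := by
    intro v hv
    ext b
    simp only [Finset.mem_filter, Finset.mem_Ico]
    by_cases e : b = m
    · subst e; omega
    · omega
  exact ⟨h.sub, fun v hv => by rw [h.weight v hv, key v hv.1.ne'],
    fun v hv => by rw [h.possum v hv, key v hv.1.ne'], h.chsum⟩

theorem Tally.shrink (h : Tally link inner nn l m M A mark weight possum chsum)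
    (h0 : mark l = 0) : Tally link inner nn (l + 1) m M A mark weight possum chsum := by
  have key : ∀ v, v ≠ 0 → ((Finset.Ico (l + 1) m).filter fun b => mark b = v) =
      (Finset.Ico l m).filter fun b => mark b = v := by
    intro v hv
    ext b
    simp only [Finset.mem_filter, Finset.mem_Ico]
    by_cases e : b = l
    · subst e; omega
    · omega
  exact ⟨h.sub, fun v hv => by rw [h.weight v hv, key v hv.1.ne'],
    fun v hv => by rw [h.possum v hv, key v hv.1.ne'], h.chsum⟩

theorem Tally.congr_mark (h : Tally link inner nn l m M A mark weight possum chsum)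
    {mark' : ℕ → ℕ} (he : ∀ a, l ≤ a → a < m → mark' a = mark a) :
    Tally link inner nn l m M A mark' weight possum chsum := by
  have key : ∀ v, ((Finset.Ico l m).filter fun b => mark' b = v) =
      (Finset.Ico l m).filter fun b => mark b = v := by
    intro v
    refine Finset.filter_congr fun b hb => ?_
    rw [Finset.mem_Ico] at hb
    rw [he b hb.1 hb.2]
  exact ⟨h.sub, fun v hv => by rw [h.weight v hv, key v],
    fun v hv => by rw [h.possum v hv, key v], h.chsum⟩

/-- This keeps the weights within a machine word. -/
theorem Tally.weight_le (h : Tally link inner nn l m M A mark weight possum chsum) {v : ℕ}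
    (hv : Nd nn v) : weight v ≤ m + 2 * nn := by
  rw [h.weight v hv]
  have h1 := Finset.card_filter_le (Finset.Ico l m) fun a => mark a = v
  have h2 := Finset.card_filter_le A fun a => link a = v
  have h3 := Finset.card_le_card h.sub
  rw [Nat.card_Ico] at h1
  rw [Finset.card_range] at h3
  omega

end

section
variable {x len link inner st mark weight possum chsum : ℕ → ℕ} {nn l m M : ℕ}

theorem Nd.of_real {v : ℕ} (h : Real nn v) : Nd nn v := ⟨by have := h.1; omega, h.2⟩

/-- A live node linked to `v` makes both numbers at least two. Without one, the weight is the number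
of recorded occurrences, and these are all occurrences. -/
theorem Tree.unique_iff (h : Tree x len link inner st nn l m) (hm : Marks x len st nn l m mark)
    (ht : Tally link inner nn l m M (live x len st nn l m) mark weight possum chsum) {v : ℕ}
    (hv : Real nn v) : (occ x len st l m v).card = 1 ↔ weight v = 1 := by
  rw [ht.weight v (.of_real hv)]
  by_cases hu : ∃ u ∈ live x len st nn l m, link u = v
  · obtain ⟨u, hu, e⟩ := hu
    have := h.two_le_occ hv hu e
    have : 0 < ((live x len st nn l m).filter fun u => link u = v).card :=
      Finset.card_pos.2 ⟨u, by simp [hu, e]⟩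
    omega
  · push Not at hu
    rw [h.occ_eq hm hv hu, Finset.filter_eq_empty_iff.2 fun u h1 => hu u h1]
    simp

/-- For the same reason a weight of 0 means absence, so `enliven` and `kill` need no separate flag
for live nodes. -/
theorem Tree.mem_live_iff (h : Tree x len link inner st nn l m) (hm : Marks x len st nn l m mark)
    (ht : Tally link inner nn l m M (live x len st nn l m) mark weight possum chsum) {v : ℕ}
    (hv : Real nn v) : v ∈ live x len st nn l m ↔ weight v ≠ 0 := by
  rw [ht.weight v (.of_real hv), mem_live, ← Finset.card_pos]
  by_cases hu : ∃ u ∈ live x len st nn l m, link u = v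
  · obtain ⟨u, hu, e⟩ := hu
    have := h.two_le_occ hv hu e
    have : 0 < ((live x len st nn l m).filter fun u => link u = v).card :=
      Finset.card_pos.2 ⟨u, by simp [hu, e]⟩
    simp only [hv, true_and]
    omega
  · push Not at hu
    rw [h.occ_eq hm hv hu, Finset.filter_eq_empty_iff.2 fun u h1 => hu u h1]
    simp only [hv, true_and, Finset.card_empty]
    omega

/-- A unique palindrome has exactly one recorded position, and a sum of one position below `M` is
that position, also modulo `M`. -/
theorem Tree.possum_mem (h : Tree x len link inner st nn l m) (hm : Marks x len st nn l m mark)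
    (ht : Tally link inner nn l m M (live x len st nn l m) mark weight possum chsum) {v : ℕ}
    (hmM : m ≤ M) (hv : Real nn v) (hc : (occ x len st l m v).card = 1) :
    possum v ∈ occ x len st l m v := by
  have hu : ∀ u ∈ live x len st nn l m, link u ≠ v := by
    intro u hu e
    have := h.two_le_occ hv hu e
    omega
  have he := h.occ_eq hm hv hu
  obtain ⟨a, ha⟩ := Finset.card_eq_one.1 hc
  have ham : a ∈ occ x len st l m v := by rw [ha]; simp
  rw [ht.possum v (.of_real hv), ← he, ha, Finset.sum_singleton, Nat.mod_eq_of_lt]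
  · simp
  · have := (mem_occ.1 ham).2.1
    omega

/-- By `Tree.inner_inj` the sum has a single term. -/
theorem Tree.chsum_eq (h : Tree x len link inner st nn l m)
    (ht : Tally link inner nn l m M (live x len st nn l m) mark weight possum chsum) {u : ℕ}
    (hnM : nn ≤ M) (hu : u ∈ live x len st nn l m) (h3 : 3 < len u)
    (hc : (occ x len st l m (inner u)).card = 1) : chsum (inner u) = u := by
  have hur := (mem_live.1 hu).1
  have : ((live x len st nn l m).filter fun w => inner w = inner u) = {u} := by
    ext w
    rw [Finset.mem_filter, Finset.mem_singleton]
    constructor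
    · rintro ⟨h1, h2⟩
      exact (h.inner_inj hu h1 h2.symm h3 hc).symm
    · rintro rfl
      exact ⟨hu, rfl⟩
  rw [ht.chsum _ (h.inner_lt u hur), this, Finset.sum_singleton, Nat.mod_eq_of_lt]
  have := hur.2
  omega

end

/-! ### Programs for the counts -/

section
open Reg Arr

/-- Add `e` to the entry `i` of an array, modulo `M`. -/
def addMod (b : Arr) (i e : HExpr) : HCmd :=
  .cond (.lt (b.at i + e) modulus) (.store b i (b.at i + e)) (.store b i (b.at i + e - modulus))

/-- Subtract `e` from the entry `i` of an array, modulo `M`. -/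
def subMod (b : Arr) (i e : HExpr) : HCmd :=
  .cond (.lt (b.at i) e) (.store b i (b.at i + modulus - e)) (.store b i (b.at i - e))

/-- The node in `p` is added to the live nodes, unless it is there. -/
def enliven : HCmd :=
  .cond (.eq (weight.at p) 0)
    (addMod chsum (inner.at p) p ;; .store weight (link.at p) (weight.at (link.at p) + 2)) .skip

/-- The node in `p` is removed from the live nodes if its weight is `0`. -/
def kill : HCmd :=
  .cond (.eq (weight.at p) 0)
    (subMod chsum (inner.at p) p ;; .store weight (link.at p) (weight.at (link.at p) - 2)) .skip

/-- The occurrence of the node in `w` at the position in `a` is recorded. -/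
def addMark (w : Reg) : HCmd :=
  addMod possum w a ;; .store weight w (weight.at w + 1) ;; .store mark a w

/-- The occurrence recorded at the position in `r` is forgotten. -/
def forget (r : Reg) : HCmd :=
  .cond (.eq (mark.at r) 0) .skip
    (subMod possum (mark.at r) r ;; .store weight (mark.at r) (weight.at (mark.at r) - 1) ;;
      .store mark r 0)

end

/-- The counts of a state. -/
abbrev St.Tally (s : St) (l m : ℕ) (A : Finset ℕ) : Prop :=
  SlidingMUPS.Tally (s.arr .link) (s.arr .inner) (s.reg .nodes) l m (s.reg .modulus) A
    (s.arr .mark) (s.arr .weight) (s.arr .possum) (s.arr .chsum)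

/-- The arrays and numbers are large enough. -/
structure St.Fits (s : St) (N word m : ℕ) : Prop where
  modulus : s.reg .modulus = N
  word : s.reg .base + 4 * N ≤ word
  nodes : 4 * s.reg .nodes + 4 < N
  right : m + 3 < N

section
variable {N word l m : ℕ} {s : St} {A : Finset ℕ} {Q : St → Prop}

theorem addMod_wp {b : Arr} {i e : HExpr} (hi : i.eval s < N) (hM : s.reg .modulus = N)
    (hw : 2 * N ≤ word) (hb : s.arr b (i.eval s) < N) (he : e.eval s < N)
    (hQ : Q (s.put b (i.eval s) ((s.arr b (i.eval s) + e.eval s) % N))) :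
    (addMod b i e).wp N word Q s := by
  simp only [addMod, HCmd.wp, HTest.Holds, HExpr.eval_add, HExpr.eval_sub, HExpr.eval_arr,
    HExpr.eval_reg, hM]
  refine ⟨fun h => ⟨hi, by omega, ?_⟩, fun h => ⟨hi, by omega, ?_⟩⟩
  · rwa [Nat.mod_eq_of_lt h] at hQ
  · rwa [Nat.mod_eq_sub_mod (by omega), Nat.mod_eq_of_lt (by omega)] at hQ

theorem subMod_wp {b : Arr} {i e : HExpr} (hi : i.eval s < N) (hM : s.reg .modulus = N)
    (hw : 2 * N ≤ word) (hb : s.arr b (i.eval s) < N) (he : e.eval s < N)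
    (hQ : Q (s.put b (i.eval s) ((s.arr b (i.eval s) + N - e.eval s) % N))) :
    (subMod b i e).wp N word Q s := by
  simp only [subMod, HCmd.wp, HTest.Holds, HExpr.eval_add, HExpr.eval_sub, HExpr.eval_arr,
    HExpr.eval_reg, hM]
  refine ⟨fun h => ⟨hi, by omega, ?_⟩, fun h => ⟨hi, by omega, ?_⟩⟩
  · rwa [Nat.mod_eq_of_lt (by omega)] at hQ
  · rwa [show s.arr b (i.eval s) + N - e.eval s = s.arr b (i.eval s) - e.eval s + N by omega,
      Nat.add_mod_right, Nat.mod_eq_of_lt (by omega)] at hQ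

theorem St.Tally.chsum_lt (h : s.Tally l m A) (hf : s.Fits N word m) {v : ℕ}
    (hv : Nd (s.reg .nodes) v) : s.arr .chsum v < N := by
  rw [h.chsum v hv, hf.modulus]
  exact Nat.mod_lt _ (by have := hf.right; omega)

theorem St.Tally.possum_lt (h : s.Tally l m A) (hf : s.Fits N word m) {v : ℕ}
    (hv : Nd (s.reg .nodes) v) : s.arr .possum v < N := by
  rw [h.possum v hv, hf.modulus]
  exact Nat.mod_lt _ (by have := hf.right; omega)

theorem St.Tally.weight_lt (h : s.Tally l m A) (hf : s.Fits N word m) {v : ℕ}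
    (hv : Nd (s.reg .nodes) v) : s.arr .weight v + 2 < word := by
  have := h.weight_le hv
  have := hf.word
  have := hf.nodes
  have := hf.right
  omega

theorem enliven_wp (h : s.Tally l m A) (hf : s.Fits N word m) (hp : Nd (s.reg .nodes) (s.reg .p))
    (hl : Nd (s.reg .nodes) (s.arr .link (s.reg .p)))
    (hi : Nd (s.reg .nodes) (s.arr .inner (s.reg .p)))
    (hA : s.reg .p ∈ A ↔ s.arr .weight (s.reg .p) ≠ 0)
    (hQ : ∀ s', s.Frame [] [.weight, .chsum] s' → s'.Tally l m (insert (s.reg .p) A) → s'.out = s.out → Q s') :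
    enliven.wp N word Q s := by
  have hw := hf.word
  have hn := hf.nodes
  have e1 := hp.2
  have e2 := hl.2
  have e3 := hi.2
  simp only [enliven, HCmd.wp, HTest.Holds, HExpr.eval_arr, HExpr.eval_reg, HExpr.eval_ofNat]
  constructor
  · intro h0
    refine addMod_wp (by simp; omega) hf.modulus (by omega) (h.chsum_lt hf hi) (by simp; omega) ?_
    simp only [HCmd.wp, HExpr.eval_arr, HExpr.eval_reg, HExpr.eval_add, HExpr.eval_ofNat,
      St.put_reg, St.put_arr, reduceCtorEq, if_false]
    refine ⟨by omega, h.weight_lt hf hl, hQ _ (((St.Frame.refl s).put (by simp) _ _).put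
      (by simp) _ _) ?_ rfl⟩
    have := h.add_live (u := s.reg .p) (by rw [hA]; omega) e1
    rw [hf.modulus] at this
    simpa [St.Tally, hf.modulus] using this
  · intro h0
    refine hQ s (.refl s) ?_ rfl
    rwa [Finset.insert_eq_of_mem (hA.2 h0)]

theorem kill_wp (h : s.Tally l m A) (hf : s.Fits N word m) (hp : Nd (s.reg .nodes) (s.reg .p))
    (hl : Nd (s.reg .nodes) (s.arr .link (s.reg .p)))
    (hi : Nd (s.reg .nodes) (s.arr .inner (s.reg .p))) (hA : s.reg .p ∈ A)
    (hQ : ∀ s', s.Frame [] [.weight, .chsum] s' →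
      s'.Tally l m (if s.arr .weight (s.reg .p) = 0 then A.erase (s.reg .p) else A) →
      s'.out = s.out → Q s') :
    kill.wp N word Q s := by
  have hw := hf.word
  have hn := hf.nodes
  have e1 := hp.2
  have e2 := hl.2
  have e3 := hi.2
  simp only [kill, HCmd.wp, HTest.Holds, HExpr.eval_arr, HExpr.eval_reg, HExpr.eval_ofNat]
  constructor
  · intro h0
    refine subMod_wp (by simp; omega) hf.modulus (by omega) (h.chsum_lt hf hi) (by simp; omega) ?_
    simp only [HCmd.wp, HExpr.eval_arr, HExpr.eval_reg, HExpr.eval_sub, HExpr.eval_ofNat,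
      St.put_reg, St.put_arr, reduceCtorEq, if_false]
    refine ⟨by omega, by have := h.weight_lt hf hl; omega, hQ _ (((St.Frame.refl s).put (by simp) _ _).put
      (by simp) _ _) ?_ rfl⟩
    have := h.remove_live (u := s.reg .p) hA (by rw [hf.modulus]; omega)
    rw [hf.modulus] at this
    rw [if_pos h0]
    simpa [St.Tally, hf.modulus] using this
  · intro h0
    refine hQ s (.refl s) ?_ rfl
    rwa [if_neg h0]

theorem addMark_wp {w : Reg} (h : s.Tally l m A) (hf : s.Fits N word m)
    (hw : Nd (s.reg .nodes) (s.reg w)) (h0 : s.arr .mark (s.reg .a) = 0) (hal : l ≤ s.reg .a)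
    (ham : s.reg .a < m)
    (hQ : ∀ s', s.Frame [] [.weight, .possum, .mark] s' → s'.Tally l m A →
      s'.arr .mark = update (s.arr .mark) (s.reg .a) (s.reg w) → s'.out = s.out → Q s') :
    (addMark w).wp N word Q s := by
  have hwd := hf.word
  have hn := hf.nodes
  have hr := hf.right
  have e1 := hw.2
  rw [addMark, HCmd.wp]
  refine addMod_wp (by simp; omega) hf.modulus (by omega) (h.possum_lt hf hw) (by simp; omega) ?_
  simp only [HCmd.wp, HExpr.eval_arr, HExpr.eval_reg, HExpr.eval_add, HExpr.eval_ofNat,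
    St.put_reg, St.put_arr, reduceCtorEq, if_false]
  refine ⟨by omega, by have := h.weight_lt hf hw; omega, by omega, by omega,
    hQ _ ((((St.Frame.refl s).put (by simp) _ _).put (by simp) _ _).put (by simp) _ _) ?_ (by simp) rfl⟩
  have := h.add_mark (w := s.reg w) h0 hal ham
  rw [hf.modulus] at this
  simpa [St.Tally, hf.modulus] using this

theorem forget_wp {r : Reg} (h : s.Tally l m A) (hf : s.Fits N word m)
    (hw : s.arr .mark (s.reg r) < s.reg .nodes) (hal : l ≤ s.reg r) (ham : s.reg r < m)
    (hQ : ∀ s', s.Frame [] [.weight, .possum, .mark] s' → s'.Tally l m A →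
      s'.arr .mark = update (s.arr .mark) (s.reg r) 0 → s'.out = s.out → Q s') :
    (forget r).wp N word Q s := by
  have hwd := hf.word
  have hn := hf.nodes
  have hr := hf.right
  simp only [forget, HCmd.wp, HTest.Holds, HExpr.eval_arr, HExpr.eval_reg, HExpr.eval_ofNat]
  constructor
  · intro h0
    refine hQ s (.refl s) h ?_ rfl
    rw [← h0, update_eq_self]
  · intro h0
    have hnd : Nd (s.reg .nodes) (s.arr .mark (s.reg r)) := ⟨by omega, hw⟩
    refine subMod_wp (by simp; omega) hf.modulus (by omega) (h.possum_lt hf hnd) (by simp; omega) ?_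
    simp only [HExpr.eval_arr, HExpr.eval_reg, HExpr.eval_sub, HExpr.eval_ofNat,
      St.put_reg, St.put_arr, reduceCtorEq, if_false]
    refine ⟨by omega, by have := h.weight_lt hf hnd; omega, by omega, by omega,
      hQ _ ((((St.Frame.refl s).put (by simp) _ _).put (by simp) _ _).put (by simp) _ _) ?_ (by simp) rfl⟩
    have := h.remove_mark (a := s.reg r) hal ham (by rw [hf.modulus]; omega)
    rw [hf.modulus] at this
    simpa [St.Tally, hf.modulus] using this

end

end SlidingMUPS

namespace SlidingMUPS
open Function

theorem HCmd.wp.mono {N word : ℕ} {c : HCmd} {s : St} {Q Q' : St → Prop} (h : c.wp N word Q s)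
    (hQ : ∀ s', Q s' → Q' s') : c.wp N word Q' s := by
  induction c generalizing s Q Q' with
  | skip => exact hQ _ h
  | assign r e => exact ⟨h.1, h.2.1, hQ _ h.2.2⟩
  | store a i e => exact ⟨h.1, h.2.1, hQ _ h.2.2⟩
  | emit i e => exact ⟨h.1, h.2.1, hQ _ h.2.2⟩
  | seq c₁ c₂ ih₁ ih₂ => exact ih₁ h fun s' h' => ih₂ h' hQ
  | cond b c₁ c₂ ih₁ ih₂ => exact ⟨fun hb => ih₁ (h.1 hb) hQ, fun hb => ih₂ (h.2 hb) hQ⟩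
  | loop b c => exact h

theorem HCmd.wp_of_bdd {N word : ℕ} {c : HCmd} {s : St} {Q : St → Prop} (hs : s.Bdd word)
    (h : c.wp N word (fun s' => s'.Bdd word → Q s') s) : c.wp N word Q s := by
  induction c generalizing s Q with
  | skip => exact h hs
  | assign r e =>
    refine ⟨h.1, h.2.1, h.2.2 ?_⟩
    exact HRun.bdd (N := word + 1) (.assign s r e h.1 h.2.1) hs
  | store a i e =>
    refine ⟨h.1, h.2.1, h.2.2 ?_⟩
    exact HRun.bdd (.store s a i e h.1 h.2.1) hs
  | emit i e => exact ⟨h.1, h.2.1, h.2.2 ⟨hs.reg, hs.arr⟩⟩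
  | seq c₁ c₂ ih₁ ih₂ =>
    exact ih₁ hs (HCmd.wp.mono (c := c₁) h fun s' h' hs' => ih₂ hs' h')
  | cond b c₁ c₂ ih₁ ih₂ => exact ⟨fun hb => ih₁ hs (h.1 hb), fun hb => ih₂ hs (h.2 hb)⟩
  | loop b c => exact h

/-! ### The explicit list -/

section
open Reg Arr

/-- The node in `r` is removed from the list, if it is there. -/
def unlist (r : Reg) : HCmd :=
  .cond (.eq (slot.at r) 0) .skip
    (.assign t (slot.at r - 1) ;; .assign cnt (cnt - 1) ;; .assign u (owner.at cnt) ;;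
      .emit (t + t) (entry.at cnt) ;; .emit (t + t + 1) (entry.at cnt + len.at u - 2) ;;
      .store entry t (entry.at cnt) ;; .store owner t u ;;
      -- The order matters: if the removed entry is the last one, then `u` is the node in `r`, and
      -- the second store has to win.
      .store slot u (t + 1) ;; .store slot r 0)

/-- The node in `r` is put on the list if it is a minimal unique palindrome. -/
def enlist (r : Reg) : HCmd :=
  .cond (.conj (.eq (weight.at r) 1)
      (.disj (.lt (len.at r) 4) (.neg (.eq (weight.at (inner.at r)) 1))))
    (.emit (cnt + cnt) (base + possum.at r) ;;
      .emit (cnt + cnt + 1) (base + possum.at r + len.at r - 2) ;;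
      .store entry cnt (base + possum.at r) ;; .store owner cnt r ;;
      .store slot r (cnt + 1) ;; .assign cnt (cnt + 1)) .skip

/-- The presence of the node in `r` in the list is brought up to date. -/
def refresh (r : Reg) : HCmd :=
  -- The register may hold a root, or a sum of several children that is not a node at all; such
  -- values are skipped.
  .cond (.conj (.neg (.lt r 3)) (.lt r nodes)) (unlist r ;; enlist r) .skip

end

/-- The list of nodes: `owner` has the nodes, `entry` their positions, `slot` the places of the
nodes in the list. -/
structure Listing (s : St) (word : ℕ) : Prop where
  back : ∀ v, Real (s.reg .nodes) v → s.arr .slot v ≠ 0 →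
    s.arr .slot v ≤ s.reg .cnt ∧ s.arr .owner (s.arr .slot v - 1) = v
  fwd : ∀ i < s.reg .cnt, Real (s.reg .nodes) (s.arr .owner i) ∧
    s.arr .slot (s.arr .owner i) = i + 1 ∧ s.out (i + i) = s.arr .entry i ∧
    s.out (i + i + 1) = s.arr .entry i + s.arr .len (s.arr .owner i) - 2 ∧
    s.arr .entry i + s.arr .len (s.arr .owner i) < word

/-- The node `v` is on the list, with the position `e`. -/
def Shown (s : St) (v e : ℕ) : Prop :=
  s.arr .slot v ≠ 0 ∧ s.arr .entry (s.arr .slot v - 1) = e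

/-- The node `v` counts as a minimal unique palindrome at the position `e`. -/
def Due (s : St) (v e : ℕ) : Prop :=
  (s.arr .weight v = 1 ∧ (s.arr .len v < 4 ∨ s.arr .weight (s.arr .inner v) ≠ 1)) ∧
    e = s.reg .base + s.arr .possum v

section
variable {N word m : ℕ} {s : St} {Q : St → Prop} {r : Reg}

/-- Entries have different owners, because `slot` recovers the place from the owner. So the output
fits into its cells. -/
theorem Listing.cnt_le (h : Listing s word) : s.reg .cnt ≤ s.reg .nodes := by
  have := Finset.card_le_card_of_injOn (s := Finset.range (s.reg .cnt))
    (t := Finset.range (s.reg .nodes)) (s.arr .owner) (fun i hi => by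
      have := (h.fwd i (by simpa using hi)).1.2
      simpa using this) (fun i hi j hj e => by
      have h1 := (h.fwd i (by simpa using hi)).2.1
      have h2 := (h.fwd j (by simpa using hj)).2.1
      rw [e] at h1
      omega)
  simpa using this

theorem Listing.congr (h : Listing s word) {s' : St} (h1 : s'.reg .cnt = s.reg .cnt)
    (h2 : s.reg .nodes ≤ s'.reg .nodes) (h3 : s'.arr .owner = s.arr .owner)
    (h4 : s'.arr .entry = s.arr .entry) (h5 : s'.out = s.out)
    (h6 : ∀ v, Real (s.reg .nodes) v → s'.arr .slot v = s.arr .slot v ∧ s'.arr .len v = s.arr .len v)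
    (h7 : ∀ v, Real (s'.reg .nodes) v → ¬ Real (s.reg .nodes) v → s'.arr .slot v = 0) :
    Listing s' word := by
  constructor
  · intro v hv h0
    have hr : Real (s.reg .nodes) v := by
      by_contra hc
      exact h0 (h7 v hv hc)
    rw [(h6 v hr).1] at h0 ⊢
    rw [h1, h3]
    exact h.back v hr h0
  · intro i hi
    rw [h1] at hi
    obtain ⟨a, b, c, d, e⟩ := h.fwd i hi
    rw [h3, h4, h5, (h6 _ a).1, (h6 _ a).2]
    exact ⟨⟨a.1, a.2.trans_le h2⟩, b, c, d, e⟩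

/-- The last entry moves into the gap, so that a removal takes constant time and the list stays
contiguous. -/
theorem unlist_wp (h : Listing s word) (hf : s.Fits N word m) (hb : s.Bdd word)
    (hr : r ≠ .t ∧ r ≠ .u ∧ r ≠ .cnt) (hreal : Real (s.reg .nodes) (s.reg r))
    (hQ : ∀ s', s.Frame [.cnt, .t, .u] [.owner, .entry, .slot] s' → Listing s' word →
      (∀ v e, Real (s.reg .nodes) v → (Shown s' v e ↔ v ≠ s.reg r ∧ Shown s v e)) → Q s') :
    (unlist r).wp N word Q s := by
  have hN := hf.nodes
  have hW := hf.word
  have hc := h.cnt_le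
  obtain ⟨hr1, hr2, hr3⟩ := hr
  simp only [unlist, HCmd.wp, HTest.Holds, HExpr.eval_arr, HExpr.eval_reg, HExpr.eval_ofNat,
    HExpr.eval_add, HExpr.eval_sub, St.put_reg, St.put_arr, St.set_reg, St.set_arr, St.emit_reg,
    St.emit_arr, reduceCtorEq, if_true, if_false, hr1, hr2, hr3]
  constructor
  · intro h0
    refine hQ s (.refl s) h fun v e hv => ?_
    constructor
    · rintro ⟨a, b⟩
      exact ⟨by rintro rfl; exact a h0, a, b⟩
    · exact fun a => a.2
  · intro h0
    obtain ⟨k1, k2⟩ := h.back _ hreal h0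
    obtain ⟨c1, c2, c3, c4, c5⟩ := h.fwd (s.reg .cnt - 1) (by omega)
    set R := s.reg r with hR
    set k := s.arr .slot R - 1 with hk
    set c := s.reg .cnt - 1 with hcc
    set o := s.arr .owner c with ho
    have c12 := c1.2
    have hr12 := hreal.2
    refine ⟨by decide, by have := hb.arr .slot R; omega, by decide, by have := hb.reg .cnt; omega,
      by decide, hb.arr _ _, by omega, hb.arr _ _, by omega, by omega, by omega, hb.arr _ _,
      by omega, hb.arr _ _, by omega, by omega, by omega, by omega, ?_⟩
    have hoR : k ≠ c → o ≠ R := by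
      intro hne e
      rw [e] at c2
      omega
    refine hQ _ ?_ ⟨?_, ?_⟩ ?_
    · constructor
      · intro r' hr'
        simp only [List.mem_cons, List.not_mem_nil, or_false, not_or] at hr'
        simp [hr']
      · intro r' hr'
        simp only [List.mem_cons, List.not_mem_nil, or_false, not_or] at hr'
        simp [hr']
    · intro v hv
      simp only [St.put_reg, St.put_arr, St.set_reg, St.set_arr, St.emit_reg,
        St.emit_arr, reduceCtorEq, if_true, if_false] at hv ⊢
      intro h1
      have hvR : v ≠ R := by
        rintro rfl; rw [update_self] at h1; exact h1 rfl
      rw [update_of_ne hvR] at h1 ⊢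
      by_cases hvo : v = o
      · have : k ≠ c := by
          intro e; rw [e] at k2; exact hvR (hvo.trans k2)
        rw [hvo, update_self]
        simp only [Nat.add_sub_cancel, update_self, and_true]
        omega
      · rw [update_of_ne hvo] at h1 ⊢
        obtain ⟨f1, f2⟩ := h.back v hv h1
        have f3 : s.arr .slot v - 1 ≠ c := by
          intro e; rw [e] at f2; exact hvo f2.symm
        have f4 : s.arr .slot v - 1 ≠ k := by
          intro e; rw [e] at f2; exact hvR (f2.symm.trans k2)
        rw [update_of_ne f4]
        exact ⟨by omega, f2⟩
    · intro i
      simp only [St.put_reg, St.put_arr, St.set_reg, St.set_arr, St.emit_reg,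
        St.emit_arr, reduceCtorEq, if_true, if_false, St.put_out, St.set_out, St.emit_out]
      intro hi
      by_cases hik : i = k
      · have e1 := hoR (by omega)
        rw [hik]
        simp only [update_self, update_of_ne e1]
        rw [update_of_ne (by omega), update_self]
        exact ⟨c1, by simp, by simp, by simp, c5⟩
      · obtain ⟨f1, f2, f3, f4, f5⟩ := h.fwd i (by omega)
        have g1 : s.arr .owner i ≠ R := by
          intro e; rw [e] at f2; omega
        have g2 : s.arr .owner i ≠ o := by
          intro e; rw [e] at f2; omega
        rw [update_of_ne hik, update_of_ne hik, update_of_ne g1, update_of_ne g2,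
          update_of_ne (by omega), update_of_ne (by omega), update_of_ne (by omega),
          update_of_ne (by omega)]
        exact ⟨f1, f2, f3, f4, f5⟩
    · intro v e hv
      simp only [Shown, St.put_reg, St.put_arr, St.set_reg, St.set_arr, St.emit_reg,
        St.emit_arr, reduceCtorEq, if_true, if_false]
      by_cases hvR : v = R
      · rw [hvR]; simp
      · simp only [update_of_ne hvR, ne_eq, hvR, not_false_eq_true, true_and]
        by_cases hvo : v = o
        · rw [hvo, update_self, c2]; simp
        · rw [update_of_ne hvo]
          refine and_congr_right fun h1 => ?_
          obtain ⟨f1, f2⟩ := h.back v hv h1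
          have f4 : s.arr .slot v - 1 ≠ k := by
            intro e; rw [e] at f2; exact hvR (f2.symm.trans k2)
          rw [update_of_ne f4]

theorem enlist_wp (h : Listing s word) (hf : s.Fits N word m) (hb : s.Bdd word)
    (hr : r ≠ .t ∧ r ≠ .u ∧ r ≠ .cnt) (hreal : Real (s.reg .nodes) (s.reg r))
    (h0 : s.arr .slot (s.reg r) = 0) (hp : s.arr .possum (s.reg r) < N)
    (hl : s.arr .len (s.reg r) < N)
    (hQ : ∀ s', s.Frame [.cnt, .t, .u] [.owner, .entry, .slot] s' → Listing s' word →
      (∀ v e, Real (s.reg .nodes) v → (Shown s' v e ↔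
        (v ≠ s.reg r ∧ Shown s v e) ∨ (v = s.reg r ∧ Due s v e))) → Q s') :
    (enlist r).wp N word Q s := by
  have hN := hf.nodes
  have hW := hf.word
  have hc := h.cnt_le
  have hr12 := hreal.2
  obtain ⟨hr1, hr2, hr3⟩ := hr
  simp only [enlist, HCmd.wp, HTest.Holds, HExpr.eval_arr, HExpr.eval_reg, HExpr.eval_ofNat,
    HExpr.eval_add, HExpr.eval_sub, St.put_reg, St.put_arr, St.set_reg, St.set_arr, St.emit_reg,
    St.emit_arr, reduceCtorEq, if_true, if_false, hr1, hr2, hr3]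
  set R := s.reg r with hR
  set c := s.reg .cnt with hcc
  constructor
  · intro hdue
    refine ⟨by omega, by omega, by omega, by omega, by omega, by omega, by omega, hb.reg _,
      by omega, by omega, by decide, by omega, ?_⟩
    refine hQ _ ?_ ⟨?_, ?_⟩ ?_
    · constructor
      · intro r' hr'
        simp only [List.mem_cons, List.not_mem_nil, or_false, not_or] at hr'
        simp [hr']
      · intro r' hr'
        simp only [List.mem_cons, List.not_mem_nil, or_false, not_or] at hr'
        simp [hr']
    · intro v hv
      simp only [St.put_reg, St.put_arr, St.set_reg, St.set_arr, St.emit_reg,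
        St.emit_arr, reduceCtorEq, if_true, if_false] at hv ⊢
      intro h1
      by_cases hvR : v = R
      · rw [hvR, update_self]; simp
      · rw [update_of_ne hvR] at h1 ⊢
        obtain ⟨f1, f2⟩ := h.back v hv h1
        rw [update_of_ne (by omega)]
        exact ⟨by omega, f2⟩
    · intro i
      simp only [St.put_reg, St.put_arr, St.set_reg, St.set_arr, St.emit_reg,
        St.emit_arr, reduceCtorEq, if_true, if_false, St.put_out, St.set_out, St.emit_out]
      intro hi
      by_cases hik : i = c
      · rw [hik]
        simp only [update_self]
        rw [update_of_ne (by omega), update_self]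
        exact ⟨hreal, by simp, by simp, by simp, by omega⟩
      · obtain ⟨f1, f2, f3, f4, f5⟩ := h.fwd i (by omega)
        have g1 : s.arr .owner i ≠ R := by
          intro e; rw [e] at f2; omega
        rw [update_of_ne hik, update_of_ne hik, update_of_ne g1,
          update_of_ne (by omega), update_of_ne (by omega), update_of_ne (by omega),
          update_of_ne (by omega)]
        exact ⟨f1, f2, f3, f4, f5⟩
    · intro v e hv
      simp only [Shown, Due, St.put_reg, St.put_arr, St.set_reg, St.set_arr, St.emit_reg,
        St.emit_arr, reduceCtorEq, if_true, if_false]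
      by_cases hvR : v = R
      · rw [hvR]
        simp only [update_self, ne_eq, Nat.add_one_ne_zero, not_false_eq_true, true_and,
          Nat.add_sub_cancel, not_true_eq_false, false_and, false_or, hdue.1]
        exact ⟨fun e => ⟨hdue.2, e.symm⟩, fun e => e.2.symm⟩
      · simp only [update_of_ne hvR, ne_eq, hvR, not_false_eq_true, true_and, false_and, or_false]
        refine and_congr_right fun h1 => ?_
        obtain ⟨f1, f2⟩ := h.back v hv h1
        rw [update_of_ne (by omega)]
  · intro hdue
    refine hQ s (.refl s) h fun v e hv => ?_
    by_cases hvR : v = R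
    · rw [hvR]
      simp [Shown, Due, h0, hdue]
    · simp [hvR]

theorem refresh_wp (h : Listing s word) (hf : s.Fits N word m) (hb : s.Bdd word)
    (hr : r ≠ .t ∧ r ≠ .u ∧ r ≠ .cnt)
    (hp : ∀ v, Real (s.reg .nodes) v → s.arr .possum v < N)
    (hl : ∀ v, Real (s.reg .nodes) v → s.arr .len v < N)
    (hQ : ∀ s', s.Frame [.cnt, .t, .u] [.owner, .entry, .slot] s' → s'.Bdd word →
      Listing s' word → (∀ v e, Real (s.reg .nodes) v → (Shown s' v e ↔
        (v ≠ s.reg r ∧ Shown s v e) ∨ (v = s.reg r ∧ Due s v e))) → Q s') :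
    (refresh r).wp N word Q s := by
  refine HCmd.wp_of_bdd hb ?_
  simp only [refresh, HCmd.wp, HTest.Holds, HExpr.eval_reg, HExpr.eval_ofNat]
  constructor
  · rintro ⟨h1, h2⟩
    have hreal : Real (s.reg .nodes) (s.reg r) := ⟨by omega, h2⟩
    refine HCmd.wp_of_bdd hb (unlist_wp h hf hb hr hreal fun s₁ f1 l1 sh1 hb1 => ?_)
    have hr1 : s₁.reg r = s.reg r := f1.reg r (by simp; tauto)
    have hn1 : s₁.reg .nodes = s.reg .nodes := f1.reg _ (by simp)
    have hdue : ∀ v e, Due s₁ v e ↔ Due s v e := by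
      intro v e
      rw [Due, Due, f1.arr .weight (by simp), f1.arr .len (by simp), f1.arr .inner (by simp),
        f1.arr .possum (by simp), f1.reg .base (by simp)]
    refine enlist_wp l1 ⟨by rw [f1.reg _ (by simp), hf.modulus], by
      rw [f1.reg _ (by simp)]; exact hf.word, by rw [hn1]; exact hf.nodes, hf.right⟩ hb1 hr
      (by rwa [hn1, hr1]) ?_ (by rw [hr1, f1.arr _ (by simp)]; exact hp _ hreal)
      (by rw [hr1, f1.arr _ (by simp)]; exact hl _ hreal) fun s₂ f2 l2 sh2 hb2 =>
        hQ s₂ (f1.comp f2) hb2 l2 fun v e hv => ?_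
    · by_contra h0
      have := (sh1 (s.reg r) _ hreal).1 ⟨by rwa [hr1] at h0, rfl⟩
      exact this.1 rfl
    · rw [sh2 v e (by rwa [hn1]), hr1, hdue, sh1 v e hv]
      tauto
  · intro h1
    intro _
    refine hQ s (.refl s) hb h fun v e hv => ?_
    have : v ≠ s.reg r := by
      rintro rfl
      exact h1 ⟨by have := hv.1; omega, hv.2⟩
    simp [this]

end

end SlidingMUPS

namespace SlidingMUPS
open Function

/-- The program does not write to the output array. -/
def HCmd.Silent : HCmd → Prop
  | .emit _ _ => False
  | .seq c₁ c₂ => c₁.Silent ∧ c₂.Silent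
  | .cond _ c₁ c₂ => c₁.Silent ∧ c₂.Silent
  | .loop _ c => c.Silent
  | _ => True

/-- This carries the correctness of the displayed list through the loops of `find`. -/
theorem HRun.out_eq {N word : ℕ} {c : HCmd} {s s' : St} {t : ℕ} (h : HRun N word c s t s')
    (hc : c.Silent) : s'.out = s.out := by
  induction h with
  | skip => rfl
  | assign => rfl
  | store => rfl
  | emit => exact hc.elim
  | seq _ _ ih₁ ih₂ => rw [ih₂ hc.2, ih₁ hc.1]
  | condTrue _ _ ih => exact ih hc.1
  | condFalse _ _ ih => exact ih hc.2
  | loopDone => rfl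
  | loopStep _ _ _ ih₁ ih₂ => rw [ih₂ hc, ih₁ hc]

theorem Ex.silent {N word : ℕ} {c : HCmd} {s : St} {Q : ℕ → St → Prop} (h : Ex N word c s Q)
    (hc : c.Silent) : Ex N word c s fun t s' => Q t s' ∧ s'.out = s.out :=
  let ⟨t, s', r, q⟩ := h
  ⟨t, s', r, q, r.out_eq hc⟩

/-! ### The node of the longest palindromic suffix -/

section
open Reg Arr

/-- From the node in `r`, follow the links to the first node that the letter extends. -/
def climb (r : Reg) : HCmd :=
  .loop (.neg (.conj (.neg (.lt Reg.right (left + len.at r)))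
    (.eq (buf.at (Reg.right - len.at r)) letter))) (.assign r (link.at r))

/-- A new node, with an empty dictionary. -/
def create : HCmd :=
  .assign p nodes ;; .store len p (len.at x + 2) ;; .store link p q ;; .store inner p x ;;
    .store weight p 0 ;; .store possum p 0 ;; .store chsum p 0 ;; .store slot p 0 ;;
    .store head p cells ;; .store key cells 0 ;; .store Arr.right cells 0 ;;
    .store down cells 0 ;; .assign cells (cells + 1) ;; .assign nodes (nodes + 1)

/-- Find the link of the new node around `x`. -/
def findLink : HCmd :=
  -- Around the imaginary root the new palindrome is a single letter, and its link is the empty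
  -- string.
  .cond (.eq (len.at x) 0) (.assign q 2)
    (.assign y (link.at x) ;; climb y ;; search y ;; .assign q (val.at t))

/-- Find or create the node of the longest palindromic suffix. -/
def find : HCmd :=
  -- The mark of a position is cleared when the position enters the window, so a rebuild need not
  -- clear the array. Keys are letters increased by one, since the key 0 ends the lists.
  .store buf Reg.right letter ;; .store mark Reg.right 0 ;; .assign v (letter + 1) ;;
    .assign x cur ;; climb x ;; search x ;;
    -- The entry is inserted before its node exists: `insertion` stores the value of `nodes`, which
    -- is the number that `create` gives to the new node.
    .cond (.eq (key.at t) v) (.assign p (val.at t)) (findLink ;; insertion x ;; create) ;;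
    .assign cur p ;; .assign Reg.right (Reg.right + 1)

end

/-- A step takes two units of time and makes the node shorter by at least one, so the lost length
pays for the climb. The links met on the way never get longer, which bounds the start of the second
climb in `findLink`. -/
theorem climb_spec {N word : ℕ} {s : St} {x st : ℕ → ℕ} {l m p₀ : ℕ} {r : Reg}
    (h : Tree x (s.arr .len) (s.arr .link) (s.arr .inner) st (s.reg .nodes) l m) (hlm : l ≤ m)
    (hl : s.reg .left = l) (hm : s.reg .right = m) (hx : s.reg .letter = x m)
    (hbuf : ∀ k ≤ m, s.arr .buf k = x k) (hr : r ≠ .d ∧ r ≠ .left ∧ r ≠ .right ∧ r ≠ .letter ∧ r ≠ .nodes)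
    (hb : s.Bdd word) (hc : Climb x (s.arr .len) st (s.reg .nodes) l m p₀ (s.reg r)) :
    Ex N word (climb r) s fun t s' => s.Frame [r] [] s' ∧
      Climb x (s.arr .len) st (s.reg .nodes) l m p₀ (s'.reg r) ∧
      (l + s.arr .len (s'.reg r) ≤ m ∧ x (m - s.arr .len (s'.reg r)) = x m) ∧
      s.arr .len (s.arr .link (s'.reg r)) ≤ s.arr .len (s.arr .link (s.reg r)) ∧
      t + 2 * s.arr .len (s'.reg r) ≤ 2 * s.arr .len (s.reg r) + 1 := by
  obtain ⟨r0, r1, r2, r3, r4⟩ := hr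
  have key : ∀ s', s.Frame [r] [] s' → ((HTest.neg (.conj (.neg (.lt Reg.right (Reg.left +
      Arr.len.at r))) (.eq (Arr.buf.at (Reg.right - Arr.len.at r)) Reg.letter))).Holds s' ↔
      ¬ (l + s.arr .len (s'.reg r) ≤ m ∧ x (m - s.arr .len (s'.reg r)) = x m)) := by
    intro s' hf
    simp only [HTest.Holds, HExpr.eval_arr, HExpr.eval_reg, HExpr.eval_add, HExpr.eval_sub]
    rw [hf.reg _ (by simpa using r2.symm), hf.reg .left (by simpa using r1.symm),
      hf.reg .letter (by simpa using r3.symm), hf.arr .buf (by simp), hf.arr .len (by simp), hl, hm, hx,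
      not_lt, hbuf _ (by omega)]
  refine (Ex.loop (I := fun n s' => s.Frame [r] [] s' ∧
    Climb x (s.arr .len) st (s.reg .nodes) l m p₀ (s'.reg r) ∧
    s.arr .len (s.arr .link (s'.reg r)) ≤ s.arr .len (s.arr .link (s.reg r)) ∧
    n = s.arr .len (s'.reg r))
    (n := s.arr .len (s.reg r)) (k := 1) ⟨.refl s, hc, le_rfl, rfl⟩ ?_).mono ?_
  · rintro n s' ⟨hf, hcl, hlk2, rfl⟩ ht
    rw [key s' hf] at ht
    obtain ⟨c1, c2⟩ := hcl.step h hlm ht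
    have hlk : s'.arr .link = s.arr .link := hf.arr _ (by simp)
    refine ⟨1, _, .assign s' r _ r0 ?_, le_rfl, s.arr .len (s.arr .link (s'.reg r)), c2, ?_⟩
    · simp only [HExpr.eval_arr, HExpr.eval_reg, hlk]; exact hb.arr _ _
    · simp only [HExpr.eval_arr, HExpr.eval_reg, hlk]
      refine ⟨hf.set (by simp) _, by simpa using c1, ?_, by simp⟩
      simp only [St.set_reg, if_true]
      obtain ⟨d1, d2⟩ := h.link_pos hcl.pos hcl.lt
      exact (h.len_link_le d1 d2).trans hlk2
  · rintro t s' ⟨n', hn', ⟨hf, hcl, hlk2, rfl⟩, ht, htime⟩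
    rw [key s' hf, not_not] at ht
    exact ⟨hf, hcl, ht, hlk2, by omega⟩

/-- The text structures of a state: `x` is the text, and the window is `l, …, m - 1`. -/
structure Core (s : St) (x st lv ow : ℕ → ℕ) (l m : ℕ) : Prop where
  left : s.reg .left = l
  right : s.reg .right = m
  le : l ≤ m
  buf : ∀ k < m, s.arr .buf k = x k
  len0 : s.arr .len 0 = 0
  tree : Tree x (s.arr .len) (s.arr .link) (s.arr .inner) st (s.reg .nodes) l m
  fits : ∀ v, Real (s.reg .nodes) v → st v + s.arr .len v ≤ m + 1
  dict : Dict s lv ow (s.reg .nodes)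
  entry : ∀ o k u, s.Entry lv ow o k u ↔
    Real (s.reg .nodes) u ∧ s.arr .inner u = o ∧ k = x (st u) + 1
  ground : (ground lv (s.reg .cells)).card + 4 = 2 * s.reg .nodes
  nodes_le : s.reg .nodes ≤ m + 3
  cur_nd : 2 ≤ s.reg .cur ∧ s.reg .cur < s.reg .nodes
  cur_le : l + s.arr .len (s.reg .cur) ≤ m + 1
  cur_at : At x (s.arr .len) st (s.reg .cur) (m + 1 - s.arr .len (s.reg .cur))
  cur_max : ∀ q, l ≤ q → q < m → Pal x q m → m + 1 ≤ q + s.arr .len (s.reg .cur)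

/-- The ground keys of a dictionary are 0 and distinct letters increased by one, so there are at
most `D + 1` of them, and `Skip.pow_le_card` bounds the height. -/
theorem Core.height {s : St} {x st lv ow : ℕ → ℕ} {l m o D : ℕ} (h : Core s x st lv ow l m)
    (hD : ((Finset.range m).image x).card ≤ D) (ho : 0 < o) (hn : o < s.reg .nodes) :
    lv (s.arr .head o) ≤ Nat.log 2 (D + 1) := by
  have ht := h.dict.top o ho hn
  have h1 := h.dict.skip.pow_le_card ht.nd
  refine Nat.le_log_of_pow_le (by norm_num) (h1.trans ?_)
  rw [ht.own]
  have h2 : (level lv ow (s.reg .cells) o 0).card ≤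
      (insert 0 (((Finset.range m).image x).image (· + 1))).card := by
    refine Finset.card_le_card_of_injOn (s.arr .key) ?_ ?_
    · intro p hp
      obtain ⟨p1, p2, p3⟩ := mem_level.1 hp
      rw [Finset.mem_coe, Finset.mem_insert]
      by_cases e : s.arr .key p = 0
      · exact Or.inl e
      · obtain ⟨e1, e2, e3⟩ := (h.entry o (s.arr .key p) (s.arr .val p)).1 ⟨p, p1, p2, p3, rfl, e, rfl⟩
        have := h.fits _ e1
        have := h.tree.two_le_len _ e1
        refine Or.inr (Finset.mem_image.2 ⟨x (st (s.arr .val p)), Finset.mem_image.2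
          ⟨st (s.arr .val p), by rw [Finset.mem_range]; omega, rfl⟩, e3.symm⟩)
    · intro p hp q hq e
      obtain ⟨p1, p2, p3⟩ := mem_level.1 hp
      obtain ⟨q1, q2, q3⟩ := mem_level.1 hq
      exact h.dict.skip.inj p q p1 q1 (by omega) (by omega) e
  have h3 := Finset.card_insert_le 0 (((Finset.range m).image x).image (· + 1))
  have h4 : (((Finset.range m).image x).image (· + 1)).card ≤ ((Finset.range m).image x).card :=
    Finset.card_image_le
  omega

/-- The conditions on a dictionary that the search for a child needs. -/
structure Children (s : St) (x st lv ow : ℕ → ℕ) (H : ℕ) : Prop where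
  dict : Dict s lv ow (s.reg .nodes)
  entry : ∀ o k u, s.Entry lv ow o k u ↔
    Real (s.reg .nodes) u ∧ s.arr .inner u = o ∧ k = x (st u) + 1
  height : ∀ o, 0 < o → o < s.reg .nodes → lv (s.arr .head o) ≤ H

theorem Children.frame {s s' : St} {x st lv ow : ℕ → ℕ} {H : ℕ} (h : Children s x st lv ow H)
    (h1 : ∀ a ∈ [Arr.key, .right, .down, .val, .head, .inner], s'.arr a = s.arr a)
    (h2 : s'.reg .cells = s.reg .cells) (h3 : s'.reg .nodes = s.reg .nodes) :
    Children s' x st lv ow H := by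
  simp only [List.forall_mem_cons] at h1
  obtain ⟨a1, a2, a3, a4, a5, a6, -⟩ := h1
  refine ⟨⟨?_, ?_, ?_, ?_⟩, ?_, ?_⟩
  · rw [St.Skip, a1, a2, a3, h2]; exact h.dict.skip
  · rw [h2]; exact h.dict.pos
  · rw [a1, h2, a5, h3]; exact h.dict.top
  · rw [h2, h3]; exact h.dict.own
  · intro o k u
    rw [St.Entry, a1, a4, h2, h3, a6]; exact h.entry o k u
  · rw [h3, a5]; exact h.height

theorem Children.search {N word : ℕ} {s : St} {x st lv ow : ℕ → ℕ} {H : ℕ}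
    (h : Children s x st lv ow H) (hb : s.Bdd word) {r : Reg} (ho : 0 < s.reg r)
    (hn : s.reg r < s.reg .nodes) (hv : 0 < s.reg .v) :
    Ex N word (search r) s fun n s' => n ≤ 16 * H + 2 ∧ s.Frame [.t] [] s' ∧
      (s.arr .key (s'.reg .t) = s.reg .v → Real (s.reg .nodes) (s.arr .val (s'.reg .t)) ∧
        s.arr .inner (s.arr .val (s'.reg .t)) = s.reg r ∧
        s.reg .v = x (st (s.arr .val (s'.reg .t))) + 1) ∧
      ∀ u, Real (s.reg .nodes) u → s.arr .inner u = s.reg r → s.reg .v = x (st u) + 1 →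
        s.arr .key (s'.reg .t) = s.reg .v ∧ s.arr .val (s'.reg .t) = u := by
  refine (search_spec h.dict.skip (hb.reg _).le (h.dict.top _ ho hn)).mono ?_
  rintro n s' ⟨h1, h2, h3, h4, h5, h6⟩
  have := h.height _ ho hn
  refine ⟨by omega, h2, fun e => (h.entry _ _ _).1 ⟨_, h3, h4, h5, e, hv.ne', rfl⟩, ?_⟩
  intro u hu hi hk
  obtain ⟨p, p1, p2, p3, p4, p5, p6⟩ := (h.entry (s.reg r) (s.reg .v) u).2 ⟨hu, hi, hk⟩
  have e : s.arr .key (s'.reg .t) = s.reg .v := by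
    by_contra hne
    have := h6.1
    have := h6.2 p p1 (by omega) (by omega) (by omega)
    omega
  have := h.dict.skip.inj _ _ h3 p1 (by omega) (by omega) (e.trans p4.symm)
  rw [this]
  exact ⟨p4, p6⟩

end SlidingMUPS

/-! ### The link of a new node, and its creation -/

namespace SlidingMUPS
open Function

/-- As a palindromic suffix of the new palindrome, the link also begins it, so it occurs without the
new letter and has a node already. The climb finds its interior, and the search among the children
of that interior cannot fail. -/
theorem findLink_spec {N word : ℕ} {s : St} {x st lv ow : ℕ → ℕ} {l m p H : ℕ}
    (h : Tree x (s.arr .len) (s.arr .link) (s.arr .inner) st (s.reg .nodes) l m)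
    (hch : Children s x st lv ow H) (hl : s.reg .left = l) (hm : s.reg .right = m)
    (hx : s.reg .letter = x m) (hbuf : ∀ k ≤ m, s.arr .buf k = x k) (hv : s.reg .v = x m + 1)
    (hb : s.Bdd word) (hw : 2 < word) (hlp : l ≤ p) (hlen : p + s.arr .len (s.reg .x) = m)
    (hX0 : 0 < s.reg .x) (hX : s.reg .x < s.reg .nodes) (hpal : Pal x p (m + 1))
    (hat : At x (s.arr .len) st (s.reg .x) (p + 1)) :
    Ex N word findLink s fun t s' => s.Frame [.t, .y, .q] [] s' ∧
      2 ≤ s'.reg .q ∧ s'.reg .q < s.reg .nodes ∧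
      s.arr .len (s'.reg .q) < s.arr .len (s.reg .x) + 2 ∧
      At x (s.arr .len) st (s'.reg .q) (m + 2 - s.arr .len (s'.reg .q)) ∧
      (∀ q, p < q → q ≤ m → Pal x q (m + 1) → m + 2 ≤ q + s.arr .len (s'.reg .q)) ∧
      t + 2 * s.arr .len (s'.reg .q) ≤
        2 * s.arr .len (s.arr .link (s.reg .x)) + 16 * H + 20 := by
  have hn3 := h.three_le
  have h1 := h.len_one
  have h2 := h.len_two
  refine Ex.cond (fun hc => ?_) (fun hc => ?_) <;>
    simp only [HTest.Holds, HExpr.eval_arr, HExpr.eval_reg, HExpr.eval_ofNat] at hc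
  · refine ⟨1, _, .assign s .q _ (by decide) (by simpa using hw), (St.Frame.refl s).set (by simp) _, ?_⟩
    simp only [HExpr.eval_ofNat, St.set_reg, if_true, h2, hc]
    refine ⟨le_rfl, by omega, by omega, ?_, fun q _ _ _ => by omega, by omega⟩
    intro k hk
    rw [h2] at hk
    omega
  · obtain ⟨d1, d2⟩ := h.link_pos hX0 hX
    refine Ex.seq ⟨1, _, .assign s .y _ (by decide) (by simpa using hb.arr _ _), ?_⟩
    simp only [HExpr.eval_arr, HExpr.eval_reg]
    -- Candidates for the link begin after `p`, so this climb works with the bound `p + 1` in place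
    -- of the left end of the window.
    have hcl : Climb x (s.arr .len) st (s.reg .nodes) l m (p + 1) (s.arr .link (s.reg .x)) := by
      rcases h.real_or hX0 hX with e | e | hr
      · rw [e, h1] at hc; omega
      · rw [e, h2] at hlen
        rw [e, h.link_two]
        refine ⟨one_pos, by omega, by omega, by omega, by omega, ?_, fun q _ _ _ => by omega⟩
        intro k hk
        rw [h1] at hk
        omega
      · have e1 := h.len_link _ hr
        have e2 := h.link_at' hr hat
        rw [show p + 1 + s.arr .len (s.reg .x) = m + 1 by omega] at e2
        refine ⟨d1, d2, by omega, by omega, by omega, e2, fun q hq1 hq2 hq3 => ?_⟩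
        by_cases hq : q + 1 < m
        · have e3 := hq3.shrink 1 (by omega)
          have e4 := h.len_link_ge hr hat (q := q + 1) (by omega) (by omega) (by
            rwa [show p + 1 + (s.arr .len (s.reg .x) - 1) = m + 1 - 1 by omega])
          omega
        · have e3 := h.link_lt _ hr
          rcases h.real_or d1 d2 with e | e | e
          · omega
          · rw [e, h2]; omega
          · have := h.two_le_len _ e
            omega
    refine Ex.seq ((climb_spec (s := s.set .y (s.arr .link (s.reg .x))) (p₀ := p + 1) (r := .y) h
      (by omega) (by simpa using hl) (by simpa using hm) (by simpa using hx) hbuf (by decide)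
      ⟨fun r => by rw [St.set_reg]; split_ifs; exacts [hb.arr _ _, hb.reg _], hb.arr⟩
      (by simpa using hcl)).mono ?_)
    rintro t₁ s₁ ⟨f1, c1, c2, -, c4⟩
    simp only [St.set_reg, St.set_arr, if_true] at c1 c2 c4
    have hf1 : s.Frame [.t, .y, .q] [] s₁ :=
      ((St.Frame.refl s).set (r := .y) (by simp) _).comp (f1.mono (by simp) (by simp))
    have hnn : s₁.reg .nodes = s.reg .nodes := hf1.reg _ (by simp)
    have hbd1 : s₁.Bdd word := ⟨fun r => by
      by_cases e : r = .y
      · rw [e]; exact c1.lt.trans (by simpa using hb.reg .nodes)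
      · rw [f1.reg r (by simpa using e), St.set_reg, if_neg e]; exact hb.reg _,
      fun a i => by rw [f1.arr a (by simp)]; exact hb.arr _ _⟩
    have hch1 : Children s₁ x st lv ow H := hch.frame
      (fun a _ => hf1.arr a (by simp)) (hf1.reg _ (by simp)) hnn
    have hy0 := c1.pos
    have hyn : s₁.reg .y < s₁.reg .nodes := by rw [hnn]; simpa using c1.lt
    obtain ⟨g1, g2, g3⟩ := c1.done (by simpa using h) c2
    refine Ex.seq ((hch1.search (r := .y) hbd1 hy0 hyn (by rw [hf1.reg _ (by simp), hv]; omega)).mono ?_)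
    rintro t₂ s₂ ⟨b1, f2, -, b3⟩
    have hf2 : s.Frame [.t, .y, .q] [] s₂ := hf1.comp (f2.mono (by simp) (by simp))
    set Y := s₁.reg .y with hY
    -- The palindrome around `Y` is mirrored to the start of the new palindrome, where completeness
    -- of the old tree applies.
    have r1 := hpal.reflect (c := m - s.arr .len Y) (by omega) (by omega) le_rfl g2
    have r2 := hpal.reflect_pal (c := m - s.arr .len Y) (by omega) (by omega) le_rfl g2
    obtain ⟨u, u1, u2, u3⟩ := h.complete _ _ (by omega) (by omega) (by omega) r2
    have u4 : At x (s.arr .len) st u (m - s.arr .len Y) := by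
      refine u3.trans ?_
      rw [u2]
      convert r1.symm using 1
      omega
    have u5 : s.arr .len u = s.arr .len Y + 2 := by omega
    have u6 := h.inner_eq u1 u4 hy0 (by rwa [← hnn]) g3 u5.symm
    have u7 : x (st u) = x m := by
      have := u4 0 (by omega)
      rw [Nat.add_zero, Nat.add_zero] at this
      rw [this, c2.2]
    obtain ⟨w1, w2⟩ := b3 u (by rwa [hnn]) (by rw [hf1.arr _ (by simp), u6])
      (by rw [hf1.reg _ (by simp), hv, u7])
    rw [hf1.arr .val (by simp)] at w2
    refine ⟨1, _, .assign s₂ .q _ (by decide) ?_, hf2.set (by simp) _, ?_⟩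
    · simp only [HExpr.eval_arr, HExpr.eval_reg, hf2.arr .val (by simp)]; exact hb.arr _ _
    simp only [HExpr.eval_arr, HExpr.eval_reg, hf2.arr .val (by simp), St.set_reg, if_true, w2]
    refine ⟨by have := u1.1; omega, u1.2, by omega, ?_, ?_, by omega⟩
    · rwa [show m + 2 - s.arr .len u = m - s.arr .len Y by omega]
    · intro q hq1 hq2 hq3
      have := c1.max q (by omega) hq2 hq3
      omega

theorem create_wp {N word : ℕ} {s : St} {Q : St → Prop} (hN : s.reg .nodes < N)
    (hc : s.reg .cells < N) (hw : N < word) (hb : s.Bdd word)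
    (hl : s.arr .len (s.reg .x) + 2 < word)
    (hQ : ∀ s', s.Frame [.p, .cells, .nodes]
      [.len, .link, .inner, .weight, .possum, .chsum, .slot, .head, .key, .right, .down] s' →
      s'.arr .len = update (s.arr .len) (s.reg .nodes) (s.arr .len (s.reg .x) + 2) →
      s'.arr .link = update (s.arr .link) (s.reg .nodes) (s.reg .q) →
      s'.arr .inner = update (s.arr .inner) (s.reg .nodes) (s.reg .x) →
      s'.arr .weight = update (s.arr .weight) (s.reg .nodes) 0 →
      s'.arr .possum = update (s.arr .possum) (s.reg .nodes) 0 →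
      s'.arr .chsum = update (s.arr .chsum) (s.reg .nodes) 0 →
      s'.arr .slot = update (s.arr .slot) (s.reg .nodes) 0 →
      s'.arr .head = update (s.arr .head) (s.reg .nodes) (s.reg .cells) →
      s'.arr .key = update (s.arr .key) (s.reg .cells) 0 →
      s'.arr .right = update (s.arr .right) (s.reg .cells) 0 →
      s'.arr .down = update (s.arr .down) (s.reg .cells) 0 →
      s'.reg .p = s.reg .nodes → s'.reg .cells = s.reg .cells + 1 →
      s'.reg .nodes = s.reg .nodes + 1 → Q s') : create.wp N word Q s := by
  simp only [create, HCmd.wp, HExpr.eval_reg, HExpr.eval_arr, HExpr.eval_add, HExpr.eval_ofNat,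
    St.set_reg, St.set_arr, St.put_reg, St.put_arr, reduceCtorEq, if_true, if_false, ne_eq,
    not_false_eq_true, true_and]
  refine ⟨hb.reg _, hN, hl, hN, hb.reg _, hN, hb.reg _, hN, by omega, hN, by omega, hN, by omega,
    hN, by omega, hN, hb.reg _, hc, by omega, hc, by omega, hc, by omega, by omega, by omega, ?_⟩
  refine hQ _ ⟨?_, ?_⟩ ?_ ?_ ?_ ?_ ?_ ?_ ?_ ?_ ?_ ?_ ?_ ?_ ?_ ?_
  · intro r' hr'
    simp only [List.mem_cons, List.not_mem_nil, or_false, not_or] at hr'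
    simp [hr']
  · intro r' hr'
    simp only [List.mem_cons, List.not_mem_nil, or_false, not_or] at hr'
    simp [hr']
  all_goals simp

/-- An empty dictionary is a single ground node with the key 0, which is the case `l = 0` of
`Skip.sentinel`. -/
theorem Dict.add_owner {s s' : St} {lv ow : ℕ → ℕ} {nn : ℕ} (h : Dict s lv ow nn) (hn : 0 < nn)
    (h1 : s'.arr .head = update (s.arr .head) nn (s.reg .cells))
    (h2 : s'.arr .key = update (s.arr .key) (s.reg .cells) 0)
    (h3 : s'.arr .right = update (s.arr .right) (s.reg .cells) 0)
    (h4 : s'.arr .down = update (s.arr .down) (s.reg .cells) 0)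
    (h5 : s'.reg .cells = s.reg .cells + 1) (h6 : s'.arr .val = s.arr .val) :
    Dict s' (update lv (s.reg .cells) 0) (update ow (s.reg .cells) nn) (nn + 1) ∧
      (∀ o k u, s'.Entry (update lv (s.reg .cells) 0) (update ow (s.reg .cells) nn) o k u ↔
        s.Entry lv ow o k u) ∧
      (ground (update lv (s.reg .cells) 0) (s'.reg .cells)).card =
        (ground lv (s.reg .cells)).card + 1 := by
  have hal := h.pos
  have hne : ∀ p, Nd (s.reg .cells) p → p ≠ s.reg .cells := by
    rintro p hp rfl; exact absurd hp.2 (lt_irrefl _)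
  refine ⟨⟨?_, by omega, ?_, ?_⟩, ?_, ?_⟩
  · rw [St.Skip, h2, h3, h4, h5]
    refine h.skip.sentinel hal (fun q hq e => ?_) (fun _ => rfl) (fun e => absurd rfl e)
    have := (h.own q hq).2
    omega
  · intro o ho hn
    rw [h2, h5, h1]
    by_cases e : o = nn
    · subst e
      rw [update_self]
      refine ⟨⟨hal, by omega⟩, by rw [update_self], by rw [update_self], ?_, ?_⟩
      · intro q hq e
        rcases (nd_succ hal).1 hq with hq | rfl
        · rw [update_of_ne (hne q hq)] at e
          have := (h.own q hq).2
          omega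
        · exact le_rfl
      · intro q hq e _
        rcases (nd_succ hal).1 hq with hq | rfl
        · rw [update_of_ne (hne q hq)] at e
          have := (h.own q hq).2
          omega
        · rfl
    · rw [update_of_ne e]
      have ht := h.top o ho (by omega)
      have hcne := hne _ ht.nd
      refine ⟨ht.nd.mono (by omega), by rw [update_of_ne hcne, ht.own],
        by rw [update_of_ne hcne, ht.key], ?_, ?_⟩
      · intro q hq e2
        rcases (nd_succ hal).1 hq with hq | rfl
        · rw [update_of_ne (hne q hq)] at e2
          rw [update_of_ne (hne q hq), update_of_ne hcne]
          exact ht.le q hq e2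
        · rw [update_self] at e2
          exact absurd e2.symm e
      · intro q hq e2 e3
        rcases (nd_succ hal).1 hq with hq | rfl
        · rw [update_of_ne (hne q hq)] at e2
          rw [update_of_ne (hne q hq), update_of_ne hcne] at e3
          exact ht.eq q hq e2 e3
        · rw [update_self] at e2
          exact absurd e2.symm e
  · intro p hp
    rw [h5] at hp
    rcases (nd_succ hal).1 hp with hp | rfl
    · rw [update_of_ne (hne p hp)]
      have := h.own p hp
      omega
    · rw [update_self]
      omega
  · intro o k u
    rw [St.Entry, h2, h5, h6]
    constructor
    · rintro ⟨p, p1, p2, p3, p4, p5, p6⟩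
      rcases (nd_succ hal).1 p1 with hp | rfl
      · rw [update_of_ne (hne p hp)] at p2 p3 p4
        exact ⟨p, hp, p2, p3, p4, p5, p6⟩
      · rw [update_self] at p4
        omega
    · rintro ⟨p, p1, p2, p3, p4, p5, p6⟩
      refine ⟨p, p1.mono (by omega), ?_, ?_, ?_, p5, p6⟩ <;> rwa [update_of_ne (hne p p1)]
  · rw [h5, card_ground_succ hal, if_pos rfl]

end SlidingMUPS

/-! ### The complete search for the longest palindromic suffix -/

namespace SlidingMUPS
open Function

/-- At most one node was added, and the other nodes are the same. -/
structure Grown (s s' : St) : Prop where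
  same : ∀ a ∈ [Arr.len, .link, .inner, .weight, .possum, .chsum, .slot],
    ∀ v, v < s.reg .nodes → s'.arr a v = s.arr a v
  new : s'.reg .nodes = s.reg .nodes ∨ s'.reg .nodes = s.reg .nodes + 1 ∧
    ∀ a ∈ [Arr.weight, .possum, .chsum, .slot], s'.arr a (s.reg .nodes) = 0

/-- A palindrome is determined by its interior and its end letter; this translates between a hit in
the dictionary of `X` and an occurrence at `p`. -/
theorem Core.child {s : St} {x st lv ow : ℕ → ℕ} {l m p X u : ℕ} (h : Core s x st lv ow l m)
    (hX : 0 < X ∧ X < s.reg .nodes) (hpal : Pal x p (m + 1)) (hlen : p + s.arr .len X = m)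
    (hat : At x (s.arr .len) st X (p + 1)) (hx : x p = x m) :
    (Real (s.reg .nodes) u ∧ s.arr .len u = s.arr .len X + 2 ∧ At x (s.arr .len) st u p) ↔
    Real (s.reg .nodes) u ∧ s.arr .inner u = X ∧ x m + 1 = x (st u) + 1 := by
  constructor
  · rintro ⟨h1, h2, h3⟩
    refine ⟨h1, h.tree.inner_eq h1 h3 hX.1 hX.2 hat h2.symm, ?_⟩
    have := h3 0 (by omega)
    rw [Nat.add_zero, Nat.add_zero] at this
    omega
  · rintro ⟨h1, h2, h3⟩
    have h4 := h.tree.len_inner u h1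
    rw [h2] at h4
    refine ⟨h1, h4.symm, h.tree.at_of_inner h1 (by rwa [h2]) (by omega) ?_⟩
    rwa [show p + (s.arr .len u - 1) = m + 1 by omega]

/-- The effect of the search for the longest palindromic suffix. -/
structure Found (s s' : St) (x st st' lv' ow' : ℕ → ℕ) (l m a : ℕ) : Prop where
  core : Core s' x st' lv' ow' l (m + 1)
  suffix : IsSuffix x (s'.arr .len) st' (s'.reg .nodes) l m (s'.reg .p) a
  same : ∀ v, v < s.reg .nodes → st' v = st v
  grown : Grown s s'
  mark : s'.arr .mark = update (s.arr .mark) m 0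
  buf : s'.arr .buf = update (s.arr .buf) m (x m)
  fresh : ∀ v, Real (s'.reg .nodes) v → ¬ Real (s.reg .nodes) v →
    occ x (s'.arr .len) st' l m v = ∅
  frame : s.Frame [.right, .cur, .nodes, .cells, .x, .y, .t, .v, .p, .q]
    [.buf, .len, .link, .inner, .head, .weight, .possum, .chsum, .slot, .mark, .key, .right, .down,
      .val] s'

-- The climbs are paid for by the lengths of the current suffix and of its link, up to a constant
-- increase. The logarithmic part consists of two searches of `16 * H` and one insertion of `48 *
-- H`.
set_option maxHeartbeats 800000 in
theorem find_spec {N word : ℕ} {s : St} {x st lv ow : ℕ → ℕ} {l m H : ℕ}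
    (h : Core s x st lv ow l m) (hH : ∀ o, 0 < o → o < s.reg .nodes → lv (s.arr .head o) ≤ H)
    (hx : s.reg .letter = x m) (hxw : x m + 1 < word) (hb : s.Bdd word) (hf : s.Fits N word m) :
    Ex N word find s fun t s' => (∃ st' lv' ow' a, Found s s' x st st' lv' ow' l m a) ∧
      t + 2 * (s'.arr .len (s'.reg .cur) + s'.arr .len (s'.arr .link (s'.reg .cur))) ≤
      2 * (s.arr .len (s.reg .cur) + s.arr .len (s.arr .link (s.reg .cur))) + 80 * H + 100 := by
  have hN := hf.nodes
  have hW := hf.word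
  have hR := hf.right
  have htr := h.tree
  have hmr := h.right
  have hle := h.le
  refine Ex.seq ⟨1, _, .store s .buf _ _ (by simp; omega) (by simpa using hb.reg _), ?_⟩
  refine Ex.seq ⟨1, _, .store _ .mark _ _ (by simp; omega) (by simp; omega), ?_⟩
  refine Ex.seq ⟨1, _, .assign _ .v _ (by decide) (by simp; omega), ?_⟩
  refine Ex.seq ⟨1, _, .assign _ .x _ (by decide) (by simpa using hb.reg _), ?_⟩
  simp only [HExpr.eval_arr, HExpr.eval_reg, HExpr.eval_add, HExpr.eval_ofNat, St.put_reg,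
    St.set_reg, reduceCtorEq, if_false, hmr, hx]
  set s₀ : St := (((s.put .buf m (x m)).put .mark m 0).set .v (x m + 1)).set .x (s.reg .cur) with hs₀
  have f0 : s.Frame [.v, .x] [.buf, .mark] s₀ :=
    ((((St.Frame.refl s).put (by simp) _ _).put (by simp) _ _).set (by simp) _).set (by simp) _
  have hv0 : s₀.reg .v = x m + 1 := by simp [hs₀]
  have hx0 : s₀.reg .x = s.reg .cur := by simp [hs₀]
  have hmk0 : s₀.arr .mark = update (s.arr .mark) m 0 := by simp [hs₀]
  have hbu0 : s₀.arr .buf = update (s.arr .buf) m (x m) := by simp [hs₀]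
  have hbf0 : ∀ k ≤ m, s₀.arr .buf k = x k := by
    intro k hk
    simp only [hs₀, St.set_arr, St.put_arr, reduceCtorEq, if_false, if_true]
    rcases Nat.eq_or_lt_of_le hk with rfl | hk
    · rw [update_self]
    · rw [update_of_ne hk.ne, h.buf k hk]
  have hb0 : s₀.Bdd word := by
    constructor
    · intro r
      simp only [hs₀, St.set_reg, St.put_reg]
      split_ifs
      · exact hb.reg _
      · exact hxw
      · exact hb.reg _
    · intro a i
      simp only [hs₀, St.set_arr, St.put_arr, reduceCtorEq, if_false]
      split_ifs
      · rw [update_apply]; split_ifs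
        · omega
        · exact hb.arr _ _
      · rw [update_apply]; split_ifs
        · omega
        · exact hb.arr _ _
      · exact hb.arr _ _
  have hl0 : s₀.arr .len = s.arr .len := f0.arr _ (by simp)
  have hk0 : s₀.arr .link = s.arr .link := f0.arr _ (by simp)
  have hi0 : s₀.arr .inner = s.arr .inner := f0.arr _ (by simp)
  have hn0 : s₀.reg .nodes = s.reg .nodes := f0.reg _ (by simp)
  have hch0 : Children s₀ x st lv ow H := Children.frame ⟨h.dict, h.entry, hH⟩
    (fun a ha => f0.arr a (by
      simp only [List.mem_cons, List.not_mem_nil, or_false] at ha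
      rcases ha with rfl | rfl | rfl | rfl | rfl | rfl <;> simp)) (f0.reg _ (by simp)) hn0
  have hcl : Climb x (s₀.arr .len) st (s₀.reg .nodes) l m l (s₀.reg .x) := by
    rw [hl0, hn0, hx0]
    have hc := h.cur_le
    refine ⟨by have := h.cur_nd; omega, h.cur_nd.2, le_rfl, hc, Or.inl rfl, h.cur_at, ?_⟩
    intro q h1 h2 h3
    have hc1 : 1 ≤ s.arr .len (s.reg .cur) := by
      rcases htr.real_or (by have := h.cur_nd.1; omega) h.cur_nd.2 with e | e | e
      · have := h.cur_nd.1; omega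
      · rw [e, htr.len_two]
      · have := htr.two_le_len _ e; omega
    -- A palindromic suffix of three or more letters surrounds one of the old window, whose length
    -- `cur_max` bounds; the shorter ones need only `hc1`.
    by_cases hq : q + 1 < m
    · have h4 := h3.shrink 1 (by omega)
      have := h.cur_max (q + 1) (by omega) hq h4
      omega
    · omega
  have htr0 : Tree x (s₀.arr .len) (s₀.arr .link) (s₀.arr .inner) st (s₀.reg .nodes) l m := by
    rw [hl0, hk0, hi0, hn0]; exact htr
  refine Ex.seq ((climb_spec (r := .x) htr0 hle ((f0.reg _ (by simp)).trans h.left)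
    ((f0.reg _ (by simp)).trans hmr) ((f0.reg _ (by simp)).trans hx) hbf0 (by decide) hb0
    hcl).bdd hb0 |>.mono ?_)
  rintro t₁ s₁ ⟨⟨f1, c1, c2, c3, c4⟩, hb1⟩
  have hc1 := c1.done htr0 c2
  rw [hl0, hn0] at c1
  rw [hl0] at c2 c3 c4 hc1
  rw [hk0, hx0] at c3
  rw [hx0] at c4
  obtain ⟨g1, g2, g3⟩ := hc1
  have f1' : s₀.Frame [.x, .t] [] s₁ := f1.mono (by simp) (by simp)
  have hn1 : s₁.reg .nodes = s.reg .nodes := by rw [f1.reg _ (by simp), hn0]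
  have hch1 : Children s₁ x st lv ow H := hch0.frame (fun a _ => f1.arr a (by simp))
    (f1.reg _ (by simp)) (f1.reg _ (by simp))
  have hv1 : s₁.reg .v = x m + 1 := by rw [f1.reg _ (by simp), hv0]
  refine Ex.seq ((hch1.search (r := .x) hb1 c1.pos (by rw [hn1]; exact c1.lt)
    (by omega)).bdd hb1 |>.mono ?_)
  rintro t₂ s₂ ⟨⟨ht₂, f2, d1, d2⟩, hb2⟩
  have f02 : s₀.Frame [.x, .t] [] s₂ := f1'.comp (f2.mono (by simp) (by simp))
  have hx2 : s₂.reg .x = s₁.reg .x := f2.reg _ (by simp)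
  set X := s₁.reg .x with hX
  set p := m - s.arr .len X with hp
  have hXlen : p + s.arr .len X = m := by omega
  have hA1 : ∀ a, s₁.arr a = s₀.arr a := fun a => f1.arr a (by simp)
  have hA2 : ∀ a, s₂.arr a = s₀.arr a := fun a => f02.arr a (by simp)
  have hn2 : s₂.reg .nodes = s.reg .nodes := by rw [f02.reg _ (by simp), hn0]
  have hv2 : s₂.reg .v = x m + 1 := by rw [f02.reg _ (by simp), hv0]
  rw [hA1 .key, hA1 .val, hA1 .inner, hi0, hn1, hv1] at d1
  rw [hA1 .key, hA1 .val, hA1 .inner, hi0, hn1, hv1] at d2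
  have hmax : ∀ q, l ≤ q → q ≤ m → Pal x q (m + 1) → p ≤ q := by
    intro q h1 h2 h3
    have := c1.max q h1 h2 h3
    omega
  have hmid : ∀ s₃ t₃ P, HRun N word (.cond (.eq (Arr.key.at Reg.t) Reg.v)
      (.assign .p (Arr.val.at Reg.t)) (findLink ;; insertion .x ;; create)) s₂ t₃ s₃ →
      s₃.reg .p = P → s₃.reg .right = m →
      (∃ st' lv' ow' a, Found s ((s₃.set .cur P).set .right (m + 1)) x st st' lv' ow' l m a) →
      t₃ + 2 * (s₃.arr .len P + s₃.arr .len (s₃.arr .link P)) ≤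
        2 * s.arr .len X + 2 * s.arr .len (s.arr .link X) + 64 * H + 80 →
      P < word →
      Ex N word (.cond (.eq (Arr.key.at Reg.t) Reg.v) (.assign .p (Arr.val.at Reg.t))
        (findLink ;; insertion .x ;; create) ;; .assign .cur Reg.p ;;
        .assign Reg.right (Reg.right + 1)) s₂ fun t s' =>
        (∃ st' lv' ow' a, Found s s' x st st' lv' ow' l m a) ∧
        (1 + (1 + (1 + (1 + (t₁ + (t₂ + t)))))) +
        2 * (s'.arr .len (s'.reg .cur) + s'.arr .len (s'.arr .link (s'.reg .cur))) ≤
        2 * (s.arr .len (s.reg .cur) + s.arr .len (s.arr .link (s.reg .cur))) + 80 * H + 100 := by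
    intro s₃ t₃ P r3 e1 e2 e3 e4 e5
    refine ⟨_, _, r3.seq (.seq (.assign s₃ .cur _ (by decide) (by simpa [e1] using e5))
      (.assign _ .right _ (by decide) (by simp [e2]; omega))), ?_⟩
    simp only [HExpr.eval_reg, HExpr.eval_add, HExpr.eval_ofNat, St.set_reg, St.set_arr,
      reduceCtorEq, if_true, if_false, e1, e2]
    exact ⟨e3, by omega⟩
  by_cases hold : s₀.arr .key (s₂.reg .t) = x m + 1
  · obtain ⟨o1, o2, o3⟩ := d1 hold
    obtain ⟨o4, o5, o6⟩ := (h.child ⟨c1.pos, c1.lt⟩ g2 hXlen g3 c2.2).2 ⟨o1, o2, o3⟩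
    set P := s₀.arr .val (s₂.reg .t) with hP
    have hPw : P < word := hb0.arr _ _
    have hrun : HRun N word (.assign .p (Arr.val.at Reg.t)) s₂ 1 (s₂.set .p P) := by
      have := HRun.assign (N := N) (word := word) s₂ .p (Arr.val.at Reg.t) (by decide)
      simp only [HExpr.eval_arr, HExpr.eval_reg, hA2, ← hP] at this
      exact this hPw
    -- No second climb takes place for an old node; the length of its link is bounded through its
    -- parent instead.
    have hlkP := htr.len_link_inner o1
    rw [o2] at hlkP
    refine hmid (s₂.set .p P) _ P (.condTrue ?_ hrun) (by simp) ?_ ?_ ?_ hPw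
    · simp only [HTest.Holds, HExpr.eval_arr, HExpr.eval_reg, hA2, hv2, hold]
    · simp [f02.reg .right (by simp), hs₀, hmr]
    · set s' := ((s₂.set .p P).set .cur P).set .right (m + 1) with hs'
      have hA' : ∀ a, s'.arr a = s₀.arr a := hA2
      have hn' : s'.reg .nodes = s.reg .nodes := by simp [hs', hn2]
      have hc' : s'.reg .cells = s.reg .cells := by
        simp [hs', f02.reg .cells (by simp), hs₀]
      have hch' : Children s' x st lv ow H := hch0.frame (fun a _ => hA' a)
        (by rw [hc']; simp [hs₀]) (by rw [hn', hn0])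
      have hsuf : IsSuffix x (s.arr .len) st (s.reg .nodes) l m P p :=
        ⟨o1, o6, by omega, by omega, hmax⟩
      refine ⟨st, lv, ow, p, ⟨?_, ?_, ?_, ?_, ?_, ?_, ?_, hch'.dict, hch'.entry, ?_, ?_, ?_, ?_, ?_,
        ?_⟩, ?_, fun _ _ => rfl, ⟨?_, Or.inl hn'⟩, ?_, ?_, ?_, ?_⟩
      · simp [hs', f02.reg .left (by simp), hs₀, h.left]
      · simp [hs']
      · omega
      · intro k hk; rw [hA']; exact hbf0 k (by omega)
      · rw [hA', hl0]; exact h.len0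
      · rw [hA', hA', hA', hl0, hk0, hi0, hn']
        exact htr.append_old (v := P) (by omega) g2 hmax o1 (by omega) o6
      · rw [hA', hl0, hn']; intro v hv; have := h.fits v hv; omega
      · rw [hc', hn']; exact h.ground
      · rw [hn']; have := h.nodes_le; omega
      · rw [hn']; simp only [hs', St.set_reg, reduceCtorEq, if_true, if_false]
        have := o1.1; exact ⟨by omega, o1.2⟩
      · rw [hA', hl0]; simp only [hs', St.set_reg, reduceCtorEq, if_true, if_false]; omega
      · rw [hA', hl0]; simp only [hs', St.set_reg, reduceCtorEq, if_true, if_false]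
        rwa [show m + 1 + 1 - s.arr .len P = p by omega]
      · rw [hA', hl0]; simp only [hs', St.set_reg, reduceCtorEq, if_true, if_false]
        intro q h1 h2 h3
        have := hmax q h1 (by omega) h3
        omega
      · rw [hA', hl0, hn', show s'.reg .p = P by simp [hs']]
        exact hsuf
      · intro a ha v _
        rw [hA']
        simp only [List.mem_cons, List.not_mem_nil, or_false] at ha
        rw [f0.arr a (by rcases ha with rfl | rfl | rfl | rfl | rfl | rfl | rfl <;> simp)]
      · rw [hA', hmk0]
      · rw [hA', hbu0]
      · intro v h1 h2; rw [hn'] at h1; exact absurd h1 h2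
      · refine St.Frame.set (St.Frame.set (St.Frame.set ?_ (by simp) _) (by simp) _) (by simp) _
        exact (f0.mono (by simp) (by simp)).comp (f02.mono (by simp) (by simp))
    · simp only [St.set_arr, hA2, hl0, hk0]
      omega
  · have hnew : ∀ u, ¬ (Real (s.reg .nodes) u ∧ s.arr .inner u = X ∧ x m + 1 = x (st u) + 1) :=
      fun u hu => hold (d2 u hu.1 hu.2.1 hu.2.2).1
    have hnew' : ∀ v, Real (s.reg .nodes) v → s.arr .len v = s.arr .len X + 2 →
        ¬ At x (s.arr .len) st v p := fun v h1 h2 h3 =>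
      hnew v ((h.child ⟨c1.pos, c1.lt⟩ g2 hXlen g3 c2.2).1 ⟨h1, h2, h3⟩)
    have hX0 := c1.pos
    have hXn := c1.lt
    have hch2 : Children s₂ x st lv ow H := hch0.frame (fun a _ => hA2 a)
      (f02.reg _ (by simp)) (f02.reg _ (by simp))
    obtain ⟨t₃, s₃, r3, ⟨f3, q1, q2, q3, q4, q5, q6⟩, hb3⟩ := (findLink_spec (N := N) (p := p) (st := st)
      (lv := lv) (ow := ow) (H := H) (by rw [hA2, hA2, hA2, hl0, hk0, hi0, hn2]; exact htr) hch2
      ((f02.reg _ (by simp)).trans ((f0.reg _ (by simp)).trans h.left))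
      ((f02.reg _ (by simp)).trans ((f0.reg _ (by simp)).trans hmr))
      ((f02.reg _ (by simp)).trans ((f0.reg _ (by simp)).trans hx))
      (by rw [hA2]; exact hbf0) hv2 hb2 (by omega) (by omega) (by rw [hA2, hl0, hx2]; exact hXlen)
      (by rw [hx2]; exact hX0) (by rw [hx2, hn2]; exact hXn) g2
      (by rw [hA2, hl0, hx2]; exact g3)).bdd hb2
    rw [hA2, hl0] at q3 q4 q5 q6
    rw [hA2, hk0] at q6
    rw [hx2] at q3 q6
    rw [hn2] at q2
    have hn3 : s₃.reg .nodes = s.reg .nodes := by rw [f3.reg _ (by simp), hn2]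
    have hx3 : s₃.reg .x = X := by rw [f3.reg _ (by simp), hx2]
    have hv3 : s₃.reg .v = x m + 1 := by rw [f3.reg _ (by simp), hv2]
    have hA3 : ∀ a, s₃.arr a = s₀.arr a := fun a => (f3.arr a (by simp)).trans (hA2 a)
    have hc3 : s₃.reg .cells = s.reg .cells := by
      rw [f3.reg _ (by simp), f02.reg _ (by simp)]; simp [hs₀]
    have hch3 : Children s₃ x st lv ow H := hch2.frame (fun a _ => f3.arr a (by simp))
      (f3.reg _ (by simp)) (f3.reg _ (by simp))
    have hg := h.ground
    have hd3 := hch3.dict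
    rw [hn3] at hd3
    obtain ⟨t₄, s₄, r4, ⟨ht₄, lv', ow', f4, dict4, ent4, gr4⟩, hb4⟩ := (insertion_spec (N := N) hd3
      (x := .x) (by decide) hx3 hX0 hXn (by omega) (by
        intro u hu
        have := (hch3.entry _ _ _).1 hu
        rw [hn3, hv3, hA3, hi0] at this
        exact hnew u this) hb3 (by omega) (by rw [hc3]; omega) (by omega)).bdd hb3
    have hhd : lv (s₃.arr .head X) ≤ H := by
      have := hch3.height X hX0 (by rw [hn3]; exact hXn)
      exact this
    rw [hc3] at gr4
    have hn4 : s₄.reg .nodes = s.reg .nodes := by rw [f4.reg _ (by simp), hn3]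
    have hx4 : s₄.reg .x = X := by rw [f4.reg _ (by simp), hx3]
    have hq4 : s₄.reg .q = s₃.reg .q := f4.reg _ (by simp)
    have hcell := dict4.skip.le_two_mul_ground
    have hA4 : ∀ a, a ∉ [Arr.key, .right, .down, .val, .head] → s₄.arr a = s₀.arr a :=
      fun a ha => (f4.arr a ha).trans (hA3 a)
    obtain ⟨t₅, s₅, r5, ht₅, f5, l5, k5, i5, w5, p5, ch5, sl5, hd5, ky5, ri5, do5, pp5, ce5, no5⟩ :=
      (create_wp (N := N) (s := s₄) (Q := fun s' => s₄.Frame [.p, .cells, .nodes]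
      [.len, .link, .inner, .weight, .possum, .chsum, .slot, .head, .key, .right, .down] s' ∧
      s'.arr .len = update (s₄.arr .len) (s₄.reg .nodes) (s₄.arr .len (s₄.reg .x) + 2) ∧
      s'.arr .link = update (s₄.arr .link) (s₄.reg .nodes) (s₄.reg .q) ∧
      s'.arr .inner = update (s₄.arr .inner) (s₄.reg .nodes) (s₄.reg .x) ∧
      s'.arr .weight = update (s₄.arr .weight) (s₄.reg .nodes) 0 ∧
      s'.arr .possum = update (s₄.arr .possum) (s₄.reg .nodes) 0 ∧
      s'.arr .chsum = update (s₄.arr .chsum) (s₄.reg .nodes) 0 ∧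
      s'.arr .slot = update (s₄.arr .slot) (s₄.reg .nodes) 0 ∧
      s'.arr .head = update (s₄.arr .head) (s₄.reg .nodes) (s₄.reg .cells) ∧
      s'.arr .key = update (s₄.arr .key) (s₄.reg .cells) 0 ∧
      s'.arr .right = update (s₄.arr .right) (s₄.reg .cells) 0 ∧
      s'.arr .down = update (s₄.arr .down) (s₄.reg .cells) 0 ∧
      s'.reg .p = s₄.reg .nodes ∧ s'.reg .cells = s₄.reg .cells + 1 ∧
      s'.reg .nodes = s₄.reg .nodes + 1) (by omega) (by omega) (by omega) hb4
      (by rw [hA4 _ (by simp), hl0, hx4]; omega)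
      (fun s' a1 a2 a3 a4 a5 a6 a7 a8 a9 a10 a11 a12 a13 a14 a15 =>
        ⟨a1, a2, a3, a4, a5, a6, a7, a8, a9, a10, a11, a12, a13, a14, a15⟩)).run
    obtain ⟨dict5, ent5, gr5⟩ := dict4.add_owner (by have := htr.three_le; omega) (hn4 ▸ hd5) ky5 ri5 do5 ce5
      (f5.arr _ (by simp))
    rw [hn4] at l5 k5 i5 w5 p5 ch5 sl5 no5 pp5
    rw [hA4 _ (by simp), hl0, hx4] at l5
    rw [hA4 _ (by simp), hk0, hq4] at k5
    rw [hA4 _ (by simp), hi0, hx4] at i5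
    rw [hA4 _ (by simp), f0.arr _ (by simp)] at w5 p5 ch5 sl5
    set nn := s.reg .nodes with hnn
    set Q := s₃.reg .q with hQ
    refine hmid s₅ _ nn (.condFalse ?_ (r3.seq (r4.seq r5))) pp5 ?_ ?_ ?_ (by omega)
    · simp only [HTest.Holds, HExpr.eval_arr, HExpr.eval_reg, hA2, hv2, hold, not_false_eq_true]
    · rw [f5.reg _ (by simp), f4.reg _ (by simp), f3.reg _ (by simp), f02.reg _ (by simp),
        f0.reg _ (by simp), hmr]
    · set s' := (s₅.set .cur nn).set .right (m + 1) with hs'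
      have htree' := htr.append_new (X := X) (Q := Q) (p := p) (by omega) g2 hmax hX0 hXn hXlen g3 q1 q2
        q3 q4 q5 hnew'
      have hsuf : IsSuffix x (update (s.arr .len) nn (s.arr .len X + 2)) (update st nn p) (nn + 1) l m
          nn p := by
        refine ⟨⟨htr.three_le, by omega⟩, ?_, by omega, by rw [update_self]; omega, hmax⟩
        rw [At, update_self]; exact Same.refl _ _ _
      have hn' : s'.reg .nodes = nn + 1 := by simp [hs', no5]
      have hl' : s'.arr .len = _ := l5
      have hA5 : ∀ a, a ∉ [Arr.key, .right, .down, .val, .head, .len, .link, .inner, .weight, .possum,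
          .chsum, .slot] → s'.arr a = s₀.arr a := fun a ha => by
        simp only [List.mem_cons, List.not_mem_nil, or_false, not_or] at ha
        exact (f5.arr a (by simp only [List.mem_cons, List.not_mem_nil, or_false, not_or]; tauto)).trans
          (hA4 a (by simp only [List.mem_cons, List.not_mem_nil, or_false, not_or]; tauto))
      refine ⟨update st nn p, update lv' (s₄.reg .cells) 0, update ow' (s₄.reg .cells) nn, p, ⟨?_, ?_, ?_, ?_, ?_, ?_, ?_, ?_, ?_, ?_, ?_, ?_, ?_, ?_,
        ?_⟩, ?_, ?_, ⟨?_, ?_⟩, ?_, ?_, ?_, ?_⟩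
      · simp [hs', f5.reg .left (by simp), f4.reg .left (by simp), f3.reg .left (by simp),
          f02.reg .left (by simp), hs₀, h.left]
      · simp [hs']
      · omega
      · intro k hk; rw [hA5 _ (by simp)]; exact hbf0 k (by omega)
      · rw [hl', update_of_ne (by have := htr.three_le; omega)]; exact h.len0
      · rw [hl', hn', show s'.arr .link = _ from k5, show s'.arr .inner = _ from i5]
        exact htree'
      · rw [hl', hn']
        intro v hv
        by_cases e : v = nn
        · rw [e, update_self, update_self]; omega
        · rw [update_of_ne e, update_of_ne e]
          have := h.fits v ⟨hv.1, by have := hv.2; omega⟩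
          omega
      · rw [hn']
        exact ⟨dict5.skip, dict5.pos, dict5.top, dict5.own⟩
      · intro o k u
        have e1 := ent5 o k u
        rw [ent4, hch3.entry, hn3, hv3, hA3, hi0] at e1
        rw [hn', show s'.arr .inner = _ from i5]
        refine Iff.trans e1 ?_
        by_cases e : u = nn
        · rw [e, update_self, update_self, c2.2]
          constructor
          · rintro (hh | hh)
            · exact absurd hh.1.2 (lt_irrefl _)
            · exact ⟨⟨htr.three_le, by omega⟩, hh.1.symm, hh.2.1⟩
          · rintro ⟨_, hh1, hh2⟩
            exact Or.inr ⟨hh1.symm, hh2, rfl⟩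
        · rw [update_of_ne e, update_of_ne e]
          constructor
          · rintro (hh | hh)
            · exact ⟨⟨hh.1.1, by have := hh.1.2; omega⟩, hh.2⟩
            · exact absurd hh.2.2 e
          · rintro ⟨hh1, hh2⟩
            exact Or.inl ⟨⟨hh1.1, by have := hh1.2; omega⟩, hh2⟩
      · rw [hn', show s'.reg .cells = s₅.reg .cells by simp [hs'], gr5, gr4]
        omega
      · rw [hn']; have := h.nodes_le; omega
      · rw [hn']; simp only [hs', St.set_reg, reduceCtorEq, if_true, if_false]
        have := htr.three_le; omega
      · rw [hl']; simp only [hs', St.set_reg, reduceCtorEq, if_true, if_false, update_self]; omega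
      · rw [hl']; simp only [hs', St.set_reg, reduceCtorEq, if_true, if_false, update_self]
        rw [show m + 1 + 1 - (s.arr .len X + 2) = p by omega]
        exact hsuf.at_
      · rw [hl']; simp only [hs', St.set_reg, reduceCtorEq, if_true, if_false, update_self]
        intro q h1 h2 h3
        have := hmax q h1 (by omega) h3
        omega
      · rw [hl', hn', show s'.reg .p = nn by simp [hs', pp5]]
        exact hsuf
      · intro v hv; rw [update_of_ne hv.ne]
      · intro a ha v hv
        simp only [List.mem_cons, List.not_mem_nil, or_false] at ha
        rcases ha with rfl | rfl | rfl | rfl | rfl | rfl | rfl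
        · rw [hl', update_of_ne hv.ne]
        · rw [show s'.arr .link = _ from k5, update_of_ne hv.ne]
        · rw [show s'.arr .inner = _ from i5, update_of_ne hv.ne]
        · rw [show s'.arr .weight = _ from w5, update_of_ne hv.ne]
        · rw [show s'.arr .possum = _ from p5, update_of_ne hv.ne]
        · rw [show s'.arr .chsum = _ from ch5, update_of_ne hv.ne]
        · rw [show s'.arr .slot = _ from sl5, update_of_ne hv.ne]
      · refine Or.inr ⟨hn', fun a ha => ?_⟩
        simp only [List.mem_cons, List.not_mem_nil, or_false] at ha
        rcases ha with rfl | rfl | rfl | rfl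
        · rw [show s'.arr .weight = _ from w5, update_self]
        · rw [show s'.arr .possum = _ from p5, update_self]
        · rw [show s'.arr .chsum = _ from ch5, update_self]
        · rw [show s'.arr .slot = _ from sl5, update_self]
      · rw [hA5 _ (by simp), hmk0]
      · rw [hA5 _ (by simp), hbu0]
      · intro v h1 h2
        rw [hn'] at h1
        have : v = nn := by
          by_contra hne
          exact h2 ⟨h1.1, by have := h1.2; omega⟩
        subst this
        rw [hl', Finset.eq_empty_iff_forall_notMem]
        intro b hb
        obtain ⟨b1, b2, b3, b4⟩ := mem_occ.1 hb
        rw [update_self] at b3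
        rw [At, update_self, update_self] at b4
        have b5 := Pal.congr b4 (by
          rwa [show p + (s.arr .len X + 2 - 1) = m + 1 by omega])
        -- If the new palindrome occurred in the old window, it would have a node, and the search
        -- would have found that node.
        obtain ⟨u, u1, u2, u3⟩ := htr.complete b _ b1 (by omega) (by omega) b5
        refine hnew' u u1 (by omega) (u3.trans ?_)
        rw [u2]
        convert b4.symm using 1
        omega
      · refine St.Frame.set (St.Frame.set ?_ (by simp) _) (by simp) _
        have a1 := (f0.mono (rs' := [.right, .cur, .nodes, .cells, .x, .y, .t, .v, .p, .q])
          (as' := [.buf, .len, .link, .inner, .head, .weight, .possum, .chsum, .slot, .mark, .key,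
            .right, .down, .val]) (by simp) (by simp))
        exact (((a1.comp (f02.mono (by simp) (by simp))).comp (f3.mono (by simp) (by simp))).comp
          (f4.mono (by simp) (by simp))).comp (f5.mono (by simp) (by simp))
    · rw [l5, k5, update_self, update_self, update_of_ne (by omega)]
      simp [create, HCmd.size] at ht₅
      omega

end SlidingMUPS

/-! ### The nodes whose status can change -/

namespace SlidingMUPS
open Function

/-- The node `v` is a minimal unique palindrome of the window and occurs at `a`. -/
def Target (x len inner st : ℕ → ℕ) (l m v a : ℕ) : Prop :=
  (occ x len st l m v).card = 1 ∧ (len v < 4 ∨ (occ x len st l m (inner v)).card ≠ 1) ∧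
    a ∈ occ x len st l m v

section
variable {x len link inner st mark weight possum chsum : ℕ → ℕ} {nn l m M : ℕ}

theorem Tree.inner_real (h : Tree x len link inner st nn l m) {v : ℕ} (hv : Real nn v)
    (h4 : ¬ len v < 4) : Real nn (inner v) := by
  have h1 := h.len_inner v hv
  have h2 := h.inner_lt v hv
  rcases h.real_or h2.1 h2.2 with e | e | e
  · rw [e, h.len_one] at h1; omega
  · rw [e, h.len_two] at h1; omega
  · exact e

theorem mem_live_of_card {v : ℕ} (hv : Real nn v) (h : (occ x len st l m v).card = 1) :
    v ∈ live x len st nn l m :=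
  mem_live.2 ⟨hv, Finset.card_pos.1 (by omega)⟩

/-- Uniqueness can be read off the weights of `v` and of `inner v`. The case `len v < 4` is separate
because the interior is then a root, whose weight says nothing about uniqueness. -/
theorem Tree.target_iff (h : Tree x len link inner st nn l m) (hm : Marks x len st nn l m mark)
    (ht : Tally link inner nn l m M (live x len st nn l m) mark weight possum chsum) {v a : ℕ}
    (hmM : m ≤ M) (hv : Real nn v) : Target x len inner st l m v a ↔
      (weight v = 1 ∧ (len v < 4 ∨ weight (inner v) ≠ 1)) ∧ a = possum v := by
  rw [Target, h.unique_iff hm ht hv]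
  by_cases hw : weight v = 1
  · have hc := (h.unique_iff hm ht hv).2 hw
    have hp := h.possum_mem hm ht hmM hv hc
    have ha : a ∈ occ x len st l m v ↔ a = possum v := by
      constructor
      · exact fun ha => Finset.card_le_one.1 hc.le _ ha _ hp
      · rintro rfl; exact hp
    rw [ha]
    by_cases h4 : len v < 4
    · simp [hw, h4]
    · have := h.unique_iff hm ht (h.inner_real hv h4)
      simp only [ne_eq, this, hw, h4, false_or, true_and]
  · simp [hw]

/-- If `inner v` is unique in the old window and equals `P` or `link P`, then the child sum of that
node is `v`, which is excluded. An interior that is not unique there has two occurrences already and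
keeps them. All other interiors are covered by `Tree.unique_append`. -/
theorem Tree.target_append (h : Tree x len link inner st nn l (m + 1)) {P a v b : ℕ}
    (hP : IsSuffix x len st nn l m P a)
    (ht : Tally link inner nn l m M (live x len st nn l m) mark weight possum chsum) (hnM : nn ≤ M)
    (hv : Real nn v) (h1 : v ≠ P) (h2 : v ≠ link P) (h3 : v ≠ chsum P) (h4 : v ≠ chsum (link P)) :
    Target x len inner st l m v b ↔ Target x len inner st l (m + 1) v b := by
  have hu := h.unique_append hP hv h1 h2
  have h' := h.mono_right (Nat.le_succ m)
  rw [Target, Target, ← hu]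
  refine and_congr_right fun hc => ?_
  have hlive := mem_live_of_card (nn := nn) hv hc
  have hoc : occ x len st l m v = occ x len st l (m + 1) v :=
    Finset.eq_of_subset_of_card_le (occ_append_of v) (by rw [hu.1 hc, hc])
  rw [← hoc]
  refine and_congr_left fun hb => ?_
  by_cases hl : len v < 4
  · simp [hl]
  simp only [hl, false_or]
  have hi := h.inner_real hv hl
  by_cases hw : inner v = P ∨ inner v = link P
  · have hne : (occ x len st l m (inner v)).card ≠ 1 := by
      intro e
      have := h'.chsum_eq ht hnM hlive (by omega) e
      rcases hw with e | e <;> rw [e] at this <;> omega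
    have hpos := Finset.card_pos.2 ⟨_, (h'.inner_occ hv hb).2 (by omega)⟩
    have := Finset.card_le_card (occ_append_of (x := x) (len := len) (st := st) (l := l) (m := m)
      (inner v))
    refine iff_of_true hne (by omega)
  · rw [not_or] at hw
    exact not_congr (h.unique_append hP hi hw.1 hw.2)

/-- The argument is that for appending, now with the counts after the deletion: the child sums have
to belong to the smaller of the two windows, since an interior that occurs twice there does so in
the larger one as well. -/
theorem Tree.target_delete (h : Tree x len link inner st nn l m) {P v b : ℕ}
    (hP : IsPrefix x len st nn l m P)
    (ht : Tally link inner nn (l + 1) m M (live x len st nn (l + 1) m) mark weight possum chsum)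
    (hnM : nn ≤ M)
    (hv : Real nn v) (h1 : v ≠ P) (h2 : v ≠ link P) (h3 : v ≠ chsum P) (h4 : v ≠ chsum (link P)) :
    Target x len inner st l m v b ↔ Target x len inner st (l + 1) m v b := by
  have hu := h.unique_delete hP hv h1 h2
  have h' := h.mono_left (l' := l + 1) (by omega)
  rw [Target, Target, hu]
  refine and_congr_right fun hc => ?_
  have hlive := mem_live_of_card (nn := nn) hv hc
  have hoc : occ x len st (l + 1) m v = occ x len st l m v :=
    Finset.eq_of_subset_of_card_le (occ_delete_of v) (by rw [hu.2 hc, hc])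
  rw [hoc]
  refine and_congr_left fun hb => ?_
  by_cases hl : len v < 4
  · simp [hl]
  simp only [hl, false_or]
  have hi := h.inner_real hv hl
  by_cases hw : inner v = P ∨ inner v = link P
  · have hne : (occ x len st (l + 1) m (inner v)).card ≠ 1 := by
      intro e
      have := h'.chsum_eq ht hnM hlive (by omega) e
      rcases hw with e | e <;> rw [e] at this <;> omega
    have hpos := Finset.card_pos.2 ⟨_, (h'.inner_occ hv (hoc ▸ hb)).2 (by omega)⟩
    have := Finset.card_le_card (occ_delete_of (x := x) (len := len) (st := st) (l := l) (m := m)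
      (inner v))
    refine iff_of_true (by omega) hne
  · rw [not_or] at hw
    exact not_congr (h.unique_delete hP hi hw.1 hw.2)

end

section
open Reg Arr

/-- All nodes whose status may have changed are brought up to date. -/
def refreshes : HCmd := refresh p ;; refresh c1 ;; refresh q ;; refresh c2

end

theorem St.Fits.frame {s s' : St} {N word m : ℕ} (h : s.Fits N word m)
    (h1 : s'.reg .modulus = s.reg .modulus) (h2 : s'.reg .base = s.reg .base)
    (h3 : s'.reg .nodes = s.reg .nodes) : s'.Fits N word m :=
  ⟨h1.trans h.modulus, by rw [h2]; exact h.word, by rw [h3]; exact h.nodes, h.right⟩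

theorem refreshes_wp {N word m : ℕ} {s : St} {Q : St → Prop} (h : Listing s word)
    (hf : s.Fits N word m) (hb : s.Bdd word)
    (hp : ∀ v, Real (s.reg .nodes) v → s.arr .possum v < N)
    (hl : ∀ v, Real (s.reg .nodes) v → s.arr .len v < N)
    (hQ : ∀ s', s.Frame [.cnt, .t, .u] [.owner, .entry, .slot] s' → Listing s' word →
      (∀ v e, Real (s.reg .nodes) v → (Shown s' v e ↔
        if v = s.reg .p ∨ v = s.reg .c1 ∨ v = s.reg .q ∨ v = s.reg .c2 then Due s v e
        else Shown s v e)) → Q s') :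
    refreshes.wp N word Q s := by
  have hdue : ∀ {s'}, s.Frame [.cnt, .t, .u] [.owner, .entry, .slot] s' → ∀ v e,
      Due s' v e ↔ Due s v e := by
    intro s' f v e
    rw [Due, Due, f.arr .weight (by simp), f.arr .len (by simp), f.arr .inner (by simp),
      f.arr .possum (by simp), f.reg .base (by simp)]
  have step : ∀ {s₁ : St} {r : Reg} {c : HCmd}, s.Frame [.cnt, .t, .u] [.owner, .entry, .slot] s₁ →
      r ≠ .t ∧ r ≠ .u ∧ r ≠ .cnt → s₁.Bdd word → Listing s₁ word →
      (∀ s₂, s.Frame [.cnt, .t, .u] [.owner, .entry, .slot] s₂ → s₂.Bdd word → Listing s₂ word →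
        (∀ v e, Real (s.reg .nodes) v → (Shown s₂ v e ↔
          (v ≠ s.reg r ∧ Shown s₁ v e) ∨ (v = s.reg r ∧ Due s v e))) → c.wp N word Q s₂) →
      (refresh r).wp N word (c.wp N word Q) s₁ := by
    intro s₁ r c f hr hb1 l1 hc
    have hn : s₁.reg .nodes = s.reg .nodes := f.reg _ (by simp)
    have hrr : s₁.reg r = s.reg r := f.reg _ (by simp; tauto)
    refine refresh_wp l1 (hf.frame (f.reg _ (by simp)) (f.reg _ (by simp)) hn) hb1 hr
      (by rw [hn, f.arr _ (by simp)]; exact hp) (by rw [hn, f.arr _ (by simp)]; exact hl)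
      fun s₂ f2 hb2 l2 sh => hc s₂ (f.comp f2) hb2 l2 fun v e hv => ?_
    rw [sh v e (by rwa [hn]), hrr, hdue f]
  refine step (r := .p) (.refl s) (by decide) hb h fun s₁ f1 b1 l1 sh1 => ?_
  refine step (r := .c1) f1 (by decide) b1 l1 fun s₂ f2 b2 l2 sh2 => ?_
  refine step (r := .q) f2 (by decide) b2 l2 fun s₃ f3 b3 l3 sh3 => ?_
  refine step (r := .c2) (c := .skip) f3 (by decide) b3 l3 fun s₄ f4 b4 l4 sh4 => ?_
  refine hQ s₄ f4 l4 fun v e hv => ?_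
  rw [sh4 v e hv, sh3 v e hv, sh2 v e hv, sh1 v e hv]
  split_ifs with hc <;> tauto

end SlidingMUPS

/-! ### The full invariant and the append operation -/

namespace SlidingMUPS
open Function

section
variable {s s' : St} {x st st' lv' ow' : ℕ → ℕ} {l m a : ℕ}

theorem Grown.eq (h : Grown s s') {b : Arr}
    (hb : b ∈ [Arr.len, .link, .inner, .weight, .possum, .chsum, .slot]) {v : ℕ}
    (hv : v < s.reg .nodes) : s'.arr b v = s.arr b v := h.same b hb v hv

theorem Grown.le (h : Grown s s') : s.reg .nodes ≤ s'.reg .nodes := by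
  rcases h.new with e | e <;> omega

theorem Found.occ_eq (h : Found s s' x st st' lv' ow' l m a) {v i j : ℕ} (hv : v < s.reg .nodes) :
    occ x (s'.arr .len) st' i j v = occ x (s.arr .len) st i j v := by
  ext b
  rw [mem_occ, mem_occ, At, At, h.grown.eq (by simp) hv, h.same v hv]

theorem Found.live_eq (h : Found s s' x st st' lv' ow' l m a) :
    live x (s'.arr .len) st' (s'.reg .nodes) l m = live x (s.arr .len) st (s.reg .nodes) l m := by
  have hle := h.grown.le
  ext v
  rw [mem_live, mem_live]
  constructor
  · rintro ⟨h1, h2⟩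
    by_cases hv : Real (s.reg .nodes) v
    · exact ⟨hv, by rwa [h.occ_eq hv.2] at h2⟩
    · rw [h.fresh v h1 hv] at h2
      simp at h2
  · rintro ⟨h1, h2⟩
    exact ⟨⟨h1.1, h1.2.trans_le hle⟩, by rwa [h.occ_eq h1.2]⟩

theorem Found.marks (h : Found s s' x st st' lv' ow' l m a)
    (hM : Marks x (s.arr .len) st (s.reg .nodes) l m (s.arr .mark)) :
    Marks x (s'.arr .len) st' (s'.reg .nodes) l m (s'.arr .mark) := by
  have hle := h.grown.le
  have hmk : ∀ b, b < m → s'.arr .mark b = s.arr .mark b := fun b hb => by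
    rw [h.mark, update_of_ne hb.ne]
  constructor
  · intro b h1 h2 h3
    rw [hmk b h2] at h3 ⊢
    obtain ⟨e1, e2, e3⟩ := hM.ok b h1 h2 h3
    rw [At, h.grown.eq (by simp) e1.2, h.same _ e1.2]
    exact ⟨⟨e1.1, e1.2.trans_le hle⟩, e2, e3⟩
  · intro b c h1 h2 h3 h4 h5 h6
    rw [hmk b (by omega)]
    obtain ⟨e1, e2⟩ := hM.surface b c h1 h2 h3 h4 h5 h6
    obtain ⟨e3, -, -⟩ := hM.ok b h1 (by omega) e1
    rw [h.grown.eq (by simp) e3.2]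
    exact ⟨e1, e2⟩

/-- A new node has no recorded occurrence and no live link or child in the old window, so its zero
entries are correct until the new letter is accounted for. -/
theorem Found.tally (h : Found s s' x st st' lv' ow' l m a)
    (htr : Tree x (s.arr .len) (s.arr .link) (s.arr .inner) st (s.reg .nodes) l m)
    (hM : Marks x (s.arr .len) st (s.reg .nodes) l m (s.arr .mark))
    (hT : s.Tally l m (live x (s.arr .len) st (s.reg .nodes) l m)) :
    s'.Tally l m (live x (s'.arr .len) st' (s'.reg .nodes) l m) := by
  have hle := h.grown.le
  rw [St.Tally, h.live_eq, show s'.reg .modulus = s.reg .modulus from h.frame.reg _ (by simp)]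
  have hA : ∀ u ∈ live x (s.arr .len) st (s.reg .nodes) l m, Real (s.reg .nodes) u :=
    fun u hu => (mem_live.1 hu).1
  have hT' := hT.congr_mark (mark' := s'.arr .mark) fun b _ hb => by rw [h.mark, update_of_ne hb.ne]
  have f1 : ∀ v, (live x (s.arr .len) st (s.reg .nodes) l m).filter (fun u => s'.arr .link u = v) =
      (live x (s.arr .len) st (s.reg .nodes) l m).filter fun u => s.arr .link u = v := fun v =>
    Finset.filter_congr fun u hu => by rw [h.grown.eq (by simp) (hA u hu).2]
  have f2 : ∀ v, (live x (s.arr .len) st (s.reg .nodes) l m).filter (fun u => s'.arr .inner u = v) =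
      (live x (s.arr .len) st (s.reg .nodes) l m).filter fun u => s.arr .inner u = v := fun v =>
    Finset.filter_congr fun u hu => by rw [h.grown.eq (by simp) (hA u hu).2]
  have hnd : ∀ v, Nd (s'.reg .nodes) v → Nd (s.reg .nodes) v ∨ v = s.reg .nodes ∧
      ∀ b ∈ [Arr.weight, .possum, .chsum, .slot], s'.arr b (s.reg .nodes) = 0 := by
    intro v hv
    rcases h.grown.new with e | e
    · rw [e] at hv; exact Or.inl hv
    · by_cases hv' : v < s.reg .nodes
      · exact Or.inl ⟨hv.1, hv'⟩
      · exact Or.inr ⟨by have := hv.2; omega, e.2⟩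
  have g0 : ((Finset.Ico l m).filter fun b => s'.arr .mark b = s.reg .nodes) = ∅ := by
    rw [Finset.filter_eq_empty_iff]
    intro b hb e
    rw [Finset.mem_Ico] at hb
    rw [h.mark, update_of_ne hb.2.ne] at e
    have h3 := htr.three_le
    have := (hM.ok b hb.1 hb.2 (by omega)).1.2
    omega
  have g1 : ((live x (s.arr .len) st (s.reg .nodes) l m).filter fun u =>
      s.arr .link u = s.reg .nodes) = ∅ := by
    rw [Finset.filter_eq_empty_iff]
    intro u hu e
    have := (htr.link_lt u (hA u hu)).2
    omega
  have g2 : ((live x (s.arr .len) st (s.reg .nodes) l m).filter fun u =>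
      s.arr .inner u = s.reg .nodes) = ∅ := by
    rw [Finset.filter_eq_empty_iff]
    intro u hu e
    have := (htr.inner_lt u (hA u hu)).2
    omega
  refine ⟨hT.sub.trans (Finset.range_mono hle), ?_, ?_, ?_⟩ <;> intro v hv <;>
    rcases hnd v hv with hv | ⟨rfl, h0⟩
  · rw [h.grown.eq (by simp) hv.2, hT'.weight v hv, f1]
  · rw [h0 _ (by simp), f1, g0, g1]; rfl
  · rw [h.grown.eq (by simp) hv.2, hT'.possum v hv]
  · rw [h0 _ (by simp), g0]; simp
  · rw [h.grown.eq (by simp) hv.2, hT'.chsum v hv, f2]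
  · rw [h0 _ (by simp), f2, g2]; simp

end

/-- The invariant: `x` is the text, and the window is `l, …, m - 1`. -/
structure Full (s : St) (x st lv ow : ℕ → ℕ) (l m word : ℕ) : Prop where
  core : Core s x st lv ow l m
  marks : Marks x (s.arr .len) st (s.reg .nodes) l m (s.arr .mark)
  tally : s.Tally l m (live x (s.arr .len) st (s.reg .nodes) l m)
  listing : Listing s word
  shown : ∀ v e, Real (s.reg .nodes) v → (Shown s v e ↔
    ∃ a, Target x (s.arr .len) (s.arr .inner) st l m v a ∧ e = s.reg .base + a)

section
open Reg Arr

/-- Account for the new occurrence of the node in `p` at the right end. -/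
def account : HCmd :=
  -- The child sums are read before the node in `p` comes alive, because they must belong to the
  -- smaller window.
  .assign q (link.at p) ;; .assign c1 (chsum.at p) ;; .assign c2 (chsum.at q) ;;
    enliven ;; .assign a (Reg.right + 1 - len.at p) ;; forget a ;; addMark p

/-- Append the letter in the register `letter`. -/
def append : HCmd := find ;; account ;; refreshes

/-- The registers that a program for appending may change. -/
def scratch : List Reg :=
  [.cnt, .right, .cur, .nodes, .cells, .x, .y, .t, .v, .p, .q, .a, .u, .c1, .c2]

end

theorem due_iff {s : St} {x st : ℕ → ℕ} {l m N word : ℕ}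
    (h : Tree x (s.arr .len) (s.arr .link) (s.arr .inner) st (s.reg .nodes) l m)
    (hM : Marks x (s.arr .len) st (s.reg .nodes) l m (s.arr .mark))
    (hT : s.Tally l m (live x (s.arr .len) st (s.reg .nodes) l m)) (hf : s.Fits N word m) {v e : ℕ}
    (hv : Real (s.reg .nodes) v) : Due s v e ↔
      ∃ a, Target x (s.arr .len) (s.arr .inner) st l m v a ∧ e = s.reg .base + a := by
  have hmM : m ≤ s.reg .modulus := by rw [hf.modulus]; have := hf.right; omega
  constructor
  · rintro ⟨h1, h2⟩
    exact ⟨_, (h.target_iff hM hT hmM hv).2 ⟨h1, rfl⟩, h2⟩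
  · rintro ⟨a, h1, h2⟩
    obtain ⟨h3, rfl⟩ := (h.target_iff hM hT hmM hv).1 h1
    exact ⟨h3, h2⟩

theorem Core.frame {s s' : St} {x st lv ow : ℕ → ℕ} {l m : ℕ} (h : Core s x st lv ow l m)
    {rs : List Reg} {as : List Arr} (hf : s.Frame rs as s')
    (hr : ∀ r ∈ rs, r ∉ [Reg.left, .right, .nodes, .cells, .cur])
    (ha : ∀ a ∈ as, a ∉ [Arr.buf, .len, .link, .inner, .head, .key, .right, .down, .val]) :
    Core s' x st lv ow l m := by
  have hr' : ∀ r ∈ [Reg.left, .right, .nodes, .cells, .cur], s'.reg r = s.reg r :=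
    fun r h1 => hf.reg r fun h2 => hr r h2 h1
  have ha' : ∀ a ∈ [Arr.buf, .len, .link, .inner, .head, .key, .right, .down, .val],
      s'.arr a = s.arr a := fun a h1 => hf.arr a fun h2 => ha a h2 h1
  simp only [List.forall_mem_cons] at hr' ha'
  obtain ⟨r1, r2, r3, r4, r5, -⟩ := hr'
  obtain ⟨a1, a2, a3, a4, a5, a6, a7, a8, a9, -⟩ := ha'
  constructor
  · rw [r1]; exact h.left
  · rw [r2]; exact h.right
  · exact h.le
  · rw [a1]; exact h.buf
  · rw [a2]; exact h.len0
  · rw [a2, a3, a4, r3]; exact h.tree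
  · rw [a2, r3]; exact h.fits
  · refine ⟨?_, ?_, ?_, ?_⟩
    · rw [St.Skip, a6, a7, a8, r4]; exact h.dict.skip
    · rw [r4]; exact h.dict.pos
    · rw [a6, r4, a5, r3]; exact h.dict.top
    · rw [r4, r3]; exact h.dict.own
  · intro o k u
    rw [St.Entry, a6, a9, r4, r3, a4]; exact h.entry o k u
  · rw [r4, r3]; exact h.ground
  · rw [r3]; exact h.nodes_le
  · rw [r5, r3]; exact h.cur_nd
  · rw [r5, a2]; exact h.cur_le
  · rw [r5, a2]; exact h.cur_at
  · rw [r5, a2]; exact h.cur_max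

theorem Core.len_le {s : St} {x st lv ow : ℕ → ℕ} {l m : ℕ} (h : Core s x st lv ow l m) {v : ℕ}
    (hv : Real (s.reg .nodes) v) : s.arr .len v ≤ m + 1 := by
  have := h.fits v hv
  omega

theorem account_wp {N word : ℕ} {s : St} {Q : St → Prop} {l m pos : ℕ} {A : Finset ℕ}
    (hT : s.Tally l (m + 1) A) (hf : s.Fits N word (m + 1)) (hb : s.Bdd word)
    (hm : s.reg .right = m + 1)
    (hp : Nd (s.reg .nodes) (s.reg .p)) (hl : Nd (s.reg .nodes) (s.arr .link (s.reg .p)))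
    (hi : Nd (s.reg .nodes) (s.arr .inner (s.reg .p)))
    (hA : s.reg .p ∈ A ↔ s.arr .weight (s.reg .p) ≠ 0) (hpos : l ≤ pos) (hpm : pos ≤ m)
    (hlen : pos + s.arr .len (s.reg .p) = m + 2) (hmk : s.arr .mark pos < s.reg .nodes)
    (hQ : ∀ s', s.Frame [.q, .c1, .c2, .a] [.weight, .chsum, .possum, .mark] s' →
      s'.Tally l (m + 1) (insert (s.reg .p) A) →
      s'.arr .mark = update (s.arr .mark) pos (s.reg .p) →
      s'.reg .q = s.arr .link (s.reg .p) → s'.reg .c1 = s.arr .chsum (s.reg .p) →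
      s'.reg .c2 = s.arr .chsum (s.arr .link (s.reg .p)) → s'.out = s.out → Q s') :
    account.wp N word Q s := by
  have hN := hf.nodes
  have hW := hf.word
  have hR := hf.right
  simp only [account, HCmd.wp, HExpr.eval_arr, HExpr.eval_reg, HExpr.eval_add, HExpr.eval_sub,
    HExpr.eval_ofNat, St.set_reg, St.set_arr, reduceCtorEq, if_true, if_false, ne_eq,
    not_false_eq_true, true_and]
  refine ⟨hb.arr _ _, hb.arr _ _, hb.arr _ _, ?_⟩
  set s₁ := ((s.set .q (s.arr .link (s.reg .p))).set .c1 (s.arr .chsum (s.reg .p))).set .c2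
    (s.arr .chsum (s.arr .link (s.reg .p))) with hs₁
  have f1 : s.Frame [.q, .c1, .c2, .a] [.weight, .chsum, .possum, .mark] s₁ :=
    (((St.Frame.refl s).set (by simp) _).set (by simp) _).set (by simp) _
  have hfr : ∀ {s' : St}, s.Frame [.q, .c1, .c2, .a] [.weight, .chsum, .possum, .mark] s' →
      s'.Fits N word (m + 1) := fun f => hf.frame (f.reg _ (by simp)) (f.reg _ (by simp))
        (f.reg _ (by simp))
  have hp1 : s₁.reg .p = s.reg .p := by simp [hs₁]
  refine enliven_wp (l := l) (m := m + 1) (A := A) (by simpa [St.Tally, hs₁] using hT) (hfr f1)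
    (by simpa [hs₁] using hp) (by simpa [hs₁] using hl) (by simpa [hs₁] using hi)
    (by simpa [hs₁] using hA) fun s₂ f2 hT2 ho2 => ?_
  have f12 := f1.comp (f2.mono (rs' := [.q, .c1, .c2, .a]) (as' := [.weight, .chsum, .possum, .mark])
    (by simp) (by simp))
  have e1 : s₂.reg .right + 1 - s₂.arr .len (s₂.reg .p) = pos := by
    rw [f12.reg _ (by simp), f12.reg .p (by simp), f12.arr .len (by simp), hm]
    omega
  rw [e1]
  refine ⟨by omega, ?_⟩
  have f3 := f12.set (r := .a) (by simp) pos
  have hmk2 : s₂.arr .mark = s.arr .mark := by rw [f2.arr _ (by simp)]; simp [hs₁]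
  refine forget_wp (l := l) (m := m + 1) (A := insert (s.reg .p) A)
    (by simpa [St.Tally, hp1] using hT2) (hfr f3) (by
      rw [f3.reg .nodes (by simp)]; simpa [hmk2] using hmk) (by simpa using hpos)
    (by simp; omega) fun s₄ f4 hT4 mk4 ho4 => ?_
  have f34 := f3.comp (f4.mono (rs' := [.q, .c1, .c2, .a]) (as' := [.weight, .chsum, .possum, .mark])
    (by simp) (by simp))
  have ha4 : s₄.reg .a = pos := by rw [f4.reg _ (by simp)]; simp
  have hp4 : s₄.reg .p = s.reg .p := f34.reg _ (by simp)
  simp only [St.set_reg, if_true, St.set_arr, hmk2] at mk4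
  refine addMark_wp (l := l) (m := m + 1) (A := insert (s.reg .p) A) hT4 (hfr f34)
    (by rw [hp4, f34.reg .nodes (by simp)]; exact hp) (by rw [ha4, mk4, update_self])
    (by omega) (by omega) fun s₅ f5 hT5 mk5 ho5 => ?_
  have f45 := f34.comp (f5.mono (rs' := [.q, .c1, .c2, .a]) (as' := [.weight, .chsum, .possum, .mark])
    (by simp) (by simp))
  refine hQ s₅ f45 hT5 ?_ ?_ ?_ ?_ ?_
  · rw [mk5, mk4, ha4, hp4, update_idem]
  · rw [f5.reg _ (by simp), f4.reg _ (by simp), St.set_reg, if_neg (by decide),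
      f2.reg _ (by simp)]; simp [hs₁]
  · rw [f5.reg _ (by simp), f4.reg _ (by simp), St.set_reg, if_neg (by decide),
      f2.reg _ (by simp)]; simp [hs₁]
  · rw [f5.reg _ (by simp), f4.reg _ (by simp), St.set_reg, if_neg (by decide),
      f2.reg _ (by simp)]; simp [hs₁]
  · rw [ho5, ho4, St.set_out, ho2]; simp [hs₁]

/-- By `Tree.target_append` the refreshed nodes are the only ones whose status can differ; for all
others the list is still right. -/
theorem append_spec {N word : ℕ} {s : St} {x st lv ow : ℕ → ℕ} {l m H : ℕ}
    (h : Full s x st lv ow l m word) (hH : ∀ o, 0 < o → o < s.reg .nodes → lv (s.arr .head o) ≤ H)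
    (hx : s.reg .letter = x m) (hxw : x m + 1 < word) (hb : s.Bdd word)
    (hf : s.Fits N word (m + 1)) (hn : 4 * (s.reg .nodes + 1) + 4 < N) :
    Ex N word append s fun t s' => (∃ st' lv' ow', Full s' x st' lv' ow' l (m + 1) word) ∧
      (∀ r, r ∉ scratch → s'.reg r = s.reg r) ∧ s'.arr .buf = update (s.arr .buf) m (x m) ∧
      t + 2 * (s'.arr .len (s'.reg .cur) + s'.arr .len (s'.arr .link (s'.reg .cur))) ≤
      2 * (s.arr .len (s.reg .cur) + s.arr .len (s.arr .link (s.reg .cur))) + 80 * H + 300 := by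
  have hsil : find.Silent := by
    simp [find, HCmd.Silent, climb, search, findLink, insertion, create, descend, raise, putBehind]
  refine Ex.seq ((((find_spec h.core hH hx hxw hb ⟨hf.modulus, hf.word, hf.nodes,
    by have := hf.right; omega⟩).bdd hb).silent hsil).mono ?_)
  rintro t₁ s₁ ⟨⟨⟨⟨st', lv', ow', pos, hF⟩, ht₁⟩, hb₁⟩, hout⟩
  have hle := hF.grown.le
  have hcore := hF.core
  have htr := hcore.tree
  have htr' := htr.mono_right (Nat.le_succ m)
  have hM := hF.marks h.marks
  have hT := hF.tally h.core.tree h.marks h.tally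
  have hP := hF.suffix
  have hPl := hP.left
  have hPr := hP.right
  have hP2 := htr.two_le_len _ hP.real
  have hPnd := Nd.of_real hP.real
  have hlk := htr.link_lt _ hP.real
  have hlm := h.core.le
  have hmod : s₁.reg .modulus = s.reg .modulus := hF.frame.reg _ (by simp)
  have hbase : s₁.reg .base = s.reg .base := hF.frame.reg _ (by simp)
  have hN1 : s₁.reg .nodes ≤ s.reg .nodes + 1 := by rcases hF.grown.new with e | e <;> omega
  have hf₁ : s₁.Fits N word (m + 1) := ⟨by rw [hmod, hf.modulus], by rw [hbase]; exact hf.word,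
    by omega, hf.right⟩
  have hm0 : s₁.arr .mark m = 0 := by rw [hF.mark, update_self]
  have hmk : s₁.arr .mark pos < s₁.reg .nodes := by
    by_cases e : s₁.arr .mark pos = 0
    · have := htr.three_le; omega
    · by_cases e2 : pos = m
      · rw [e2] at e; exact absurd hm0 e
      · exact (hM.ok pos hPl (by omega) e).1.2
  have hslot : ∀ v, Real (s₁.reg .nodes) v → ¬ Real (s.reg .nodes) v → s₁.arr .slot v = 0 := by
    intro v h1 h2
    rcases hF.grown.new with e | ⟨e, e'⟩
    · rw [e] at h1; exact absurd h1 h2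
    · have : v = s.reg .nodes := by
        by_contra hne
        exact h2 ⟨h1.1, by have := h1.2; omega⟩
      rw [this]; exact e' _ (by simp)
  have hL₁ : Listing s₁ word := h.listing.congr (hF.frame.reg _ (by simp)) hle
    (hF.frame.arr _ (by simp)) (hF.frame.arr _ (by simp)) hout
    (fun v hv => ⟨hF.grown.eq (by simp) hv.2, hF.grown.eq (by simp) hv.2⟩) hslot
  have hshown : ∀ v e, Real (s₁.reg .nodes) v → (Shown s₁ v e ↔
      ∃ a, Target x (s₁.arr .len) (s₁.arr .inner) st' l m v a ∧ e = s₁.reg .base + a) := by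
    intro v e hv
    by_cases hv' : Real (s.reg .nodes) v
    · rw [Shown, hF.grown.eq (by simp) hv'.2, hF.frame.arr .entry (by simp), hbase]
      refine (h.shown v e hv').trans (exists_congr fun b => ?_)
      rw [Target, Target, hF.occ_eq hv'.2, hF.grown.eq (by simp) hv'.2, hF.grown.eq (by simp) hv'.2,
        hF.occ_eq (h.core.tree.inner_lt v hv').2]
    · rw [Shown, hslot v hv hv']
      refine iff_of_false (fun h => h.1 rfl) ?_
      rintro ⟨b, hb, -⟩
      rw [Target, hF.fresh v hv hv'] at hb
      simp at hb
  have hPlive := htr'.mem_live_iff hM hT hP.real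
  obtain ⟨t₂, s₂, r₂, ⟨ht₂, f2, hT2, mk2, q2, c12, c22, ho2⟩, hb₂⟩ := (account_wp (N := N) (pos := pos)
    (Q := fun s' => s₁.Frame [.q, .c1, .c2, .a] [.weight, .chsum, .possum, .mark] s' ∧
      s'.Tally l (m + 1) (insert (s₁.reg .p) (live x (s₁.arr .len) st' (s₁.reg .nodes) l m)) ∧
      s'.arr .mark = update (s₁.arr .mark) pos (s₁.reg .p) ∧
      s'.reg .q = s₁.arr .link (s₁.reg .p) ∧ s'.reg .c1 = s₁.arr .chsum (s₁.reg .p) ∧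
      s'.reg .c2 = s₁.arr .chsum (s₁.arr .link (s₁.reg .p)) ∧ s'.out = s₁.out)
    (hT.grow hlm hm0) hf₁ hb₁ hcore.right hPnd ⟨by omega, hlk.2⟩ (htr.inner_lt _ hP.real) hPlive
    hPl (by omega) hPr hmk fun s' a1 a2 a3 a4 a5 a6 a7 => ⟨a1, a2, a3, a4, a5, a6, a7⟩).run.bdd hb₁
  rw [← htr.live_append hP] at hT2
  have hn2 : s₂.reg .nodes = s₁.reg .nodes := f2.reg _ (by simp)
  have hl2 : s₂.arr .len = s₁.arr .len := f2.arr _ (by simp)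
  have hi2 : s₂.arr .inner = s₁.arr .inner := f2.arr _ (by simp)
  have hf₂ : s₂.Fits N word (m + 1) := hf₁.frame (f2.reg _ (by simp)) (f2.reg _ (by simp)) hn2
  have hcore2 : Core s₂ x st' lv' ow' l (m + 1) := hcore.frame f2 (by decide) (by decide)
  have hM2 : Marks x (s₂.arr .len) st' (s₂.reg .nodes) l (m + 1) (s₂.arr .mark) := by
    rw [hl2, hn2, mk2]
    have := Marks.append htr hP hM
    rwa [← hm0, update_eq_self] at this
  have hT2' : s₂.Tally l (m + 1) (live x (s₂.arr .len) st' (s₂.reg .nodes) l (m + 1)) := by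
    rw [hl2, hn2]; exact hT2
  have hL₂ : Listing s₂ word := hL₁.congr (f2.reg _ (by simp)) hn2.ge (f2.arr _ (by simp))
    (f2.arr _ (by simp)) ho2 (fun v _ => by rw [f2.arr .slot (by simp), hl2]; exact ⟨rfl, rfl⟩)
    (fun v h1 h2 => by rw [hn2] at h1; exact absurd h1 h2)
  obtain ⟨t₃, s₃, r₃, ht₃, f3, hL₃, hsh⟩ := (refreshes_wp (N := N) (Q := fun s' =>
      s₂.Frame [.cnt, .t, .u] [.owner, .entry, .slot] s' ∧ Listing s' word ∧
      (∀ v e, Real (s₂.reg .nodes) v → (Shown s' v e ↔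
        if v = s₂.reg .p ∨ v = s₂.reg .c1 ∨ v = s₂.reg .q ∨ v = s₂.reg .c2 then Due s₂ v e
        else Shown s₂ v e))) hL₂ hf₂ hb₂
      (fun v hv => hT2.possum_lt hf₂ (.of_real hv))
      (fun v hv => by have := hcore2.len_le hv; have := hf.right; omega)
      fun s' a1 a2 a3 => ⟨a1, a2, a3⟩).run
  have hn3 : s₃.reg .nodes = s₂.reg .nodes := f3.reg _ (by simp)
  have hl3 : s₃.arr .len = s₂.arr .len := f3.arr _ (by simp)
  have hi3 : s₃.arr .inner = s₂.arr .inner := f3.arr _ (by simp)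
  refine ⟨t₂ + t₃, s₃, r₂.seq r₃, ⟨st', lv', ow', hcore2.frame f3 (by decide) (by decide), ?_, ?_,
    hL₃, ?_⟩, ?_, ?_, ?_⟩
  · rw [hn3, hl3, f3.arr .mark (by simp)]; exact hM2
  · rw [St.Tally, hn3, hl3, hi3, f3.arr .mark (by simp), f3.arr .weight (by simp),
      f3.arr .possum (by simp), f3.arr .chsum (by simp), f3.arr .link (by simp),
      f3.reg .modulus (by simp)]
    exact hT2'
  · intro v e hv
    rw [hn3] at hv
    rw [hsh v e hv, hl3, hi3, f3.reg .base (by simp)]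
    have hdue := due_iff (e := e) hcore2.tree hM2 hT2' hf₂ hv
    split_ifs with hc
    · exact hdue
    · simp only [not_or] at hc
      obtain ⟨n1, n2, n3, n4⟩ := hc
      rw [hn2] at hv
      rw [f2.reg .p (by simp)] at n1
      rw [c12] at n2
      rw [q2] at n3
      rw [c22] at n4
      rw [Shown, f2.arr .slot (by simp), f2.arr .entry (by simp), hl2, hi2, f2.reg .base (by simp)]
      refine (hshown v e hv).trans (exists_congr fun b => and_congr_left fun _ => ?_)
      exact htr.target_append hP hT (by rw [hf₁.modulus]; have := hf₁.nodes; omega) hv n1 n3 n2 n4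
  · intro r hr
    simp only [scratch, List.mem_cons, List.not_mem_nil, or_false, not_or] at hr
    rw [f3.reg r (by simp; tauto), f2.reg r (by simp; tauto), hF.frame.reg r (by simp; tauto)]
  · rw [f3.arr _ (by simp), f2.arr _ (by simp), hF.buf]
  · rw [hl3, hl2, f3.arr .link (by simp), f2.arr .link (by simp), f3.reg .cur (by simp),
      f2.reg .cur (by simp)]
    simp [account, refreshes, refresh, enlist, unlist, enliven, forget, addMark, addMod, subMod,
      HCmd.size] at ht₂ ht₃
    omega

end SlidingMUPS

/-! ### Deleting the first letter -/

namespace SlidingMUPS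
open Function

section
open Reg Arr

/-- Account for the loss of the first letter. -/
def discount : HCmd :=
  .assign p (mark.at left) ;; .assign q (link.at p) ;; .assign a (left + len.at p - len.at q) ;;
    -- The longest palindromic suffix is the whole window; lengths are stored increased by one.
    .cond (.eq (len.at cur) (Reg.right + 1 - left)) (.assign cur (link.at cur)) .skip ;;
    forget left ;; .assign left (left + 1) ;; kill ;;
    -- Roots are never recorded, and a mark that is at least as long stays.
    .cond (.conj (.neg (.lt q 3)) (.lt (len.at (mark.at a)) (len.at q)))
      (forget a ;; addMark q) .skip ;;
    -- Here the child sums are read at the end, again for the smaller window.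
    .assign c1 (chsum.at p) ;; .assign c2 (chsum.at q)

/-- Delete the first letter of the window. -/
def drop : HCmd := discount ;; refreshes

end

section
variable {x len link inner st mark : ℕ → ℕ} {nn l m : ℕ}

theorem Marks.congr (h : Marks x len st nn l m mark) {mark' : ℕ → ℕ}
    (he : ∀ a, l ≤ a → a < m → mark' a = mark a) : Marks x len st nn l m mark' := by
  constructor
  · intro a h1 h2
    rw [he a h1 h2]
    exact h.ok a h1 h2
  · intro a b h1 h2 h3
    rw [he a h1 (by omega)]
    exact h.surface a b h1 h2 h3

/-- The longest palindromic prefix occurs elsewhere if it still counts. -/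
theorem Tree.live_delete_self (h : Tree x len link inner st nn l m) {P M : ℕ}
    {mark' mark₂ weight possum chsum : ℕ → ℕ}
    (hP : IsPrefix x len st nn l m P)
    (hM' : Marks x len st nn (l + 1) m mark')
    (he : ∀ a, l + 1 ≤ a → a < m → mark' a = mark a ∨
      mark' a = link P ∧ len (mark a) < len (link P))
    (he₂ : ∀ a, l + 1 ≤ a → a < m → mark₂ a = mark a)
    (hT : Tally link inner nn (l + 1) m M (live x len st nn l m) mark₂ weight possum chsum) :
    P ∈ live x len st nn (l + 1) m ↔ weight P ≠ 0 := by
  have hlk := h.len_link P hP.real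
  have hT' := hT.congr_mark (mark' := mark) fun a h1 h2 => (he₂ a h1 h2).symm
  rw [hT'.weight P (.of_real hP.real)]
  have h' := h.mono_left (l' := l + 1) (by omega)
  have hu : (∃ u ∈ live x len st nn (l + 1) m, link u = P) ↔
      ((live x len st nn l m).filter fun u => link u = P).card ≠ 0 := by
    rw [Finset.card_ne_zero, Finset.filter_nonempty_iff]
    refine exists_congr fun u => and_congr_left fun e => h.live_delete hP ?_
    rintro rfl
    rw [e] at hlk
    omega
  by_cases hc : ∃ u ∈ live x len st nn (l + 1) m, link u = P
  · have h1 := hu.1 hc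
    obtain ⟨u, u1, u2⟩ := hc
    have := h'.two_le_occ hP.real u1 u2
    exact iff_of_true (mem_live.2 ⟨hP.real, Finset.card_pos.1 (by omega)⟩) (by omega)
  · have h1 := not_not.1 (mt hu.2 hc)
    push Not at hc
    rw [h1, mem_live, h'.occ_eq hM' hP.real hc]
    simp only [Nat.mul_zero, Nat.add_zero, Finset.card_ne_zero, hP.real, true_and,
      Finset.filter_nonempty_iff]
    refine exists_congr fun a => and_congr_right fun ha => ?_
    rw [Finset.mem_Ico] at ha
    rcases he a ha.1 ha.2 with e | ⟨e, e'⟩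
    · rw [e]
    · rw [e]
      exact iff_of_false (fun e' => by rw [e'] at hlk; omega) fun e2 => by rw [e2] at e'; omega

end

/-- Only a palindromic suffix that fills the window is destroyed by the deletion. Its link takes
over, and this does not raise the potential. -/
theorem Full.cur_drop {s : St} {x st lv ow : ℕ → ℕ} {l m word : ℕ} (h : Full s x st lv ow l m word)
    (hlm : l < m) {c : ℕ} (hc : c = if s.arr .len (s.reg .cur) = m + 1 - l then
      s.arr .link (s.reg .cur) else s.reg .cur) :
    (2 ≤ c ∧ c < s.reg .nodes) ∧ l + 1 + s.arr .len c ≤ m + 1 ∧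
      At x (s.arr .len) st c (m + 1 - s.arr .len c) ∧
      (∀ q, l + 1 ≤ q → q < m → Pal x q m → m + 1 ≤ q + s.arr .len c) ∧
      s.arr .len c + s.arr .len (s.arr .link c) ≤
        s.arr .len (s.reg .cur) + s.arr .len (s.arr .link (s.reg .cur)) := by
  have htr := h.core.tree
  have hle := h.core.cur_le
  have hnd := h.core.cur_nd
  have hat := h.core.cur_at
  have hmax := h.core.cur_max
  split_ifs at hc with e <;> subst hc
  · have hr : Real (s.reg .nodes) (s.reg .cur) := by
      rcases htr.real_or (by omega) hnd.2 with e' | e' | e'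
      · omega
      · rw [e', htr.len_two] at e; omega
      · exact e'
    have h1 := htr.len_link _ hr
    have h2 := htr.link_lt _ hr
    have h3 := htr.link_at' hr hat
    rw [show m + 1 - s.arr .len (s.reg .cur) + s.arr .len (s.reg .cur) = m + 1 by omega] at h3
    refine ⟨h2, by omega, h3, fun q q1 q2 q3 => ?_, ?_⟩
    · have := htr.len_link_ge hr hat (q := q) (by omega) (by omega) (by
        rwa [show m + 1 - s.arr .len (s.reg .cur) + (s.arr .len (s.reg .cur) - 1) = m by omega])
      omega
    · have := htr.len_link_le (v := s.arr .link (s.reg .cur)) (by omega) h2.2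
      omega
  · exact ⟨hnd, by omega, hat, fun q q1 q2 q3 => hmax q (by omega) q2 q3, le_rfl⟩

theorem discount_wp {N word : ℕ} {s : St} {Q : St → Prop} {x st lv ow : ℕ → ℕ} {l m : ℕ}
    (h : Full s x st lv ow l m word) (hlm : l < m) (hf : s.Fits N word m) (hb : s.Bdd word)
    (hQ : ∀ s', s.Frame [.p, .q, .a, .cur, .left, .c1, .c2] [.weight, .chsum, .possum, .mark] s' →
      Core s' x st lv ow (l + 1) m →
      Marks x (s'.arr .len) st (s'.reg .nodes) (l + 1) m (s'.arr .mark) →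
      s'.Tally (l + 1) m (live x (s'.arr .len) st (s'.reg .nodes) (l + 1) m) →
      s'.reg .p = s.arr .mark l → s'.reg .q = s.arr .link (s.arr .mark l) →
      s'.reg .c1 = s'.arr .chsum (s.arr .mark l) →
      s'.reg .c2 = s'.arr .chsum (s.arr .link (s.arr .mark l)) → s'.out = s.out →
      s.arr .len (s'.reg .cur) + s.arr .len (s.arr .link (s'.reg .cur)) ≤
        s.arr .len (s.reg .cur) + s.arr .len (s.arr .link (s.reg .cur)) → Q s') :
    discount.wp N word Q s := by
  have hN := hf.nodes
  have hW := hf.word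
  have hR := hf.right
  have htr := h.core.tree
  have hM := h.marks
  have hP := hM.isPrefix hlm
  obtain ⟨hc1, hc2, hc3, hc4, hc5⟩ := h.cur_drop hlm rfl
  set P := s.arr .mark l with hPdef
  set L := s.arr .link P with hLdef
  have hP2 := htr.two_le_len P hP.real
  have hPl := h.core.len_le hP.real
  have hPr := hP.right
  have hlk : s.arr .len L < s.arr .len P := htr.len_link P hP.real
  have hlt := htr.link_lt P hP.real
  have hmkl : ∀ b, l ≤ b → b < m → s.arr .mark b < s.reg .nodes := by
    intro b b1 b2
    by_cases e : s.arr .mark b = 0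
    · rw [e]; have := htr.three_le; omega
    · exact (hM.ok b b1 b2 e).1.2
  have hL1 : 1 ≤ s.arr .len L := by
    rcases htr.real_or (v := L) (by omega) hlt.2 with e | e | e
    · omega
    · rw [e, htr.len_two]
    · have := htr.two_le_len _ e; omega
  set pos := l + s.arr .len P - s.arr .len L with hpos
  have hM' := Marks.delete htr hP hM h.core.len0 hpos
  set c := (if s.arr .len (s.reg .cur) = m + 1 - l then
      s.arr .link (s.reg .cur) else s.reg .cur) with hcdef
  have hmain : ∀ s₁ : St, s.Frame [.p, .q, .a, .cur, .left, .c1, .c2]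
      [.weight, .chsum, .possum, .mark] s₁ → s₁.reg .p = P → s₁.reg .q = L → s₁.reg .a = pos →
      s₁.reg .cur = c → s₁.reg .left = l → s₁.Tally l m (live x (s.arr .len) st (s.reg .nodes) l m) →
      s₁.arr .mark = s.arr .mark → s₁.out = s.out →
      (forget .left ;; .assign .left (Reg.left + 1) ;; kill ;;
    .cond (.conj (.neg (.lt Reg.q 3)) (.lt (Arr.len.at (Arr.mark.at Reg.a)) (Arr.len.at Reg.q)))
      (forget .a ;; addMark .q) .skip ;;
    .assign .c1 (Arr.chsum.at Reg.p) ;; .assign .c2 (Arr.chsum.at Reg.q)).wp N word Q s₁ := by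
    intro s₁ f1 p1 q1 a1 cu1 l1 T1 m1 o1
    have hfr : ∀ {s' : St}, s.Frame [.p, .q, .a, .cur, .left, .c1, .c2]
      [.weight, .chsum, .possum, .mark] s' → s'.Fits N word m := fun f =>
        hf.frame (f.reg _ (by simp)) (f.reg _ (by simp)) (f.reg _ (by simp))
    have hext : ∀ {s₁ s₂ : St} {rs : List Reg} {as : List Arr}, s.Frame [.p, .q, .a, .cur, .left, .c1, .c2]
        [.weight, .chsum, .possum, .mark] s₁ → s₁.Frame rs as s₂ →
        rs ⊆ [.p, .q, .a, .cur, .left, .c1, .c2] → as ⊆ [.weight, .chsum, .possum, .mark] →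
        s.Frame [.p, .q, .a, .cur, .left, .c1, .c2] [.weight, .chsum, .possum, .mark] s₂ :=
      fun f g h1 h2 => f.comp (g.mono h1 h2)
    refine forget_wp (l := l) (m := m) T1 (hfr f1) ?_ l1.ge (by omega) fun s₂ f2 T2 m2 o2 => ?_
    · rw [m1, l1, f1.reg .nodes (by simp)]; exact hmkl l le_rfl hlm
    have g2 := hext f1 f2 (by simp) (by simp)
    rw [m1, l1] at m2
    have hl2 : s₂.reg .left = l := by rw [f2.reg _ (by simp), l1]
    refine ⟨by decide, by simp [hl2]; omega, ?_⟩
    simp only [HExpr.eval_add, HExpr.eval_reg, HExpr.eval_ofNat, hl2]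
    have T2' := T2.shrink (by rw [m2, update_self])
    have g3 := g2.set (r := .left) (by simp) (l + 1)
    have hp3 : (s₂.set .left (l + 1)).reg .p = P := by simp [f2.reg .p (by simp), p1]
    -- At this moment the mark at `l` is gone, while the weights still count the old live nodes and
    -- the mark of the link has not been moved.
    have hself := htr.live_delete_self (mark₂ := s₂.arr .mark) hP hM' (by
      intro b b1 b2
      split_ifs with hc
      · by_cases e : b = pos
        · rw [e, update_self]; exact Or.inr ⟨rfl, hc.2⟩
        · rw [update_of_ne e]; exact Or.inl rfl
      · exact Or.inl rfl) (fun b b1 b2 => by rw [m2, update_of_ne (by omega)])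
      (by
        have := T2'
        rwa [g2.arr .link (by simp), g2.arr .inner (by simp), g2.reg .nodes (by simp)] at this)
    refine kill_wp (l := l + 1) (m := m) (A := live x (s.arr .len) st (s.reg .nodes) l m)
      (by simpa [St.Tally] using T2') (hfr g3) ?_ ?_ ?_ ?_ fun s₄ f4 T4 o4 => ?_
    · rw [hp3, g3.reg .nodes (by simp)]; exact .of_real hP.real
    · rw [hp3, g3.reg .nodes (by simp), g3.arr .link (by simp)]; exact ⟨by omega, hlt.2⟩
    · rw [hp3, g3.reg .nodes (by simp), g3.arr .inner (by simp)]; exact htr.inner_lt P hP.real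
    · rw [hp3]
      exact mem_live.2 ⟨hP.real, l, mem_occ.2 ⟨le_rfl, hlm, hPr, hP.at_⟩⟩
    -- Among all nodes only `P` can die, and its weight decides.
    have hlive : (if (s₂.set .left (l + 1)).arr .weight ((s₂.set .left (l + 1)).reg .p) = 0 then
        (live x (s.arr .len) st (s.reg .nodes) l m).erase ((s₂.set .left (l + 1)).reg .p) else
        live x (s.arr .len) st (s.reg .nodes) l m) =
        live x (s.arr .len) st (s.reg .nodes) (l + 1) m := by
      rw [hp3, St.set_arr]
      ext v
      by_cases e : v = P
      · rw [e, hself]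
        have : P ∈ live x (s.arr .len) st (s.reg .nodes) l m :=
          mem_live.2 ⟨hP.real, l, mem_occ.2 ⟨le_rfl, hlm, hPr, hP.at_⟩⟩
        split_ifs with h0 <;> simp [h0, this]
      · rw [htr.live_delete hP e]
        split_ifs with h0 <;> simp [e]
    rw [hlive] at T4
    have g4 := hext g3 f4 (by simp) (by simp)
    have m4 : s₄.arr .mark = update (s.arr .mark) l 0 := by rw [f4.arr _ (by simp)]; exact m2
    have p4 : s₄.reg .p = P := by rw [f4.reg _ (by simp), hp3]
    have q4 : s₄.reg .q = L := by
      rw [f4.reg _ (by simp)]; simp [f2.reg .q (by simp), q1]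
    have a4 : s₄.reg .a = pos := by
      rw [f4.reg _ (by simp)]; simp [f2.reg .a (by simp), a1]
    have cu4 : s₄.reg .cur = c := by
      rw [f4.reg _ (by simp)]; simp [f2.reg .cur (by simp), cu1]
    have l4 : s₄.reg .left = l + 1 := by rw [f4.reg _ (by simp)]; simp
    have o4' : s₄.out = s.out := by rw [o4, St.set_out, o2, o1]
    have hend : ∀ s₅ : St, s₄.Frame [] [.weight, .possum, .mark] s₅ →
        s₅.Tally (l + 1) m (live x (s.arr .len) st (s.reg .nodes) (l + 1) m) →
        Marks x (s.arr .len) st (s.reg .nodes) (l + 1) m (s₅.arr .mark) → s₅.out = s.out →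
        (HCmd.assign .c1 (Arr.chsum.at Reg.p) ;; .assign .c2 (Arr.chsum.at Reg.q)).wp N word Q s₅ := by
      intro s₅ f5 T5 M5 o5
      have g5 := hext g4 f5 (by simp) (by simp)
      have e1 : s₅.reg .p = P := by rw [f5.reg _ (by simp), p4]
      have e2 : s₅.reg .q = L := by rw [f5.reg _ (by simp), q4]
      have e3 : s₅.reg .cur = c := by rw [f5.reg _ (by simp), cu4]
      have e4 : s₅.reg .left = l + 1 := by rw [f5.reg _ (by simp), l4]
      simp only [HCmd.wp, HExpr.eval_arr, HExpr.eval_reg, St.set_reg, St.set_arr, reduceCtorEq,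
        if_false, e1, e2]
      have hn5 : s₅.reg .nodes = s.reg .nodes := g5.reg _ (by simp)
      refine ⟨by decide, (T5.chsum_lt (hfr g5) (hn5 ▸ Nd.of_real hP.real)).trans (by omega),
        by decide, (T5.chsum_lt (hfr g5) (hn5 ▸ ⟨by omega, hlt.2⟩)).trans (by omega), ?_⟩
      have g6 := (g5.set (r := .c1) (by simp) (s₅.arr .chsum P)).set (r := .c2) (by simp)
        (s₅.arr .chsum L)
      set s₆ := (s₅.set .c1 (s₅.arr .chsum P)).set .c2 (s₅.arr .chsum L) with hs₆
      have d1 : s₆.reg .cur = c := by simp [hs₆, e3]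
      have d2 : s₆.reg .left = l + 1 := by simp [hs₆, e4]
      have hn6 : s₆.reg .nodes = s.reg .nodes := g6.reg _ (by simp)
      have hl6 : s₆.arr .len = s.arr .len := g6.arr _ (by simp)
      -- `Core.frame` applies after `cur` and `left` have been put back to their old values; the
      -- fields that mention them are supplied separately.
      have hC6 : Core s₆ x st lv ow (l + 1) m := by
        have hc := h.core.frame (s' := (s₆.set .cur (s.reg .cur)).set .left (s.reg .left)) (rs := [.p, .q, .a, .c1, .c2])
          (as := [.weight, .chsum, .possum, .mark]) ⟨fun r hr => by
            simp only [List.mem_cons, List.not_mem_nil, or_false, not_or] at hr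
            simp only [St.set_reg]
            split_ifs with z1 z2
            · rw [z1]
            · rw [z2]
            · exact g6.reg r (by simp; tauto), g6.arr⟩ (by decide) (by decide)
        refine ⟨d2, (g6.reg _ (by simp)).trans h.core.right, hlm, hc.buf, hc.len0,
          (Tree.mono_left (l' := l + 1) hc.tree (by omega)), hc.fits,
          ⟨hc.dict.skip, hc.dict.pos, hc.dict.top, hc.dict.own⟩, hc.entry, hc.ground, hc.nodes_le,
          ?_, ?_, ?_, ?_⟩
        · rw [d1, hn6]; exact hc1
        · rw [d1, hl6]; exact hc2
        · rw [d1, hl6]; exact hc3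
        · rw [d1, hl6]; exact hc4
      refine hQ s₆ g6 hC6 (by rw [hl6, hn6]; exact M5) (by rw [hl6, hn6]; exact T5) ?_ ?_ ?_ ?_
        o5 ?_
      · simp [hs₆, e1]
      · simp [hs₆, e2]
      · simp [hs₆]
      · simp [hs₆]
      · rw [d1]; exact hc5
    have hml : ∀ b, l + 1 ≤ b → s₄.arr .mark b = s.arr .mark b := fun b b1 => by
      rw [m4, update_of_ne (by omega)]
    have hlen4 : s₄.arr .len = s.arr .len := g4.arr _ (by simp)
    have hn4 : s₄.reg .nodes = s.reg .nodes := g4.reg _ (by simp)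
    have hpl : l + 1 ≤ pos := by omega
    have htest : (HTest.conj (.neg (.lt Reg.q 3))
        (.lt (Arr.len.at (Arr.mark.at Reg.a)) (Arr.len.at Reg.q))).Holds s₄ ↔
        3 ≤ L ∧ s.arr .len (s.arr .mark pos) < s.arr .len L := by
      simp only [HTest.Holds, HExpr.eval_reg, HExpr.eval_arr, HExpr.eval_ofNat, q4, a4, hlen4,
        hml pos hpl, not_lt]
    refine ⟨fun ht => ?_, fun ht => hend s₄ (.refl _) T4 ?_ o4'⟩
    · rw [htest] at ht
      rw [if_pos ht] at hM'
      have hpm : pos < m := by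
        have : 2 ≤ s.arr .len L := htr.two_le_len L ⟨ht.1, hlt.2⟩
        omega
      refine forget_wp (l := l + 1) (m := m) T4 (hfr g4) ?_ (by omega) (by omega) fun s₅ f5 T5 m5 o5 => ?_
      · rw [a4, hml pos hpl, hn4]; exact hmkl pos (by omega) hpm
      have g5 := hext g4 f5 (by simp) (by simp)
      have a5 : s₅.reg .a = pos := by rw [f5.reg _ (by simp), a4]
      have q5 : s₅.reg .q = L := by rw [f5.reg _ (by simp), q4]
      rw [a4] at m5
      refine addMark_wp (l := l + 1) (m := m) T5 (hfr g5) ?_ (by rw [a5, m5, update_self]) (by omega)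
        (by omega) fun s₆ f6 T6 m6 o6 => ?_
      · rw [q5, g5.reg .nodes (by simp)]; exact ⟨by omega, hlt.2⟩
      refine hend s₆ (f5.comp f6) T6 (hM'.congr fun b b1 b2 => ?_) (by rw [o6, o5, o4'])
      rw [m6, m5, a5, q5, update_idem]
      by_cases e : b = pos
      · rw [e, update_self, update_self]
      · rw [update_of_ne e, update_of_ne e, hml b b1]
    · rw [htest] at ht
      rw [if_neg ht] at hM'
      exact hM'.congr fun b b1 _ => hml b b1
  have hl0 := h.core.left
  have hw : ∀ a i, s.arr a i < word := hb.arr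
  have f0 := St.Frame.refl (rs := [.p, .q, .a, .cur, .left, .c1, .c2])
    (as := [.weight, .chsum, .possum, .mark]) s
  have hT : s.Tally l m (live x (s.arr .len) st (s.reg .nodes) l m) := h.tally
  simp only [discount]
  refine ⟨by decide, by simpa using hw _ _, by decide, by simpa using hw _ _, by decide, ?_, ?_⟩
  · have hposw : pos < word := by omega
    simpa [hl0] using hposw
  simp only [HExpr.eval_arr, HExpr.eval_reg, HExpr.eval_add, HExpr.eval_sub, St.set_reg,
    St.set_arr, reduceCtorEq, if_true, if_false, hl0]
  have g1 := ((f0.set (r := .p) (by simp) P).set (r := .q) (by simp) L).set (r := .a) (by simp) pos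
  have hcond : (HTest.eq (Arr.len.at Reg.cur) (Reg.right + 1 - Reg.left)).Holds
      (((s.set .p P).set .q L).set .a pos) ↔ s.arr .len (s.reg .cur) = m + 1 - l := by
    simp [HTest.Holds, hl0, h.core.right]
  refine ⟨fun ht => ?_, fun ht => ?_⟩
  · rw [hcond] at ht
    rw [if_pos ht] at hcdef
    refine ⟨by decide, by simpa using hw _ _, ?_⟩
    refine hmain _ (g1.set (by simp) _) (by simp [hPdef]) (by simp [hLdef, hPdef])
      (by simp [hpos, hLdef, hPdef]) (by simp [hcdef]) (by simp [hl0])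
      (by simpa [St.Tally] using hT) (by simp) (by simp)
  · rw [hcond] at ht
    rw [if_neg ht] at hcdef
    refine hmain _ g1 (by simp [hPdef]) (by simp [hLdef, hPdef]) (by simp [hpos, hLdef, hPdef]) (by simp [hcdef]) (by simp [hl0])
      (by simpa [St.Tally] using hT) (by simp) (by simp)

theorem drop_spec {N word : ℕ} {s : St} {x st lv ow : ℕ → ℕ} {l m : ℕ}
    (h : Full s x st lv ow l m word) (hlm : l < m) (hf : s.Fits N word m) (hb : s.Bdd word) :
    Ex N word drop s fun t s' => Full s' x st lv ow (l + 1) m word ∧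
      (∀ r, r ∉ scratch → r ≠ .left → s'.reg r = s.reg r) ∧ s'.arr .buf = s.arr .buf ∧
      s'.arr .head = s.arr .head ∧ s'.reg .nodes = s.reg .nodes ∧
      t + 2 * (s'.arr .len (s'.reg .cur) + s'.arr .len (s'.arr .link (s'.reg .cur))) ≤
      2 * (s.arr .len (s.reg .cur) + s.arr .len (s.arr .link (s.reg .cur))) + 250 := by
  have htr := h.core.tree
  have hP := h.marks.isPrefix hlm
  obtain ⟨t₂, s₂, r₂, ⟨ht₂, f2, hcore2, hM2, hT2, p2, q2, c12, c22, ho2, hcur⟩, hb₂⟩ :=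
    (discount_wp (N := N) (Q := fun s' =>
      s.Frame [.p, .q, .a, .cur, .left, .c1, .c2] [.weight, .chsum, .possum, .mark] s' ∧
      Core s' x st lv ow (l + 1) m ∧
      Marks x (s'.arr .len) st (s'.reg .nodes) (l + 1) m (s'.arr .mark) ∧
      s'.Tally (l + 1) m (live x (s'.arr .len) st (s'.reg .nodes) (l + 1) m) ∧
      s'.reg .p = s.arr .mark l ∧ s'.reg .q = s.arr .link (s.arr .mark l) ∧
      s'.reg .c1 = s'.arr .chsum (s.arr .mark l) ∧
      s'.reg .c2 = s'.arr .chsum (s.arr .link (s.arr .mark l)) ∧ s'.out = s.out ∧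
      s.arr .len (s'.reg .cur) + s.arr .len (s.arr .link (s'.reg .cur)) ≤
        s.arr .len (s.reg .cur) + s.arr .len (s.arr .link (s.reg .cur)))
      h hlm hf hb fun s' a1 a2 a3 a4 a5 a6 a7 a8 a9 a10 =>
        ⟨a1, a2, a3, a4, a5, a6, a7, a8, a9, a10⟩).run.bdd hb
  have hn2 : s₂.reg .nodes = s.reg .nodes := f2.reg _ (by simp)
  have hl2 : s₂.arr .len = s.arr .len := f2.arr _ (by simp)
  have hi2 : s₂.arr .inner = s.arr .inner := f2.arr _ (by simp)
  have hf₂ : s₂.Fits N word m := hf.frame (f2.reg _ (by simp)) (f2.reg _ (by simp)) hn2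
  have hL₂ : Listing s₂ word := h.listing.congr (f2.reg _ (by simp)) hn2.ge (f2.arr _ (by simp))
    (f2.arr _ (by simp)) ho2 (fun v _ => by rw [f2.arr .slot (by simp), hl2]; exact ⟨rfl, rfl⟩)
    (fun v h1 h2 => by rw [hn2] at h1; exact absurd h1 h2)
  obtain ⟨t₃, s₃, r₃, ht₃, f3, hL₃, hsh⟩ := (refreshes_wp (N := N) (Q := fun s' =>
      s₂.Frame [.cnt, .t, .u] [.owner, .entry, .slot] s' ∧ Listing s' word ∧
      (∀ v e, Real (s₂.reg .nodes) v → (Shown s' v e ↔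
        if v = s₂.reg .p ∨ v = s₂.reg .c1 ∨ v = s₂.reg .q ∨ v = s₂.reg .c2 then Due s₂ v e
        else Shown s₂ v e))) hL₂ hf₂ hb₂
      (fun v hv => hT2.possum_lt hf₂ (.of_real hv))
      (fun v hv => by have := hcore2.len_le hv; have := hf.right; omega)
      fun s' a1 a2 a3 => ⟨a1, a2, a3⟩).run
  have hn3 : s₃.reg .nodes = s₂.reg .nodes := f3.reg _ (by simp)
  have hl3 : s₃.arr .len = s₂.arr .len := f3.arr _ (by simp)
  have hi3 : s₃.arr .inner = s₂.arr .inner := f3.arr _ (by simp)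
  refine ⟨t₂ + t₃, s₃, r₂.seq r₃, ⟨hcore2.frame f3 (by decide) (by decide), ?_, ?_,
    hL₃, ?_⟩, ?_, ?_, ?_, by rw [hn3, hn2], ?_⟩
  · rw [hn3, hl3, f3.arr .mark (by simp)]; exact hM2
  · rw [St.Tally, hn3, hl3, hi3, f3.arr .mark (by simp), f3.arr .weight (by simp),
      f3.arr .possum (by simp), f3.arr .chsum (by simp), f3.arr .link (by simp),
      f3.reg .modulus (by simp)]
    exact hT2
  · intro v e hv
    rw [hn3] at hv
    rw [hsh v e hv, hl3, hi3, f3.reg .base (by simp)]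
    have hdue := due_iff (e := e) hcore2.tree hM2 hT2 hf₂ hv
    split_ifs with hc
    · exact hdue
    · simp only [not_or] at hc
      obtain ⟨n1, n2, n3, n4⟩ := hc
      rw [hn2] at hv
      rw [p2] at n1
      rw [c12] at n2
      rw [q2] at n3
      rw [c22] at n4
      rw [Shown, f2.arr .slot (by simp), f2.arr .entry (by simp), hl2, hi2, f2.reg .base (by simp)]
      refine (h.shown v e hv).trans (exists_congr fun b => and_congr_left fun _ => ?_)
      rw [St.Tally, hl2, hi2, hn2, f2.arr .link (by simp)] at hT2
      exact htr.target_delete hP hT2 (by rw [hf₂.modulus]; have := hf.nodes; omega) hv n1 n3 n2 n4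
  · intro r hr hr'
    simp only [scratch, List.mem_cons, List.not_mem_nil, or_false, not_or] at hr
    rw [f3.reg r (by simp; tauto), f2.reg r (by simp; tauto)]
  · rw [f3.arr _ (by simp), f2.arr _ (by simp)]
  · rw [f3.arr _ (by simp), f2.arr _ (by simp)]
  · rw [hl3, hl2, f3.arr .link (by simp), f2.arr .link (by simp), f3.reg .cur (by simp)]
    simp [discount, refreshes, refresh, enlist, unlist, kill, forget, addMark, addMod, subMod,
      HCmd.size] at ht₂ ht₃
    omega

end SlidingMUPS

/-! ### Resetting the structure and rebuilding it from the current window -/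

namespace SlidingMUPS
open Function

/-- Set the entry `i` of the arrays to zero. -/
def clear (i : HExpr) : List Arr → HCmd
  | [] => .skip
  | b :: bs => .store b i 0 ;; clear i bs

section
open Reg Arr

/-- The arrays that are cleared for the roots of the palindromic tree. -/
def cleared : List Arr := [key, Arr.right, down, weight, possum, chsum]

/-- The empty window. -/
def reset : HCmd :=
  -- Only the null entry and the two roots need values. All other entries are written when a
  -- position, a node or a cell comes into use, so the reset takes constant time.
  clear 0 [len, key] ;; clear 1 (len :: cleared) ;; clear 2 cleared ;; .store len 2 1 ;;
    .store head 1 1 ;; .store head 2 2 ;; .store link 1 1 ;; .store link 2 1 ;;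
    .assign nodes 3 ;; .assign cells 3 ;; .assign cur 2 ;; .assign left 0 ;;
    .assign Reg.right 0 ;; .assign cnt 0

/-- Append the letters at the positions from `k` to `e` of the buffer. -/
def refill : HCmd :=
  .loop (.lt k e) (.assign letter (buf.at k) ;; append ;; .assign k (k + 1))

/-- Start a new epoch, with the current window as its text. -/
def rebuild : HCmd :=
  -- `base` converts positions of the epoch into positions of `S`, so it advances by the letters
  -- that are discarded.
  .assign k left ;; .assign e Reg.right ;; .assign base (base + left) ;; reset ;; refill ;;
    .assign epoch Reg.right

/-- Delete the first letter; start a new epoch when no letter of the first window of the current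
epoch is left. -/
def delete : HCmd := drop ;; .cond (.lt epoch left) rebuild .skip

end

theorem Full.initial {s : St} {word : ℕ} (x st : ℕ → ℕ) (h1 : s.reg .nodes = 3)
    (h2 : s.reg .cells = 3) (h3 : s.reg .cur = 2) (h4 : s.reg .left = 0) (h5 : s.reg .right = 0)
    (h6 : s.reg .cnt = 0) (h7 : s.arr .len 0 = 0 ∧ s.arr .len 1 = 0 ∧ s.arr .len 2 = 1)
    (h8 : s.arr .head 1 = 1 ∧ s.arr .head 2 = 2) (h9 : s.arr .link 1 = 1 ∧ s.arr .link 2 = 1)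
    (h10 : s.arr .key 0 = 0) (h11 : ∀ a ∈ cleared, s.arr a 1 = 0 ∧ s.arr a 2 = 0) :
    Full s x st (fun _ => 0) id 0 0 word := by
  have hr : ∀ v, ¬ Real 3 v := by unfold Real; omega
  have hnd : ∀ v, Nd 3 v → v = 1 ∨ v = 2 := by unfold Nd; omega
  have hz : ∀ a ∈ cleared, ∀ v, Nd 3 v → s.arr a v = 0 := fun a ha v hv => by
    rcases hnd v hv with rfl | rfl
    · exact (h11 a ha).1
    · exact (h11 a ha).2
  have hk := hz .key (by simp [cleared])
  have hR := hz .right (by simp [cleared])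
  have hD := hz .down (by simp [cleared])
  have hlive : live x (s.arr .len) st 3 0 0 = ∅ := by simp [live]
  refine ⟨⟨h4, h5, le_rfl, by simp, h7.1, ?_, ?_, ⟨?_, by omega, ?_, ?_⟩, ?_, ?_, by omega,
    by omega, ?_, ?_, ?_⟩, ⟨?_, ?_⟩, ?_, ⟨?_, ?_⟩, ?_⟩ <;> try rw [h1]
  · exact ⟨le_rfl, h7.2.1, h7.2.2, h9.1, h9.2, fun v hv => absurd hv (hr v),
      fun v hv => absurd hv (hr v), fun v _ hv => absurd hv (hr v), fun v hv => absurd hv (hr v),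
      fun v hv => absurd hv (hr v), fun v hv => absurd hv (hr v), fun v hv => absurd hv (hr v),
      fun v hv => absurd hv (hr v), fun v hv => absurd hv (hr v), fun v hv => absurd hv (hr v),
      fun a b _ _ _ => by omega⟩
  · exact fun v hv => absurd hv (hr v)
  · rw [h2]
    exact ⟨h10, fun p q _ _ ho _ _ => ho, fun p hp _ => hR p hp,
      fun p hp h0 => absurd (hk p hp) h0, fun p q hp hq _ _ hlt => by rw [hk p hp] at hlt; omega,
      fun p hp => by simp [hD p hp], fun p _ h0 => absurd rfl h0, fun p q _ _ _ _ h0 => absurd rfl h0,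
      fun p r _ _ _ h0 => by omega, fun p _ h0 => absurd rfl h0, fun p _ h0 => absurd rfl h0⟩
  · intro o h0 ho
    rw [h2]
    have hh : s.arr .head o = o := by
      rcases hnd o ⟨h0, ho⟩ with rfl | rfl
      · exact h8.1
      · exact h8.2
    rw [hh]
    exact ⟨⟨h0, ho⟩, rfl, hk o ⟨h0, ho⟩, fun _ _ _ => le_rfl, fun q _ e _ => e⟩
  · rw [h2]; exact fun p hp => hp
  · intro o k u
    rw [St.Entry, h2]
    refine iff_of_false ?_ fun h => hr u h.1
    rintro ⟨p, p1, -, -, p4, p5, -⟩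
    exact p5 (p4 ▸ hk p p1)
  · rw [h2]; rfl
  · rw [h3, h7.2.2]
  · rw [h3, At, h7.2.2]; exact fun k hk => by omega
  · intro q _ hq; omega
  · intro a _ ha; omega
  · intro a b _ _ hb; omega
  · rw [St.Tally, h1, hlive]
    exact ⟨by simp, fun v hv => by rw [hz .weight (by simp [cleared]) v hv]; simp,
      fun v hv => by rw [hz .possum (by simp [cleared]) v hv]; simp,
      fun v hv => by rw [hz .chsum (by simp [cleared]) v hv]; simp⟩
  · exact fun v hv => absurd hv (hr v)
  · intro i hi; omega
  · exact fun v _ hv => absurd hv (hr v)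

theorem clear_wp {N word : ℕ} {i : HExpr} {i₀ : ℕ} {as : List Arr} {s : St} {Q : St → Prop}
    (hi : ∀ s' : St, s'.reg = s.reg → i.eval s' = i₀) (hN : i₀ < N) (hw : 0 < word)
    (hQ : ∀ s' : St, s'.reg = s.reg → (∀ a j, s'.arr a j = if a ∈ as ∧ j = i₀ then 0 else s.arr a j) →
      s'.out = s.out → Q s') : (clear i as).wp N word Q s := by
  induction as generalizing s with
  | nil => rw [clear, HCmd.wp]; exact hQ s rfl (by simp) rfl
  | cons a as ih =>
    have e := hi s rfl
    rw [clear, HCmd.wp, HCmd.wp]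
    refine ⟨by rw [e]; exact hN, hw, ih (fun s' h => hi s' h) fun s' h1 h2 h3 => hQ s' h1 ?_ h3⟩
    intro b j
    rw [h2, St.put_arr, e]
    by_cases hj : j = i₀
    · by_cases hb : b = a
      · simp [hb, hj]
      · simp [hb, hj]
    · by_cases hb : b = a
      · simp [hb, hj]
      · simp [hb, hj]

theorem reset_wp {N word : ℕ} {s : St} {Q : St → Prop} (x st : ℕ → ℕ) (hN : 3 < N) (hw : 3 < word)
    (hQ : ∀ s', Full s' x st (fun _ => 0) id 0 0 word →
      s.Frame [.nodes, .cells, .cur, .left, .right, .cnt]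
        [.len, .key, .right, .down, .weight, .possum, .chsum, .head, .link] s' →
      s'.reg .cur = 2 → s'.arr .len 2 = 1 → s'.arr .link 2 = 1 → s'.arr .len 1 = 0 → Q s') :
    reset.wp N word Q s := by
  simp only [reset, HCmd.wp]
  refine clear_wp (i₀ := 0) (fun _ _ => rfl) (by omega) (by omega) fun s₁ r1 a1 o1 => ?_
  refine clear_wp (i₀ := 1) (fun _ _ => rfl) (by omega) (by omega) fun s₂ r2 a2 o2 => ?_
  refine clear_wp (i₀ := 2) (fun _ _ => rfl) (by omega) (by omega) fun s₃ r3 a3 o3 => ?_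
  have hr : s₃.reg = s.reg := r3.trans (r2.trans r1)
  simp only [HExpr.eval_ofNat]
  refine ⟨by omega, by omega, by omega, by omega, by omega, by omega, by omega, by omega, by omega,
    by omega, by decide, by omega, by decide, by omega, by decide, by omega, by decide, by omega,
    by decide, by omega, by decide, by omega, ?_⟩
  refine hQ _ (Full.initial x st ?_ ?_ ?_ ?_ ?_ ?_ ?_ ?_ ?_ ?_ ?_) ⟨?_, ?_⟩ ?_ ?_ ?_ ?_
  · simp
  · simp
  · simp
  · simp
  · simp
  · simp
  · simp [a3, a2, a1, cleared]
  · simp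
  · simp
  · simp [a3, a2, a1, cleared]
  · intro a ha
    simp only [cleared, List.mem_cons, List.not_mem_nil, or_false] at ha
    rcases ha with rfl | rfl | rfl | rfl | rfl | rfl <;> simp [a3, a2, cleared]
  · intro r h
    simp only [List.mem_cons, List.not_mem_nil, or_false, not_or] at h
    simp [h, hr]
  · intro a h
    simp only [List.mem_cons, List.not_mem_nil, or_false, not_or] at h
    ext j
    simp [h, a3, a2, a1, cleared]
  · simp
  · simp
  · simp
  · simp [a3, a2, cleared]

theorem Full.congr {s s' : St} {x st lv ow : ℕ → ℕ} {l m word : ℕ}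
    (h : Full s x st lv ow l m word) (hr : ∀ r ∈ [Reg.left, .right, .nodes, .cells, .cur, .cnt,
      .modulus, .base], s'.reg r = s.reg r) (ha : s'.arr = s.arr) (ho : s'.out = s.out) :
    Full s' x st lv ow l m word := by
  have hc : Core s' x st lv ow l m := h.core.frame
    (rs := [.d, .letter, .out, .cnt, .base, .epoch, .modulus, .x, .y, .t, .v, .p, .q, .a, .u, .c1,
      .c2, .k, .e]) (as := [])
    ⟨fun r h1 => hr r (by revert h1; cases r <;> simp), fun a _ => by rw [ha]⟩ (by decide) (by decide)
  simp only [List.forall_mem_cons] at hr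
  obtain ⟨-, -, r3, -, -, r6, r7, r8, -⟩ := hr
  refine ⟨hc, ?_, ?_, ?_, ?_⟩
  · rw [ha, r3]; exact h.marks
  · rw [St.Tally, ha, r3, r7]; exact h.tally
  · exact h.listing.congr r6 r3.ge (by rw [ha]) (by rw [ha]) ho (fun v _ => by rw [ha]; exact ⟨rfl, rfl⟩)
      fun v h1 h2 => by rw [r3] at h1; exact absurd h1 h2
  · intro v e
    rw [Shown, ha, r3, r8]; exact h.shown v e

end SlidingMUPS

/-! ### Amortized analysis of the operations -/

namespace SlidingMUPS
open Function

/-- The potential of the palindromic suffix of the window. -/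
def St.suffixes (s : St) : ℕ := 2 * (s.arr .len (s.reg .cur) + s.arr .len (s.arr .link (s.reg .cur)))

/-- The text moves to the front of the buffer in place: the append of letter `r` writes the entry
`r`, and the letters still to be read stand at `c + r + 1` or later. -/
theorem refill_spec {N word : ℕ} {x : ℕ → ℕ} {c n D : ℕ}
    (hD : ((Finset.range n).image x).card ≤ D) (hx : ∀ k, x k + 1 < word) (hcw : c + n < word)
    (hN : 4 * n + 20 < N) : ∀ (u r : ℕ) (s : St) (st lv ow : ℕ → ℕ), r + u = n →
    Full s x st lv ow 0 r word → s.reg .k = c + r → s.reg .e = c + n →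
    (∀ q, r ≤ q → q < n → s.arr .buf (c + q) = x q) → s.reg .modulus = N →
    s.reg .base + 4 * N ≤ word → s.Bdd word → Ex N word refill s fun t s' =>
      (∃ st' lv' ow', Full s' x st' lv' ow' 0 n word) ∧
      (∀ r, r ∉ scratch → r ≠ .letter → r ≠ .k → s'.reg r = s.reg r) ∧
      t + s'.suffixes ≤ s.suffixes + u * (80 * Nat.log 2 (D + 1) + 303) + 1 := by
  intro u
  induction u with
  | zero =>
    intro r s st lv ow hr hF hk he _ _ _ _
    obtain rfl : r = n := by omega
    exact ⟨1, s, .loopDone (by simp [HTest.Holds, hk, he]), ⟨st, lv, ow, hF⟩, fun _ _ _ _ => rfl,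
      by omega⟩
  | succ u ih =>
    intro r s st lv ow hr hF hk he hbuf hmod hbase hb
    have hn := hF.core.nodes_le
    have hlet : s.arr .buf (s.reg .k) = x r := by rw [hk, hbuf r le_rfl (by omega)]
    have r₁ : HRun N word (.assign .letter (Arr.buf.at Reg.k)) s 1 (s.set .letter (x r)) := by
      have := HRun.assign (N := N) (word := word) s .letter (Arr.buf.at Reg.k) (by decide)
        (by simpa using hb.arr _ _)
      simpa [hlet] using this
    have hF₁ : Full (s.set .letter (x r)) x st lv ow 0 r word := hF.congr (by simp) rfl rfl
    obtain ⟨t₂, s₂, r₂, ⟨⟨st', lv', ow', hF₂⟩, hreg, hbuf₂, htime⟩, hb₂⟩ :=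
      (append_spec (N := N) (H := Nat.log 2 (D + 1)) hF₁ (fun o h0 ho => hF₁.core.height
        ((Finset.card_le_card (Finset.image_subset_image (Finset.range_mono (by omega)))).trans hD)
        h0 ho) (by simp) (hx r) (r₁.bdd hb) ⟨by simpa using hmod, by simpa using hbase,
          by simp; omega, by omega⟩ (by simp; omega)).bdd (r₁.bdd hb)
    have hk₂ : s₂.reg .k = c + r := by rw [hreg _ (by decide)]; simp [hk]
    have r₃ : HRun N word (.assign .k (Reg.k + 1)) s₂ 1 (s₂.set .k (c + (r + 1))) := by
      have := HRun.assign (N := N) (word := word) s₂ .k (Reg.k + 1) (by decide)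
        (by simp [hk₂]; omega)
      simpa [hk₂, Nat.add_assoc] using this
    obtain ⟨t₄, s₄, r₄, hF₄, hreg₄, ht₄⟩ := ih (r + 1) (s₂.set .k (c + (r + 1))) st' lv' ow' (by omega)
      (hF₂.congr (by simp) rfl rfl) (by simp) (by simp [hreg .e (by decide), he]) (by
        intro q q1 q2
        rw [St.set_arr, hbuf₂, update_of_ne (by omega)]
        exact hbuf q (by omega) q2)
      (by simp [hreg .modulus (by decide), hmod]) (by simpa [hreg .base (by decide)] using hbase)
      (r₃.bdd hb₂)
    refine ⟨_, s₄, .loopStep ?_ (r₁.seq (r₂.seq r₃)) r₄, hF₄, ?_, ?_⟩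
    · simp [HTest.Holds, hk, he]; omega
    · intro r' h1 h2 h3
      rw [hreg₄ r' h1 h2 h3, St.set_reg, if_neg h3, hreg r' h1, St.set_reg, if_neg h2]
    · simp only [St.suffixes, St.set_arr, St.set_reg, reduceCtorEq, if_false] at ht₄ htime ⊢
      rw [Nat.add_mul u 1]
      omega

/-- The cost of a letter, when there are at most `D` letters in each window. -/
def rate (D : ℕ) : ℕ := 80 * Nat.log 2 (2 * D + 1) + 400

/-- The invariant of the algorithm: the letters of the text are given by `f`, and the window is
`i, …, j - 1`. -/
structure Sound (s : St) (f : ℕ → ℕ) (d D word i j : ℕ) : Prop where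
  full : ∃ st lv ow, Full s (fun k => f (s.reg .base + k)) st lv ow (s.reg .left) (s.reg .right) word
  left : s.reg .base + s.reg .left = i
  right : s.reg .base + s.reg .right = j
  le_epoch : s.reg .left ≤ s.reg .epoch
  epoch_le : s.reg .epoch ≤ s.reg .right
  epoch_le' : s.reg .epoch ≤ d
  few : ((Finset.range (s.reg .epoch)).image fun k => f (s.reg .base + k)).card ≤ D
  modulus : s.reg .modulus = 32 * d
  window : j ≤ i + d
  out : s.reg .out = 0
  bdd : s.Bdd word

/-- The potential of a state. -/
def St.pot (s : St) (D : ℕ) : ℕ := s.suffixes + (s.reg .right - s.reg .epoch) * rate D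

theorem card_image_shift_le {f : ℕ → ℕ} {b l r i j D : ℕ} (hi : i ≤ b + l) (hj : b + r ≤ j)
    (h : ((Finset.Ico i j).image f).card ≤ D) :
    ((Finset.Ico l r).image fun k => f (b + k)).card ≤ D := by
  refine (Finset.card_le_card fun y hy => ?_).trans h
  obtain ⟨k, hk, rfl⟩ := Finset.mem_image.1 hy
  rw [Finset.mem_Ico] at hk
  exact Finset.mem_image_of_mem f (Finset.mem_Ico.2 ⟨by omega, by omega⟩)

/-- Every position of the epoch lies in its first window or in the current one, since `left` has not
passed `epoch`, and either has at most `D` different letters. -/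
theorem Sound.height {s : St} {f : ℕ → ℕ} {d D word i j : ℕ} (h : Sound s f d D word i j)
    (hD : ((Finset.Ico i j).image f).card ≤ D) :
    ((Finset.range (s.reg .right)).image fun k => f (s.reg .base + k)).card ≤ 2 * D := by
  have h1 := card_image_shift_le h.left.ge h.right.le hD
  have h2 : (Finset.range (s.reg .right)).image (fun k => f (s.reg .base + k)) ⊆
      (Finset.range (s.reg .epoch)).image (fun k => f (s.reg .base + k)) ∪
        (Finset.Ico (s.reg .left) (s.reg .right)).image fun k => f (s.reg .base + k) := by
    rw [← Finset.image_union]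
    refine Finset.image_subset_image fun k hk => ?_
    have := h.le_epoch
    simp only [Finset.mem_union, Finset.mem_range, Finset.mem_Ico] at hk ⊢
    omega
  have h3 := (Finset.card_le_card h2).trans (Finset.card_union_le _ _)
  have := h.few
  omega

/-- One `rate D` pays for the append itself; the other one is laid aside in the potential, for the
repetition of this append in the next rebuild. -/
theorem append_sound {s : St} {f : ℕ → ℕ} {d D word i j : ℕ} (h : Sound s f d D word i j)
    (hD : ((Finset.Ico i j).image f).card ≤ D) (hj : j + 1 ≤ i + d) (hf : ∀ k, f k + 1 < word)
    (hw : j + 128 * d ≤ word) (hl : s.reg .letter = f j) :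
    Ex (32 * d) word append s fun t s' => Sound s' f d D word i (j + 1) ∧
      t + s'.pot D ≤ s.pot D + 2 * rate D := by
  obtain ⟨st, lv, ow, hF⟩ := h.full
  have h1 := h.left
  have h2 := h.right
  have h3 := h.le_epoch
  have h4 := h.epoch_le
  have h5 := h.epoch_le'
  have hn := hF.core.nodes_le
  refine ((append_spec (N := 32 * d) hF (fun o h0 ho => hF.core.height (h.height hD) h0 ho)
    (by rw [h2]; exact hl) (by rw [h2]; exact hf j) h.bdd ⟨h.modulus, by omega, by omega, by omega⟩
    (by omega)).bdd h.bdd).mono ?_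
  rintro t s' ⟨⟨⟨st', lv', ow', hF'⟩, hreg, hbuf, ht⟩, hb⟩
  have e1 := hF'.core.left
  have e2 := hF'.core.right
  have e3 : s'.reg .base = s.reg .base := hreg _ (by decide)
  have e4 : s'.reg .epoch = s.reg .epoch := hreg _ (by decide)
  refine ⟨⟨⟨st', lv', ow', by rw [e1, e2, e3]; exact hF'⟩, by omega, by omega, by omega, by omega,
    by omega, by rw [e3, e4]; exact h.few, by rw [hreg _ (by decide), h.modulus], by omega,
    by rw [hreg _ (by decide), h.out], hb⟩, ?_⟩
  have e5 : s.reg .right + 1 - s.reg .epoch = s.reg .right - s.reg .epoch + 1 := by omega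
  rw [St.pot, St.pot, e2, e4, e5, Nat.succ_mul]
  simp only [St.suffixes, rate] at ht ⊢
  omega

/-- Each letter of the window is appended once more, with dictionaries that hold only letters of
this window. Moving `epoch` to the right end uses up the credit for later rebuilds. -/
theorem rebuild_spec {s : St} {f : ℕ → ℕ} {d D word i j : ℕ} {st lv ow : ℕ → ℕ}
    (hF : Full s (fun k => f (s.reg .base + k)) st lv ow (s.reg .left) (s.reg .right) word)
    (hl : s.reg .base + s.reg .left = i) (hr : s.reg .base + s.reg .right = j) (hd : 0 < d)
    (hmod : s.reg .modulus = 32 * d) (hwin : j ≤ i + d) (hout : s.reg .out = 0)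
    (hb : s.Bdd word) (hD : ((Finset.Ico i j).image f).card ≤ D)
    (hf : ∀ k, f k + 1 < word) (hw : j + 128 * d ≤ word) :
    Ex (32 * d) word rebuild s fun t s' => Sound s' f d D word i j ∧
      t + s'.pot D ≤ (s.reg .right - s.reg .left) * rate D + 60 := by
  have hlr := hF.core.le
  set l := s.reg .left with hl_def
  set m := s.reg .right with hm_def
  set b := s.reg .base with hb_def
  have r₁ : HRun (32 * d) word (.assign .k Reg.left) s 1 (s.set .k l) :=
    .assign _ _ _ (by decide) (hb.reg _)
  have r₂ : HRun (32 * d) word (.assign .e Reg.right) (s.set .k l) 1 ((s.set .k l).set .e m) := by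
    have := HRun.assign (N := 32 * d) (word := word) (s.set .k l) .e (Reg.right) (by decide)
      (by simpa using hb.reg _)
    simpa using this
  have r₃ : HRun (32 * d) word (.assign .base (Reg.base + Reg.left)) ((s.set .k l).set .e m) 1
      (((s.set .k l).set .e m).set .base i) := by
    have := HRun.assign (N := 32 * d) (word := word) ((s.set .k l).set .e m) .base
      (Reg.base + Reg.left) (by decide) (by
        simp only [HExpr.eval_add, HExpr.eval_reg, St.set_reg, reduceCtorEq, if_false]
        omega)
    simpa [← hl_def, ← hb_def, hl] using this
  have hb₃ := r₃.bdd (r₂.bdd (r₁.bdd hb))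
  obtain ⟨t₄, s₄, r₄, ⟨ht₄, hF₄, f₄, c1, c2, c3, c4⟩, hb₄⟩ := (reset_wp (N := 32 * d) (word := word)
    (s := ((s.set .k l).set .e m).set .base i) (Q := fun s' =>
      Full s' (fun k => f (i + k)) st (fun _ => 0) id 0 0 word ∧
      (((s.set .k l).set .e m).set .base i).Frame [.nodes, .cells, .cur, .left, .right, .cnt]
        [.len, .key, .right, .down, .weight, .possum, .chsum, .head, .link] s' ∧
      s'.reg .cur = 2 ∧ s'.arr .len 2 = 1 ∧ s'.arr .link 2 = 1 ∧ s'.arr .len 1 = 0)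
    (fun k => f (i + k)) st (by omega) (by omega) fun s' a1 a2 a3 a4 a5 a6 =>
      ⟨a1, a2, a3, a4, a5, a6⟩).run.bdd hb₃
  have g : ∀ r, r ∉ [Reg.nodes, .cells, .cur, .left, .right, .cnt, .k, .e, .base] →
      s₄.reg r = s.reg r := by
    intro r h
    simp only [List.mem_cons, List.not_mem_nil, or_false, not_or] at h
    rw [f₄.reg r (by simp; tauto)]
    simp [h]
  have hcard : ((Finset.range (m - l)).image fun k => f (i + k)).card ≤ D := by
    rw [Finset.range_eq_Ico]
    exact card_image_shift_le (by omega) (by omega) hD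
  obtain ⟨t₅, s₅, r₅, ⟨⟨st', lv', ow', hF₅⟩, hreg₅, ht₅⟩, hb₅⟩ := (refill_spec (N := 32 * d)
    (c := l) (n := m - l) hcard (fun k => hf _) (by omega) (by omega) (m - l) 0 s₄ st _ _
    (by omega) hF₄ (by rw [f₄.reg _ (by simp)]; simp)
    (by rw [f₄.reg _ (by simp)]; simp only [St.set_reg, reduceCtorEq, if_true, if_false]; omega) (by
      intro q _ hq
      rw [f₄.arr _ (by simp), St.set_arr, St.set_arr, St.set_arr, hF.core.buf _ (by omega), ← hl,
        Nat.add_assoc])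
    (by rw [g _ (by simp), hmod]) (by rw [f₄.reg _ (by simp)]; simp only [St.set_reg, if_true]; omega)
    hb₄).bdd hb₄
  have g₅ : ∀ r, r ∉ scratch → r ∉ [Reg.letter, .k, .e, .base, .left] → s₅.reg r = s.reg r := by
    intro r h1 h2
    have h3 : r ∉ [Reg.nodes, .cells, .cur, .left, .right, .cnt, .k, .e, .base] := by
      revert h1 h2; cases r <;> decide
    simp only [List.mem_cons, List.not_mem_nil, or_false, not_or] at h2
    rw [hreg₅ r h1 h2.1 h2.2.1, g r h3]
  have hr₅ := hF₅.core.right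
  have hl₅ := hF₅.core.left
  have hbase₅ : s₅.reg .base = i := by
    rw [hreg₅ _ (by decide) (by decide) (by decide), f₄.reg _ (by simp)]; simp
  have r₆ : HRun (32 * d) word (.assign .epoch Reg.right) s₅ 1 (s₅.set .epoch (m - l)) := by
    have := HRun.assign (N := 32 * d) (word := word) s₅ .epoch Reg.right (by decide) (hb₅.reg _)
    simpa [hr₅] using this
  refine ⟨_, _, r₁.seq (r₂.seq (r₃.seq (r₄.seq (r₅.seq r₆)))), ⟨⟨st', lv', ow', ?_⟩, ?_, ?_, ?_, ?_,
    ?_, ?_, ?_, hwin, ?_, r₆.bdd hb₅⟩, ?_⟩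
  · simp only [St.set_reg, reduceCtorEq, if_false, hl₅, hr₅, hbase₅]
    exact hF₅.congr (by simp) rfl rfl
  · simp [hl₅, hbase₅]
  · simp only [St.set_reg, reduceCtorEq, if_false, hr₅, hbase₅]; omega
  · simp [hl₅]
  · simp [hr₅]
  · simp only [St.set_reg, if_true]; omega
  · simpa [hbase₅] using hcard
  · simp [g₅ .modulus (by decide) (by decide), hmod]
  · simp [g₅ .out (by decide) (by decide), hout]
  · have e1 : Nat.log 2 (D + 1) ≤ Nat.log 2 (2 * D + 1) := Nat.log_mono_right (by omega)
    have e2 : (m - l) * (80 * Nat.log 2 (D + 1) + 303) ≤ (m - l) * rate D :=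
      Nat.mul_le_mul_left _ (by rw [rate]; omega)
    have e3 : s₄.suffixes = 2 := by rw [St.suffixes, c1, c2, c3, c4]
    have e4 : (s₅.set .epoch (m - l)).pot D = s₅.suffixes := by
      simp [St.pot, St.suffixes, hr₅]
    rw [e4]
    simp [reset, clear, cleared, HCmd.size] at ht₄
    omega

/-- A rebuild happens when `left` has passed `epoch`. The window then consists of letters appended
during the epoch, and their credit of `rate D` each pays for the rebuild. -/
theorem delete_sound {s : St} {f : ℕ → ℕ} {d D word i j : ℕ} (h : Sound s f d D word i j)
    (hij : i < j) (hD : ((Finset.Ico (i + 1) j).image f).card ≤ D) (hf : ∀ k, f k + 1 < word)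
    (hw : j + 128 * d ≤ word) :
    Ex (32 * d) word delete s fun t s' => Sound s' f d D word (i + 1) j ∧
      t + s'.pot D ≤ s.pot D + 2 * rate D := by
  obtain ⟨st, lv, ow, hF⟩ := h.full
  have h1 := h.left
  have h2 := h.right
  have h3 := h.le_epoch
  have h4 := h.epoch_le
  have h5 := h.epoch_le'
  have h6 := h.window
  have hn := hF.core.nodes_le
  refine Ex.seq (((drop_spec (N := 32 * d) hF (by omega) ⟨h.modulus, by omega, by omega, by omega⟩
    h.bdd).bdd h.bdd).mono ?_)
  rintro t s' ⟨⟨hF', hreg, hbuf, hhead, hnodes, ht⟩, hb⟩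
  have e1 := hF'.core.left
  have e2 := hF'.core.right
  have e3 : s'.reg .base = s.reg .base := hreg _ (by decide) (by decide)
  have e4 : s'.reg .epoch = s.reg .epoch := hreg _ (by decide) (by decide)
  have e5 : s'.reg .modulus = 32 * d := by rw [hreg _ (by decide) (by decide), h.modulus]
  have e6 : s'.reg .out = 0 := by rw [hreg _ (by decide) (by decide), h.out]
  rw [← e3, ← e1, ← e2] at hF'
  have hs : s'.suffixes + t ≤ s.suffixes + 250 := by simp only [St.suffixes]; omega
  refine Ex.cond (fun hc => ?_) (fun hc => ?_)
  · simp only [HTest.Holds, HExpr.eval_reg, e4, e1] at hc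
    refine (rebuild_spec hF' (i := i + 1) (by omega) (by omega) (by omega) e5 (by omega) e6 hb hD
      hf hw).mono ?_
    rintro t' s'' ⟨hS, ht'⟩
    refine ⟨hS, ?_⟩
    have e7 : (s'.reg .right - s'.reg .left) * rate D ≤ (s.reg .right - s.reg .epoch) * rate D :=
      Nat.mul_le_mul_right _ (by omega)
    have e8 : 400 ≤ rate D := Nat.le_add_left _ _
    simp only [St.pot] at ht' ⊢
    omega
  · simp only [HTest.Holds, HExpr.eval_reg, e4, e1] at hc
    refine ⟨1, s', .skip _, ⟨⟨st, lv, ow, hF'⟩, by omega, by omega, by omega, by omega, by omega, by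
      rw [e3, e4]; exact h.few, e5, by omega, e6, hb⟩, ?_⟩
    have e8 : 400 ≤ rate D := Nat.le_add_left _ _
    simp only [St.pot, e2, e4]
    omega

end SlidingMUPS

/-! ### Locality of the changes, on strings -/

namespace SlidingMUPS

section
variable {α : Type} [DecidableEq α]

theorem mem_occurrences {w W : List α} {s : ℕ} :
    s ∈ occurrences w W ↔ ∃ a b, W = a ++ (w ++ b) ∧ a.length = s := by
  rw [occurrences, Finset.mem_filter, Finset.mem_range]
  constructor
  · rintro ⟨h1, h2⟩
    refine ⟨W.take s, (W.drop s).drop w.length, ?_, by simp; omega⟩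
    conv_rhs => enter [2, 1]; rw [← h2]
    rw [List.take_append_drop, List.take_append_drop]
  · rintro ⟨a, b, rfl, rfl⟩
    exact ⟨by simp, by simp⟩

theorem card_occurrences_cons {w W : List α} {c : α} :
    (occurrences w (c :: W)).card =
      (occurrences w W).card + if w <+: c :: W then 1 else 0 := by
  have h : occurrences w (c :: W) = (if w <+: c :: W then {0} else ∅) ∪
      (occurrences w W).image (· + 1) := by
    ext s
    rw [Finset.mem_union, Finset.mem_image]
    cases s with
    | zero =>
      simp only [Nat.add_eq_zero_iff, one_ne_zero, and_false, exists_false, or_false]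
      rw [mem_occurrences]
      constructor
      · rintro ⟨a, b, h, ha⟩
        rw [List.length_eq_zero_iff.1 ha, List.nil_append] at h
        rw [if_pos ⟨b, h.symm⟩]; simp
      · intro h
        split_ifs at h with hp
        · exact ⟨[], hp.choose, hp.choose_spec.symm, rfl⟩
        · simp at h
    | succ s =>
      have : s + 1 ∉ (if w <+: c :: W then {0} else ∅ : Finset ℕ) := by split_ifs <;> simp
      simp only [this, false_or, Nat.add_right_cancel_iff, exists_eq_right]
      rw [mem_occurrences, mem_occurrences]
      constructor
      · rintro ⟨a, b, h, ha⟩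
        cases a with
        | nil => simp at ha
        | cons y a => exact ⟨a, b, (List.cons.inj h).2, by simpa using ha⟩
      · rintro ⟨a, b, rfl, rfl⟩
        exact ⟨c :: a, b, rfl, rfl⟩
  rw [h, Finset.card_union_of_disjoint, Finset.card_image_of_injective _ (add_left_injective 1),
    add_comm]
  · split_ifs <;> rfl
  · split_ifs <;> simp

theorem card_occurrences_reverse (w W : List α) :
    (occurrences w.reverse W.reverse).card = (occurrences w W).card := by
  have key : ∀ {w W : List α} {s : ℕ}, s ∈ occurrences w W → s + w.length ≤ W.length ∧
      W.length - w.length - s ∈ occurrences w.reverse W.reverse := by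
    intro w W s h
    obtain ⟨a, b, rfl, rfl⟩ := mem_occurrences.1 h
    exact ⟨by simp, mem_occurrences.2 ⟨b.reverse, a.reverse, by simp, by simp; omega⟩⟩
  refine Finset.card_nbij' (fun s => W.length - w.length - s) (fun s => W.length - w.length - s)
    (fun s hs => ?_) (fun s hs => (key hs).2) (fun s hs => ?_) (fun s hs => ?_)
  · simpa using (key hs).2
  · have := (key hs).1
    simp only [List.length_reverse] at this ⊢
    omega
  · have := (key hs).1
    simp only
    omega

/-- A palindromic prefix of a palindrome is also its suffix. -/
theorem prefix_occurs {p u W : List α} (hu : u.Palindrome) (hp : p.Palindrome) (hup : u <+: p)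
    (hpW : p <+: W) : p.length - u.length ∈ occurrences u W := by
  obtain ⟨b, rfl⟩ := hpW
  obtain ⟨c, rfl⟩ := hup
  refine mem_occurrences.2 ⟨c.reverse, b, ?_, by simp⟩
  have := hp.reverse_eq
  rw [List.reverse_append, hu.reverse_eq] at this
  rw [← List.append_assoc, this]

/-- The string `u` occurs at the start of `W` and at the end of each longer palindromic prefix.
These positions are different, so two longer prefixes would give three occurrences. -/
theorem IsTopTwoPalPrefix.of_card_le {u W : List α} (h0 : u ≠ []) (hu : u.Palindrome)
    (hW : u <+: W) (h : (occurrences u W).card ≤ 2) : IsTopTwoPalPrefix u W := by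
  refine ⟨h0, hW, hu, ?_⟩
  by_contra hc
  have hle := hW.length_le
  have hpos := List.length_pos_iff.2 h0
  refine absurd h (not_le.2 ?_)
  set F := (Finset.Icc (u.length + 1) W.length).filter fun l => (W.take l).Palindrome with hF
  -- A longer palindromic prefix of length `l` contributes the position `l - u.length`, which is
  -- positive; the position 0 is one more.
  have h3 : (insert 0 (F.image (· - u.length))).card = F.card + 1 := by
    rw [Finset.card_insert_of_notMem, Finset.card_image_of_injOn]
    · intro a ha b hb e
      simp only [hF, Finset.coe_filter, Finset.mem_Icc, Set.mem_ofPred_eq] at ha hb e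
      omega
    · simp only [hF, Finset.mem_image, Finset.mem_filter, Finset.mem_Icc, not_exists, not_and]
      omega
  have h4 : insert 0 (F.image (· - u.length)) ⊆ occurrences u W := by
    intro s hs
    rcases Finset.mem_insert.1 hs with rfl | hs
    · simpa using prefix_occurs hu hu (List.prefix_refl u) hW
    · obtain ⟨l, hl, rfl⟩ := Finset.mem_image.1 hs
      simp only [hF, Finset.mem_filter, Finset.mem_Icc] at hl
      have hlen : (W.take l).length = l := by simp; omega
      have := prefix_occurs hu hl.2 (List.prefix_of_prefix_length_le hW (List.take_prefix l W)
        (by omega)) (List.take_prefix l W)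
      rwa [hlen] at this
  have := Finset.card_le_card h4
  omega

theorem interior_palindrome {w : List α} (h : w.Palindrome) : (interior w).Palindrome := by
  cases h with
  | nil => exact .nil
  | singleton => exact .nil
  | cons_concat a h => simpa [interior] using h

/-- The number of occurrences of a string changes only if it is a prefix of `c :: W`, and then by
one. Uniqueness or repetition is affected only if there were at most two occurrences, so
`IsTopTwoPalPrefix.of_card_le` applies to `w` or to its interior. -/
theorem isMUPS_cons_iff_of_not {W w : List α} {c : α}
    (h : ¬ (IsMUPS w (c :: W) ↔ IsMUPS w W)) :
    IsTopTwoPalPrefix w (c :: W) ∨ IsTopTwoPalPrefix (interior w) (c :: W) := by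
  by_contra hc
  rw [not_or] at hc
  refine h (and_congr_right fun hw => and_congr ?_ ?_)
  · refine and_congr_right fun h0 => ?_
    have h1 := card_occurrences_cons (w := w) (W := W) (c := c)
    split_ifs at h1 with hp
    · have : 2 < (occurrences w (c :: W)).card :=
        lt_of_not_ge fun h => hc.1 (.of_card_le h0 hw hp h)
      omega
    · omega
  · by_cases h0 : interior w = []
    · simp [IsRepeating, h0]
    have h1 := card_occurrences_cons (w := interior w) (W := W) (c := c)
    refine or_congr_right ?_
    split_ifs at h1 with hp
    · have : 2 < (occurrences (interior w) (c :: W)).card :=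
        lt_of_not_ge fun h => hc.2 (.of_card_le h0 (interior_palindrome hw) hp h)
      omega
    · omega

theorem isMUPS_reverse {W w : List α} : IsMUPS w W.reverse ↔ IsMUPS w W := by
  refine and_congr_right fun hw => ?_
  have h1 := card_occurrences_reverse w W
  have h2 := card_occurrences_reverse (interior w) W
  rw [hw.reverse_eq] at h1
  rw [(interior_palindrome hw).reverse_eq] at h2
  rw [IsUnique, IsUnique, IsRepeating, IsRepeating, h1, h2]

theorem IsTopTwoPalPrefix.suffix {w W : List α} (h : IsTopTwoPalPrefix w W.reverse) :
    IsTopTwoPalSuffix w W := by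
  obtain ⟨h1, h2, h3, h4⟩ := h
  refine ⟨h1, ?_, h3, ?_⟩
  · rw [← List.reverse_prefix, h3.reverse_eq]; exact h2
  · rw [List.length_reverse] at h4
    refine (Finset.card_le_card fun l hl => ?_).trans h4
    simp only [Finset.mem_filter] at hl ⊢
    refine ⟨hl.1, ?_⟩
    rw [List.take_reverse, List.Palindrome.iff_reverse_eq, List.reverse_reverse]
    exact hl.2.reverse_eq.symm

/-- Reversal turns appending into deleting, and palindromes and their numbers of occurrences are
invariant under it. -/
theorem isMUPS_concat_iff_of_not {W w : List α} {c : α}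
    (h : ¬ (IsMUPS w (W ++ [c]) ↔ IsMUPS w W)) :
    IsTopTwoPalSuffix w (W ++ [c]) ∨ IsTopTwoPalSuffix (interior w) (W ++ [c]) := by
  rw [← isMUPS_reverse, ← isMUPS_reverse (W := W), List.reverse_append] at h
  refine (isMUPS_cons_iff_of_not h).imp (fun h => IsTopTwoPalPrefix.suffix ?_)
    fun h => IsTopTwoPalPrefix.suffix ?_ <;> rwa [List.reverse_append]

end

end SlidingMUPS

/-! ### From strings to positions and nodes, and the correctness of the output -/

namespace SlidingMUPS

section
variable {α : Type} {W : List α} {y : ℕ → ℕ} {a b : ℕ}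

/-- The numbers `y k` tell the letters of `W` apart. -/
def Spells (y : ℕ → ℕ) (W : List α) : Prop :=
  ∀ a b, a < W.length → b < W.length → (y a = y b ↔ W[a]? = W[b]?)

theorem slice_getElem? (W : List α) (a b k : ℕ) :
    (slice W a b)[k]? = if k < b + 1 - a then W[a + k]? else none := by
  rw [slice, List.getElem?_take, List.getElem?_drop]

theorem slice_length (hb : b < W.length) : (slice W a b).length = b + 1 - a := by
  simp [slice]; omega

theorem interior_slice (hb : b < W.length) : interior (slice W a b) = slice W (a + 1) (b - 1) := by
  rw [interior, List.dropLast_eq_take, ← List.drop_one]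
  ext1 k
  rw [List.getElem?_take, List.getElem?_drop, slice_getElem?, slice_getElem?, List.length_drop,
    slice_length hb, show a + (1 + k) = a + 1 + k by omega]
  split_ifs <;> first | rfl | omega

theorem slice_palindrome (hy : Spells y W) (hab : a ≤ b) (hb : b < W.length) :
    (slice W a b).Palindrome ↔ Pal y a (b + 1) := by
  rw [List.Palindrome.iff_reverse_eq]
  have hl := slice_length (a := a) hb
  constructor
  · intro h k h1 h2
    rw [hy k _ (by omega) (by omega)]
    have e := congrArg (·[k - a]?) h
    rw [List.getElem?_reverse (by omega), slice_getElem?, slice_getElem?, hl, if_pos (by omega),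
      if_pos (by omega), show a + (k - a) = k by omega] at e
    rw [← e]
    congr 1
    omega
  · intro h
    ext1 k
    by_cases hk : k < b + 1 - a
    · rw [List.getElem?_reverse (by omega), slice_getElem?, slice_getElem?, hl, if_pos (by omega),
        if_pos hk, ← hy _ _ (by omega) (by omega), h (a + k) (by omega) (by omega)]
      congr 1
      omega
    · rw [List.getElem?_eq_none (by simp; omega), List.getElem?_eq_none (by omega)]

variable [DecidableEq α]

theorem mem_occurrences_slice (hy : Spells y W) (hab : a ≤ b) (hb : b < W.length) {s : ℕ} :
    s ∈ occurrences (slice W a b) W ↔ s + (b + 1 - a) ≤ W.length ∧ Same y a s (b + 1 - a) := by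
  rw [occurrences, Finset.mem_filter, Finset.mem_range, slice_length hb]
  constructor
  · rintro ⟨h1, h2⟩
    have h3 := congrArg List.length h2
    rw [slice_length hb, List.length_take, List.length_drop] at h3
    refine ⟨by omega, fun k hk => ?_⟩
    rw [hy _ _ (by omega) (by omega)]
    have e := congrArg (·[k]?) h2
    rw [slice_getElem?, List.getElem?_take, List.getElem?_drop, if_pos hk, if_pos hk] at e
    exact e.symm
  · rintro ⟨h1, h2⟩
    refine ⟨by omega, ?_⟩
    ext1 k
    rw [slice_getElem?, List.getElem?_take, List.getElem?_drop]
    split_ifs with hk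
    · rw [← hy _ _ (by omega) (by omega)]
      exact (h2 k hk).symm
    · rfl

variable {x len link inner st : ℕ → ℕ} {nn l m : ℕ}

theorem card_occurrences_slice (hy : Spells (fun k => x (l + k)) W) (hlm : l + W.length = m)
    (hab : a ≤ b) (hb : b < W.length) {v : ℕ} (hv : At x len st v (l + a))
    (hlen : len v + a = b + 2) :
    (occurrences (slice W a b) W).card = (occ x len st l m v).card := by
  have key : ∀ s, s ∈ occurrences (slice W a b) W ↔ l + s ∈ occ x len st l m v := by
    intro s
    rw [mem_occurrences_slice hy hab hb, mem_occ]
    have e : Same (fun k => x (l + k)) a s (b + 1 - a) ↔ Same x (l + a) (l + s) (len v - 1) := by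
      rw [show len v - 1 = b + 1 - a by omega]
      simp only [Same, Nat.add_assoc]
    rw [e]
    constructor
    · rintro ⟨h1, h2⟩
      exact ⟨by omega, by omega, by omega, hv.trans h2⟩
    · rintro ⟨-, -, h1, h2⟩
      exact ⟨by omega, hv.symm.trans h2⟩
  refine Finset.card_nbij' (l + ·) (· - l) (fun s hs => (key s).1 hs) (fun c hc => ?_)
    (fun s hs => by simp) (fun c hc => ?_)
  · have := (mem_occ.1 hc).1
    refine (key _).2 ?_
    rwa [show l + (c - l) = c by omega]
  · have := (mem_occ.1 hc).1
    simp only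
    omega

/-- A nonempty interior occurs at least once, inside the slice, so repeating means not unique. For
`len v < 4` the palindrome has at most two letters, and its empty interior is repeating by
convention. -/
theorem Tree.isMUPS_slice_iff (h : Tree x len link inner st nn l m)
    (hy : Spells (fun k => x (l + k)) W) (hlm : l + W.length = m) (hab : a ≤ b)
    (hb : b < W.length) {v : ℕ} (hr : Real nn v) (hv : At x len st v (l + a))
    (hlen : len v + a = b + 2) :
    IsMUPS (slice W a b) W ↔ Target x len inner st l m v (l + a) := by
  have hpal : (slice W a b).Palindrome := by
    rw [slice_palindrome hy hab hb]
    have := h.pal_at hr hv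
    intro k h1 h2
    simp only
    rw [this (l + k) (by omega) (by omega)]
    congr 1
    omega
  have hne : slice W a b ≠ [] := by
    rw [← List.length_pos_iff, slice_length hb]; omega
  rw [IsMUPS, IsUnique, card_occurrences_slice hy hlm hab hb hv hlen, interior_slice hb, Target,
    IsRepeating]
  simp only [hpal, hne, true_and, ne_eq, not_false_eq_true]
  refine and_congr_right fun hu => ?_
  have ha : l + a ∈ occ x len st l m v := mem_occ.2 ⟨by omega, by omega, by omega, hv⟩
  refine Iff.trans ?_ (and_iff_left ha).symm
  by_cases h4 : len v < 4
  · have : slice W (a + 1) (b - 1) = [] := by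
      rw [← List.length_eq_zero_iff, slice_length (by omega)]; omega
    simp [this, h4]
  · have hin : At x len st (inner v) (l + (a + 1)) := by
      have h1 := h.inner_at v hr
      have h2 := h.len_inner v hr
      refine h1.trans ?_
      have := hv.sub 1 (len (inner v) - 1) (by omega)
      rwa [Nat.add_assoc] at this
    have h2 := h.len_inner v hr
    have hne : slice W (a + 1) (b - 1) ≠ [] := by
      rw [← List.length_pos_iff, slice_length (by omega)]; omega
    rw [card_occurrences_slice hy hlm (by omega) (by omega) hin (by omega)]
    have : 0 < (occ x len st l m (inner v)).card := Finset.card_pos.2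
      ⟨l + (a + 1), mem_occ.2 ⟨by omega, by omega, by omega, hin⟩⟩
    simp only [hne, h4, false_or]
    omega

theorem Tree.mem_MUPS_iff (h : Tree x len link inner st nn l m)
    (hy : Spells (fun k => x (l + k)) W) (hlm : l + W.length = m) {q : ℕ × ℕ} :
    q ∈ MUPS W ↔ ∃ v, Real nn v ∧ Target x len inner st l m v (l + q.1) ∧
      len v + q.1 = q.2 + 2 := by
  constructor
  · rintro ⟨h1, h2, h3⟩
    have hp := (slice_palindrome hy h1 h2).1 h3.1
    obtain ⟨v, v1, v2, v3⟩ := h.complete (l + q.1) (l + q.2 + 1) (by omega) (by omega) (by omega) (by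
      intro k k1 k2
      have := hp (k - l) (by omega) (by omega)
      simp only at this
      rw [show l + (k - l) = k by omega] at this
      rw [this]
      congr 1
      omega)
    exact ⟨v, v1, (h.isMUPS_slice_iff hy hlm h1 h2 v1 v3 (by omega)).1 h3, by omega⟩
  · rintro ⟨v, v1, v2, v3⟩
    obtain ⟨-, -, h1, h2⟩ := mem_occ.1 v2.2.2
    have := h.two_le_len v v1
    exact ⟨by omega, by omega,
      (h.isMUPS_slice_iff hy hlm (by omega) (by omega) v1 h2 (by omega)).2 v2⟩

/-- In a sound state, the memory holds the minimal unique palindromic substrings. -/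
theorem Sound.stores {s : St} {f : ℕ → ℕ} {d D word i j : ℕ} (h : Sound s f d D word i (j + 1))
    {S : List α} (hij : i ≤ j) (hj : j < S.length) (hf : Spells f S) {S' : Config}
    (hS : Sim d S' s) {cells : ℕ} (hc : 544 * d ≤ cells) : StoresMUPS cells S i j S' := by
  obtain ⟨st, lv, ow, hF⟩ := h.full
  have hL := hF.listing
  have htr := hF.core.tree
  have h1 := h.left
  have h2 := h.right
  have h3 := h.le_epoch
  have h4 := h.epoch_le
  have h5 := h.epoch_le'
  have h6 := h.window
  have hn := hF.core.nodes_le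
  have hcnt := hL.cnt_le
  have hreg2 : S'.reg 2 = 0 := (hS.reg .out).trans h.out
  have hreg3 : S'.reg 3 = s.reg .cnt := hS.reg .cnt
  have hWl : (slice S i j).length = j + 1 - i := slice_length hj
  have hy : Spells (fun k => (fun k => f (s.reg .base + k)) (s.reg .left + k)) (slice S i j) := by
    intro a b ha hb
    rw [hWl] at ha hb
    simp only
    rw [slice_getElem?, slice_getElem?, if_pos ha, if_pos hb, ← Nat.add_assoc, ← Nat.add_assoc, h1]
    exact hf _ _ (by omega) (by omega)
  have hmem : ∀ q : ℕ × ℕ, q ∈ S'.pairs ↔ ∃ i < s.reg .cnt,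
      q = (s.arr .entry i, s.arr .entry i + s.arr .len (s.arr .owner i) - 2) := by
    intro q
    simp only [Config.pairs, List.mem_map, List.mem_range, hreg2, hreg3]
    refine exists_congr fun k => and_congr_right fun hk => ?_
    obtain ⟨-, -, e1, e2, -⟩ := hL.fwd k hk
    rw [show 0 + 2 * k = k + k by omega, hS.out _ (by omega), hS.out _ (by omega), e1, e2]
    exact eq_comm
  refine ⟨by rw [hreg2, hreg3]; omega, ?_, fun p => ?_⟩
  · refine List.Nodup.map_on (fun k hk k' hk' e => ?_) List.nodup_range
    rw [List.mem_range, hreg3] at hk hk'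
    obtain ⟨a1, a2, a3, a4, a5⟩ := hL.fwd k hk
    obtain ⟨b1, b2, b3, b4, b5⟩ := hL.fwd k' hk'
    rw [hreg2, show 0 + 2 * k = k + k by omega, show 0 + 2 * k' = k' + k' by omega,
      hS.out _ (by omega), hS.out _ (by omega), hS.out _ (by omega), hS.out _ (by omega), a3, a4,
      b3, b4, Prod.mk.injEq] at e
    have l1 := htr.two_le_len _ a1
    have l2 := htr.two_le_len _ b1
    obtain ⟨a, ha, ea⟩ := (hF.shown (s.arr .owner k) (s.arr .entry k) a1).1 ⟨by omega, by rw [a2]; rfl⟩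
    obtain ⟨b, hb, eb⟩ := (hF.shown (s.arr .owner k') (s.arr .entry k') b1).1 ⟨by omega, by rw [b2]; rfl⟩
    obtain rfl : a = b := by omega
    have := htr.inj' (by have := a1.1; omega) a1.2 (by have := b1.1; omega) b1.2 (by omega)
      (mem_occ.1 ha.2.2).2.2.2 (mem_occ.1 hb.2.2).2.2.2
    rw [this] at a2
    omega
  · rw [hmem]
    constructor
    · rintro ⟨k, hk, rfl⟩
      obtain ⟨a1, a2, -⟩ := hL.fwd k hk
      have l1 := htr.two_le_len _ a1
      obtain ⟨a, ha, ea⟩ := (hF.shown (s.arr .owner k) (s.arr .entry k) a1).1 ⟨by omega, by rw [a2]; rfl⟩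
      have ha' := (mem_occ.1 ha.2.2).1
      refine ⟨(a - s.reg .left, a - s.reg .left + s.arr .len (s.arr .owner k) - 2),
        (htr.mem_MUPS_iff hy (by omega)).2 ⟨s.arr .owner k, a1, ?_, by simp only; omega⟩, ?_⟩
      · rwa [show s.reg .left + (a - s.reg .left) = a by omega]
      · rw [Prod.mk.injEq]
        exact ⟨by omega, by omega⟩
    · rintro ⟨q, hq, rfl⟩
      obtain ⟨v, v1, v2, v3⟩ := (htr.mem_MUPS_iff hy (by omega)).1 hq
      obtain ⟨c1, c2⟩ := (hF.shown v (i + q.1) v1).2 ⟨_, v2, by omega⟩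
      obtain ⟨c3, c4⟩ := hL.back v v1 c1
      refine ⟨s.arr .slot v - 1, by omega, ?_⟩
      rw [c2, c4, Prod.mk.injEq]
      exact ⟨rfl, by omega⟩

end

end SlidingMUPS

/-! ### The algorithm and its executions on the machine -/

namespace SlidingMUPS
open Function

section
open Reg

/-- The initialization: an empty window. -/
def prepare : HCmd :=
  -- Five doublings give `32 * d`, which is the size of the arrays and the modulus of the sums.
  .assign modulus d ;; .assign modulus (modulus + modulus) ;; .assign modulus (modulus + modulus) ;;
    .assign modulus (modulus + modulus) ;; .assign modulus (modulus + modulus) ;;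
    .assign modulus (modulus + modulus) ;; reset

end

/-- The state at the start. -/
def St.start (d : ℕ) : St where
  reg r := if r = .d then d else 0
  arr _ _ := 0
  out _ := 0

theorem sim_start (d : ℕ) : Sim d (startConfig d) (.start d) where
  reg r := by cases r <;> simp [startConfig, St.start, Reg.idx]
  arr _ _ := rfl
  out _ _ := rfl
  size := rfl

theorem Sim.letter {d : ℕ} {S : Config} {s : St} (h : Sim d S s) (v : ℕ) :
    Sim d (S.setReg 1 v) (s.set .letter v) where
  reg r := by
    rw [St.set_reg, ← h.reg r, Config.setReg]
    cases r <;> simp [Reg.idx]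
  arr := h.arr
  out := h.out
  size := by simp [h.size]

theorem Sound.letter {s : St} {f : ℕ → ℕ} {d D word i j : ℕ} (h : Sound s f d D word i j) {v : ℕ}
    (hv : v < word) : Sound (s.set .letter v) f d D word i j := by
  obtain ⟨⟨st, lv, ow, hF⟩, h1, h2, h3, h4, h5, h6, h7, h8, h9, h10⟩ := h
  refine ⟨⟨st, lv, ow, ?_⟩, ?_, ?_, ?_, ?_, ?_, ?_, ?_, h8, ?_, ⟨fun r => ?_, h10.arr⟩⟩
  · simpa using hF.congr (s' := s.set .letter v) (by simp) rfl rfl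
  all_goals simp only [St.set_reg, reduceCtorEq, if_false]
  iterate 8 assumption
  split_ifs
  · exact hv
  · exact h10.reg r

theorem prepare_sound {d D word : ℕ} {f : ℕ → ℕ} (hd : 0 < d) (hw : 32 * d < word) :
    Ex (32 * d) word prepare (.start d) fun t s' => Sound s' f d D word 0 0 ∧ t + s'.pot D ≤ 60 := by
  have hb : (St.start d).Bdd word := ⟨fun r => by simp only [St.start]; split_ifs <;> omega,
    fun a i => by simp only [St.start]; omega⟩
  have key : prepare.wp (32 * d) word (fun s' => s'.reg .modulus = 32 * d ∧
      (St.start d).Frame [.modulus, .nodes, .cells, .cur, .left, .right, .cnt]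
        [.len, .key, .right, .down, .weight, .possum, .chsum, .head, .link] s' ∧
      Full s' f (fun _ => 0) (fun _ => 0) id 0 0 word ∧
      s'.suffixes = 2) (.start d) := by
    simp only [prepare, HCmd.wp, HExpr.eval_reg, HExpr.eval_add, St.set_reg, if_true]
    have e : (St.start d).reg .d = d := rfl
    rw [e]
    refine ⟨by decide, by omega, by decide, by omega, by decide, by omega, by decide, by omega,
      by decide, by omega, by decide, by omega, ?_⟩
    refine reset_wp f (fun _ => 0) (by omega) (by omega) fun s' hF f1 c1 c2 c3 c4 =>
      ⟨?_, ?_, hF, by rw [St.suffixes, c1, c2, c3, c4]⟩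
    · rw [f1.reg _ (by simp)]
      simp only [St.set_reg, if_true]
      omega
    · refine St.Frame.comp ?_ (f1.mono (by simp) (by simp))
      exact ((((((St.Frame.refl _).set (by simp) _).set (by simp) _).set (by simp) _).set
        (by simp) _).set (by simp) _).set (by simp) _
  obtain ⟨t, s', r, ⟨ht, hm, hf, hF, hs⟩, hb'⟩ := key.run.bdd hb
  have hl := hF.core.left
  have hr := hF.core.right
  have hbase : s'.reg .base = 0 := hf.reg _ (by simp)
  have hepoch : s'.reg .epoch = 0 := hf.reg _ (by simp)
  have hout : s'.reg .out = 0 := hf.reg _ (by simp)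
  refine ⟨t, s', r, ⟨⟨_, _, _, by rw [hl, hr, hbase]; simpa using hF⟩, by omega, by omega, by omega,
    by omega, by omega, by simp [hepoch], hm, by omega, hout, hb'⟩, ?_⟩
  simp [prepare, reset, clear, cleared, HCmd.size] at ht
  simp only [St.pot, hs, hr, hepoch]
  omega

/-- The algorithm. -/
def algorithm : Algorithm where
  init := prepare.compile
  append := append.compile
  delete := delete.compile

/-- A bound for the number of steps of the machine for a step of the programs. -/
def pace : ℕ := prepare.unit + append.unit + delete.unit

/-- The letters of a text as numbers. -/
def letters {σ : ℕ} (S : List (Fin σ)) (k : ℕ) : ℕ := (S[k]?.map Fin.val).getD 0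

section
variable {σ : ℕ} {S : List (Fin σ)}

theorem letters_eq {k : ℕ} (hk : k < S.length) : letters S k = S[k] := by
  simp [letters, hk]

theorem spells_letters : Spells (letters S) S := by
  intro a b ha hb
  rw [letters_eq ha, letters_eq hb, List.getElem?_eq_getElem ha, List.getElem?_eq_getElem hb,
    Option.some.injEq, Fin.val_inj]

theorem letters_lt (hS : S ≠ []) (k : ℕ) : letters S k < σ := by
  by_cases hk : k < S.length
  · rw [letters_eq hk]; exact (S[k]).2
  · have := (S.head hS).2
    simp only [letters, List.getElem?_eq_none (not_lt.1 hk)]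
    simp
    omega

theorem card_letters_le {i j : ℕ} (hj : j < S.length) :
    ((Finset.Ico i (j + 1)).image (letters S)).card ≤ (slice S i j).toFinset.card := by
  refine (Finset.card_le_card fun y hy => ?_).trans
    (Finset.card_image_le (s := (slice S i j).toFinset) (f := Fin.val))
  obtain ⟨k, hk, rfl⟩ := Finset.mem_image.1 hy
  rw [Finset.mem_Ico] at hk
  refine Finset.mem_image.2 ⟨S[k], ?_, (letters_eq (by omega)).symm⟩
  rw [List.mem_toFinset]
  refine List.mem_of_getElem? (i := k - i) ?_
  rw [slice_getElem?, if_pos (by omega), show i + (k - i) = k by omega, List.getElem?_eq_getElem]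

theorem appends_sound {d D word i j cells : ℕ} {s : St} {S₁ : Config} (hS₁ : Sim d S₁ s)
    (h : Sound s (letters S) d D word i j) (hj : j < S.length)
    (hD : ((Finset.Ico i j).image (letters S)).card ≤ D) (hjd : j + 1 ≤ i + d)
    (hf : ∀ k, letters S k + 1 < word) (hw : j + 128 * d ≤ word) (hc : 544 * d ≤ cells) :
    ∃ t S₂ s', Appends algorithm cells word S j S₁ t S₂ ∧ Sim d S₂ s' ∧
      Sound s' (letters S) d D word i (j + 1) ∧
      t + pace * s'.pot D ≤ pace * (s.pot D + 2 * rate D) := by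
  have hl := hf j
  obtain ⟨t, s', r, hs', ht⟩ := append_sound (h.letter (v := letters S j) (by omega)) hD hjd hf hw
    (by simp)
  obtain ⟨t', S₂, r', hS₂, ht'⟩ := r.compile (hS₁.letter _) hc
  refine ⟨t', S₂, s', ⟨S[j], List.getElem?_eq_getElem hj, ?_⟩, hS₂, hs', ?_⟩
  · rwa [letters_eq hj] at r'
  · have e : (s.set .letter (letters S j)).pot D = s.pot D := by simp [St.pot, St.suffixes]
    rw [e] at ht
    have h1 : append.unit * t ≤ pace * t := Nat.mul_le_mul_right _ (by unfold pace; omega)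
    have h2 := Nat.mul_le_mul_left pace ht
    rw [Nat.mul_add] at h2
    omega

theorem IsExecution.extend {A : Algorithm} {cells word d T : ℕ} {i j : ℕ → ℕ}
    {conf : ℕ → Config} {cost : ℕ → ℕ} (h : IsExecution A cells word d S T i j conf cost)
    {S' : Config} {c : ℕ}
    (h1 : i (T + 1) = i T + 1 → Run cells word A.delete (conf T) c S')
    (h2 : j (T + 1) = j T + 1 → Appends A cells word S (j (T + 1)) (conf T) c S') :
    IsExecution A cells word d S (T + 1) i j (update conf (T + 1) S') (update cost (T + 1) c) := by
  have e : ∀ t ≤ T, update conf (T + 1) S' t = conf t ∧ update cost (T + 1) c t = cost t :=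
    fun t ht => ⟨update_of_ne (by omega) _ _, update_of_ne (by omega) _ _⟩
  refine ⟨?_, fun t ht hi => ?_, fun t ht hi => ?_⟩
  · rw [(e 0 (by omega)).1, (e 0 (by omega)).2]; exact h.start
  · rw [(e t (by omega)).1]
    by_cases ht' : t = T
    · subst ht'
      rw [update_self, update_self]; exact h1 hi
    · rw [(e (t + 1) (by omega)).1, (e (t + 1) (by omega)).2]; exact h.step_delete t (by omega) hi
  · rw [(e t (by omega)).1]
    by_cases ht' : t = T
    · subst ht'
      rw [update_self, update_self]; exact h2 hi
    · rw [(e (t + 1) (by omega)).1, (e (t + 1) (by omega)).2]; exact h.step_append t (by omega) hi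

/-- Induction on time with `Sound` as the invariant. Appends and deletions have the same amortized
cost, two rates, and the potential starts within the constant 60 of the initialization. -/
theorem exists_execution {d T cells word : ℕ} {i j : ℕ → ℕ} (h : IsWindowSequence S.length T i j)
    (hd : ∀ t ≤ T, j t - i t + 1 ≤ d) (hw : σ + S.length + 128 * d < word)
    (hc : 544 * d ≤ cells) : ∀ T' ≤ T, ∃ (conf : ℕ → Config) (cost : ℕ → ℕ),
      IsExecution algorithm cells word d S T' i j conf cost ∧
      (∀ t ≤ T', StoresMUPS cells S (i t) (j t) (conf t)) ∧
      ∃ s, Sim d (conf T') s ∧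
        Sound s (letters S) d (maxDistinct S T i j) word (i T') (j T' + 1) ∧
        ∑ t ∈ Finset.range (T' + 1), cost t + pace * s.pot (maxDistinct S T i j) ≤
          pace * (60 + 2 * rate (maxDistinct S T i j) * (T' + 1)) := by
  have hd0 := hd 0 (by omega)
  have hn := h.right_lt 0 (by omega)
  have hlet : ∀ k, letters S k + 1 < word := fun k => by
    have := letters_lt (S := S) (by rw [← List.length_pos_iff]; omega) k
    omega
  have hD : ∀ t ≤ T, ((Finset.Ico (i t) (j t + 1)).image (letters S)).card ≤ maxDistinct S T i j :=
    fun t ht => (card_letters_le (h.right_lt t ht)).trans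
      (Finset.le_sup (f := fun t => (slice S (i t) (j t)).toFinset.card)
        (Finset.mem_range.2 (by omega)))
  set D := maxDistinct S T i j
  intro T'
  induction T' with
  | zero =>
    intro _
    obtain ⟨t, s, r, hs, ht⟩ := prepare_sound (D := D) (f := letters S) (d := d) (word := word)
      (by omega) (by omega)
    obtain ⟨t', S₁, r', hS₁, ht'⟩ := r.compile (sim_start d) hc
    obtain ⟨t₂, S₂, s₂, hA, hS₂, hs₂, ht₂⟩ := appends_sound hS₁ hs (by omega) (by simp) (by omega) hlet
      (by omega) hc
    refine ⟨fun _ => S₂, fun _ => t' + t₂, ⟨⟨S₁, t', t₂, r', hA, rfl⟩, by omega, by omega⟩, ?_, s₂,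
      hS₂, ?_, ?_⟩
    · intro t ht
      obtain rfl : t = 0 := by omega
      rw [h.left_zero, h.right_zero]
      exact hs₂.stores le_rfl (by omega) spells_letters hS₂ hc
    · rw [h.left_zero, h.right_zero]; exact hs₂
    · have h1 : prepare.unit * t ≤ pace * t := Nat.mul_le_mul_right _ (by unfold pace; omega)
      have h2 := Nat.mul_le_mul_left pace ht
      rw [Nat.mul_add] at h2 ht₂ ⊢
      simp only [zero_add, Finset.sum_range_one, mul_one]
      omega
  | succ T' ih =>
    intro hT
    obtain ⟨conf, cost, hE, hst, s, hS, hs, hcost⟩ := ih (by omega)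
    have a1 := h.left_le_right T' (by omega)
    have a2 := h.left_le_right (T' + 1) hT
    have a3 := h.right_lt (T' + 1) hT
    have a4 := hd (T' + 1) hT
    have key : ∃ c S' s', (i (T' + 1) = i T' + 1 → Run cells word algorithm.delete (conf T') c S') ∧
        (j (T' + 1) = j T' + 1 → Appends algorithm cells word S (j (T' + 1)) (conf T') c S') ∧
        Sim d S' s' ∧ Sound s' (letters S) d D word (i (T' + 1)) (j (T' + 1) + 1) ∧
        c + pace * s'.pot D ≤ pace * (s.pot D + 2 * rate D) := by
      rcases h.step T' (by omega) with ⟨e1, e2⟩ | ⟨e1, e2⟩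
      · have hD' := hD (T' + 1) hT
        rw [e1, e2] at hD' ⊢
        obtain ⟨t, s', r, hs', ht⟩ := delete_sound hs (by omega) hD' hlet (by omega)
        obtain ⟨t', S', r', hS', ht'⟩ := r.compile hS hc
        refine ⟨t', S', s', fun _ => r', by omega, hS', hs', ?_⟩
        have h1 : delete.unit * t ≤ pace * t := Nat.mul_le_mul_right _ (by unfold pace; omega)
        have h2 := Nat.mul_le_mul_left pace ht
        rw [Nat.mul_add] at h2
        omega
      · rw [e1, e2]
        obtain ⟨t, S', s', hA, hS', hs', ht⟩ := appends_sound hS hs (by omega) (hD T' (by omega))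
          (by omega) hlet (by omega) hc
        exact ⟨t, S', s', by omega, fun _ => hA, hS', hs', ht⟩
    obtain ⟨c, S', s', h1, h2, hS', hs', hc'⟩ := key
    refine ⟨_, _, hE.extend h1 h2, fun t ht => ?_, s', by rw [update_self]; exact hS', hs', ?_⟩
    · by_cases e : t = T' + 1
      · subst e
        rw [update_self]
        exact hs'.stores a2 a3 spells_letters hS' hc
      · rw [update_of_ne e]
        exact hst t (by omega)
    · have hsum : ∑ t ∈ Finset.range (T' + 1), update cost (T' + 1) c t =
          ∑ t ∈ Finset.range (T' + 1), cost t := Finset.sum_congr rfl fun t ht =>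
        update_of_ne (by have := Finset.mem_range.1 ht; omega) _ _
      rw [Finset.sum_range_succ, update_self, hsum]
      have e : 60 + 2 * rate D * (T' + 1 + 1) = 60 + 2 * rate D * (T' + 1) + 2 * rate D := by ring
      rw [e, Nat.mul_add]
      rw [Nat.mul_add] at hc'
      omega

/-- Every step advances exactly one end of the window, so `i t + j t = t`, and both ends stay below
`n`. -/
theorem IsWindowSequence.length_le {n T : ℕ} {i j : ℕ → ℕ} (h : IsWindowSequence n T i j) :
    T + 1 ≤ 2 * n := by
  have key : ∀ t ≤ T, i t + j t = t := by
    intro t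
    induction t with
    | zero => intro _; rw [h.left_zero, h.right_zero]
    | succ t ih =>
      intro ht
      have := ih (by omega)
      rcases h.step t (by omega) with ⟨e1, e2⟩ | ⟨e1, e2⟩ <;> omega
  have := key T le_rfl
  have := h.left_le_right T le_rfl
  have := h.right_lt T le_rfl
  omega

theorem rate_le (D : ℕ) : rate D ≤ 560 * (1 + Nat.log 2 D) := by
  have : Nat.log 2 (2 * D + 1) ≤ Nat.log 2 D + 2 := by
    rcases Nat.eq_zero_or_pos D with rfl | hD
    · simp
    · have h1 : Nat.log 2 (2 * D + 1) ≤ Nat.log 2 (D * 2 * 2) := Nat.log_mono_right (by omega)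
      rwa [Nat.log_mul_base (by norm_num) (by omega), Nat.log_mul_base (by norm_num) (by omega)] at h1
  unfold rate
  omega

end

end SlidingMUPS

/-! ### The theorem -/

theorem mainTheorem3 :
    (∃ (A : SlidingMUPS.Algorithm) (C : ℕ),
      ∀ (σ d T : ℕ) (S : List (Fin σ)) (i j : ℕ → ℕ),
        SlidingMUPS.IsWindowSequence S.length T i j →
        (∀ t ≤ T, j t - i t + 1 ≤ d) →
        ∃ (conf : ℕ → SlidingMUPS.Config) (cost : ℕ → ℕ),
          SlidingMUPS.IsExecution A (C * d) (σ + C * (S.length + d)) d S T i j conf cost ∧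
          (∀ t ≤ T, SlidingMUPS.StoresMUPS (C * d) S (i t) (j t) (conf t)) ∧
          ∑ t ∈ Finset.range (T + 1), cost t ≤
            C * (S.length * (1 + Nat.log 2 (SlidingMUPS.maxDistinct S T i j)))) ∧
    (∀ (σ : ℕ) (W : List (Fin σ)) (c : Fin σ) (w : List (Fin σ)),
      ¬ (SlidingMUPS.IsMUPS w (c :: W) ↔ SlidingMUPS.IsMUPS w W) →
        SlidingMUPS.IsTopTwoPalPrefix w (c :: W) ∨
        SlidingMUPS.IsTopTwoPalPrefix (SlidingMUPS.interior w) (c :: W)) ∧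
    (∀ (σ : ℕ) (W : List (Fin σ)) (c : Fin σ) (w : List (Fin σ)),
      ¬ (SlidingMUPS.IsMUPS w (W ++ [c]) ↔ SlidingMUPS.IsMUPS w W) →
        SlidingMUPS.IsTopTwoPalSuffix w (W ++ [c]) ∨
        SlidingMUPS.IsTopTwoPalSuffix (SlidingMUPS.interior w) (W ++ [c])) := by
  -- Here `2300 = 60 + 2 * 560 * 2`: the initialization, two rates per operation, the factor of
  -- `rate_le`, and at most twice as many operations as letters. And `544 = 32 + 16 * 32` cells per
  -- unit of `d`, for the output and the arrays.
  refine ⟨⟨SlidingMUPS.algorithm, 2300 * SlidingMUPS.pace + 544, ?_⟩,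
    fun _ _ _ _ => SlidingMUPS.isMUPS_cons_iff_of_not,
    fun _ _ _ _ => SlidingMUPS.isMUPS_concat_iff_of_not⟩
  intro σ d T S i j h hd
  have hT := h.length_le
  have h0 := hd 0 (by omega)
  have hC : ∀ k, 544 * k ≤ (2300 * SlidingMUPS.pace + 544) * k := fun k =>
    Nat.mul_le_mul_right _ (by omega)
  have hC1 := hC (S.length + d)
  obtain ⟨conf, cost, hE, hst, s, -, -, hcost⟩ := SlidingMUPS.exists_execution
    (word := σ + (2300 * SlidingMUPS.pace + 544) * (S.length + d)) h hd (by omega) (hC d) T le_rfl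
  refine ⟨conf, cost, hE, hst, ?_⟩
  refine (le_of_add_le_left hcost).trans ?_
  have hr := SlidingMUPS.rate_le (SlidingMUPS.maxDistinct S T i j)
  generalize SlidingMUPS.rate (SlidingMUPS.maxDistinct S T i j) = R at *
  generalize Nat.log 2 (SlidingMUPS.maxDistinct S T i j) = L at *
  generalize SlidingMUPS.pace = U at *
  have h1 : 2 * R * (T + 1) ≤ 2 * (560 * (1 + L)) * (2 * S.length) := Nat.mul_le_mul (by omega) hT
  have h2 : 60 ≤ 60 * (S.length * (1 + L)) :=
    Nat.le_mul_of_pos_right _ (Nat.mul_pos (by omega) (by omega))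
  calc U * (60 + 2 * R * (T + 1))
      ≤ U * (60 * (S.length * (1 + L)) + 2 * (560 * (1 + L)) * (2 * S.length)) :=
        Nat.mul_le_mul_left _ (by omega)
    _ = 2300 * U * (S.length * (1 + L)) := by ring
    _ ≤ (2300 * U + 544) * (S.length * (1 + L)) := Nat.mul_le_mul_right _ (by omega)
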